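/- **Data.** Fix a countably infinite set $\mathbf{dom}$ of atomic values. A *path* is a finite sequence of values; a *value* is an atomic value or a packed value $\langle p\rangle$ with $p$ a path. A schema is a finite set of relation names, each with an arity; an instance of a schema $\Gamma$ is a finite set of facts $R(p_1,\dots,p_n)$ with $R\in\Gamma$ of arity $n$ and $p_i$ paths. It is *flat* if no packed value occurs in it. A schema is monadic if all its arities are at most $1$. **Programs.** Path expressions are built from atomic values, atomic variables (ranging over $\mathbf{dom}$), path variables (ranging over paths), packing $\langle e\rangle$ and finite concatenation (including the empty one). Atoms are predicates $P(e_1,\dots,e_n)$ and equations $e_1=e_2$; literals are atoms and negated atoms. A rule $H\leftarrow B$ has a predicate $H$ as head and a finite set $B$ of literals as body. The limited variables of a rule form the smallest set that contains all variables of positive predicates in the body and that, whenever it contains all variables of one side of a positive equation in the body, contains those of the other side. A rule is safe if all its variables are limited. A Sequence Datalog program is a finite sequence of strata (finite sets of safe rules) such that, if a negated predicate $\neg P(\dots)$ occurs in a stratum, $P$ is not the head relation of any rule in that stratum or a later one. Relation names that occur in heads are IDB, the others EDB; a program is over $\Gamma$ if its EDB names are in $\Gamma$ and its IDB names are not. The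 strata are applied in order, each to the result of the preceding ones: the result of a stratum on a finite set $I$ of facts is the smallest finite set of facts that contains $I$, satisfies all rules of the stratum, and agrees with $I$ on all relation names that are not heads in the stratum. If some stratum has no such result, the program does not terminate on the input; otherwise the final result is $P(I)$. **Features.** A program uses: $\mathsf A$ if it contains a predicate of arity greater than $1$; $\mathsf R$ if there is a cycle in the graph on its IDB names with an edge from $R_1$ to $R_2$ whenever $R_2$ occurs in the body of a rule with head relation $R_1$; $\mathsf E$ if it contains an equation (possibly negated); $\mathsf N$ if it contains a negated atom; $\mathsf P$ if some expression $\langle e\rangle$ occurs in it; $\mathsf I$ if it has at least two IDB names. A fragment is a subset $F$ of $\{\mathsf A,\mathsf E,\mathsf I,\mathsf N,\mathsf P,\mathsf R\}$; a program belongs to $F$ if it uses only features from $F$. **Subsumption.** For a monadic schema $\Gamma$ and a relation name $S\notin\Gamma$ of arity at most $1$, a query from $\Gamma$ to $S$ is a total map $Q$ from flat instances of $\Gamma$ to flat instances of $\{S\}$. A program $P$ computes $Q$ if it is over $\Gamma$, terminates on every flat instance $I$ of $\Gamma$, and the set of $S$-facts of $P(I)$ is $Q(I)$ for each such $I$ (this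 set is empty if $S$ is not an IDB name of $P$). Write $F_1\le F_2$ if every query computed by a program in $F_1$ is computed by a program in $F_2$. **Theorem.** For all fragments $F_1,F_2$, we have $F_1\le F_2$ if and only if the following five conditions hold: 1. $\mathsf N\in F_1\Rightarrow \mathsf N\in F_2$; 2. $\mathsf R\in F_1\Rightarrow \mathsf R\in F_2$; 3. $\mathsf E\in F_1\Rightarrow(\mathsf E\in F_2\lor \mathsf I\in F_2)$; 4. $(\mathsf I\in F_1\land \mathsf R\notin F_1\land \mathsf N\notin F_1)\Rightarrow(\mathsf I\in F_2\lor \mathsf E\in F_2)$; 5. $(\mathsf I\in F_1\land(\mathsf R\in F_1\lor \mathsf N\in F_1))\Rightarrow \mathsf I\in F_2$. Consequently, under mutual subsumption the fragments form exactly 11 equivalence classes, with representatives $\emptyset$, $\{\mathsf E\}$, $\{\mathsf N\}$, $\{\mathsf R\}$, $\{\mathsf E,\mathsf N\}$, $\{\mathsf E,\mathsf R\}$, $\{\mathsf N,\mathsf R\}$, $\{\mathsf I,\mathsf N\}$, $\{\mathsf I,\mathsf R\}$, $\{\mathsf E,\mathsf N,\mathsf R\}$, $\{\mathsf I,\mathsf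 N,\mathsf R\}$, and the covering pairs of the induced partial order (the edges of its Hasse diagram) are exactly: each pair $(G,G\cup\{X\})$ with $G\subseteq\{\mathsf E,\mathsf N,\mathsf R\}$ and $X\in\{\mathsf E,\mathsf N,\mathsf R\}\setminus G$ (12 pairs); $(\{\mathsf E\}\cup X,\{\mathsf I\}\cup X)$ for $\emptyset\ne X\subseteq\{\mathsf N,\mathsf R\}$ (3 pairs); and $(\{\mathsf I,\mathsf N\},\{\mathsf I,\mathsf N,\mathsf R\})$, $(\{\mathsf I,\mathsf R\},\{\mathsf I,\mathsf N,\mathsf R\})$. -/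

import Mathlib

namespace SeqDatalog

universe u

/-! ### Data model -/

/-- Values: atomic values, and packed values `⟨p⟩` with `p` a path (finite sequence of values). -/
inductive Value (dom : Type u) : Type u
  | atom (a : dom) : Value dom
  | packed (p : List (Value dom)) : Value dom

/-- Paths are finite sequences of values; concatenation is `++`, the empty path is `[]`. -/
abbrev Path (dom : Type u) : Type u := List (Value dom)

/-- A path is flat if no packed value occurs in it. -/
def Path.Flat {dom : Type u} (p : Path dom) : Prop :=
  ∀ v ∈ p, ∃ a : dom, v = Value.atom a

/-- Relation names, each with an associated arity; infinitely many names for every arity. -/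
structure RelName where
  id : ℕ
  arity : ℕ
  deriving DecidableEq

/-- A schema is a finite set of relation names. -/
abbrev Schema := Finset RelName

/-- A schema is monadic if every relation name in it has arity zero or one. -/
def Schema.Monadic (Γ : Schema) : Prop := ∀ R ∈ Γ, R.arity ≤ 1

/-- A fact `R(p₁, …, pₙ)`. -/
structure Fact (dom : Type u) where
  rel : RelName
  args : Fin rel.arity → Path dom

/-- `I` is an instance of `Γ`: a finite set of facts over the relation names of `Γ`. -/
def IsInstance {dom : Type u} (Γ : Schema) (I : Set (Fact dom)) : Prop :=
  I.Finite ∧ ∀ f ∈ I, f.rel ∈ Γ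

/-- A set of facts is flat if no packed value occurs in it. -/
def FlatFacts {dom : Type u} (I : Set (Fact dom)) : Prop :=
  ∀ f ∈ I, ∀ i, (f.args i).Flat

/-- The flat instances of a schema. -/
def FlatInstance (dom : Type u) (Γ : Schema) : Type u :=
  {I : Set (Fact dom) // IsInstance Γ I ∧ FlatFacts I}

/-! ### Syntax -/

/-- Atomic variables `@x` and path variables `$x`. -/
inductive Var
  | atomic (n : ℕ) : Var
  | path (n : ℕ) : Var
  deriving DecidableEq

/-- Path expressions; finite sequences of path expressions are generated by the empty
expression and binary concatenation. -/
inductive PathExpr (dom : Type u) : Type u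
  | const (a : dom) : PathExpr dom
  | var (x : Var) : PathExpr dom
  | pack (e : PathExpr dom) : PathExpr dom
  | empty : PathExpr dom
  | concat (e₁ e₂ : PathExpr dom) : PathExpr dom

/-- The variables occurring in a path expression. -/
def PathExpr.vars {dom : Type u} : PathExpr dom → Set Var
  | .const _ => ∅
  | .var x => {x}
  | .pack e => e.vars
  | .empty => ∅
  | .concat e₁ e₂ => e₁.vars ∪ e₂.vars

/-- A subexpression of the form `⟨e⟩` occurs in the path expression. -/
def PathExpr.HasPacking {dom : Type u} : PathExpr dom → Prop
  | .const _ => False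
  | .var _ => False
  | .pack _ => True
  | .empty => False
  | .concat e₁ e₂ => e₁.HasPacking ∨ e₂.HasPacking

/-- A predicate `P(e₁, …, eₙ)`, with `P` a relation name of arity `n`. -/
structure Predicate (dom : Type u) where
  rel : RelName
  args : Fin rel.arity → PathExpr dom

/-- An atom is a predicate or an equation. -/
inductive Atom (dom : Type u) : Type u
  | pred (P : Predicate dom) : Atom dom
  | eqn (e₁ e₂ : PathExpr dom) : Atom dom

/-- A literal is an atom or a negated atom. -/
inductive Literal (dom : Type u) : Type u
  | pos (A : Atom dom) : Literal dom
  | neg (A : Atom dom) : Literal dom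

/-- A rule `H ← B`. The body is a finite set of literals, listed in some order. -/
structure Rule (dom : Type u) where
  head : Predicate dom
  body : List (Literal dom)

def Literal.atom {dom : Type u} : Literal dom → Atom dom
  | .pos A => A
  | .neg A => A

def Predicate.vars {dom : Type u} (P : Predicate dom) : Set Var := ⋃ i, (P.args i).vars

def Atom.vars {dom : Type u} : Atom dom → Set Var
  | .pred P => P.vars
  | .eqn e₁ e₂ => e₁.vars ∪ e₂.vars

/-- The variables occurring in a rule. -/
def Rule.vars {dom : Type u} (r : Rule dom) : Set Var :=
  r.head.vars ∪ {x | ∃ L ∈ r.body, x ∈ L.atom.vars}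

/-- The limited variables of a rule with body `B`. -/
inductive Limited {dom : Type u} (B : List (Literal dom)) : Var → Prop
  | pred (P : Predicate dom) (x : Var) :
      Literal.pos (Atom.pred P) ∈ B → x ∈ P.vars → Limited B x
  | eqn_right (e₁ e₂ : PathExpr dom) (x : Var) :
      Literal.pos (Atom.eqn e₁ e₂) ∈ B → (∀ y ∈ e₁.vars, Limited B y) → x ∈ e₂.vars →
      Limited B x
  | eqn_left (e₁ e₂ : PathExpr dom) (x : Var) :
      Literal.pos (Atom.eqn e₁ e₂) ∈ B → (∀ y ∈ e₂.vars, Limited B y) → x ∈ e₁.vars →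
      Limited B x

/-- A rule is safe if all its variables are limited. -/
def Rule.Safe {dom : Type u} (r : Rule dom) : Prop := ∀ x ∈ r.vars, Limited r.body x

/-- A stratum is a finite set of rules, listed in some order. -/
abbrev Stratum (dom : Type u) : Type u := List (Rule dom)

/-- `R` is used in the head of some rule of the stratum. -/
def Stratum.IsHead {dom : Type u} (Δ : Stratum dom) (R : RelName) : Prop :=
  ∃ r ∈ Δ, r.head.rel = R

/-- Stratified negation: when a negated predicate occurs in some stratum, no rule in that
stratum or later strata uses its relation name in the head. -/
def Stratified {dom : Type u} : List (Stratum dom) → Prop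
  | [] => True
  | Δ :: rest =>
      (∀ r ∈ Δ, ∀ P : Predicate dom, Literal.neg (Atom.pred P) ∈ r.body →
        ∀ Δ' ∈ Δ :: rest, ¬ Stratum.IsHead Δ' P.rel) ∧ Stratified rest

/-- A program: a finite sequence of strata of safe rules, with stratified negation. -/
structure Program (dom : Type u) where
  strata : List (Stratum dom)
  safe : ∀ Δ ∈ strata, ∀ r ∈ Δ, r.Safe
  stratified : Stratified strata

/-- The rule `r` occurs in (some stratum of) the program. -/
def Program.HasRule {dom : Type u} (P : Program dom) (r : Rule dom) : Prop :=
  ∃ Δ ∈ P.strata, r ∈ Δ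

/-! ### Semantics -/

/-- A valuation maps atomic variables to atomic values and path variables to paths. (Values on
variables that do not occur in a construct are irrelevant to it.) -/
structure Valuation (dom : Type u) where
  atomic : ℕ → dom
  path : ℕ → Path dom

/-- The path `ν(e)`. -/
def PathExpr.eval {dom : Type u} (ν : Valuation dom) : PathExpr dom → Path dom
  | .const a => [Value.atom a]
  | .var (.atomic n) => [Value.atom (ν.atomic n)]
  | .var (.path n) => ν.path n
  | .pack e => [Value.packed (e.eval ν)]
  | .empty => []
  | .concat e₁ e₂ => e₁.eval ν ++ e₂.eval ν

/-- The fact `ν(P)`. -/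
def Predicate.eval {dom : Type u} (ν : Valuation dom) (P : Predicate dom) : Fact dom :=
  ⟨P.rel, fun i => (P.args i).eval ν⟩

def Atom.Sat {dom : Type u} (I : Set (Fact dom)) (ν : Valuation dom) : Atom dom → Prop
  | .pred P => P.eval ν ∈ I
  | .eqn e₁ e₂ => e₁.eval ν = e₂.eval ν

/-- `I, ν` satisfies a literal. -/
def Literal.Sat {dom : Type u} (I : Set (Fact dom)) (ν : Valuation dom) : Literal dom → Prop
  | .pos A => A.Sat I ν
  | .neg A => ¬ A.Sat I ν

/-- A rule is satisfied in `I`. -/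
def Rule.Sat {dom : Type u} (I : Set (Fact dom)) (r : Rule dom) : Prop :=
  ∀ ν : Valuation dom, (∀ L ∈ r.body, L.Sat I ν) → r.head.eval ν ∈ I

/-- `K` is a candidate result of the stratum `Δ` on `I`: a finite set of facts satisfying all
rules of `Δ`, extending `I`, and agreeing with `I` on all relation names that are not head
relation names of `Δ`. -/
def IsModelOver {dom : Type u} (Δ : Stratum dom) (I K : Set (Fact dom)) : Prop :=
  K.Finite ∧ I ⊆ K ∧ (∀ f ∈ K, ¬ Δ.IsHead f.rel → f ∈ I) ∧ ∀ r ∈ Δ, r.Sat K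

/-- `K` is the result of applying the stratum `Δ` to `I`: the smallest candidate. If there is
none, the stratum does not terminate on `I`. -/
def StratumResult {dom : Type u} (Δ : Stratum dom) (I K : Set (Fact dom)) : Prop :=
  IsLeast {K' | IsModelOver Δ I K'} K

/-- The strata are applied one after the other, each to the result of the preceding ones. -/
def StrataResult {dom : Type u} : List (Stratum dom) → Set (Fact dom) → Set (Fact dom) → Prop
  | [], I, J => J = I
  | Δ :: rest, I, J => ∃ K, StratumResult Δ I K ∧ StrataResult rest K J

/-- `P(I)` is defined and equals `J`. -/
def Program.Result {dom : Type u} (P : Program dom) (I J : Set (Fact dom)) : Prop :=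
  StrataResult P.strata I J

/-- IDB relation names: those used in the head of some rule. -/
def Program.IsIDB {dom : Type u} (P : Program dom) (R : RelName) : Prop :=
  ∃ r, P.HasRule r ∧ r.head.rel = R

/-- The relation name `R` occurs in the body of the rule `r` (positively or negated). -/
def Rule.InBody {dom : Type u} (r : Rule dom) (R : RelName) : Prop :=
  ∃ L ∈ r.body, ∃ Q : Predicate dom, L.atom = Atom.pred Q ∧ Q.rel = R

/-- EDB relation names: the other relation names occurring in the program. -/
def Program.IsEDB {dom : Type u} (P : Program dom) (R : RelName) : Prop :=
  (∃ r, P.HasRule r ∧ r.InBody R) ∧ ¬ P.IsIDB R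

/-- The program is over `Γ`. -/
def Program.Over {dom : Type u} (P : Program dom) (Γ : Schema) : Prop :=
  (∀ R, P.IsEDB R → R ∈ Γ) ∧ ∀ R, P.IsIDB R → R ∉ Γ

/-! ### Features and fragments -/

/-- Arity, Equations, Intermediate predicates, Negation, Packing, Recursion. -/
inductive Feature
  | A | E | I | N | P | R
  deriving DecidableEq

/-- A fragment is a set of features. -/
abbrev Fragment := Finset Feature

/-- The edges of the dependency graph, whose nodes are the IDB relation names. -/
def Program.Depends {dom : Type u} (P : Program dom) (R₁ R₂ : RelName) : Prop :=
  P.IsIDB R₂ ∧ ∃ r, P.HasRule r ∧ r.head.rel = R₁ ∧ r.InBody R₂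

def Predicate.HasPacking {dom : Type u} (Q : Predicate dom) : Prop :=
  ∃ i, (Q.args i).HasPacking

def Atom.HasPacking {dom : Type u} : Atom dom → Prop
  | .pred Q => Q.HasPacking
  | .eqn e₁ e₂ => e₁.HasPacking ∨ e₂.HasPacking

/-- The program uses the given feature. -/
def Program.Uses {dom : Type u} (P : Program dom) : Feature → Prop
  | .A => ∃ r, P.HasRule r ∧ (1 < r.head.rel.arity ∨ ∃ R, r.InBody R ∧ 1 < R.arity)
  | .E => ∃ r, P.HasRule r ∧ ∃ L ∈ r.body, ∃ e₁ e₂, L.atom = Atom.eqn e₁ e₂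
  | .I => ∃ R₁ R₂, P.IsIDB R₁ ∧ P.IsIDB R₂ ∧ R₁ ≠ R₂
  | .N => ∃ r, P.HasRule r ∧ ∃ A, Literal.neg A ∈ r.body
  | .P => ∃ r, P.HasRule r ∧ (r.head.HasPacking ∨ ∃ L ∈ r.body, L.atom.HasPacking)
  | .R => ∃ R, Relation.TransGen P.Depends R R

/-- The program belongs to the fragment `F`. -/
def Program.InFragment {dom : Type u} (P : Program dom) (F : Fragment) : Prop :=
  ∀ f, P.Uses f → f ∈ F

/-! ### Queries and subsumption -/

/-- A query from `Γ` to `S`: a total mapping from flat instances over `Γ` to flat instances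
over `{S}`. It is used for monadic `Γ` and for `S ∉ Γ` of arity at most one. -/
abbrev Query (dom : Type u) (Γ : Schema) (S : RelName) : Type u :=
  FlatInstance dom Γ → FlatInstance dom {S}

/-- The program computes the query: it is over `Γ`, terminates on every flat instance `I` of
`Γ`, and its result restricted to `S` is the value of the query. If `S` is not the head of any
rule, this restriction is empty. -/
def Program.Computes {dom : Type u} (P : Program dom) {Γ : Schema} {S : RelName}
    (Q : Query dom Γ S) : Prop :=
  P.Over Γ ∧ ∀ I : FlatInstance dom Γ, ∃ J, P.Result I.1 J ∧ {f ∈ J | f.rel = S} = (Q I).1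

/-- The query is computable by a program in the fragment `F`. -/
def ComputableIn {dom : Type u} (F : Fragment) {Γ : Schema} {S : RelName}
    (Q : Query dom Γ S) : Prop :=
  ∃ P : Program dom, P.InFragment F ∧ P.Computes Q

/-- `F₁ ≤ F₂`: every query computable in `F₁` is computable in `F₂`. -/
def Subsumed (dom : Type u) (F₁ F₂ : Fragment) : Prop :=
  ∀ (Γ : Schema) (S : RelName), Γ.Monadic → S ∉ Γ → S.arity ≤ 1 →
    ∀ Q : Query dom Γ S, ComputableIn F₁ Q → ComputableIn F₂ Q

/-- Equivalence in expressive power. -/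
def Equivalent (dom : Type u) (F₁ F₂ : Fragment) : Prop :=
  Subsumed dom F₁ F₂ ∧ Subsumed dom F₂ F₁

/-- Strict subsumption. -/
def StrictlySubsumed (dom : Type u) (F₁ F₂ : Fragment) : Prop :=
  Subsumed dom F₁ F₂ ∧ ¬ Subsumed dom F₂ F₁

/-! ### The Hasse diagram -/

open Feature in
/-- One fragment for each node of the Hasse diagram. -/
def hasseNodes : List Fragment :=
  [∅, {E}, {N}, {R}, {E, N}, {E, R}, {N, R}, {I, N}, {I, R}, {E, N, R}, {I, N, R}]

open Feature in
/-- The edges of the Hasse diagram, from the lower to the upper node. -/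
def hasseEdges : List (Fragment × Fragment) :=
  [(∅, {E}), (∅, {N}), (∅, {R}),
   ({E}, {E, N}), ({E}, {E, R}),
   ({N}, {E, N}), ({N}, {N, R}),
   ({R}, {E, R}), ({R}, {N, R}),
   ({E, N}, {I, N}), ({E, N}, {E, N, R}),
   ({E, R}, {I, R}), ({E, R}, {E, N, R}),
   ({N, R}, {E, N, R}),
   ({I, N}, {I, N, R}), ({I, R}, {I, N, R}),
   ({E, N, R}, {I, N, R})]

end SeqDatalog

-- Separating queries show that the five conditions are necessary; program transformations show that
-- they suffice. The semantics is first made total. Stratification ensures that the negated atoms of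
-- a stratum refer to relations which the stratum does not change, so the least candidate is the
-- inductively generated set `lfp`, provided that this set is finite (`stratumResult_iff`). A
-- program then amounts to the total map `run` together with a finiteness condition.
--
-- Necessity. Programs without negation are monotone, which settles N. A nonrecursive program
-- increases a tame measure of paths, such as the number of adjacent pairs b·b, only by an amount
-- independent of the input length, whereas deleting the letters a from (ab)^n creates n - 1 such
-- pairs; this settles R. The other separations concern programs with a single IDB name. If such a
-- program derives anything, one of its rules already fires on the input (`exists_firing_rule`), and
-- the input can be altered around this one firing. Without equations, a variable of the rule may be
-- given a fresh letter, so the rule cannot insist on a word over the letter a alone. A rule with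
-- few literals inspects only part of a long chain of edges, so it cannot verify reachability. A
-- rule that fires on the empty instance knows only the constants of the program, so it still fires
-- when a fact with a fresh letter is added, and emptiness is not expressible.
--
-- Sufficiency rests on five eliminations. Arity: a tuple is coded as one path by joining its
-- components with a separator a and then again with a separator b; the two copies together are
-- unambiguous (`join_append_inj`, `eliminate_arity`). Positive equations: when one side has only
-- variables bound by predicates, its value is stored in a new relation together with these
-- variables, and the other side is matched against the stored value (`eliminate_one_equation`).
-- Negated equations: distinct flat paths differ at a first position, or one properly extends the
-- other; both cases are positive once the pairs of distinct letters are available, and those are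
-- computed with a negated predicate (`eliminate_negEq`). Packing, bounded case: a path consists of
-- a bracket word and of flat segments. If the number of packed values is bounded, finitely many
-- bracket words occur, and these can be moved into the relation names
-- (`eliminate_bounded_packing`). Packing, recursive case: a path is spelled out twice, with
-- brackets (a, b) and (b, a). The pair determines the path, and a recursively defined relation
-- recognizes the relevant pairs (`eliminate_packing_of_not_posEq`).
--
-- With intermediate predicates available, these steps leave only N and R besides I
-- (`normalize_with_intermediate`). A program without them has only the flat output relation as IDB
-- name, so bounded packing applies with bound zero and needs no new name
-- (`normalize_without_intermediate`). A program with neither recursion nor negation is a finite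
-- iteration of immediate consequences and unfolds into rules over the input schema, at the price of
-- equations (`unfold_program`).
--
-- Subsumption thereby coincides with the decidable relation `Fragment.Below`, and the classes and
-- covering pairs are found by inspecting the 64 fragments.

namespace SeqDatalog

universe u

variable {dom : Type u}

/-! ### Least fixpoints of strata -/

/-- Facts derivable by the rules of a stratum, negated atoms being evaluated in the input. -/
inductive Derivable (Δ : Stratum dom) (I : Set (Fact dom)) : Fact dom → Prop
  | base {f : Fact dom} : f ∈ I → Derivable Δ I f
  | step (r : Rule dom) (ν : Valuation dom) : r ∈ Δ →
      (∀ Q, Literal.pos (Atom.pred Q) ∈ r.body → Derivable Δ I (Q.eval ν)) →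
      (∀ e₁ e₂, Literal.pos (Atom.eqn e₁ e₂) ∈ r.body → e₁.eval ν = e₂.eval ν) →
      (∀ A, Literal.neg A ∈ r.body → ¬ A.Sat I ν) → Derivable Δ I (r.head.eval ν)

/-- Possibly infinite; termination of the stratum is exactly finiteness of this set. -/
def lfp (Δ : Stratum dom) (I : Set (Fact dom)) : Set (Fact dom) := {f | Derivable Δ I f}

/-- No relation name negated in `Δ` is a head of `Δ'`. -/
def NegFree (Δ Δ' : Stratum dom) : Prop :=
  ∀ r ∈ Δ, ∀ P : Predicate dom, Literal.neg (Atom.pred P) ∈ r.body → ¬ Stratum.IsHead Δ' P.rel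

/-- A local condition and a pairwise one are both easily transported along maps and concatenations
of strata, which is how every transformed program is shown to be stratified. -/
theorem stratified_iff (s : List (Stratum dom)) :
    Stratified s ↔ (∀ Δ ∈ s, NegFree Δ Δ) ∧ s.Pairwise NegFree := by
  induction s with
  | nil => simp [Stratified]
  | cons Δ s ih =>
    simp only [Stratified, ih, List.pairwise_cons, List.mem_cons, forall_eq_or_imp]
    constructor
    · rintro ⟨h1, h2, h3⟩
      exact ⟨⟨fun r hr P hP => (h1 r hr P hP).1, h2⟩,
        fun Δ' hΔ' r hr P hP => (h1 r hr P hP).2 Δ' hΔ', h3⟩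
    · rintro ⟨⟨h1, h2⟩, h3, h4⟩
      exact ⟨fun r hr P hP => ⟨h1 r hr P hP, fun Δ' hΔ' => h3 Δ' hΔ' r hr P hP⟩, h2, h4⟩

theorem subset_lfp (Δ : Stratum dom) (I : Set (Fact dom)) : I ⊆ lfp Δ I :=
  fun _ hf => Derivable.base hf

theorem lfp_agree {Δ : Stratum dom} {I : Set (Fact dom)} {f : Fact dom} (hf : f ∈ lfp Δ I)
    (h : ¬ Δ.IsHead f.rel) : f ∈ I := by
  cases hf with
  | base h' => exact h'
  | step r ν hr _ _ _ => exact absurd ⟨r, hr, rfl⟩ h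

/-- A negated relation name is no head of the stratum, so its facts are the same in the input and in
every candidate result. -/
theorem sat_congr_of_agree {Δ : Stratum dom} {I K : Set (Fact dom)} (hn : NegFree Δ Δ)
    (hIK : I ⊆ K) (hag : ∀ f ∈ K, ¬ Δ.IsHead f.rel → f ∈ I) {r : Rule dom} (hr : r ∈ Δ)
    {A : Atom dom} (hA : Literal.neg A ∈ r.body) (ν : Valuation dom) :
    A.Sat K ν ↔ A.Sat I ν := by
  cases A with
  | eqn e₁ e₂ => exact Iff.rfl
  | pred Q => exact ⟨fun h => hag _ h (hn r hr Q hA), fun h => hIK h⟩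

theorem sat_lfp_iff {Δ : Stratum dom} {I : Set (Fact dom)} (hn : NegFree Δ Δ) {r : Rule dom}
    (hr : r ∈ Δ) {A : Atom dom} (hA : Literal.neg A ∈ r.body) (ν : Valuation dom) :
    A.Sat (lfp Δ I) ν ↔ A.Sat I ν :=
  sat_congr_of_agree hn (subset_lfp Δ I) (fun _ hf h => lfp_agree hf h) hr hA ν

theorem lfp_sat {Δ : Stratum dom} {I : Set (Fact dom)} (hn : NegFree Δ Δ) {r : Rule dom}
    (hr : r ∈ Δ) : r.Sat (lfp Δ I) := fun ν h =>
  Derivable.step r ν hr (fun Q hQ => h _ hQ) (fun _ _ he => h _ he)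
    (fun A hA hs => h _ hA ((sat_lfp_iff hn hr hA ν).2 hs))

/-- The step may use that the whole body, including its negated literals, holds in the final
fixpoint. The set `X` itself need only be tracked on positive predicates. -/
theorem lfp_induction {Δ : Stratum dom} {I X : Set (Fact dom)} (hn : NegFree Δ Δ) (hI : I ⊆ X)
    (hstep : ∀ r ∈ Δ, ∀ ν : Valuation dom, (∀ L ∈ r.body, L.Sat (lfp Δ I) ν) →
      (∀ Q, Literal.pos (Atom.pred Q) ∈ r.body → Q.eval ν ∈ X) → r.head.eval ν ∈ X) :
    lfp Δ I ⊆ X := by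
  intro f hf
  induction hf with
  | base h => exact hI h
  | step r ν hr hp he hneg ih =>
    refine hstep r hr ν ?_ ih
    intro L hL
    cases L with
    | pos A =>
      cases A with
      | pred Q => exact hp Q hL
      | eqn e₁ e₂ => exact he e₁ e₂ hL
    | neg A => exact fun h => hneg A hL ((sat_lfp_iff hn hr hL ν).1 h)

theorem lfp_cases {Δ : Stratum dom} {I : Set (Fact dom)} (hn : NegFree Δ Δ) {f : Fact dom}
    (hf : f ∈ lfp Δ I) : f ∈ I ∨ ∃ r ∈ Δ, ∃ ν : Valuation dom,
      (∀ L ∈ r.body, L.Sat (lfp Δ I) ν) ∧ r.head.eval ν = f := by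
  have : lfp Δ I ⊆ {f | f ∈ I ∨ ∃ r ∈ Δ, ∃ ν : Valuation dom,
      (∀ L ∈ r.body, L.Sat (lfp Δ I) ν) ∧ r.head.eval ν = f} :=
    lfp_induction hn (fun _ h => Or.inl h) fun r hr ν h _ => Or.inr ⟨r, hr, ν, h, rfl⟩
  exact this hf

theorem lfp_least {Δ : Stratum dom} {I K : Set (Fact dom)} (hn : NegFree Δ Δ) (hIK : I ⊆ K)
    (hag : ∀ f ∈ K, ¬ Δ.IsHead f.rel → f ∈ I) (hK : ∀ r ∈ Δ, r.Sat K) : lfp Δ I ⊆ K := by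
  refine lfp_induction hn hIK fun r hr ν h hp => hK r hr ν fun L hL => ?_
  cases L with
  | pos A =>
    cases A with
    | pred Q => exact hp Q hL
    | eqn e₁ e₂ => exact h _ hL
  | neg A =>
    exact fun hs => h _ hL ((sat_lfp_iff hn hr hL ν).2 ((sat_congr_of_agree hn hIK hag hr hL ν).1 hs))

/-- The generated set lies below every candidate. So if a finite candidate exists, the generated set
is finite, hence a candidate itself and the least one. -/
theorem stratumResult_iff {Δ : Stratum dom} {I K : Set (Fact dom)} (hn : NegFree Δ Δ) :
    StratumResult Δ I K ↔ K = lfp Δ I ∧ K.Finite := by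
  constructor
  · rintro ⟨⟨hf, h1, h2, h3⟩, hl⟩
    have hsub := lfp_least hn h1 h2 h3
    have : IsModelOver Δ I (lfp Δ I) :=
      ⟨hf.subset hsub, subset_lfp Δ I, fun f h h' => lfp_agree h h', fun r hr => lfp_sat hn hr⟩
    exact ⟨Set.Subset.antisymm (hl this) hsub, hf⟩
  · rintro ⟨rfl, hf⟩
    exact ⟨⟨hf, subset_lfp Δ I, fun f h h' => lfp_agree h h', fun r hr => lfp_sat hn hr⟩,
      fun K' hK' => lfp_least hn hK'.2.1 hK'.2.2.1 hK'.2.2.2⟩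

/-- The result of applying strata in order, without the finiteness requirement. -/
def run : List (Stratum dom) → Set (Fact dom) → Set (Fact dom)
  | [], I => I
  | Δ :: s, I => run s (lfp Δ I)

theorem run_append (s t : List (Stratum dom)) (I : Set (Fact dom)) :
    run (s ++ t) I = run t (run s I) := by
  induction s generalizing I with
  | nil => rfl
  | cons Δ s ih => exact ih _

theorem subset_run (s : List (Stratum dom)) (I : Set (Fact dom)) : I ⊆ run s I := by
  induction s generalizing I with
  | nil => exact fun _ h => h
  | cons Δ s ih => exact (subset_lfp Δ I).trans (ih _)

/-- Strata only add facts, so finiteness of the last set forces finiteness of all intermediate ones.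
-/
theorem strataResult_iff {s : List (Stratum dom)} (hs : ∀ Δ ∈ s, NegFree Δ Δ)
    {I J : Set (Fact dom)} (hI : I.Finite) :
    StrataResult s I J ↔ J = run s I ∧ J.Finite := by
  induction s generalizing I with
  | nil =>
    simp only [StrataResult, run]
    exact ⟨fun h => ⟨h, h ▸ hI⟩, fun h => h.1⟩
  | cons Δ s ih =>
    simp only [StrataResult, run]
    have hs' := fun Δ' h => hs Δ' (List.mem_cons_of_mem _ h)
    have hn := hs Δ List.mem_cons_self
    constructor
    · rintro ⟨K, hK, h⟩
      obtain ⟨rfl, hf⟩ := (stratumResult_iff hn).1 hK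
      exact (ih hs' hf).1 h
    · rintro ⟨rfl, hf⟩
      have hf' := hf.subset (subset_run s (lfp Δ I))
      exact ⟨_, (stratumResult_iff hn).2 ⟨rfl, hf'⟩, (ih hs' hf').2 ⟨rfl, hf⟩⟩

theorem Program.negFree (P : Program dom) : ∀ Δ ∈ P.strata, NegFree Δ Δ :=
  ((stratified_iff _).1 P.stratified).1

theorem Program.computes_iff (P : Program dom) {Γ : Schema} {S : RelName} (Q : Query dom Γ S) :
    P.Computes Q ↔ P.Over Γ ∧ ∀ I : FlatInstance dom Γ,
      (run P.strata I.1).Finite ∧ {f ∈ run P.strata I.1 | f.rel = S} = (Q I).1 := by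
  refine and_congr_right fun _ => forall_congr' fun I => ?_
  simp only [Program.Result, strataResult_iff P.negFree I.2.1.1]
  constructor
  · rintro ⟨J, ⟨rfl, hf⟩, h⟩
    exact ⟨hf, h⟩
  · rintro ⟨hf, h⟩
    exact ⟨_, ⟨rfl, hf⟩, h⟩

theorem mem_run_cases {s : List (Stratum dom)} {I : Set (Fact dom)} {f : Fact dom}
    (hf : f ∈ run s I) : f ∈ I ∨ ∃ Δ ∈ s, Δ.IsHead f.rel := by
  induction s generalizing I with
  | nil => exact Or.inl hf
  | cons Δ s ih =>
    rcases ih hf with h | ⟨Δ', h, h'⟩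
    · by_cases hh : Δ.IsHead f.rel
      · exact Or.inr ⟨Δ, List.mem_cons_self, hh⟩
      · exact Or.inl (lfp_agree h hh)
    · exact Or.inr ⟨Δ', List.mem_cons_of_mem _ h, h'⟩

theorem Program.isIDB_iff (P : Program dom) (R : RelName) :
    P.IsIDB R ↔ ∃ Δ ∈ P.strata, Δ.IsHead R :=
  ⟨fun ⟨r, ⟨Δ, h, hr⟩, h'⟩ => ⟨Δ, h, r, hr, h'⟩, fun ⟨Δ, h, r, hr, h'⟩ => ⟨r, ⟨Δ, h, hr⟩, h'⟩⟩

/-! ### Valuations -/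

/-- The path assigned to a variable. -/
def Valuation.get (ν : Valuation dom) (x : Var) : Path dom := (PathExpr.var x).eval ν

theorem PathExpr.eval_congr {ν ν' : Valuation dom} (e : PathExpr dom)
    (h : ∀ x ∈ e.vars, ν.get x = ν'.get x) : e.eval ν = e.eval ν' := by
  induction e with
  | const a => rfl
  | var x => exact h x rfl
  | pack e ih => simp only [PathExpr.eval, ih h]
  | empty => rfl
  | concat e₁ e₂ ih₁ ih₂ =>
    simp only [PathExpr.eval, ih₁ fun x hx => h x (Or.inl hx), ih₂ fun x hx => h x (Or.inr hx)]

theorem Predicate.eval_congr {ν ν' : Valuation dom} (P : Predicate dom)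
    (h : ∀ x ∈ P.vars, ν.get x = ν'.get x) : P.eval ν = P.eval ν' := by
  unfold Predicate.eval
  congr 1
  funext i
  exact PathExpr.eval_congr _ fun x hx => h x (Set.mem_iUnion.2 ⟨i, hx⟩)

theorem Atom.sat_congr {I : Set (Fact dom)} {ν ν' : Valuation dom} (A : Atom dom)
    (h : ∀ x ∈ A.vars, ν.get x = ν'.get x) : A.Sat I ν ↔ A.Sat I ν' := by
  cases A with
  | pred P => simp only [Atom.Sat, Predicate.eval_congr P h]
  | eqn e₁ e₂ =>
    simp only [Atom.Sat, PathExpr.eval_congr e₁ fun x hx => h x (Or.inl hx),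
      PathExpr.eval_congr e₂ fun x hx => h x (Or.inr hx)]

theorem Literal.sat_congr {I : Set (Fact dom)} {ν ν' : Valuation dom} (L : Literal dom)
    (h : ∀ x ∈ L.atom.vars, ν.get x = ν'.get x) : L.Sat I ν ↔ L.Sat I ν' := by
  cases L with
  | pos A => exact Atom.sat_congr A h
  | neg A => exact not_congr (Atom.sat_congr A h)

theorem PathExpr.finite_vars (e : PathExpr dom) : e.vars.Finite := by
  induction e with
  | const a => exact Set.finite_empty
  | var x => exact Set.finite_singleton x
  | pack e ih => exact ih
  | empty => exact Set.finite_empty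
  | concat e₁ e₂ ih₁ ih₂ => exact ih₁.union ih₂

theorem Predicate.finite_vars (P : Predicate dom) : P.vars.Finite :=
  Set.finite_iUnion fun i => (P.args i).finite_vars

theorem Atom.finite_vars (A : Atom dom) : A.vars.Finite := by
  cases A with
  | pred P => exact P.finite_vars
  | eqn e₁ e₂ => exact e₁.finite_vars.union e₂.finite_vars

def bodyVars (B : List (Literal dom)) : Set Var := {x | ∃ L ∈ B, x ∈ L.atom.vars}

theorem finite_bodyVars (B : List (Literal dom)) : (bodyVars B).Finite := by
  have : bodyVars B = ⋃ L ∈ {L | L ∈ B}, L.atom.vars := by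
    ext x; simp [bodyVars]
  rw [this]
  exact (List.finite_toSet B).biUnion fun L _ => L.atom.finite_vars

theorem Rule.finite_vars (r : Rule dom) : r.vars.Finite :=
  r.head.finite_vars.union (finite_bodyVars r.body)

/-- Limited variables inherit properties of the facts matched by the body. The property is graded,
the grade being allowed to grow along equations. -/
theorem limited_property {B : List (Literal dom)} (C : ℕ → Path dom → Prop)
    (hmono : ∀ m n p, m ≤ n → C m p → C n p)
    (hup : ∀ e : PathExpr dom, (∃ e', .pos (.eqn e e') ∈ B ∨ .pos (.eqn e' e) ∈ B) → ∀ m, ∃ m',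
      ∀ ν : Valuation dom, (∀ x ∈ e.vars, C m (ν.get x)) → C m' (e.eval ν))
    (hdown : ∀ (e : PathExpr dom) (x : Var), x ∈ e.vars → ∀ (m : ℕ) (ν : Valuation dom),
      C m (e.eval ν) → C m (ν.get x)) (m : ℕ) :
    ∃ m', ∀ (M : Set (Fact dom)) (ν : Valuation dom), (∀ L ∈ B, L.Sat M ν) →
      (∀ Q, .pos (.pred Q) ∈ B → ∀ i, C m ((Q.args i).eval ν)) →
      ∀ x, Limited B x → C m' (ν.get x) := by
  have key : ∀ x, Limited B x → ∃ m', ∀ (M : Set (Fact dom)) (ν : Valuation dom),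
      (∀ L ∈ B, L.Sat M ν) → (∀ Q, .pos (.pred Q) ∈ B → ∀ i, C m ((Q.args i).eval ν)) →
      C m' (ν.get x) := by
    -- An expression has finitely many variables, so their separate grades have a common upper
    -- bound; only then can the grade of the whole side be computed.
    have comb : ∀ e : PathExpr dom, (∃ e', .pos (.eqn e e') ∈ B ∨ .pos (.eqn e' e) ∈ B) →
        (∀ y ∈ e.vars, ∃ m', ∀ (M : Set (Fact dom)) (ν : Valuation dom),
          (∀ L ∈ B, L.Sat M ν) → (∀ Q, .pos (.pred Q) ∈ B → ∀ i, C m ((Q.args i).eval ν)) →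
          C m' (ν.get y)) →
        ∃ m', ∀ (M : Set (Fact dom)) (ν : Valuation dom),
          (∀ L ∈ B, L.Sat M ν) → (∀ Q, .pos (.pred Q) ∈ B → ∀ i, C m ((Q.args i).eval ν)) →
          C m' (e.eval ν) := by
      intro e he h
      choose! g hg using h
      obtain ⟨N, hN⟩ := (e.finite_vars.image g).bddAbove
      obtain ⟨m', hm'⟩ := hup e he N
      exact ⟨m', fun M ν h1 h2 => hm' ν fun y hy =>
        hmono _ _ _ (hN ⟨y, hy, rfl⟩) (hg y hy M ν h1 h2)⟩
    intro x hx
    induction hx with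
    | pred P x hP hx =>
      obtain ⟨i, hi⟩ := Set.mem_iUnion.1 hx
      exact ⟨m, fun M ν _ h => hdown _ x hi m ν (h P hP i)⟩
    | eqn_right e₁ e₂ x he _ hx ih =>
      obtain ⟨m', hm'⟩ := comb e₁ ⟨e₂, Or.inl he⟩ ih
      refine ⟨m', fun M ν h1 h2 => hdown e₂ x hx m' ν ?_⟩
      have : e₁.eval ν = e₂.eval ν := h1 _ he
      exact this ▸ hm' M ν h1 h2
    | eqn_left e₁ e₂ x he _ hx ih =>
      obtain ⟨m', hm'⟩ := comb e₂ ⟨e₁, Or.inr he⟩ ih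
      refine ⟨m', fun M ν h1 h2 => hdown e₁ x hx m' ν ?_⟩
      have : e₁.eval ν = e₂.eval ν := h1 _ he
      exact this ▸ hm' M ν h1 h2
  -- There are only finitely many limited variables, so one grade serves for all of them.
  have hB : {x | Limited B x} ⊆ bodyVars B := by
    intro x hx
    cases hx with
    | pred P x hP hx => exact ⟨_, hP, hx⟩
    | eqn_right e₁ e₂ x he _ hx => exact ⟨_, he, Or.inr hx⟩
    | eqn_left e₁ e₂ x he _ hx => exact ⟨_, he, Or.inl hx⟩
  choose! g hg using key
  obtain ⟨N, hN⟩ := (((finite_bodyVars B).subset hB).image g).bddAbove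
  exact ⟨N, fun M ν h1 h2 x hx => hmono _ _ _ (hN ⟨x, hx, rfl⟩) (hg x hx M ν h1 h2)⟩

/-- The ungraded case of `limited_property`. -/
theorem limited_closed {B : List (Literal dom)} (C : Path dom → Prop)
    (hup : ∀ e : PathExpr dom, (∃ e', .pos (.eqn e e') ∈ B ∨ .pos (.eqn e' e) ∈ B) →
      ∀ ν : Valuation dom, (∀ x ∈ e.vars, C (ν.get x)) → C (e.eval ν))
    (hdown : ∀ (e : PathExpr dom) (x : Var), x ∈ e.vars → ∀ (ν : Valuation dom),
      C (e.eval ν) → C (ν.get x)) {M : Set (Fact dom)} {ν : Valuation dom}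
    (hsat : ∀ L ∈ B, L.Sat M ν)
    (hpos : ∀ Q, .pos (.pred Q) ∈ B → ∀ i, C ((Q.args i).eval ν)) {x : Var} (hx : Limited B x) :
    C (ν.get x) := by
  obtain ⟨_, h⟩ := limited_property (B := B) (fun _ => C) (fun _ _ _ _ h => h)
    (fun e he _ => ⟨0, fun ν h => hup e he ν h⟩) (fun e x hx _ ν h => hdown e x hx ν h) 0
  exact h M ν hsat hpos x hx

/-! ### Lists of arguments -/

/-- Arguments given as lists avoid casts along equalities of arities. The default value is never
reached when the length equals the arity. -/
def mkFact (R : RelName) (l : List (Path dom)) : Fact dom := ⟨R, fun i => l.getD i []⟩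

def mkPred (R : RelName) (l : List (PathExpr dom)) : Predicate dom :=
  ⟨R, fun i => l.getD i .empty⟩

def Fact.list (f : Fact dom) : List (Path dom) := List.ofFn f.args

def Predicate.list (P : Predicate dom) : List (PathExpr dom) := List.ofFn P.args

@[simp] theorem mkFact_rel (R : RelName) (l : List (Path dom)) : (mkFact R l).rel = R := rfl

@[simp] theorem mkPred_rel (R : RelName) (l : List (PathExpr dom)) : (mkPred R l).rel = R := rfl

@[simp] theorem Predicate.eval_rel (P : Predicate dom) (ν : Valuation dom) :
    (P.eval ν).rel = P.rel := rfl

theorem mkFact_list (f : Fact dom) : mkFact f.rel f.list = f := by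
  unfold mkFact Fact.list
  cases f with
  | mk R a => congr 1; funext i; simp

theorem length_list (f : Fact dom) : f.list.length = f.rel.arity := by simp [Fact.list]

theorem length_predList (P : Predicate dom) : P.list.length = P.rel.arity := by
  simp [Predicate.list]

theorem list_mkFact {R : RelName} {l : List (Path dom)} (h : l.length = R.arity) :
    (mkFact R l).list = l := by
  unfold mkFact Fact.list
  apply List.ext_getElem
  · simp [h]
  · intro i h1 h2
    simp [h2]

theorem list_eval (P : Predicate dom) (ν : Valuation dom) :
    (P.eval ν).list = P.list.map (·.eval ν) := by
  simp only [Fact.list, Predicate.list, List.map_ofFn]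
  rfl

theorem eval_mkPred (R : RelName) (l : List (PathExpr dom)) (ν : Valuation dom) :
    (mkPred R l).eval ν = mkFact R (l.map (·.eval ν)) := by
  unfold mkPred mkFact Predicate.eval
  congr 1
  funext i
  simp only [List.getD_eq_getElem?_getD, List.getElem?_map]
  cases l[(i : ℕ)]? <;> rfl

theorem mkFact_inj {R R' : RelName} {l l' : List (Path dom)} (h : l.length = R.arity)
    (h' : l'.length = R'.arity) (he : mkFact R l = mkFact R' l') : R = R' ∧ l = l' := by
  have h1 : R = R' := congrArg Fact.rel he
  refine ⟨h1, ?_⟩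
  rw [← list_mkFact h, he, list_mkFact h']

theorem fact_ext {f g : Fact dom} (h : f.rel = g.rel) (h' : f.list = g.list) : f = g := by
  rw [← mkFact_list f, ← mkFact_list g, h, h']

/-- No hypothesis on the length is needed: missing arguments are filled with the empty expression,
which has no variables. -/
theorem mem_vars_mkPred {R : RelName} {l : List (PathExpr dom)} {x : Var}
    (hx : x ∈ (mkPred R l).vars) : ∃ e ∈ l, x ∈ e.vars := by
  obtain ⟨i, hi⟩ := Set.mem_iUnion.1 hx
  by_cases h : (i : ℕ) < l.length
  · refine ⟨l[(i : ℕ)], List.getElem_mem h, ?_⟩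
    simpa [mkPred, h] using hi
  · simp [mkPred, h, PathExpr.vars] at hi

theorem vars_mkPred {R : RelName} {l : List (PathExpr dom)} (h : l.length = R.arity) {x : Var} :
    x ∈ (mkPred R l).vars ↔ ∃ e ∈ l, x ∈ e.vars := by
  refine ⟨mem_vars_mkPred, ?_⟩
  rintro ⟨e, he, hx⟩
  obtain ⟨i, hi, rfl⟩ := List.getElem_of_mem he
  refine Set.mem_iUnion.2 ⟨⟨i, h ▸ hi⟩, ?_⟩
  simpa [mkPred, hi] using hx

theorem mem_predVars {P : Predicate dom} {x : Var} :
    x ∈ P.vars ↔ ∃ e ∈ P.list, x ∈ e.vars := by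
  simp [Predicate.vars, Predicate.list, List.mem_ofFn]

theorem hasPacking_mkPred {R : RelName} {l : List (PathExpr dom)}
    (hx : (mkPred R l).HasPacking) : ∃ e ∈ l, e.HasPacking := by
  obtain ⟨i, hi⟩ := hx
  by_cases h : (i : ℕ) < l.length
  · refine ⟨l[(i : ℕ)], List.getElem_mem h, ?_⟩
    simpa [mkPred, h] using hi
  · simp [mkPred, h, PathExpr.HasPacking] at hi

theorem forall_args {f : Fact dom} {p : Path dom → Prop} :
    (∀ i, p (f.args i)) ↔ ∀ q ∈ f.list, p q := by
  simp [Fact.list, List.mem_ofFn]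

/-- Values and paths are nested in one another; this principle treats them with a single motive,
descending into the content of a packed value and into the tail. -/
theorem path_induction {motive : Path dom → Prop} (nil : motive [])
    (atom : ∀ a p, motive p → motive (Value.atom a :: p))
    (packed : ∀ q p, motive q → motive p → motive (Value.packed q :: p)) :
    ∀ p : Path dom, motive p
  | [] => nil
  | Value.atom a :: p => atom a p (path_induction nil atom packed p)
  | Value.packed q :: p => packed q p (path_induction nil atom packed q)
      (path_induction nil atom packed p)
termination_by p => sizeOf p

/-! ### Nonrecursive programs -/

theorem Program.finite_isIDB (P : Program dom) : {R | P.IsIDB R}.Finite := by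
  refine ((P.strata.flatten.map fun r => r.head.rel).finite_toSet).subset ?_
  rintro R ⟨r, ⟨Δ, h, hr⟩, rfl⟩
  simp only [List.mem_map, List.mem_flatten, Set.mem_ofPred_eq]
  exact ⟨r, ⟨Δ, h, hr⟩, rfl⟩

/-- The rank of a name is the number of names reachable from it. Along an edge of an acyclic graph
the reachable set shrinks strictly. -/
theorem Program.exists_rank (P : Program dom) (h : ¬ P.Uses .R) :
    ∃ rk : RelName → ℕ, ∀ R₁ R₂, P.Depends R₁ R₂ → rk R₂ < rk R₁ := by
  have hfin : ∀ R, {R' | Relation.TransGen P.Depends R R'}.Finite := fun R =>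
    P.finite_isIDB.subset fun R' hR' => by
      cases hR' with
      | single h => exact h.1
      | tail _ h => exact h.1
  refine ⟨fun R => {R' | Relation.TransGen P.Depends R R'}.ncard, fun R₁ R₂ hd => ?_⟩
  -- The inclusion is strict because `R₂` is reachable from `R₁` but not from itself.
  refine Set.ncard_lt_ncard ⟨fun R' hR' => Relation.TransGen.head hd hR', fun hsub => ?_⟩ (hfin R₁)
  exact h ⟨R₂, hsub (Relation.TransGen.single hd)⟩

theorem Program.not_uses_R_of_rank (P : Program dom) (rk : RelName → ℕ)
    (h : ∀ R₁ R₂, P.Depends R₁ R₂ → rk R₂ < rk R₁) : ¬ P.Uses .R := by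
  rintro ⟨R, hR⟩
  have : ∀ R', Relation.TransGen P.Depends R R' → rk R' < rk R := by
    intro R' hR'
    induction hR' with
    | single hd => exact h _ _ hd
    | tail _ hd ih => exact (h _ _ hd).trans ih
  exact lt_irrefl _ (this R hR)

/-- Measures of paths that grow in a bounded way when expressions are evaluated. -/
structure TameMeasure (μ : Path dom → ℕ) : Prop where
  nil_le : μ [] ≤ 1
  atom_le : ∀ a, μ [Value.atom a] ≤ 1
  append_le : ∀ p q, μ (p ++ q) ≤ μ p + μ q + 1
  le_append_left : ∀ p q, μ p ≤ μ (p ++ q)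
  le_append_right : ∀ p q, μ q ≤ μ (p ++ q)
  pack_le : ∀ p, μ [Value.packed p] ≤ μ p + 1
  le_pack : ∀ p, μ p ≤ μ [Value.packed p]

theorem TameMeasure.get_le {μ : Path dom → ℕ} (h : TameMeasure μ) (e : PathExpr dom) (x : Var)
    (hx : x ∈ e.vars) (ν : Valuation dom) : μ (ν.get x) ≤ μ (e.eval ν) := by
  induction e with
  | const a => exact absurd hx (Set.notMem_empty _)
  | var y => rw [Set.mem_singleton_iff.1 hx]; exact le_refl _
  | pack e ih => exact (ih hx).trans (h.le_pack _)
  | empty => exact absurd hx (Set.notMem_empty _)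
  | concat e₁ e₂ ih₁ ih₂ =>
    rcases hx with hx | hx
    · exact (ih₁ hx).trans (h.le_append_left _ _)
    · exact (ih₂ hx).trans (h.le_append_right _ _)

theorem TameMeasure.eval_le {μ : Path dom → ℕ} (h : TameMeasure μ) (e : PathExpr dom) (m : ℕ) :
    ∃ m', ∀ ν : Valuation dom, (∀ x ∈ e.vars, μ (ν.get x) ≤ m) → μ (e.eval ν) ≤ m' := by
  induction e with
  | const a => exact ⟨1, fun ν _ => h.atom_le a⟩
  | var y => exact ⟨m, fun ν hν => hν y rfl⟩
  | pack e ih =>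
    obtain ⟨m', hm'⟩ := ih
    exact ⟨m' + 1, fun ν hν => (h.pack_le _).trans (Nat.add_le_add_right (hm' ν hν) 1)⟩
  | empty => exact ⟨1, fun ν _ => h.nil_le⟩
  | concat e₁ e₂ ih₁ ih₂ =>
    obtain ⟨m₁, hm₁⟩ := ih₁
    obtain ⟨m₂, hm₂⟩ := ih₂
    refine ⟨m₁ + m₂ + 1, fun ν hν => (h.append_le _ _).trans ?_⟩
    have := hm₁ ν fun x hx => hν x (Or.inl hx)
    have := hm₂ ν fun x hx => hν x (Or.inr hx)
    omega

theorem exists_bound_of_list {α : Type*} (l : List α) (p : α → ℕ → Prop)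
    (hmono : ∀ a m n, m ≤ n → p a m → p a n) (h : ∀ a ∈ l, ∃ m, p a m) :
    ∃ m, ∀ a ∈ l, p a m := by
  choose! g hg using h
  obtain ⟨N, hN⟩ := (l.finite_toSet.image g).bddAbove
  exact ⟨N, fun a ha => hmono a _ _ (hN ⟨a, ha, rfl⟩) (hg a ha)⟩

/-- By safety every variable is limited, so bounds pass from the matched facts through the
equations. The bound depends on the rule and on `m`, not on the facts or the valuation. -/
theorem TameMeasure.rule_vars {μ : Path dom → ℕ} (h : TameMeasure μ) (r : Rule dom)
    (hs : r.Safe) (m : ℕ) :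
    ∃ m', ∀ (M : Set (Fact dom)) (ν : Valuation dom), (∀ L ∈ r.body, L.Sat M ν) →
      (∀ Q, .pos (.pred Q) ∈ r.body → ∀ i, μ ((Q.args i).eval ν) ≤ m) →
      ∀ x ∈ r.vars, μ (ν.get x) ≤ m' := by
  obtain ⟨m', hm'⟩ := limited_property (B := r.body) (fun m p => μ p ≤ m)
    (fun _ _ _ h1 h2 => h2.trans h1) (fun e _ m => h.eval_le e m)
    (fun e x hx _ ν hm => (h.get_le e x hx ν).trans hm) m
  exact ⟨m', fun M ν h1 h2 x hx => hm' M ν h1 h2 x (hs x hx)⟩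

theorem TameMeasure.rule_head {μ : Path dom → ℕ} (h : TameMeasure μ) (r : Rule dom)
    (hs : r.Safe) (m : ℕ) :
    ∃ m', ∀ (M : Set (Fact dom)) (ν : Valuation dom), (∀ L ∈ r.body, L.Sat M ν) →
      (∀ Q, .pos (.pred Q) ∈ r.body → ∀ i, μ ((Q.args i).eval ν) ≤ m) →
      ∀ i, μ ((r.head.args i).eval ν) ≤ m' := by
  obtain ⟨m', hm'⟩ := h.rule_vars r hs m
  obtain ⟨N, hN⟩ := exists_bound_of_list (List.ofFn r.head.args)
    (fun e n => ∀ ν : Valuation dom, (∀ x ∈ e.vars, μ (ν.get x) ≤ m') → μ (e.eval ν) ≤ n)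
    (fun e m n hmn h ν hν => (h ν hν).trans hmn) (fun e _ => h.eval_le e m')
  refine ⟨N, fun M ν h1 h2 i => hN _ (List.mem_ofFn.2 ⟨i, rfl⟩) ν fun x hx => ?_⟩
  exact hm' M ν h1 h2 x (Or.inl (Set.mem_iUnion.2 ⟨i, hx⟩))

/-- Induction on the rank: a rule for a name of rank k reads heads of smaller rank, already bounded,
and relations left unchanged by the stratum, bounded by `m`. -/
theorem TameMeasure.stratum {μ : Path dom → ℕ} (h : TameMeasure μ) {Δ : Stratum dom}
    (hn : NegFree Δ Δ) (hs : ∀ r ∈ Δ, r.Safe) (rk : RelName → ℕ)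
    (hrk : ∀ r ∈ Δ, ∀ R, r.InBody R → Δ.IsHead R → rk R < rk r.head.rel) (m : ℕ) :
    ∃ m', ∀ I : Set (Fact dom), (∀ f ∈ I, ∀ i, μ (f.args i) ≤ m) →
      ∀ f ∈ lfp Δ I, ∀ i, μ (f.args i) ≤ m' := by
  have key : ∀ k, ∃ m', m ≤ m' ∧ ∀ I : Set (Fact dom), (∀ f ∈ I, ∀ i, μ (f.args i) ≤ m) →
      ∀ f ∈ lfp Δ I, rk f.rel < k → ∀ i, μ (f.args i) ≤ m' := by
    intro k
    induction k with
    | zero => exact ⟨m, le_refl _, fun _ _ _ _ h => absurd h (Nat.not_lt_zero _)⟩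
    | succ k ih =>
      obtain ⟨m₁, hle, hm₁⟩ := ih
      obtain ⟨N, hN⟩ := exists_bound_of_list Δ
        (fun r n => ∀ (M : Set (Fact dom)) (ν : Valuation dom), (∀ L ∈ r.body, L.Sat M ν) →
          (∀ Q, .pos (.pred Q) ∈ r.body → ∀ i, μ ((Q.args i).eval ν) ≤ m₁) →
          ∀ i, μ ((r.head.args i).eval ν) ≤ n)
        (fun r a b hab h' M ν h1 (h2 : ∀ Q : Predicate dom, _ → ∀ i, _) i =>
          (h' M ν h1 h2 i).trans hab)
        (fun r hr => h.rule_head r (hs r hr) m₁)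
      refine ⟨max m N, le_max_left _ _, fun I hI f hf hk i => ?_⟩
      rcases lfp_cases hn hf with hf' | ⟨r, hr, ν, hb, rfl⟩
      · exact (hI f hf' i).trans (le_max_left _ _)
      · refine (hN r hr _ ν hb (fun Q hQ j => ?_) i).trans (le_max_right _ _)
        have hQ' : Q.eval ν ∈ lfp Δ I := hb _ hQ
        by_cases hh : Δ.IsHead Q.rel
        · have := hrk r hr Q.rel ⟨_, hQ, Q, rfl, rfl⟩ hh
          exact hm₁ I hI _ hQ' (by simp only [Predicate.eval_rel] at hk ⊢; omega) j
        · exact (hI _ (lfp_agree hQ' hh) j).trans hle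
  obtain ⟨k, hk⟩ := exists_bound_of_list Δ (fun r n => rk r.head.rel < n)
    (fun r a b hab h => lt_of_lt_of_le h hab) (fun r _ => ⟨_, Nat.lt_succ_self _⟩)
  obtain ⟨m', hle, hm'⟩ := key k
  refine ⟨m', fun I hI f hf i => ?_⟩
  by_cases hh : Δ.IsHead f.rel
  · obtain ⟨r, hr, he⟩ := hh
    exact hm' I hI f hf (he ▸ hk r hr) i
  · exact (hI f (lfp_agree hf hh) i).trans hle

/-- The uniform growth bound for nonrecursive programs. It proves that recursion is needed, and it
bounds the number of packed values when recursion is absent. -/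
theorem TameMeasure.program {μ : Path dom → ℕ} (h : TameMeasure μ) (P : Program dom)
    (hR : ¬ P.Uses .R) (m : ℕ) :
    ∃ m', ∀ I : Set (Fact dom), (∀ f ∈ I, ∀ i, μ (f.args i) ≤ m) →
      ∀ f ∈ run P.strata I, ∀ i, μ (f.args i) ≤ m' := by
  obtain ⟨rk, hrk⟩ := P.exists_rank hR
  -- The rank decreases in every stratum; recording this stratum by stratum allows an induction over
  -- the list that no longer mentions the program.
  have hall : ∀ Δ ∈ P.strata, NegFree Δ Δ ∧ (∀ r ∈ Δ, r.Safe) ∧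
      ∀ r ∈ Δ, ∀ R, r.InBody R → Δ.IsHead R → rk R < rk r.head.rel := fun Δ hΔ =>
    ⟨P.negFree Δ hΔ, P.safe Δ hΔ, fun r hr R hb hh =>
      hrk _ _ ⟨(P.isIDB_iff R).2 ⟨Δ, hΔ, hh⟩, r, ⟨Δ, hΔ, hr⟩, rfl, hb⟩⟩
  generalize P.strata = s at hall
  induction s generalizing m with
  | nil => exact ⟨m, fun I hI => hI⟩
  | cons Δ s ih =>
    obtain ⟨h1, h2, h3⟩ := hall Δ List.mem_cons_self
    obtain ⟨m₁, hm₁⟩ := h.stratum h1 h2 rk h3 m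
    obtain ⟨m₂, hm₂⟩ := ih m₁ fun Δ' h' => hall Δ' (List.mem_cons_of_mem _ h')
    exact ⟨m₂, fun I hI => hm₂ _ (hm₁ I hI)⟩

/-! ### Two measures: packed values, and adjacent pairs of a fixed atom -/

mutual
def Value.packs : Value dom → ℕ
  | .atom _ => 0
  | .packed p => pathPacks p + 1
/-- The number of packed values occurring in a path, at all depths. -/
def pathPacks : List (Value dom) → ℕ
  | [] => 0
  | v :: p => v.packs + pathPacks p
end

theorem pathPacks_append (p q : Path dom) : pathPacks (p ++ q) = pathPacks p + pathPacks q := by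
  induction p with
  | nil => simp [pathPacks]
  | cons v p ih => simp only [List.cons_append, pathPacks, ih]; omega

theorem tameMeasure_packs : TameMeasure (pathPacks : Path dom → ℕ) where
  nil_le := by simp [pathPacks]
  atom_le a := by simp [pathPacks, Value.packs]
  append_le p q := by rw [pathPacks_append]; omega
  le_append_left p q := by rw [pathPacks_append]; omega
  le_append_right p q := by rw [pathPacks_append]; omega
  pack_le p := by simp [pathPacks, Value.packs]
  le_pack p := by simp [pathPacks, Value.packs]

theorem pathPacks_eq_zero {p : Path dom} : pathPacks p = 0 ↔ p.Flat := by
  induction p with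
  | nil => simp [pathPacks, Path.Flat]
  | cons v p ih =>
    have : Path.Flat (v :: p) ↔ (∃ a, v = Value.atom a) ∧ Path.Flat p := by simp [Path.Flat]
    rw [this, ← ih]
    cases v <;> simp [pathPacks, Value.packs]

open Classical in
noncomputable def adjacent (b : dom) (v : Value dom) (w : Option (Value dom)) : ℕ :=
  if v = Value.atom b ∧ w = some (Value.atom b) then 1 else 0

theorem adjacent_le (b : dom) (v : Value dom) (w : Option (Value dom)) : adjacent b v w ≤ 1 := by
  unfold adjacent; split_ifs <;> simp

theorem adjacent_none (b : dom) (v : Value dom) : adjacent b v none = 0 := by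
  simp [adjacent]

mutual
noncomputable def Value.pairs (b : dom) : Value dom → ℕ
  | .atom _ => 0
  | .packed p => pathPairs b p
/-- The number of adjacent pairs `b·b` in a path, at all depths. -/
noncomputable def pathPairs (b : dom) : List (Value dom) → ℕ
  | [] => 0
  | v :: p => v.pairs b + pathPairs b p + adjacent b v p.head?
end

/-- Concatenation can create at most one new adjacent pair, at the seam; this is the summand 1 in
`append_le`. Packing separates its content from the neighbours and creates none. -/
theorem tameMeasure_pairs (b : dom) : TameMeasure (pathPairs b : Path dom → ℕ) where
  nil_le := by simp [pathPairs]
  atom_le a := by simp [pathPairs, Value.pairs, adjacent_none]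
  append_le p q := by
    induction p with
    | nil => simp [pathPairs]
    | cons v p ih =>
      cases p with
      | nil =>
        simp only [List.cons_append, List.nil_append, pathPairs]
        have := adjacent_le b v q.head?
        omega
      | cons w p =>
        rw [List.cons_append, pathPairs, pathPairs.eq_def b (v :: w :: p)]
        simp only [List.cons_append, List.head?_cons] at ih ⊢
        omega
  le_append_left p q := by
    induction p with
    | nil => simp [pathPairs]
    | cons v p ih =>
      cases p with
      | nil =>
        simp only [List.cons_append, List.nil_append, pathPairs, List.head?_nil, adjacent_none]
        omega
      | cons w p =>
        rw [List.cons_append, pathPairs, pathPairs.eq_def b (v :: (w :: p ++ q))]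
        simp only [List.cons_append, List.head?_cons] at ih ⊢
        omega
  le_append_right p q := by
    induction p with
    | nil => simp
    | cons v p ih => simp only [List.cons_append, pathPairs]; omega
  pack_le p := by simp [pathPairs, Value.pairs, adjacent_none]
  le_pack p := by simp [pathPairs, Value.pairs, adjacent_none]

/-! ### Properties of paths preserved by programs -/

/-- Expressions whose values are created by the rule: head arguments and sides of positive
equations. -/
def Rule.HasExpr (r : Rule dom) (e : PathExpr dom) : Prop :=
  (∃ i, r.head.args i = e) ∨ ∃ e', .pos (.eqn e e') ∈ r.body ∨ .pos (.eqn e' e) ∈ r.body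

theorem rule_vars_closed {r : Rule dom} (hs : r.Safe) (C : Path dom → Prop)
    (hup : ∀ e, r.HasExpr e → ∀ ν : Valuation dom, (∀ x ∈ e.vars, C (ν.get x)) → C (e.eval ν))
    (hdown : ∀ (e : PathExpr dom) (x : Var), x ∈ e.vars → ∀ (ν : Valuation dom),
      C (e.eval ν) → C (ν.get x)) {M : Set (Fact dom)} {ν : Valuation dom}
    (hsat : ∀ L ∈ r.body, L.Sat M ν) (hM : ∀ f ∈ M, ∀ i, C (f.args i)) :
    ∀ x ∈ r.vars, C (ν.get x) := fun x hx =>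
  limited_closed C (fun e he => hup e (Or.inr he)) hdown hsat
    (fun Q hQ i => hM (Q.eval ν) (hsat _ hQ) i) (hs x hx)

/-- The property passes from matched facts down to variables, along equations to all limited
variables, and up again to heads. Only expressions that create values have to preserve it upwards.
-/
theorem lfp_closed {Δ : Stratum dom} (hn : NegFree Δ Δ) (hs : ∀ r ∈ Δ, r.Safe)
    (C : Path dom → Prop)
    (hup : ∀ r ∈ Δ, ∀ e, r.HasExpr e → ∀ ν : Valuation dom, (∀ x ∈ e.vars, C (ν.get x)) →
      C (e.eval ν))
    (hdown : ∀ (e : PathExpr dom) (x : Var), x ∈ e.vars → ∀ (ν : Valuation dom),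
      C (e.eval ν) → C (ν.get x)) {I : Set (Fact dom)} (hI : ∀ f ∈ I, ∀ i, C (f.args i)) :
    ∀ f ∈ lfp Δ I, ∀ i, C (f.args i) := by
  have : lfp Δ I ⊆ {f | ∀ i, C (f.args i)} := by
    refine lfp_induction hn hI fun r hr ν hsat hp i => ?_
    refine hup r hr _ (Or.inl ⟨i, rfl⟩) ν fun x hx => ?_
    exact limited_closed C (fun e he => hup r hr e (Or.inr he)) hdown hsat (fun Q hQ i => hp Q hQ i)
      (hs r hr x (Or.inl (Set.mem_iUnion.2 ⟨i, hx⟩)))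
  exact this

theorem run_closed {s : List (Stratum dom)} (hn : ∀ Δ ∈ s, NegFree Δ Δ)
    (hs : ∀ Δ ∈ s, ∀ r ∈ Δ, r.Safe) (C : Path dom → Prop)
    (hup : ∀ Δ ∈ s, ∀ r ∈ Δ, ∀ e, r.HasExpr e → ∀ ν : Valuation dom,
      (∀ x ∈ e.vars, C (ν.get x)) → C (e.eval ν))
    (hdown : ∀ (e : PathExpr dom) (x : Var), x ∈ e.vars → ∀ (ν : Valuation dom),
      C (e.eval ν) → C (ν.get x)) {I : Set (Fact dom)} (hI : ∀ f ∈ I, ∀ i, C (f.args i)) :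
    ∀ f ∈ run s I, ∀ i, C (f.args i) := by
  induction s generalizing I with
  | nil => exact hI
  | cons Δ s ih =>
    exact ih (fun Δ' h => hn Δ' (List.mem_cons_of_mem _ h))
      (fun Δ' h => hs Δ' (List.mem_cons_of_mem _ h))
      (fun Δ' h => hup Δ' (List.mem_cons_of_mem _ h))
      (lfp_closed (hn Δ List.mem_cons_self) (hs Δ List.mem_cons_self) C
        (hup Δ List.mem_cons_self) hdown hI)

theorem Path.flat_append {p q : Path dom} : Path.Flat (p ++ q) ↔ p.Flat ∧ q.Flat := by
  simp only [Path.Flat, List.mem_append, or_imp, forall_and]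

theorem Path.flat_nil : Path.Flat ([] : Path dom) := fun _ h => absurd h List.not_mem_nil

theorem Path.flat_cons {v : Value dom} {p : Path dom} :
    Path.Flat (v :: p) ↔ (∃ a, v = Value.atom a) ∧ Path.Flat p := by
  simp [Path.Flat]

theorem flat_eval {e : PathExpr dom} (h : ¬ e.HasPacking) {ν : Valuation dom}
    (hν : ∀ x ∈ e.vars, (ν.get x).Flat) : (e.eval ν).Flat := by
  induction e with
  | const a => simp [PathExpr.eval, Path.Flat]
  | var x => exact hν x rfl
  | pack e ih => exact absurd trivial h
  | empty => exact Path.flat_nil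
  | concat e₁ e₂ ih₁ ih₂ =>
    exact Path.flat_append.2 ⟨ih₁ (fun h' => h (Or.inl h')) fun x hx => hν x (Or.inl hx),
      ih₂ (fun h' => h (Or.inr h')) fun x hx => hν x (Or.inr hx)⟩

theorem flat_get {e : PathExpr dom} {x : Var} (hx : x ∈ e.vars) {ν : Valuation dom}
    (h : (e.eval ν).Flat) : (ν.get x).Flat := by
  rw [← pathPacks_eq_zero] at h ⊢
  exact Nat.le_zero.1 (h ▸ tameMeasure_packs.get_le e x hx ν)

def Rule.HasPacking (r : Rule dom) : Prop :=
  r.head.HasPacking ∨ ∃ L ∈ r.body, L.atom.HasPacking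

theorem Rule.not_hasPacking_of_hasExpr {r : Rule dom} (h : ¬ r.HasPacking) {e : PathExpr dom}
    (he : r.HasExpr e) : ¬ e.HasPacking := by
  intro hp
  rcases he with ⟨i, rfl⟩ | ⟨e', he | he⟩
  · exact h (Or.inl ⟨i, hp⟩)
  · exact h (Or.inr ⟨_, he, Or.inl hp⟩)
  · exact h (Or.inr ⟨_, he, Or.inr hp⟩)

theorem rule_vars_flat {r : Rule dom} (hs : r.Safe) (hp : ¬ r.HasPacking)
    {M : Set (Fact dom)} {ν : Valuation dom}
    (hsat : ∀ L ∈ r.body, L.Sat M ν) (hM : FlatFacts M) :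
    ∀ x ∈ r.vars, (ν.get x).Flat :=
  rule_vars_closed hs Path.Flat (fun _ he _ h => flat_eval (r.not_hasPacking_of_hasExpr hp he) h)
    (fun _ _ hx _ h => flat_get hx h) hsat hM

theorem Program.run_flat (P : Program dom) (hP : ¬ P.Uses .P) {I : Set (Fact dom)}
    (hI : FlatFacts I) : FlatFacts (run P.strata I) :=
  run_closed P.negFree P.safe Path.Flat
    (fun Δ hΔ r hr _ he _ h => flat_eval (r.not_hasPacking_of_hasExpr
      (fun hh => hP ⟨r, ⟨Δ, hΔ, hr⟩, hh⟩) he) h)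
    (fun _ _ hx _ h => flat_get hx h) hI

/-! ### Atomic values occurring in paths and constants occurring in programs -/

mutual
def Value.atoms : Value dom → Set dom
  | .atom a => {a}
  | .packed p => pathAtoms p
/-- The atomic values occurring in a path. -/
def pathAtoms : List (Value dom) → Set dom
  | [] => ∅
  | v :: p => v.atoms ∪ pathAtoms p
end

theorem pathAtoms_append (p q : Path dom) : pathAtoms (p ++ q) = pathAtoms p ∪ pathAtoms q := by
  induction p with
  | nil => simp [pathAtoms]
  | cons v p ih => simp only [List.cons_append, pathAtoms, ih, Set.union_assoc]

theorem finite_pathAtoms (p : Path dom) : (pathAtoms p).Finite := by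
  induction p using path_induction with
  | nil => exact Set.finite_empty
  | atom a p ih => exact (Set.finite_singleton a).union ih
  | packed q p ih₁ ih₂ => exact ih₁.union ih₂

def PathExpr.consts : PathExpr dom → Set dom
  | .const a => {a}
  | .var _ => ∅
  | .pack e => e.consts
  | .empty => ∅
  | .concat e₁ e₂ => e₁.consts ∪ e₂.consts

theorem PathExpr.finite_consts (e : PathExpr dom) : e.consts.Finite := by
  induction e with
  | const a => exact Set.finite_singleton a
  | var x => exact Set.finite_empty
  | pack e ih => exact ih
  | empty => exact Set.finite_empty
  | concat e₁ e₂ ih₁ ih₂ => exact ih₁.union ih₂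

def Atom.consts : Atom dom → Set dom
  | .pred P => ⋃ i, (P.args i).consts
  | .eqn e₁ e₂ => e₁.consts ∪ e₂.consts

theorem Atom.finite_consts (A : Atom dom) : A.consts.Finite := by
  cases A with
  | pred P => exact Set.finite_iUnion fun i => (P.args i).finite_consts
  | eqn e₁ e₂ => exact e₁.finite_consts.union e₂.finite_consts

def Rule.consts (r : Rule dom) : Set dom :=
  (Atom.pred r.head).consts ∪ ⋃ L ∈ {L | L ∈ r.body}, L.atom.consts

theorem Rule.finite_consts (r : Rule dom) : r.consts.Finite :=
  (Atom.finite_consts _).union ((List.finite_toSet _).biUnion fun L _ => L.atom.finite_consts)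

theorem Rule.consts_of_body {r : Rule dom} {L : Literal dom} (hL : L ∈ r.body) :
    L.atom.consts ⊆ r.consts := fun _ hx => Or.inr (Set.mem_biUnion (by exact hL) hx)

theorem Rule.consts_of_hasExpr {r : Rule dom} {e : PathExpr dom} (he : r.HasExpr e) :
    e.consts ⊆ r.consts := by
  intro a ha
  rcases he with ⟨i, rfl⟩ | ⟨e', he | he⟩
  · exact Or.inl (Set.mem_iUnion.2 ⟨i, ha⟩)
  · exact Rule.consts_of_body he (Or.inl ha)
  · exact Rule.consts_of_body he (Or.inr ha)

def Program.consts (P : Program dom) : Set dom := ⋃ r ∈ {r | P.HasRule r}, r.consts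

theorem Program.finite_hasRule (P : Program dom) : {r | P.HasRule r}.Finite := by
  refine (P.strata.flatten.finite_toSet).subset ?_
  rintro r ⟨Δ, h, hr⟩
  exact List.mem_flatten.2 ⟨Δ, h, hr⟩

theorem Program.finite_consts (P : Program dom) : P.consts.Finite :=
  P.finite_hasRule.biUnion fun r _ => r.finite_consts

theorem Program.consts_of_rule {P : Program dom} {r : Rule dom} (hr : P.HasRule r) :
    r.consts ⊆ P.consts := fun _ hx => Set.mem_biUnion (by exact hr) hx

theorem pathAtoms_eval {e : PathExpr dom} {C : Set dom} (hc : e.consts ⊆ C) {ν : Valuation dom}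
    (hν : ∀ x ∈ e.vars, pathAtoms (ν.get x) ⊆ C) : pathAtoms (e.eval ν) ⊆ C := by
  induction e with
  | const a => simpa [PathExpr.eval, pathAtoms, Value.atoms, PathExpr.consts] using hc
  | var x => exact hν x rfl
  | pack e ih => simpa [PathExpr.eval, pathAtoms, Value.atoms] using ih hc hν
  | empty => exact Set.empty_subset _
  | concat e₁ e₂ ih₁ ih₂ =>
    rw [PathExpr.eval, pathAtoms_append]
    exact Set.union_subset (ih₁ (fun x hx => hc (Or.inl hx)) fun x hx => hν x (Or.inl hx))
      (ih₂ (fun x hx => hc (Or.inr hx)) fun x hx => hν x (Or.inr hx))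

theorem pathAtoms_get {e : PathExpr dom} {x : Var} (hx : x ∈ e.vars) (ν : Valuation dom) :
    pathAtoms (ν.get x) ⊆ pathAtoms (e.eval ν) := by
  induction e with
  | const a => exact absurd hx (Set.notMem_empty _)
  | var y => rw [Set.mem_singleton_iff.1 hx]; exact fun _ h => h
  | pack e ih => simpa [PathExpr.eval, pathAtoms, Value.atoms] using ih hx
  | empty => exact absurd hx (Set.notMem_empty _)
  | concat e₁ e₂ ih₁ ih₂ =>
    rw [PathExpr.eval, pathAtoms_append]
    rcases hx with hx | hx
    · exact (ih₁ hx).trans Set.subset_union_left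
    · exact (ih₂ hx).trans Set.subset_union_right

theorem rule_vars_atoms {r : Rule dom} (hs : r.Safe) {C : Set dom} (hC : r.consts ⊆ C)
    {M : Set (Fact dom)} {ν : Valuation dom}
    (hsat : ∀ L ∈ r.body, L.Sat M ν) (hM : ∀ f ∈ M, ∀ i, pathAtoms (f.args i) ⊆ C) :
    ∀ x ∈ r.vars, pathAtoms (ν.get x) ⊆ C :=
  rule_vars_closed hs (fun p => pathAtoms p ⊆ C)
    (fun _ he _ h => pathAtoms_eval ((Rule.consts_of_hasExpr he).trans hC) h)
    (fun _ _ hx ν h => (pathAtoms_get hx ν).trans h) hsat hM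

/-! ### Monotonicity -/

theorem lfp_mono_of_no_neg {Δ : Stratum dom} (h : ∀ r ∈ Δ, ∀ A, Literal.neg A ∉ r.body)
    {I I' : Set (Fact dom)} (hI : I ⊆ I') : lfp Δ I ⊆ lfp Δ I' := by
  intro f hf
  induction hf with
  | base h => exact subset_lfp Δ I' (hI h)
  | step r ν hr _ he _ ih =>
    exact Derivable.step r ν hr ih he fun A hA => absurd hA (h r hr A)

theorem run_mono_of_no_neg {s : List (Stratum dom)}
    (h : ∀ Δ ∈ s, ∀ r ∈ Δ, ∀ A, Literal.neg A ∉ r.body)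
    {I I' : Set (Fact dom)} (hI : I ⊆ I') : run s I ⊆ run s I' := by
  induction s generalizing I I' with
  | nil => exact hI
  | cons Δ s ih =>
    exact ih (fun Δ' h' => h Δ' (List.mem_cons_of_mem _ h'))
      (lfp_mono_of_no_neg (h Δ List.mem_cons_self) hI)

/-! ### Programs without intermediate predicates -/

theorem run_agree_schema {P : Program dom} {Γ : Schema} (ho : P.Over Γ) {s : List (Stratum dom)}
    (hs : s ⊆ P.strata) {I : Set (Fact dom)} {f : Fact dom} (hf : f ∈ run s I)
    (hΓ : f.rel ∈ Γ) : f ∈ I := by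
  rcases mem_run_cases hf with h | ⟨Δ, hΔ, hh⟩
  · exact h
  · exact absurd hΓ (ho.2 _ ((P.isIDB_iff _).2 ⟨Δ, hs hΔ, hh⟩))

/-- A rule that fires on the input, with negated predicates over the input schema only,
contributes to the result. -/
theorem head_mem_run {P : Program dom} {Γ : Schema} (ho : P.Over Γ) {r : Rule dom}
    (hr : P.HasRule r) (hneg : ∀ Q, .neg (.pred Q) ∈ r.body → Q.rel ∈ Γ) {I : Set (Fact dom)}
    {ν : Valuation dom} (hsat : ∀ L ∈ r.body, L.Sat I ν) : r.head.eval ν ∈ run P.strata I := by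
  obtain ⟨Δ, hΔ, hr⟩ := hr
  obtain ⟨s, t, hst⟩ := List.append_of_mem hΔ
  rw [hst, run_append]
  refine subset_run t _ (lfp_sat (P.negFree Δ hΔ) hr ν fun L hL => ?_)
  cases L with
  | pos A =>
    cases A with
    | pred Q => exact subset_lfp _ _ (subset_run s I (hsat _ hL))
    | eqn e₁ e₂ => exact hsat _ hL
  | neg A =>
    cases A with
    | pred Q =>
      intro h
      -- Relations of `Γ` are never changed by the program, so a negated fact that is absent from
      -- the input is still absent after this stratum.
      refine hsat _ hL (run_agree_schema ho (s := s ++ [Δ]) ?_ (by rw [run_append]; exact h)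
        (hneg Q hL))
      intro x hx
      rw [hst]
      simp only [List.mem_append, List.mem_singleton, List.mem_cons] at hx ⊢
      tauto
    | eqn e₁ e₂ => exact hsat _ hL

theorem head_rel_of_single {P : Program dom} (hI : ¬ P.Uses .I) {S : RelName} (hS : P.IsIDB S)
    {r : Rule dom} (hr : P.HasRule r) : r.head.rel = S := by
  by_contra h
  exact hI ⟨_, _, ⟨r, hr, rfl⟩, hS, h⟩

/-- With only one IDB name, a negated IDB predicate would carry the head relation of its own rule,
which stratification forbids. -/
theorem neg_rel_of_single {P : Program dom} {Γ : Schema} (ho : P.Over Γ) (hI : ¬ P.Uses .I)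
    {r : Rule dom} (hr : P.HasRule r) {Q : Predicate dom} (hQ : .neg (.pred Q) ∈ r.body) :
    Q.rel ∈ Γ := by
  refine ho.1 _ ⟨⟨r, hr, _, hQ, Q, rfl, rfl⟩, fun hidb => ?_⟩
  obtain ⟨Δ, hΔ, hr'⟩ := hr
  have := head_rel_of_single hI hidb ⟨Δ, hΔ, hr'⟩
  exact P.negFree Δ hΔ r hr' Q hQ ⟨r, hr', this⟩

/-- If a program without intermediate predicates derives anything, one of its rules fires on the
input. -/
theorem exists_firing_rule {P : Program dom} {Γ : Schema} (ho : P.Over Γ) (hI : ¬ P.Uses .I)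
    {I : Set (Fact dom)} (h : ¬ run P.strata I ⊆ I) :
    ∃ r, P.HasRule r ∧ ∃ ν : Valuation dom, (∀ L ∈ r.body, L.Sat I ν) ∧
      r.head.eval ν ∈ run P.strata I := by
  by_contra hcon
  apply h
  -- A rule firing on the input has its head in the result, so it would be the rule sought.
  have hno : ∀ r, P.HasRule r → ∀ ν : Valuation dom, ¬ ∀ L ∈ r.body, L.Sat I ν :=
    fun r hr ν hsat => hcon ⟨r, hr, ν, hsat, head_mem_run ho hr
      (fun Q hQ => neg_rel_of_single ho hI hr hQ) hsat⟩
  -- If no rule fires on the input, every stratum leaves the input unchanged, and by induction so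
  -- does the whole program.
  have hstr : ∀ Δ ∈ P.strata, lfp Δ I ⊆ I := fun Δ hΔ => by
    refine lfp_induction (P.negFree Δ hΔ) (fun _ h => h) fun r hr ν hsat hp => ?_
    refine absurd (fun L hL => ?_) (hno r ⟨Δ, hΔ, hr⟩ ν)
    cases L with
    | pos A =>
      cases A with
      | pred Q => exact hp Q hL
      | eqn e₁ e₂ => exact hsat _ hL
    | neg A => exact fun hs => hsat _ hL ((sat_lfp_iff (P.negFree Δ hΔ) hr hL ν).2 hs)
  generalize P.strata = s at hstr
  induction s with
  | nil => exact fun _ h => h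
  | cons Δ s ih =>
    rw [run, Set.Subset.antisymm (hstr Δ List.mem_cons_self) (subset_lfp Δ I)]
    exact ih fun Δ' h' => hstr Δ' (List.mem_cons_of_mem _ h')

/-- The query computed by a program that terminates with flat output. -/
def Program.query (P : Program dom) (Γ : Schema) (S : RelName)
    (h : ∀ I : FlatInstance dom Γ, (run P.strata I.1).Finite ∧
      FlatFacts {f ∈ run P.strata I.1 | f.rel = S}) : Query dom Γ S := fun I =>
  ⟨{f ∈ run P.strata I.1 | f.rel = S}, ⟨(h I).1.subset fun _ hf => hf.1,
    fun f hf => Finset.mem_singleton.2 hf.2⟩, (h I).2⟩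

theorem Program.computes_query (P : Program dom) (Γ : Schema) (S : RelName) (ho : P.Over Γ)
    (h : ∀ I : FlatInstance dom Γ, (run P.strata I.1).Finite ∧
      FlatFacts {f ∈ run P.strata I.1 | f.rel = S}) : P.Computes (P.query Γ S h) :=
  (P.computes_iff _).2 ⟨ho, fun I => ⟨(h I).1, rfl⟩⟩

/-- If `F₁ ≤ F₂`, every terminating program in `F₁` has an equivalent in `F₂`. -/
theorem Subsumed.exists_program {F₁ F₂ : Fragment} (hsub : Subsumed dom F₁ F₂) {Γ : Schema}
    {S : RelName} (hΓ : Γ.Monadic) (hS : S ∉ Γ) (hSa : S.arity ≤ 1) (P : Program dom)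
    (hP : P.InFragment F₁) (ho : P.Over Γ)
    (h : ∀ I : FlatInstance dom Γ, (run P.strata I.1).Finite ∧
      FlatFacts {f ∈ run P.strata I.1 | f.rel = S}) :
    ∃ P' : Program dom, P'.InFragment F₂ ∧ P'.Over Γ ∧ ∀ I, IsInstance Γ I → FlatFacts I →
      ∀ f : Fact dom, f.rel = S → (f ∈ run P'.strata I ↔ f ∈ run P.strata I) := by
  obtain ⟨P', hP', hc⟩ := hsub Γ S hΓ hS hSa _ ⟨P, hP, P.computes_query Γ S ho h⟩
  rw [Program.computes_iff] at hc
  refine ⟨P', hP', hc.1, fun I hI hf f hfS => ?_⟩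
  have := (hc.2 ⟨I, hI, hf⟩).2
  have h2 : f ∈ {f ∈ run P'.strata I | f.rel = S} ↔ f ∈ {f ∈ run P.strata I | f.rel = S} := by
    rw [this]; rfl
  exact ⟨fun h' => (h2.1 ⟨h', hfS⟩).1, fun h' => (h2.2 ⟨h', hfS⟩).1⟩

/-! ### Negation is needed -/

theorem arity_zero_vars {R : RelName} (h : R.arity = 0) (l : List (PathExpr dom)) :
    (mkPred R l).vars = ∅ := by
  refine Set.eq_empty_of_forall_notMem fun x hx => ?_
  obtain ⟨i, -⟩ := Set.mem_iUnion.1 hx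
  exact absurd i.2 (by simp [h])

theorem inBody_iff {h : Predicate dom} {B : List (Literal dom)} {R : RelName} :
    (Rule.mk h B).InBody R ↔ ∃ L ∈ B, ∃ Q : Predicate dom, L.atom = Atom.pred Q ∧ Q.rel = R :=
  Iff.rfl

/-- `S() ← ¬R()`. -/
def negProgram (dom : Type u) : Program dom where
  strata := [[⟨mkPred ⟨1, 0⟩ [], [.neg (.pred (mkPred ⟨0, 0⟩ []))]⟩]]
  safe := by
    simp [Rule.Safe, Rule.vars, arity_zero_vars, Literal.atom, Atom.vars]
  stratified := by
    simp [Stratified, Stratum.IsHead]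

/-- The query answers S on the empty instance but not on the instance with the single fact R, so it
is not monotone, whereas every program without negated literals is. -/
theorem negation_necessary [Nonempty dom] {F₁ F₂ : Fragment} (h : Subsumed dom F₁ F₂) (h₁ : Feature.N ∈ F₁) :
    Feature.N ∈ F₂ := by
  by_contra h₂
  have hrule : ∀ r, (negProgram dom).HasRule r ↔
      r = ⟨mkPred ⟨1, 0⟩ [], [.neg (.pred (mkPred ⟨0, 0⟩ []))]⟩ := by
    simp [Program.HasRule, negProgram]
  have hidb : ∀ R, (negProgram dom).IsIDB R ↔ R = ⟨1, 0⟩ := fun R => by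
    simp [Program.IsIDB, hrule, eq_comm]
  have hrun : ∀ I : Set (Fact dom), run (negProgram dom).strata I ⊆ insert (mkFact ⟨1, 0⟩ []) I := by
    intro I
    refine lfp_induction ((negProgram dom).negFree _ List.mem_cons_self) (Set.subset_insert _ _)
      fun r hr ν _ _ => ?_
    rw [List.mem_singleton.1 hr, eval_mkPred]
    exact Set.mem_insert _ _
  obtain ⟨P', hP', ho, hP''⟩ := h.exists_program (Γ := {⟨0, 0⟩}) (S := ⟨1, 0⟩)
    (by simp [Schema.Monadic]) (by simp) (by simp) (negProgram dom)
    (by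
      intro f hf
      cases f with
      | N => exact h₁
      | A => simp [Program.Uses, hrule, inBody_iff, Literal.atom] at hf
      | E => simp [Program.Uses, hrule, Literal.atom] at hf
      | I =>
        simp only [Program.Uses, hidb] at hf
        obtain ⟨_, _, rfl, rfl, h⟩ := hf
        exact absurd rfl h
      | P =>
        simp [Program.Uses, hrule, Literal.atom, Atom.HasPacking, Predicate.HasPacking] at hf
      | R =>
        exact absurd hf ((negProgram dom).not_uses_R_of_rank (fun _ => 0)
          (by simp [Program.Depends, hidb, hrule, inBody_iff, Literal.atom]))
      )
    ⟨by simp [Program.IsEDB, hidb, hrule, inBody_iff, Literal.atom], by simp [hidb]⟩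
    (fun I => ⟨(I.2.1.1.insert _).subset (hrun I.1), by
      rintro f ⟨-, hf⟩ i
      exact absurd i.2 (by simp [hf])⟩)
  have hmono : run P'.strata ∅ ⊆ run P'.strata {mkFact ⟨0, 0⟩ []} :=
    run_mono_of_no_neg (fun Δ hΔ r hr A hA => h₂ (hP' _ ⟨r, ⟨Δ, hΔ, hr⟩, A, hA⟩))
      (Set.empty_subset _)
  have h1 : mkFact ⟨1, 0⟩ [] ∈ run (negProgram dom).strata ∅ := by
    have := lfp_sat (I := ∅) ((negProgram dom).negFree _ List.mem_cons_self) List.mem_cons_self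
      ⟨fun _ => Classical.arbitrary dom, fun _ => []⟩ ?_
    · rwa [eval_mkPred] at this
    · simp only [List.mem_singleton, forall_eq]
      intro hs
      exact lfp_agree hs (by simp [Stratum.IsHead])
  have h2 := hmono ((hP'' ∅ ⟨Set.finite_empty, by simp⟩ (by simp [FlatFacts]) _ rfl).2 h1)
  have h3 := (hP'' _ ⟨Set.finite_singleton _, by simp⟩
    (by rintro f rfl i; exact absurd i.2 (by simp)) _ rfl).1 h2
  rcases lfp_cases ((negProgram dom).negFree _ List.mem_cons_self) h3 with h4 | ⟨r, hr, ν, hb, -⟩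
  · exact absurd (congrArg Fact.rel (Set.mem_singleton_iff.1 h4)) (by simp)
  · rw [List.mem_singleton.1 hr] at hb
    refine hb _ List.mem_cons_self (subset_lfp _ _ ?_)
    rw [eval_mkPred]
    rfl

/-! ### Recursion is needed -/

theorem safe_of_pos {r : Rule dom}
    (h : ∀ x ∈ r.vars, ∃ Q, .pos (.pred Q) ∈ r.body ∧ x ∈ Q.vars) : r.Safe := fun x hx =>
  let ⟨Q, hQ, hx'⟩ := h x hx
  .pred Q x hQ hx'

theorem vars_mkPred_one {R : RelName} (h : R.arity = 1) (e : PathExpr dom) :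
    (mkPred R [e]).vars = e.vars := by
  ext x
  rw [vars_mkPred (by simp [h])]
  simp

/-- `S($x) ← R($x)` and `S($x·$y) ← S($x·a·$y)`. -/
def deleteProgram (a : dom) : Program dom where
  strata := [[⟨mkPred ⟨1, 1⟩ [.var (.path 0)], [.pos (.pred (mkPred ⟨0, 1⟩ [.var (.path 0)]))]⟩,
    ⟨mkPred ⟨1, 1⟩ [.concat (.var (.path 0)) (.var (.path 1))],
      [.pos (.pred (mkPred ⟨1, 1⟩
        [.concat (.var (.path 0)) (.concat (.const a) (.var (.path 1)))]))]⟩]]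
  safe := by
    simp only [forall_eq, List.mem_cons, List.not_mem_nil, or_false, forall_eq_or_imp]
    constructor <;>
    · apply safe_of_pos
      simp [Rule.vars, vars_mkPred_one, PathExpr.vars, Literal.atom, Atom.vars]
  stratified := by
    simp [Stratified]

theorem pathPairs_alternating {a b : dom} (hab : a ≠ b) (n : ℕ) :
    pathPairs b (List.replicate n [Value.atom a, Value.atom b]).flatten = 0 := by
  have hne : Value.atom a ≠ Value.atom b := fun h => hab (Value.atom.inj h)
  induction n with
  | zero => simp [pathPairs]
  | succ n ih =>
    simp only [List.replicate_succ, List.flatten_cons, List.cons_append, List.nil_append, pathPairs,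
      ih, Value.pairs]
    cases n with
    | zero => simp [adjacent, hne]
    | succ n => simp [adjacent, hne, List.replicate_succ]

theorem pathPairs_replicate (b : dom) (n : ℕ) :
    pathPairs b (List.replicate (n + 1) (Value.atom b)) = n := by
  induction n with
  | zero => simp [pathPairs, Value.pairs, adjacent]
  | succ n ih =>
    rw [List.replicate_succ, pathPairs, ih]
    simp [Value.pairs, adjacent, List.replicate_succ]

/-- The paths occurring as arguments of facts. -/
def argPaths (I : Set (Fact dom)) : Set (Path dom) := {p | ∃ f ∈ I, p ∈ f.list}

theorem finite_argPaths {I : Set (Fact dom)} (h : I.Finite) : (argPaths I).Finite := by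
  have : argPaths I = ⋃ f ∈ I, {p | p ∈ f.list} := by ext p; simp [argPaths]
  rw [this]
  exact h.biUnion fun f _ => f.list.finite_toSet

/-- From a word (ab)^k, deletion of all letters a yields b^k, which has k - 1 adjacent pairs b·b
although the input has none. A nonrecursive program with inputs free of such pairs produces at most
`m` of them, uniformly in k. -/
theorem recursion_necessary [Infinite dom] {F₁ F₂ : Fragment} (h : Subsumed dom F₁ F₂)
    (h₁ : Feature.R ∈ F₁) : Feature.R ∈ F₂ := by
  by_contra h₂
  obtain ⟨a, b, hab⟩ := exists_pair_ne dom
  have hrule := fun r => (show (deleteProgram a).HasRule r ↔ r = _ ∨ r = _ by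
    simp only [Program.HasRule, deleteProgram, exists_eq_left, List.mem_cons,
      List.not_mem_nil, or_false]
    exact Iff.rfl)
  have hidb : ∀ R, (deleteProgram a).IsIDB R ↔ R = ⟨1, 1⟩ := fun R => by
    simp [Program.IsIDB, hrule, or_and_right, exists_or, eq_comm]
  have hn := (deleteProgram a).negFree _ List.mem_cons_self
  -- Deletion only produces sublists of input paths, so the recursion terminates.
  have hrun : ∀ I : Set (Fact dom), run (deleteProgram a).strata I ⊆
      I ∪ (fun q => mkFact ⟨1, 1⟩ [q]) '' ⋃ p ∈ argPaths I, {q | q ∈ p.sublists} := by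
    intro I
    have hmk : ∀ f p q, f ∈ I → p ∈ f.list → q.Sublist p → mkFact ⟨1, 1⟩ [q] ∈
        I ∪ (fun q => mkFact ⟨1, 1⟩ [q]) '' ⋃ p ∈ argPaths I, {q | q ∈ p.sublists} :=
      fun f p q hf hp hq => Or.inr ⟨q, Set.mem_biUnion (show p ∈ argPaths I from ⟨f, hf, hp⟩)
        (List.mem_sublists.2 hq), rfl⟩
    refine lfp_induction hn Set.subset_union_left fun r hr ν hb hp => ?_
    simp only [List.mem_cons, List.not_mem_nil, or_false] at hr
    rcases hr with rfl | rfl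
    · have h := hb _ List.mem_cons_self
      simp only [Literal.Sat, Atom.Sat, eval_mkPred] at h
      have h := lfp_agree h (by simp [Stratum.IsHead])
      rw [eval_mkPred]
      refine hmk _ _ _ h ?_ (List.Sublist.refl _)
      rw [list_mkFact (by simp)]
      exact List.mem_cons_self
    · have h := hp _ List.mem_cons_self
      rw [eval_mkPred] at h ⊢
      simp only [List.map_cons, List.map_nil, PathExpr.eval] at h ⊢
      have hsub : (ν.path 0 ++ ν.path 1).Sublist (ν.path 0 ++ ([Value.atom a] ++ ν.path 1)) :=
        List.Sublist.append (List.Sublist.refl _) (List.sublist_append_right _ _)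
      rcases h with h | ⟨q, hq, h⟩
      · exact hmk _ _ _ h (by rw [list_mkFact (by simp)]; exact List.mem_cons_self) hsub
      · obtain ⟨_, hq⟩ := mkFact_inj (by simp) (by simp) h
        simp only [List.cons.injEq, and_true] at hq
        subst hq
        obtain ⟨p, ⟨f, hf, hp⟩, hq⟩ := Set.mem_iUnion₂.1 hq
        exact hmk f p _ hf hp (hsub.trans (List.mem_sublists.1 hq))
  have hP : ¬ (deleteProgram a).Uses .P := by
    simp [Program.Uses, hrule, Literal.atom, Atom.HasPacking, Predicate.HasPacking, mkPred,
      PathExpr.HasPacking]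
  obtain ⟨P', hP', ho, hP''⟩ := h.exists_program (Γ := {⟨0, 1⟩}) (S := ⟨1, 1⟩)
    (by simp [Schema.Monadic]) (by simp) (by simp) (deleteProgram a)
    (by
      intro f hf
      cases f with
      | R => exact h₁
      | A => simp [Program.Uses, hrule, inBody_iff, Literal.atom] at hf
      | E => simp [Program.Uses, hrule, Literal.atom] at hf
      | I =>
        simp only [Program.Uses, hidb] at hf
        obtain ⟨_, _, rfl, rfl, h⟩ := hf
        exact absurd rfl h
      | P => exact absurd hf hP
      | N => simp [Program.Uses, hrule] at hf)
    ⟨by simp [Program.IsEDB, hidb, hrule, inBody_iff, Literal.atom]; grind, by simp [hidb]⟩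
    (fun I => ⟨Set.Finite.subset (I.2.1.1.union (((finite_argPaths I.2.1.1).biUnion
      fun p _ => p.sublists.finite_toSet).image _)) (hrun I.1),
      fun f hf => (deleteProgram a).run_flat hP I.2.2 f hf.1⟩)
  obtain ⟨m, hm⟩ := (tameMeasure_pairs b).program P' (fun h => h₂ (hP' _ h)) 0
  -- The letters a are deleted from left to right: `j` blocks have already been reduced to b, and
  -- `k` blocks ab remain.
  have hdel : ∀ (I : Set (Fact dom)) (k j : ℕ), mkFact ⟨1, 1⟩ [List.replicate j (Value.atom b) ++
      (List.replicate k [Value.atom a, Value.atom b]).flatten] ∈ run (deleteProgram a).strata I →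
      mkFact ⟨1, 1⟩ [List.replicate (j + k) (Value.atom b)] ∈ run (deleteProgram a).strata I := by
    intro I k
    induction k with
    | zero => intro j h; simpa using h
    | succ k ih =>
      intro j h
      rw [show j + (k + 1) = j + 1 + k by omega]
      apply ih
      have := lfp_sat (I := I) hn (List.mem_cons_of_mem _ List.mem_cons_self)
        ⟨fun _ => a, fun n => if n = 0 then List.replicate j (Value.atom b) else
          Value.atom b :: (List.replicate k [Value.atom a, Value.atom b]).flatten⟩ ?_
      · rw [eval_mkPred] at this
        simpa [PathExpr.eval, List.replicate_succ', run, deleteProgram] using this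
      · simp only [List.mem_singleton, forall_eq, Literal.Sat, Atom.Sat, eval_mkPred]
        simpa [PathExpr.eval, List.replicate_succ, run, deleteProgram] using h
  -- With `m + 2` blocks the fully reduced word has `m + 1` adjacent pairs, one more than the bound.
  let p : Path dom := (List.replicate (m + 2) [Value.atom a, Value.atom b]).flatten
  have hp : p.Flat := by
    intro v hv
    simp only [p, List.mem_flatten, List.mem_replicate] at hv
    obtain ⟨l, ⟨-, rfl⟩, hv⟩ := hv
    simp only [List.mem_cons, List.not_mem_nil, or_false] at hv
    rcases hv with rfl | rfl <;> exact ⟨_, rfl⟩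
  have hS : mkFact ⟨1, 1⟩ [p] ∈ run (deleteProgram a).strata {mkFact ⟨0, 1⟩ [p]} := by
    have := lfp_sat (I := {mkFact ⟨0, 1⟩ [p]}) hn List.mem_cons_self ⟨fun _ => a, fun _ => p⟩ ?_
    · rw [eval_mkPred] at this
      exact this
    · simp only [List.mem_singleton, forall_eq, Literal.Sat, Atom.Sat, eval_mkPred]
      exact subset_lfp _ _ rfl
  have h1 := hdel _ (m + 2) 0 (by simpa using hS)
  have h2 := (hP'' _ ⟨Set.finite_singleton _, by simp⟩
    (by rintro f rfl; rw [forall_args, list_mkFact (by simp)]; simpa using hp) _ rfl).2 h1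
  have h3 := hm _ (by
    rintro f rfl
    rw [forall_args (p := fun q => pathPairs b q ≤ 0), list_mkFact (by simp)]
    simp [p, pathPairs_alternating hab]) _ h2
  rw [forall_args (p := fun q => pathPairs b q ≤ m), list_mkFact (by simp)] at h3
  have h4 := h3 _ List.mem_cons_self
  rw [show 0 + (m + 2) = m + 1 + 1 by omega, pathPairs_replicate] at h4
  omega

/-! ### Equations or intermediate predicates are needed -/

mutual
def Value.map (h : dom → dom) : Value dom → Value dom
  | .atom a => .atom (h a)
  | .packed p => .packed (pathMap h p)
/-- Replace the atomic values of a path. -/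
def pathMap (h : dom → dom) : List (Value dom) → List (Value dom)
  | [] => []
  | v :: p => v.map h :: pathMap h p
end

theorem pathMap_append (h : dom → dom) (p q : Path dom) :
    pathMap h (p ++ q) = pathMap h p ++ pathMap h q := by
  induction p with
  | nil => rfl
  | cons v p ih => simp only [List.cons_append, pathMap, ih]

theorem flat_of_pathMap {h : dom → dom} {p : Path dom} (hp : Path.Flat (pathMap h p)) : p.Flat := by
  induction p with
  | nil => exact Path.flat_nil
  | cons v p ih =>
    rw [pathMap, Path.flat_cons] at hp
    refine Path.flat_cons.2 ⟨?_, ih hp.2⟩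
    cases v with
    | atom a => exact ⟨a, rfl⟩
    | packed q => obtain ⟨⟨a, ha⟩, -⟩ := hp; simp [Value.map] at ha

/-- A letter substitution that fixes the constants of an expression commutes with evaluation. It is
used to pull a modified match of a rule back to the original one. -/
theorem pathMap_eval {h : dom → dom} {ν ν' : Valuation dom} (e : PathExpr dom)
    (hc : ∀ a ∈ e.consts, h a = a) (hν : ∀ x ∈ e.vars, pathMap h (ν'.get x) = ν.get x) :
    pathMap h (e.eval ν') = e.eval ν := by
  induction e with
  | const a => simp [PathExpr.eval, pathMap, Value.map, hc a rfl]
  | var x => exact hν x rfl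
  | pack e ih => simp [PathExpr.eval, pathMap, Value.map, ih hc hν]
  | empty => rfl
  | concat e₁ e₂ ih₁ ih₂ =>
    rw [PathExpr.eval, pathMap_append, ih₁ (fun a ha => hc a (Or.inl ha)) fun x hx => hν x (Or.inl hx),
      ih₂ (fun a ha => hc a (Or.inr ha)) fun x hx => hν x (Or.inr hx), PathExpr.eval]

theorem eval_pred_of_pathMap {h : dom → dom} {ν ν' : Valuation dom} {Q : Predicate dom}
    (hc : ∀ a ∈ (Atom.pred Q).consts, h a = a)
    (hν : ∀ x ∈ Q.vars, pathMap h (ν'.get x) = ν.get x) :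
    Q.eval ν = ⟨Q.rel, fun i => pathMap h ((Q.eval ν').args i)⟩ := by
  unfold Predicate.eval
  congr 1
  funext i
  exact (pathMap_eval _ (fun a ha => hc a (Set.mem_iUnion.2 ⟨i, ha⟩))
    fun x hx => hν x (Set.mem_iUnion.2 ⟨i, hx⟩)).symm

/-- If all variables are empty, only constants and packed subexpressions contribute to the length,
one each at most. A longer value must come from a nonempty variable. -/
theorem exists_nonempty_var (e : PathExpr dom) :
    ∃ m, ∀ ν : Valuation dom, m < (e.eval ν).length → ∃ x ∈ e.vars, ν.get x ≠ [] := by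
  induction e with
  | const a => exact ⟨1, fun ν h => absurd h (by simp [PathExpr.eval])⟩
  | var x => exact ⟨0, fun ν h => ⟨x, rfl, List.length_pos_iff.1 h⟩⟩
  | pack e _ => exact ⟨1, fun ν h => absurd h (by simp [PathExpr.eval])⟩
  | empty => exact ⟨0, fun ν h => absurd h (by simp [PathExpr.eval])⟩
  | concat e₁ e₂ ih₁ ih₂ =>
    obtain ⟨m₁, h₁⟩ := ih₁
    obtain ⟨m₂, h₂⟩ := ih₂
    refine ⟨m₁ + m₂, fun ν h => ?_⟩
    rw [PathExpr.eval, List.length_append] at h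
    by_cases h' : m₁ < (e₁.eval ν).length
    · obtain ⟨x, hx, hx'⟩ := h₁ ν h'
      exact ⟨x, Or.inl hx, hx'⟩
    · obtain ⟨x, hx, hx'⟩ := h₂ ν (by omega)
      exact ⟨x, Or.inr hx, hx'⟩

/-- Comparing first letters shows that the word begins with `v`, and after cancellation its tail
commutes with `v` again. -/
theorem eq_of_commute {v : Value dom} {w : Path dom} (h : [v] ++ w = w ++ [v]) : ∀ u ∈ w, u = v := by
  induction w with
  | nil => simp
  | cons u w ih =>
    simp only [List.cons_append, List.nil_append, List.cons.injEq] at h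
    obtain ⟨rfl, h⟩ := h
    intro u' hu'
    rcases List.mem_cons.1 hu' with rfl | hu'
    · rfl
    · exact ih (by simpa using h) u' hu'

/-- `S($x) ← R($x), a·$x = $x·a`. -/
def equationProgram (a : dom) : Program dom where
  strata := [[⟨mkPred ⟨1, 1⟩ [.var (.path 0)], [.pos (.pred (mkPred ⟨0, 1⟩ [.var (.path 0)])),
    .pos (.eqn (.concat (.const a) (.var (.path 0))) (.concat (.var (.path 0)) (.const a)))]⟩]]
  safe := by
    simp only [forall_eq, List.mem_cons, List.not_mem_nil, or_false]
    apply safe_of_pos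
    simp [Rule.vars, vars_mkPred_one, PathExpr.vars, Literal.atom, Atom.vars]
  stratified := by
    simp [Stratified]

theorem mem_pathAtoms_of_mem {c : dom} {p : Path dom} (h : Value.atom c ∈ p) : c ∈ pathAtoms p := by
  induction p with
  | nil => simp at h
  | cons v p ih =>
    rcases List.mem_cons.1 h with rfl | h
    · exact Or.inl rfl
    · exact Or.inr (ih h)

theorem pathAtoms_subset_of_forall {a : dom} {p : Path dom} (h : ∀ v ∈ p, v = Value.atom a) :
    pathAtoms p ⊆ {a} := by
  induction p with
  | nil => exact Set.empty_subset _
  | cons v p ih =>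
    rw [h v List.mem_cons_self]
    exact Set.union_subset (fun _ h => h) (ih fun w hw => h w (List.mem_cons_of_mem _ hw))

/-- Suppose a single-relation program without equations outputs the words over the letter a. On a
long enough such word, the head of a firing rule contains a nonempty variable. Replacing a letter of
its value by a fresh letter c leaves the rule applicable to the correspondingly modified positive
body facts, but the derived word now contains c. A word commuting with a contains no letter other
than a. -/
theorem equation_necessary [Infinite dom] {F₁ F₂ : Fragment} (h : Subsumed dom F₁ F₂)
    (h₁ : Feature.E ∈ F₁) : Feature.E ∈ F₂ ∨ Feature.I ∈ F₂ := by
  by_contra h₂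
  rw [not_or] at h₂
  obtain ⟨a⟩ : Nonempty dom := inferInstance
  have hrule := fun r => (show (equationProgram a).HasRule r ↔ r = _ by
    simp only [Program.HasRule, equationProgram, exists_eq_left, List.mem_cons,
      List.not_mem_nil, or_false]
    exact Iff.rfl)
  have hidb : ∀ R, (equationProgram a).IsIDB R ↔ R = ⟨1, 1⟩ := fun R => by
    simp [Program.IsIDB, hrule, eq_comm]
  have hn := (equationProgram a).negFree _ List.mem_cons_self
  have hrun : ∀ I : Set (Fact dom), run (equationProgram a).strata I =
      I ∪ (fun q => mkFact ⟨1, 1⟩ [q]) '' {q | mkFact ⟨0, 1⟩ [q] ∈ I ∧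
        [Value.atom a] ++ q = q ++ [Value.atom a]} := by
    intro I
    apply Set.Subset.antisymm
    · refine lfp_induction hn Set.subset_union_left fun r hr ν hb hp => ?_
      rw [List.mem_singleton.1 hr] at hb ⊢
      have h1 := hb _ List.mem_cons_self
      have h2 := hb _ (List.mem_cons_of_mem _ List.mem_cons_self)
      simp only [Literal.Sat, Atom.Sat, eval_mkPred] at h1 h2
      rw [eval_mkPred]
      exact Or.inr ⟨_, ⟨lfp_agree h1 (by simp [Stratum.IsHead]), h2⟩, rfl⟩
    · rintro f (hf | ⟨q, ⟨hq, he⟩, rfl⟩)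
      · exact subset_run _ _ hf
      · have := lfp_sat (I := I) hn List.mem_cons_self ⟨fun _ => a, fun _ => q⟩ ?_
        · rwa [eval_mkPred] at this
        · simp only [List.mem_cons, List.not_mem_nil, or_false, forall_eq_or_imp, forall_eq,
            Literal.Sat, Atom.Sat, eval_mkPred]
          exact ⟨subset_lfp _ _ hq, he⟩
  have hP : ¬ (equationProgram a).Uses .P := by
    simp [Program.Uses, hrule, Literal.atom, Atom.HasPacking, Predicate.HasPacking, mkPred,
      PathExpr.HasPacking]
  obtain ⟨P', hP', ho, hP''⟩ := h.exists_program (Γ := {⟨0, 1⟩}) (S := ⟨1, 1⟩)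
    (by simp [Schema.Monadic]) (by simp) (by simp) (equationProgram a)
    (by
      intro f hf
      cases f with
      | E => exact h₁
      | A => simp [Program.Uses, hrule, inBody_iff, Literal.atom] at hf
      | R =>
        exact absurd hf ((equationProgram a).not_uses_R_of_rank (fun _ => 0)
          (by simp [Program.Depends, hidb, hrule, inBody_iff, Literal.atom]))
      | I =>
        simp only [Program.Uses, hidb] at hf
        obtain ⟨_, _, rfl, rfl, h⟩ := hf
        exact absurd rfl h
      | P => exact absurd hf hP
      | N => simp [Program.Uses, hrule] at hf)
    ⟨by simp [Program.IsEDB, hidb, hrule, inBody_iff, Literal.atom], by simp [hidb]⟩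
    (fun I => ⟨by
      rw [hrun]
      refine I.2.1.1.union (((finite_argPaths I.2.1.1).subset ?_).image _)
      rintro q ⟨hq, -⟩
      exact ⟨_, hq, by rw [list_mkFact (by simp)]; exact List.mem_cons_self⟩,
      fun f hf => (equationProgram a).run_flat hP I.2.2 f hf.1⟩)
  have hI' : ¬ P'.Uses .I := fun h => h₂.2 (hP' _ h)
  have hE' : ∀ r, P'.HasRule r → ∀ L ∈ r.body, ∀ e₁ e₂, L.atom ≠ .eqn e₁ e₂ :=
    fun r hr L hL e₁ e₂ he => h₂.1 (hP' _ ⟨r, hr, L, hL, e₁, e₂, he⟩)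
  -- A head value longer than this common bound must involve a nonempty variable, whichever rule
  -- derives it; hence the input word has length `n + 1`.
  obtain ⟨n, hN⟩ := exists_bound_of_list P'.strata.flatten
    (fun r m => ∀ e ∈ r.head.list, ∀ ν : Valuation dom, m < (e.eval ν).length →
      ∃ x ∈ e.vars, ν.get x ≠ [])
    (fun r k m hkm h e he ν hm => h e he ν (lt_of_le_of_lt hkm hm))
    (fun r _ => exists_bound_of_list _ _ (fun e k m hkm h ν hm => h ν (lt_of_le_of_lt hkm hm))
      fun e _ => exists_nonempty_var e)
  let w : Path dom := List.replicate (n + 1) (Value.atom a)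
  let I : Set (Fact dom) := {mkFact ⟨0, 1⟩ [w]}
  have hw : ∀ v ∈ w, v = Value.atom a := fun v hv => (List.mem_replicate.1 hv).2
  have hwf : w.Flat := fun v hv => ⟨a, hw v hv⟩
  have hII : IsInstance {⟨0, 1⟩} I := ⟨Set.finite_singleton _, by simp [I]⟩
  have hIf : FlatFacts I := by
    rintro f rfl; rw [forall_args, list_mkFact (by simp)]; simpa using hwf
  have hSrun : ∀ f ∈ run P'.strata I, f.rel = ⟨1, 1⟩ → f = mkFact ⟨1, 1⟩ [w] := by
    intro f hf hr
    have := (hP'' I hII hIf f hr).1 hf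
    rw [hrun] at this
    rcases this with h | ⟨q, ⟨hq, -⟩, rfl⟩
    · rw [Set.mem_singleton_iff.1 h] at hr; simp at hr
    · have := mkFact_inj (by simp) (by simp) (Set.mem_singleton_iff.1 hq)
      simp only [this.2]
  have hSmem : mkFact ⟨1, 1⟩ [w] ∈ run P'.strata I := by
    refine (hP'' I hII hIf _ rfl).2 ?_
    rw [hrun]
    refine Or.inr ⟨w, ⟨rfl, ?_⟩, rfl⟩
    simp only [w]
    rw [← List.replicate_one, List.replicate_append_replicate, List.replicate_append_replicate,
      Nat.add_comm]
  have hidbS : P'.IsIDB ⟨1, 1⟩ := by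
    rcases mem_run_cases hSmem with h | h
    · have := congrArg Fact.rel (Set.mem_singleton_iff.1 h); simp at this
    · exact (P'.isIDB_iff _).2 h
  obtain ⟨r, hr, ν, hsat, hhead⟩ := exists_firing_rule ho hI' (I := I) (fun hsub => by
    have := congrArg Fact.rel (Set.mem_singleton_iff.1 (hsub hSmem)); simp at this)
  have hrS := head_rel_of_single hI' hidbS hr
  have hheadw := hSrun _ hhead hrS
  have hlist : r.head.list.map (·.eval ν) = [w] := by
    rw [← list_eval, hheadw, list_mkFact (by simp)]
  obtain ⟨e, hel⟩ : ∃ e, r.head.list = [e] := by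
    cases hl : r.head.list with
    | nil => rw [hl] at hlist; simp at hlist
    | cons e l =>
      rw [hl] at hlist
      simp only [List.map_cons, List.cons.injEq, List.map_eq_nil_iff] at hlist
      exact ⟨e, by rw [hlist.2]⟩
  have hew : e.eval ν = w := by rw [hel] at hlist; simpa using hlist
  have hrsafe : r.Safe := by
    obtain ⟨Δ, hΔ, hr⟩ := hr
    exact P'.safe Δ hΔ r hr
  have hrfl : r ∈ P'.strata.flatten := by
    obtain ⟨Δ, hΔ, hr⟩ := hr
    exact List.mem_flatten.2 ⟨Δ, hΔ, hr⟩
  obtain ⟨x, hxe, hx⟩ := hN r hrfl e (by rw [hel]; exact List.mem_cons_self) ν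
    (by rw [hew]; simp [w])
  have hxr : x ∈ r.vars := Or.inl (mem_predVars.2 ⟨e, by rw [hel]; exact List.mem_cons_self, hxe⟩)
  -- every variable of the rule is bound by a predicate of the input
  have hlim : ∀ y ∈ r.vars, ∀ v ∈ ν.get y, v = Value.atom a := by
    have hsub : ∀ (e : PathExpr dom) (y : Var), y ∈ e.vars → (∀ v ∈ e.eval ν, v = Value.atom a) →
        ∀ v ∈ ν.get y, v = Value.atom a := by
      intro e y hy
      induction e with
      | const a => exact absurd hy (Set.notMem_empty _)
      | var z => rw [Set.mem_singleton_iff.1 hy]; exact fun h => h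
      | pack e _ => intro h; simp [PathExpr.eval] at h
      | empty => exact absurd hy (Set.notMem_empty _)
      | concat e₁ e₂ ih₁ ih₂ =>
        intro h
        simp only [PathExpr.eval, List.mem_append, or_imp, forall_and] at h
        rcases hy with hy | hy
        · exact ih₁ hy h.1
        · exact ih₂ hy h.2
    intro y hy
    have hl := hrsafe y hy
    cases hl with
    | pred Q _ hQ hyQ =>
      have hQI : Q.eval ν = mkFact ⟨0, 1⟩ [w] := hsat _ hQ
      obtain ⟨e', he', hye⟩ := mem_predVars.1 hyQ
      refine hsub e' y hye ?_
      have : e'.eval ν ∈ (Q.eval ν).list := by rw [list_eval]; exact List.mem_map_of_mem he'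
      rw [hQI, list_mkFact (by simp), List.mem_singleton] at this
      rw [this]
      exact hw
    | eqn_right e₁ e₂ _ he _ _ => exact absurd rfl (hE' r hr _ he e₁ e₂)
    | eqn_left e₁ e₂ _ he _ _ => exact absurd rfl (hE' r hr _ he e₁ e₂)
  obtain ⟨c, hc⟩ := (P'.finite_consts.union (Set.finite_singleton a)).exists_notMem
  have hca : c ≠ a := fun h => hc (Or.inr h)
  have hcr : c ∉ r.consts := fun h => hc (Or.inl (Program.consts_of_rule hr h))
  classical
  -- The substitution undoing the change: it sends the fresh letter back to a and fixes every
  -- constant of the rule.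
  let g : dom → dom := fun d => if d = c then a else d
  have hga : g a = a := by simp [g]
  have hgc : g c = a := by simp [g]
  have hgconst : ∀ d ∈ r.consts, g d = d := fun d hd => by
    have : d ≠ c := fun h => hcr (h ▸ hd)
    simp [g, this]
  have hgp : ∀ p : Path dom, (∀ v ∈ p, v = Value.atom a) → pathMap g p = p := by
    intro p hp
    induction p with
    | nil => rfl
    | cons v p ih =>
      rw [pathMap, ih fun u hu => hp u (List.mem_cons_of_mem _ hu), hp v List.mem_cons_self,
        Value.map, hga]
  -- The first letter of the chosen variable becomes `c`. Its old value is nonempty and consists of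
  -- letters a, so `g` maps the new value back to it.
  let ν' : Valuation dom := ⟨fun k => if x = .atomic k then c else ν.atomic k,
    fun k => if x = .path k then Value.atom c :: (ν.path k).tail else ν.path k⟩
  have hν'x : Value.atom c ∈ ν'.get x := by
    cases x with
    | atomic k => simp [Valuation.get, PathExpr.eval, ν']
    | path k => simp [Valuation.get, PathExpr.eval, ν']
  have hν' : ∀ y ∈ r.vars, pathMap g (ν'.get y) = ν.get y := by
    intro y hy
    by_cases hxy : x = y
    · subst hxy
      have h1 := hlim x hy
      cases x with
      | atomic k =>
        simp only [Valuation.get, PathExpr.eval, List.mem_singleton, forall_eq] at h1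
        simp [Valuation.get, PathExpr.eval, ν', pathMap, Value.map, hgc, h1]
      | path k =>
        simp only [Valuation.get, PathExpr.eval] at h1 hx
        simp only [Valuation.get, PathExpr.eval, ν', if_true, pathMap, Value.map, hgc]
        cases hp : ν.path k with
        | nil => exact absurd hp hx
        | cons v p =>
          rw [hp] at h1
          rw [List.tail_cons, hgp p fun u hu => h1 u (List.mem_cons_of_mem _ hu),
            h1 v List.mem_cons_self]
    · have : ν'.get y = ν.get y := by
        cases y with
        | atomic k => simp [Valuation.get, PathExpr.eval, ν', hxy]
        | path k => simp [Valuation.get, PathExpr.eval, ν', hxy]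
      rw [this]
      exact hgp _ (hlim y hy)
  have hmap : ∀ L ∈ r.body, ∀ Q, L.atom = .pred Q →
      Q.eval ν = ⟨Q.rel, fun i => pathMap g ((Q.eval ν').args i)⟩ := by
    intro L hL Q hQ
    refine eval_pred_of_pathMap (fun d hd => hgconst d ?_) fun y hy => hν' y ?_
    · exact Rule.consts_of_body hL (hQ ▸ hd)
    · exact Or.inr ⟨L, hL, by rw [hQ]; exact hy⟩
  -- The smallest instance on which the positive body holds under the new valuation.
  let I' : Set (Fact dom) := {f | ∃ Q, .pos (.pred Q) ∈ r.body ∧ Q.eval ν' = f}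
  have hI'fin : I'.Finite := by
    refine ((r.body.finite_toSet).image fun L => match L.atom with
      | .pred Q => Q.eval ν'
      | .eqn _ _ => mkFact ⟨0, 1⟩ [w]).subset ?_
    rintro f ⟨Q, hQ, rfl⟩
    exact ⟨_, hQ, rfl⟩
  have hI'Γ : IsInstance {⟨0, 1⟩} I' := by
    refine ⟨hI'fin, ?_⟩
    rintro f ⟨Q, hQ, rfl⟩
    have : Q.eval ν = mkFact ⟨0, 1⟩ [w] := hsat _ hQ
    exact Finset.mem_singleton.2 (congrArg Fact.rel this)
  have hI'f : FlatFacts I' := by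
    rintro f ⟨Q, hQ, rfl⟩ i
    have h1 : Q.eval ν ∈ I := hsat _ hQ
    have h2 := hIf _ h1
    rw [hmap _ hQ Q rfl] at h2
    exact flat_of_pathMap (h2 i)
  have hsat' : ∀ L ∈ r.body, L.Sat I' ν' := by
    intro L hL
    cases L with
    | pos A =>
      cases A with
      | pred Q => exact ⟨Q, hL, rfl⟩
      | eqn e₁ e₂ => exact absurd rfl (hE' r hr _ hL e₁ e₂)
    | neg A =>
      cases A with
      | pred Q =>
        rintro ⟨Q', hQ', he⟩
        apply hsat _ hL
        have h1 : Q'.eval ν ∈ I := hsat _ hQ'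
        change Q.eval ν ∈ I
        have hrel : Q'.rel = Q.rel := congrArg Fact.rel he
        -- If a negated fact coincided with a positive one under the new valuation, then applying
        -- `g` would make them coincide under the old one, where the rule fired.
        have h2 : Q.eval ν = Q'.eval ν := by
          rw [hmap _ hL Q rfl, hmap _ hQ' Q' rfl]
          have : ∀ f f' : Fact dom, f = f' → (⟨f.rel, fun i => pathMap g (f.args i)⟩ : Fact dom) =
              ⟨f'.rel, fun i => pathMap g (f'.args i)⟩ := by rintro f _ rfl; rfl
          exact (this _ _ he).symm
        rw [h2]
        exact h1
      | eqn e₁ e₂ => exact absurd rfl (hE' r hr _ hL e₁ e₂)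
  have hfin := head_mem_run ho hr (fun Q hQ => neg_rel_of_single ho hI' hr hQ) hsat'
  have h3 := (hP'' I' hI'Γ hI'f _ hrS).1 hfin
  rw [hrun] at h3
  rcases h3 with h3 | ⟨q, ⟨-, hq⟩, h3⟩
  · have := Finset.mem_singleton.1 (hI'Γ.2 _ h3)
    rw [Predicate.eval_rel, hrS] at this
    simp at this
  · have h4 : (r.head.eval ν').list = [q] := by rw [← h3, list_mkFact (by simp)]
    rw [list_eval, hel] at h4
    simp only [List.map_cons, List.map_nil, List.cons.injEq, and_true] at h4
    have h5 := eq_of_commute hq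
    have h6 := pathAtoms_get hxe ν' (mem_pathAtoms_of_mem hν'x)
    rw [h4] at h6
    exact hca (pathAtoms_subset_of_forall h5 h6)

/-! ### Intermediate predicates are needed in the presence of recursion -/

/-- `T(@x) ← A(@x)`, `T(@y) ← T(@x), R(@x·@y)` and `S() ← T(@x), B(@x)`, where `R`, `A`, `B`, `T`,
`S` are numbered from zero. -/
def reachProgram (dom : Type u) : Program dom where
  strata := [[⟨mkPred ⟨3, 1⟩ [.var (.atomic 0)], [.pos (.pred (mkPred ⟨1, 1⟩ [.var (.atomic 0)]))]⟩,
    ⟨mkPred ⟨3, 1⟩ [.var (.atomic 1)], [.pos (.pred (mkPred ⟨3, 1⟩ [.var (.atomic 0)])),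
      .pos (.pred (mkPred ⟨0, 1⟩ [.concat (.var (.atomic 0)) (.var (.atomic 1))]))]⟩,
    ⟨mkPred ⟨4, 0⟩ [], [.pos (.pred (mkPred ⟨3, 1⟩ [.var (.atomic 0)])),
      .pos (.pred (mkPred ⟨2, 1⟩ [.var (.atomic 0)]))]⟩]]
  safe := by
    simp only [forall_eq, List.mem_cons, List.not_mem_nil, or_false, forall_eq_or_imp]
    refine ⟨?_, ?_, ?_⟩ <;>
    · apply safe_of_pos
      simp [Rule.vars, vars_mkPred_one, arity_zero_vars, PathExpr.vars, Literal.atom, Atom.vars]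
  stratified := by
    simp [Stratified]

theorem mkFact_one_inj {R R' : RelName} (h : R.arity = 1) {p q : Path dom}
    (he : mkFact R [p] = mkFact R' [q]) : R = R' ∧ p = q := by
  have h1 : R = R' := congrArg Fact.rel he
  have := mkFact_inj (by simp [h]) (by simp [← h1, h]) he
  exact ⟨h1, by simpa using this.2⟩

/-- Reachability along a chain of `n` edges needs all of them. A single-relation program answers by
one rule firing on the input, and a rule whose body has fewer than `n` literals matches fewer than
`n` edges. Deleting the unmatched facts keeps the rule applicable while breaking the chain. -/
theorem intermediate_necessary_of_recursion [Infinite dom] {F₁ F₂ : Fragment}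
    (h : Subsumed dom F₁ F₂) (h₁ : Feature.I ∈ F₁) (h₁' : Feature.R ∈ F₁) : Feature.I ∈ F₂ := by
  by_contra h₂
  have hrule := fun r => (show (reachProgram dom).HasRule r ↔ r = _ ∨ r = _ ∨ r = _ by
    simp only [Program.HasRule, reachProgram, exists_eq_left, List.mem_cons,
      List.not_mem_nil, or_false]
    exact Iff.rfl)
  have hidb : ∀ R, (reachProgram dom).IsIDB R ↔ R = ⟨3, 1⟩ ∨ R = ⟨4, 0⟩ := fun R => by
    simp [Program.IsIDB, hrule, or_and_right, exists_or, eq_comm]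
  have hn := (reachProgram dom).negFree _ List.mem_cons_self
  -- The relation T only receives single values occurring in input paths, so the program terminates.
  have hrun : ∀ I : Set (Fact dom), run (reachProgram dom).strata I ⊆
      I ∪ ({mkFact ⟨4, 0⟩ []} ∪ (fun v => mkFact ⟨3, 1⟩ [[v]]) ''
        ⋃ p ∈ argPaths I, {v | v ∈ p}) := by
    intro I
    have hmk : ∀ f p v, f ∈ I → p ∈ f.list → v ∈ p → mkFact ⟨3, 1⟩ [[v]] ∈
        I ∪ ({mkFact ⟨4, 0⟩ []} ∪ (fun v => mkFact ⟨3, 1⟩ [[v]]) ''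
        ⋃ p ∈ argPaths I, {v | v ∈ p}) :=
      fun f p v hf hp hv => Or.inr (Or.inr ⟨v, Set.mem_biUnion
        (show p ∈ argPaths I from ⟨f, hf, hp⟩) (by exact hv), rfl⟩)
    refine lfp_induction hn Set.subset_union_left fun r hr ν hb hp => ?_
    simp only [List.mem_cons, List.not_mem_nil, or_false] at hr
    rcases hr with rfl | rfl | rfl
    · have h := hb _ List.mem_cons_self
      simp only [Literal.Sat, Atom.Sat, eval_mkPred] at h
      have h := lfp_agree h (by simp [Stratum.IsHead])
      rw [eval_mkPred]
      refine hmk _ (PathExpr.eval ν (.var (.atomic 0))) _ h ?_ List.mem_cons_self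
      rw [list_mkFact (by simp)]
      exact List.mem_cons_self
    · have h := hb _ (List.mem_cons_of_mem _ List.mem_cons_self)
      simp only [Literal.Sat, Atom.Sat, eval_mkPred] at h
      have h := lfp_agree h (by simp [Stratum.IsHead])
      rw [eval_mkPred]
      refine hmk _ (PathExpr.eval ν (.concat (.var (.atomic 0)) (.var (.atomic 1)))) _ h ?_ ?_
      · rw [list_mkFact (by simp)]
        exact List.mem_cons_self
      · simp [PathExpr.eval]
    · rw [eval_mkPred]
      exact Or.inr (Or.inl rfl)
  obtain ⟨P', hP', ho, hP''⟩ := h.exists_program (Γ := {⟨0, 1⟩, ⟨1, 1⟩, ⟨2, 1⟩}) (S := ⟨4, 0⟩)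
    (by simp [Schema.Monadic]) (by simp) (by simp) (reachProgram dom)
    (by
      intro f hf
      cases f with
      | R => exact h₁'
      | I => exact h₁
      | A => simp [Program.Uses, hrule, inBody_iff, Literal.atom] at hf
      | E => simp [Program.Uses, hrule, Literal.atom] at hf
      | P =>
        simp [Program.Uses, hrule, Literal.atom, Atom.HasPacking, Predicate.HasPacking, mkPred,
          PathExpr.HasPacking] at hf
      | N => simp [Program.Uses, hrule] at hf)
    ⟨by simp [Program.IsEDB, hidb, hrule, inBody_iff, Literal.atom]; grind, by simp [hidb]⟩
    (fun I => ⟨Set.Finite.subset (I.2.1.1.union ((Set.finite_singleton _).union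
      (((finite_argPaths I.2.1.1).biUnion fun p _ => p.finite_toSet).image _))) (hrun I.1), by
      rintro f ⟨-, hf⟩ i
      exact absurd i.2 (by simp [hf])⟩)
  have hI' : ¬ P'.Uses .I := fun h => h₂ (hP' _ h)
  -- The chain is chosen longer than every rule body of the given program.
  obtain ⟨n, hN⟩ := exists_bound_of_list P'.strata.flatten (fun r m => r.body.length < m)
    (fun r k m hkm h => lt_of_lt_of_le h hkm) (fun r _ => ⟨_, Nat.lt_succ_self _⟩)
  let c : ℕ → dom := Infinite.natEmbedding dom
  have hc : Function.Injective c := (Infinite.natEmbedding dom).injective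
  let edge : ℕ → Fact dom := fun i => mkFact ⟨0, 1⟩ [[Value.atom (c i), Value.atom (c (i + 1))]]
  have hedge : Function.Injective edge := by
    intro i j hij
    have := (mkFact_one_inj rfl hij).2
    simp only [List.cons.injEq, Value.atom.injEq] at this
    exact hc this.1
  let I : Set (Fact dom) := {mkFact ⟨1, 1⟩ [[Value.atom (c 0)]], mkFact ⟨2, 1⟩ [[Value.atom (c n)]]} ∪
    edge '' {i | i < n}
  have hII : IsInstance {⟨0, 1⟩, ⟨1, 1⟩, ⟨2, 1⟩} I := by
    refine ⟨(Set.toFinite _).union ((Set.finite_lt_nat n).image _), ?_⟩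
    rintro f ((rfl | rfl) | ⟨i, -, rfl⟩) <;> simp [edge]
  have hIf : FlatFacts I := by
    rintro f ((rfl | rfl) | ⟨i, -, rfl⟩) <;>
    · rw [forall_args, list_mkFact (by simp)]; simp [Path.Flat]
  have hT : ∀ i ≤ n, mkFact ⟨3, 1⟩ [[Value.atom (c i)]] ∈ run (reachProgram dom).strata I := by
    intro i
    induction i with
    | zero =>
      intro _
      have := lfp_sat (I := I) hn List.mem_cons_self ⟨fun _ => c 0, fun _ => []⟩ ?_
      · rwa [eval_mkPred] at this
      · simp only [List.mem_singleton, forall_eq, Literal.Sat, Atom.Sat, eval_mkPred]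
        exact subset_lfp _ _ (Or.inl (Or.inl rfl))
    | succ i ih =>
      intro hi
      have := lfp_sat (I := I) hn (List.mem_cons_of_mem _ List.mem_cons_self)
        ⟨fun k => if k = 0 then c i else c (i + 1), fun _ => []⟩ ?_
      · rwa [eval_mkPred] at this
      · simp only [List.mem_cons, List.not_mem_nil, or_false, forall_eq_or_imp, forall_eq,
          Literal.Sat, Atom.Sat, eval_mkPred]
        exact ⟨ih (by omega), subset_lfp _ _ (Or.inr ⟨i, by exact hi, rfl⟩)⟩
  have hS : mkFact ⟨4, 0⟩ [] ∈ run (reachProgram dom).strata I := by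
    have := lfp_sat (I := I) hn (List.mem_cons_of_mem _ (List.mem_cons_of_mem _ List.mem_cons_self))
        ⟨fun k => c n, fun _ => []⟩ ?_
    · rwa [eval_mkPred] at this
    · simp only [List.mem_cons, List.not_mem_nil, or_false, forall_eq_or_imp, forall_eq,
          Literal.Sat, Atom.Sat, eval_mkPred]
      exact ⟨hT n le_rfl, subset_lfp _ _ (Or.inl (Or.inr rfl))⟩
  have hnotI : mkFact ⟨4, 0⟩ [] ∉ I := fun h => absurd (hII.2 _ h) (by simp)
  have hSmem := (hP'' I hII hIf _ rfl).2 hS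
  have hidbS : P'.IsIDB ⟨4, 0⟩ := by
    rcases mem_run_cases hSmem with h | h
    · exact absurd h hnotI
    · exact (P'.isIDB_iff _).2 h
  obtain ⟨r, hr, ν, hsat, -⟩ := exists_firing_rule ho hI' (I := I) (fun hsub => hnotI (hsub hSmem))
  have hrS := head_rel_of_single hI' hidbS hr
  -- Only the matched facts are kept. Negated literals remain true because this is a subset of the
  -- input.
  let I' : Set (Fact dom) := {f | ∃ Q, .pos (.pred Q) ∈ r.body ∧ Q.eval ν = f}
  have hI'I : I' ⊆ I := by
    rintro f ⟨Q, hQ, rfl⟩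
    exact hsat _ hQ
  have hsat' : ∀ L ∈ r.body, L.Sat I' ν := by
    intro L hL
    cases L with
    | pos A =>
      cases A with
      | pred Q => exact ⟨Q, hL, rfl⟩
      | eqn e₁ e₂ => exact hsat _ hL
    | neg A =>
      cases A with
      | pred Q => exact fun h => hsat _ hL (hI'I h)
      | eqn e₁ e₂ => exact hsat _ hL
  have hfin := head_mem_run ho hr (fun Q hQ => neg_rel_of_single ho hI' hr hQ) hsat'
  have h3 := (hP'' I' ⟨hII.1.subset hI'I, fun f hf => hII.2 f (hI'I hf)⟩
    (fun f hf => hIf f (hI'I hf)) _ hrS).1 hfin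
  -- Pigeonhole: the edges are distinct and there are more of them than body literals.
  obtain ⟨i, hin, hi⟩ : ∃ i < n, edge i ∉ I' := by
    by_contra hcon
    push Not at hcon
    classical
    have hsub : (Finset.range n).image edge ⊆ (r.body.map fun L => match L.atom with
        | .pred Q => Q.eval ν
        | .eqn _ _ => edge 0).toFinset := by
      intro f hf
      obtain ⟨i, hi, rfl⟩ := Finset.mem_image.1 hf
      obtain ⟨Q, hQ, hQe⟩ := hcon i (Finset.mem_range.1 hi)
      exact List.mem_toFinset.2 (List.mem_map.2 ⟨_, hQ, hQe⟩)
    have h1 := (Finset.card_le_card hsub).trans (List.toFinset_card_le _)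
    rw [Finset.card_image_of_injective _ hedge, Finset.card_range, List.length_map] at h1
    obtain ⟨Δ, hΔ, hr⟩ := hr
    have := hN r (List.mem_flatten.2 ⟨Δ, hΔ, hr⟩)
    omega
  -- With the edge from `c i` to `c (i + 1)` missing, reachability cannot pass `c i`, and since `i <
  -- n` the target is never met.
  have hX : run (reachProgram dom).strata I' ⊆
      I' ∪ (fun j => mkFact ⟨3, 1⟩ [[Value.atom (c j)]]) '' {j | j ≤ i} := by
    refine lfp_induction hn Set.subset_union_left fun r hr ν hb hp => ?_
    simp only [List.mem_cons, List.not_mem_nil, or_false] at hr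
    have hTX : ∀ v : Value dom, mkFact ⟨3, 1⟩ [[v]] ∈
        I' ∪ (fun j => mkFact ⟨3, 1⟩ [[Value.atom (c j)]]) '' {j | j ≤ i} →
        ∃ j ≤ i, v = Value.atom (c j) := by
      rintro v (h | ⟨j, hj, h⟩)
      · exact absurd (hII.2 _ (hI'I h)) (by simp)
      · have := (mkFact_one_inj rfl h).2
        simp only [List.cons.injEq, and_true] at this
        exact ⟨j, hj, this.symm⟩
    rcases hr with rfl | rfl | rfl
    · have h := hb _ List.mem_cons_self
      simp only [Literal.Sat, Atom.Sat, eval_mkPred] at h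
      have h := hI'I (lfp_agree h (by simp [Stratum.IsHead]))
      rw [eval_mkPred]
      refine Or.inr ⟨0, Nat.zero_le _, ?_⟩
      rcases h with (h | h) | ⟨j, -, h⟩
      · have := (mkFact_one_inj rfl h).2
        simp only [List.map_cons, List.map_nil, this]
      · exact absurd (congrArg Fact.rel h) (by simp)
      · exact absurd (congrArg Fact.rel h) (by simp [edge])
    · have h := hb _ (List.mem_cons_of_mem _ List.mem_cons_self)
      have h' := hp _ List.mem_cons_self
      simp only [Literal.Sat, Atom.Sat, eval_mkPred] at h h'
      have h := lfp_agree h (by simp [Stratum.IsHead])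
      obtain ⟨j, hj, hjv⟩ := hTX _ h'
      rw [eval_mkPred]
      rcases hI'I h with (h2 | h2) | ⟨k, hk, h2⟩
      · exact absurd (congrArg Fact.rel h2) (by simp)
      · exact absurd (congrArg Fact.rel h2) (by simp)
      · have h4 := (mkFact_one_inj rfl h2).2
        simp only [PathExpr.eval, List.cons_append, List.nil_append, List.cons.injEq, and_true,
          Value.atom.injEq] at h4 hjv
        have hkj : k = j := hc (by rw [h4.1, hjv])
        subst hkj
        refine Or.inr ⟨k + 1, ?_, ?_⟩
        · rcases Nat.lt_or_eq_of_le hj with h5 | rfl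
          · exact h5
          · rw [← h2] at h
            exact absurd h hi
        · simp only [List.map_cons, List.map_nil, PathExpr.eval, h4.2]
    · exfalso
      have h := hb _ (List.mem_cons_of_mem _ List.mem_cons_self)
      have h' := hp _ List.mem_cons_self
      simp only [Literal.Sat, Atom.Sat, eval_mkPred] at h h'
      have h := lfp_agree h (by simp [Stratum.IsHead])
      obtain ⟨j, hj, hjv⟩ := hTX _ h'
      rcases hI'I h with (h2 | h2) | ⟨k, hk, h2⟩
      · exact absurd (congrArg Fact.rel h2) (by simp)
      · have h4 := (mkFact_one_inj rfl h2).2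
        simp only [PathExpr.eval, List.cons.injEq, and_true, Value.atom.injEq] at h4 hjv
        have : n = j := hc (by rw [← h4, hjv])
        omega
      · exact absurd (congrArg Fact.rel h2) (by simp [edge])
  rcases hX h3 with h4 | ⟨j, -, h4⟩
  · have := hII.2 _ (hI'I h4)
    rw [Predicate.eval_rel, hrS] at this
    simp at this
  · have := congrArg Fact.rel h4
    rw [Predicate.eval_rel, hrS] at this
    simp at this

/-! ### Intermediate predicates are needed in the presence of negation -/

/-- `T() ← R($x)`, and in a second stratum `S() ← ¬T()`. -/
def emptinessProgram (dom : Type u) : Program dom where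
  strata := [[⟨mkPred ⟨1, 0⟩ [], [.pos (.pred (mkPred ⟨0, 1⟩ [.var (.path 0)]))]⟩],
    [⟨mkPred ⟨2, 0⟩ [], [.neg (.pred (mkPred ⟨1, 0⟩ []))]⟩]]
  safe := by
    simp only [forall_eq, List.mem_cons, List.not_mem_nil, or_false, forall_eq_or_imp]
    refine ⟨?_, ?_⟩ <;>
    · apply safe_of_pos
      simp [Rule.vars, vars_mkPred_one, arity_zero_vars, PathExpr.vars, Literal.atom, Atom.vars]
  stratified := by
    simp [Stratified, Stratum.IsHead]

/-- A rule firing on the empty instance has no positive predicate in its body, so all its values are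
built from constants of the program. None of its negated literals can be falsified by a fact
containing a fresh letter, so S is still derived on a nonempty instance. -/
theorem intermediate_necessary_of_negation [Infinite dom] {F₁ F₂ : Fragment}
    (h : Subsumed dom F₁ F₂) (h₁ : Feature.I ∈ F₁) (h₁' : Feature.N ∈ F₁) : Feature.I ∈ F₂ := by
  by_contra h₂
  have hrule := fun r => (show (emptinessProgram dom).HasRule r ↔ r = _ ∨ r = _ by
    simp only [Program.HasRule, emptinessProgram, List.mem_cons, exists_eq_or_imp, exists_eq_left,
      List.not_mem_nil, or_false]
    exact Iff.rfl)
  have hidb : ∀ R, (emptinessProgram dom).IsIDB R ↔ R = ⟨1, 0⟩ ∨ R = ⟨2, 0⟩ := fun R => by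
    simp [Program.IsIDB, hrule, or_and_right, exists_or, eq_comm]
  have hn := (emptinessProgram dom).negFree _ List.mem_cons_self
  have hn' := (emptinessProgram dom).negFree _ (List.mem_cons_of_mem _ List.mem_cons_self)
  have hrun : ∀ I : Set (Fact dom), run (emptinessProgram dom).strata I ⊆
      I ∪ {mkFact ⟨1, 0⟩ [], mkFact ⟨2, 0⟩ []} := by
    intro I
    refine lfp_induction hn' ?_ fun r hr ν hb hp => ?_
    · refine lfp_induction hn Set.subset_union_left fun r hr ν hb hp => ?_
      rw [List.mem_singleton.1 hr, eval_mkPred]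
      exact Or.inr (Or.inl rfl)
    · rw [List.mem_singleton.1 hr, eval_mkPred]
      exact Or.inr (Or.inr rfl)
  obtain ⟨P', hP', ho, hP''⟩ := h.exists_program (Γ := {⟨0, 1⟩}) (S := ⟨2, 0⟩)
    (by simp [Schema.Monadic]) (by simp) (by simp) (emptinessProgram dom)
    (by
      intro f hf
      cases f with
      | N => exact h₁'
      | I => exact h₁
      | A => simp [Program.Uses, hrule, inBody_iff, Literal.atom] at hf
      | E => simp [Program.Uses, hrule, Literal.atom] at hf
      | P =>
        simp [Program.Uses, hrule, Literal.atom, Atom.HasPacking, Predicate.HasPacking, mkPred,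
          PathExpr.HasPacking] at hf
      | R =>
        exact absurd hf ((emptinessProgram dom).not_uses_R_of_rank (fun R => R.id) (by
          rintro R₁ R₂ ⟨-, r, hr, rfl, hb⟩
          rcases (hrule r).1 hr with rfl | rfl <;>
          · simp only [inBody_iff, List.mem_singleton, exists_eq_left, Literal.atom,
              Atom.pred.injEq, exists_eq_left'] at hb
            subst hb
            simp)))
    ⟨by simp [Program.IsEDB, hidb, hrule, inBody_iff, Literal.atom]; grind, by simp [hidb]⟩
    (fun I => ⟨Set.Finite.subset (I.2.1.1.union (Set.toFinite _)) (hrun I.1), by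
      rintro f ⟨-, hf⟩ i
      exact absurd i.2 (by simp [hf])⟩)
  have hI' : ¬ P'.Uses .I := fun h => h₂ (hP' _ h)
  obtain ⟨a⟩ : Nonempty dom := inferInstance
  have hS : mkFact ⟨2, 0⟩ [] ∈ run (emptinessProgram dom).strata ∅ := by
    have := lfp_sat (I := run ((emptinessProgram dom).strata.take 1) ∅) hn' List.mem_cons_self
      ⟨fun _ => a, fun _ => []⟩ ?_
    · rwa [eval_mkPred] at this
    · simp only [List.mem_singleton, forall_eq]
      intro hs
      have hs := lfp_agree hs (by simp [Stratum.IsHead])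
      rcases lfp_cases hn hs with h | ⟨r, hr, ν, hb, -⟩
      · exact h
      · rw [List.mem_singleton.1 hr] at hb
        exact lfp_agree (hb _ List.mem_cons_self) (by simp [Stratum.IsHead])
  have hSmem := (hP'' ∅ ⟨Set.finite_empty, by simp⟩ (by simp [FlatFacts]) _ rfl).2 hS
  have hidbS : P'.IsIDB ⟨2, 0⟩ := by
    rcases mem_run_cases hSmem with h | h
    · exact absurd h (Set.notMem_empty _)
    · exact (P'.isIDB_iff _).2 h
  obtain ⟨r, hr, ν, hsat, -⟩ := exists_firing_rule ho hI' (I := ∅) (fun hsub => hsub hSmem)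
  have hrS := head_rel_of_single hI' hidbS hr
  have hrsafe : r.Safe := by
    obtain ⟨Δ, hΔ, hr⟩ := hr
    exact P'.safe Δ hΔ r hr
  obtain ⟨c, hc⟩ := P'.finite_consts.exists_notMem
  -- With no facts to match, safety confines the letters of all variables to the constants of the
  -- program.
  have hvars := rule_vars_atoms hrsafe (Program.consts_of_rule hr) hsat (by simp)
  let I' : Set (Fact dom) := {mkFact ⟨0, 1⟩ [[Value.atom c]]}
  have hsat' : ∀ L ∈ r.body, L.Sat I' ν := by
    intro L hL
    cases L with
    | pos A =>
      cases A with
      | pred Q => exact absurd (hsat _ hL) (Set.notMem_empty _)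
      | eqn e₁ e₂ => exact hsat _ hL
    | neg A =>
      cases A with
      | pred Q =>
        intro hQ
        have hQ' : Q.eval ν = mkFact ⟨0, 1⟩ [[Value.atom c]] := hQ
        have h1 : Q.list.map (·.eval ν) = [[Value.atom c]] := by
          rw [← list_eval, hQ', list_mkFact (by simp)]
        have h2 : [Value.atom c] ∈ Q.list.map (·.eval ν) := by rw [h1]; exact List.mem_cons_self
        obtain ⟨e, he, hec⟩ := List.mem_map.1 h2
        obtain ⟨i, rfl⟩ := List.mem_ofFn.1 he
        have h3 := pathAtoms_eval (e := Q.args i) (C := P'.consts) (ν := ν)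
          (fun x hx => Program.consts_of_rule hr (Rule.consts_of_body hL (Set.mem_iUnion.2 ⟨i, hx⟩)))
          fun x hx => hvars x (Or.inr ⟨_, hL, Set.mem_iUnion.2 ⟨i, hx⟩⟩)
        exact hc (h3 (by rw [hec]; exact mem_pathAtoms_of_mem List.mem_cons_self))
      | eqn e₁ e₂ => exact hsat _ hL
  have hfin := head_mem_run ho hr (fun Q hQ => neg_rel_of_single ho hI' hr hQ) hsat'
  have h3 := (hP'' I' ⟨Set.finite_singleton _, by simp [I']⟩ (by
    rintro f rfl; rw [forall_args, list_mkFact (by simp)]; simp [Path.Flat]) _ hrS).1 hfin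
  have h4 : r.head.eval ν ∉ I' := fun h => by
    have := congrArg Fact.rel (Set.mem_singleton_iff.1 h)
    rw [Predicate.eval_rel, hrS] at this
    simp at this
  rcases lfp_cases hn' h3 with h5 | ⟨r', hr', ν', hb, -⟩
  · have h6 := lfp_agree h5 (by rw [Predicate.eval_rel, hrS]; simp [Stratum.IsHead])
    exact h4 h6
  · rw [List.mem_singleton.1 hr'] at hb
    refine hb _ List.mem_cons_self (subset_lfp _ _ ?_)
    have := lfp_sat (I := I') hn List.mem_cons_self ⟨fun _ => a, fun _ => [Value.atom c]⟩ ?_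
    · rw [eval_mkPred] at this ⊢
      exact this
    · simp only [List.mem_singleton, forall_eq, Literal.Sat, Atom.Sat, eval_mkPred]
      exact subset_lfp _ _ rfl

/-! ### Translations of predicates -/

/-- An injective translation of facts that is computed on predicates. -/
structure Translation (dom : Type u) where
  rel : RelName → RelName
  rel_injective : Function.Injective rel
  fact : Fact dom → Fact dom
  fact_injective : Function.Injective fact
  fact_rel : ∀ f, (fact f).rel = rel f.rel
  pred : Predicate dom → Predicate dom
  pred_rel : ∀ Q, (pred Q).rel = rel Q.rel
  pred_vars : ∀ Q, (pred Q).vars = Q.vars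
  eval_pred : ∀ Q ν, (pred Q).eval ν = fact (Q.eval ν)

namespace Translation

variable (t : Translation dom)

def atom : Atom dom → Atom dom
  | .pred Q => .pred (t.pred Q)
  | .eqn e₁ e₂ => .eqn e₁ e₂

def literal : Literal dom → Literal dom
  | .pos A => .pos (t.atom A)
  | .neg A => .neg (t.atom A)

def rule (r : Rule dom) : Rule dom := ⟨t.pred r.head, r.body.map t.literal⟩

theorem literal_atom (L : Literal dom) : (t.literal L).atom = t.atom L.atom := by
  cases L <;> rfl

theorem atom_vars (A : Atom dom) : (t.atom A).vars = A.vars := by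
  cases A with
  | pred Q => exact t.pred_vars Q
  | eqn e₁ e₂ => rfl

theorem sat_atom (I : Set (Fact dom)) (ν : Valuation dom) (A : Atom dom) :
    (t.atom A).Sat (t.fact '' I) ν ↔ A.Sat I ν := by
  cases A with
  | pred Q =>
    simp only [atom, Atom.Sat, t.eval_pred]
    exact t.fact_injective.mem_set_image
  | eqn e₁ e₂ => exact Iff.rfl

theorem sat_literal (I : Set (Fact dom)) (ν : Valuation dom) (L : Literal dom) :
    (t.literal L).Sat (t.fact '' I) ν ↔ L.Sat I ν := by
  cases L with
  | pos A => exact t.sat_atom I ν A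
  | neg A => exact not_congr (t.sat_atom I ν A)

theorem neg_pred_mem {B : List (Literal dom)} {Q' : Predicate dom}
    (h : .neg (.pred Q') ∈ B.map t.literal) : ∃ Q, .neg (.pred Q) ∈ B ∧ t.pred Q = Q' := by
  obtain ⟨L, hL, he⟩ := List.mem_map.1 h
  cases L with
  | pos A => simp [literal] at he
  | neg A =>
    cases A with
    | pred Q => exact ⟨Q, hL, by simpa [literal, atom] using he⟩
    | eqn e₁ e₂ => simp [literal, atom] at he

theorem limited {B : List (Literal dom)} {x : Var} (h : Limited B x) :
    Limited (B.map t.literal) x := by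
  induction h with
  | pred P x hP hx => exact .pred (t.pred P) x (List.mem_map.2 ⟨_, hP, rfl⟩) (by rwa [t.pred_vars])
  | eqn_right e₁ e₂ x he _ hx ih => exact .eqn_right e₁ e₂ x (List.mem_map.2 ⟨_, he, rfl⟩) ih hx
  | eqn_left e₁ e₂ x he _ hx ih => exact .eqn_left e₁ e₂ x (List.mem_map.2 ⟨_, he, rfl⟩) ih hx

theorem safe {r : Rule dom} (h : r.Safe) : (t.rule r).Safe := by
  intro x hx
  refine t.limited (h x ?_)
  rcases hx with hx | ⟨L', hL', hx⟩
  · exact Or.inl (by rwa [rule, t.pred_vars] at hx)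
  · obtain ⟨L, hL, rfl⟩ := List.mem_map.1 hL'
    rw [t.literal_atom, t.atom_vars] at hx
    exact Or.inr ⟨L, hL, hx⟩

theorem isHead_iff {Δ : Stratum dom} {R : RelName} :
    Stratum.IsHead (Δ.map t.rule) (t.rel R) ↔ Δ.IsHead R := by
  constructor
  · rintro ⟨r', hr', he⟩
    obtain ⟨r, hr, rfl⟩ := List.mem_map.1 hr'
    exact ⟨r, hr, t.rel_injective (by rw [← he]; exact (t.pred_rel _).symm)⟩
  · rintro ⟨r, hr, rfl⟩
    exact ⟨_, List.mem_map.2 ⟨r, hr, rfl⟩, t.pred_rel _⟩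

theorem negFree {Δ Δ' : Stratum dom} (h : NegFree Δ Δ') :
    NegFree (Δ.map t.rule) (Δ'.map t.rule) := by
  intro r' hr' Q' hQ'
  obtain ⟨r, hr, rfl⟩ := List.mem_map.1 hr'
  obtain ⟨Q, hQ, rfl⟩ := t.neg_pred_mem hQ'
  rw [t.pred_rel, t.isHead_iff]
  exact h r hr Q hQ

/-- Leastness is used on both sides: the image of the old fixpoint is closed under the translated
rules, and the preimage of the new fixpoint is closed under the old ones. Injectivity makes negated
atoms agree. -/
theorem lfp_image {Δ : Stratum dom} (hn : NegFree Δ Δ) (I : Set (Fact dom)) :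
    lfp (Δ.map t.rule) (t.fact '' I) = t.fact '' lfp Δ I := by
  have hn' := t.negFree hn
  apply Set.Subset.antisymm
  · refine lfp_least hn' (Set.image_mono (subset_lfp Δ I)) ?_ ?_
    · rintro _ ⟨f, hf, rfl⟩ hh
      rw [t.fact_rel, t.isHead_iff] at hh
      exact ⟨f, lfp_agree hf hh, rfl⟩
    · intro r' hr' ν hb
      obtain ⟨r, hr, rfl⟩ := List.mem_map.1 hr'
      rw [rule, t.eval_pred]
      refine ⟨_, lfp_sat hn hr ν fun L hL => ?_, rfl⟩
      exact (t.sat_literal _ ν L).1 (hb _ (List.mem_map.2 ⟨L, hL, rfl⟩))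
  · rintro _ ⟨f, hf, rfl⟩
    have : lfp Δ I ⊆ {f | t.fact f ∈ lfp (Δ.map t.rule) (t.fact '' I)} := by
      refine lfp_least hn (fun f hf => subset_lfp _ _ ⟨f, hf, rfl⟩) ?_ ?_
      · intro f hf hh
        rw [← t.isHead_iff, ← t.fact_rel] at hh
        obtain ⟨g, hg, he⟩ := lfp_agree hf hh
        rwa [← t.fact_injective he]
      · intro r hr ν hb
        change t.fact (r.head.eval ν) ∈ lfp (Δ.map t.rule) (t.fact '' I)
        rw [← t.eval_pred]
        refine lfp_sat hn' (List.mem_map.2 ⟨r, hr, rfl⟩) ν fun L' hL' => ?_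
        obtain ⟨L, hL, rfl⟩ := List.mem_map.1 hL'
        have hA : ∀ A : Atom dom, (t.atom A).Sat (lfp (Δ.map t.rule) (t.fact '' I)) ν ↔
            A.Sat {f | t.fact f ∈ lfp (Δ.map t.rule) (t.fact '' I)} ν := fun A => by
          cases A with
          | pred Q => simp only [atom, Atom.Sat, t.eval_pred]; exact Iff.rfl
          | eqn e₁ e₂ => exact Iff.rfl
        have := hb L hL
        cases L with
        | pos A => exact (hA A).2 this
        | neg A => exact fun h => this ((hA A).1 h)
    exact this hf

theorem run_image {s : List (Stratum dom)} (hn : ∀ Δ ∈ s, NegFree Δ Δ) (I : Set (Fact dom)) :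
    run (s.map fun Δ => Δ.map t.rule) (t.fact '' I) = t.fact '' run s I := by
  induction s generalizing I with
  | nil => rfl
  | cons Δ s ih =>
    simp only [List.map_cons, run]
    rw [t.lfp_image (hn Δ List.mem_cons_self), ih fun Δ' h => hn Δ' (List.mem_cons_of_mem _ h)]

def program (P : Program dom) : Program dom where
  strata := P.strata.map fun Δ => Δ.map t.rule
  safe := by
    intro Δ' hΔ' r' hr'
    obtain ⟨Δ, hΔ, rfl⟩ := List.mem_map.1 hΔ'
    obtain ⟨r, hr, rfl⟩ := List.mem_map.1 hr'
    exact t.safe (P.safe Δ hΔ r hr)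
  stratified := by
    have h := (stratified_iff _).1 P.stratified
    refine (stratified_iff _).2 ⟨?_, ?_⟩
    · intro Δ' hΔ'
      obtain ⟨Δ, hΔ, rfl⟩ := List.mem_map.1 hΔ'
      exact t.negFree (h.1 Δ hΔ)
    · exact List.pairwise_map.2 (h.2.imp fun h => t.negFree h)

theorem hasRule_program {P : Program dom} {r' : Rule dom} :
    (t.program P).HasRule r' ↔ ∃ r, P.HasRule r ∧ t.rule r = r' := by
  constructor
  · rintro ⟨Δ', hΔ', hr'⟩
    obtain ⟨Δ, hΔ, rfl⟩ := List.mem_map.1 hΔ'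
    obtain ⟨r, hr, rfl⟩ := List.mem_map.1 hr'
    exact ⟨r, ⟨Δ, hΔ, hr⟩, rfl⟩
  · rintro ⟨r, ⟨Δ, hΔ, hr⟩, rfl⟩
    exact ⟨_, List.mem_map.2 ⟨Δ, hΔ, rfl⟩, List.mem_map.2 ⟨r, hr, rfl⟩⟩

theorem isIDB_program {P : Program dom} {R' : RelName} :
    (t.program P).IsIDB R' ↔ ∃ R, P.IsIDB R ∧ t.rel R = R' := by
  constructor
  · rintro ⟨r', hr', rfl⟩
    obtain ⟨r, hr, rfl⟩ := t.hasRule_program.1 hr'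
    exact ⟨_, ⟨r, hr, rfl⟩, (t.pred_rel _).symm⟩
  · rintro ⟨R, ⟨r, hr, rfl⟩, rfl⟩
    exact ⟨_, t.hasRule_program.2 ⟨r, hr, rfl⟩, t.pred_rel _⟩

theorem inBody_rule {r : Rule dom} {R' : RelName} :
    (t.rule r).InBody R' ↔ ∃ R, r.InBody R ∧ t.rel R = R' := by
  constructor
  · rintro ⟨L', hL', Q', hQ', rfl⟩
    obtain ⟨L, hL, rfl⟩ := List.mem_map.1 hL'
    rw [t.literal_atom] at hQ'
    cases hA : L.atom with
    | pred Q =>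
      rw [hA, atom, Atom.pred.injEq] at hQ'
      exact ⟨_, ⟨L, hL, Q, hA, rfl⟩, by rw [← hQ', t.pred_rel]⟩
    | eqn e₁ e₂ => rw [hA, atom] at hQ'; exact absurd hQ' (by simp)
  · rintro ⟨R, ⟨L, hL, Q, hQ, rfl⟩, rfl⟩
    exact ⟨_, List.mem_map.2 ⟨L, hL, rfl⟩, t.pred Q, by rw [t.literal_atom, hQ]; rfl, t.pred_rel _⟩

theorem uses_E {P : Program dom} (h : (t.program P).Uses .E) : P.Uses .E := by
  obtain ⟨r', hr', L', hL', e₁, e₂, he⟩ := h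
  obtain ⟨r, hr, rfl⟩ := t.hasRule_program.1 hr'
  obtain ⟨L, hL, rfl⟩ := List.mem_map.1 hL'
  rw [t.literal_atom] at he
  cases hA : L.atom with
  | pred Q => rw [hA, atom] at he; exact absurd he (by simp)
  | eqn e₁ e₂ => exact ⟨r, hr, L, hL, e₁, e₂, hA⟩

theorem uses_N {P : Program dom} (h : (t.program P).Uses .N) : P.Uses .N := by
  obtain ⟨r', hr', A', hA'⟩ := h
  obtain ⟨r, hr, rfl⟩ := t.hasRule_program.1 hr'
  obtain ⟨L, hL, he⟩ := List.mem_map.1 hA'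
  cases L with
  | pos A => simp [literal] at he
  | neg A => exact ⟨r, hr, A, hL⟩

/-- A rank of the original program is carried over through a left inverse of the renaming. -/
theorem uses_R {P : Program dom} (h : (t.program P).Uses .R) : P.Uses .R := by
  by_contra hR
  have : Nonempty RelName := ⟨⟨0, 0⟩⟩
  obtain ⟨rk, hrk⟩ := P.exists_rank hR
  refine (t.program P).not_uses_R_of_rank (fun R' => rk (Function.invFun t.rel R')) ?_ h
  rintro R₁' R₂' ⟨hidb, r', hr', rfl, hb⟩
  obtain ⟨R₂, hR₂, rfl⟩ := t.isIDB_program.1 hidb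
  obtain ⟨r, hr, rfl⟩ := t.hasRule_program.1 hr'
  obtain ⟨R₃, hR₃, he⟩ := t.inBody_rule.1 hb
  rw [t.rel_injective he] at hR₃
  rw [show (t.rule r).head.rel = t.rel r.head.rel from t.pred_rel _,
    Function.leftInverse_invFun t.rel_injective, Function.leftInverse_invFun t.rel_injective]
  exact hrk _ _ ⟨hR₂, r, hr, rfl, hR₃⟩

theorem program_over {P : Program dom} {Γ : Schema} (h : P.Over Γ)
    (hid : ∀ R, t.rel R ∈ Γ ↔ R ∈ Γ) : (t.program P).Over Γ := by
  constructor
  · rintro R' ⟨⟨r', hr', hb⟩, hn⟩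
    obtain ⟨r, hr, rfl⟩ := t.hasRule_program.1 hr'
    obtain ⟨R, hR, rfl⟩ := t.inBody_rule.1 hb
    exact (hid R).2 (h.1 R ⟨⟨r, hr, hR⟩, fun hi => hn (t.isIDB_program.2 ⟨R, hi, rfl⟩)⟩)
  · intro R' hR' hmem
    obtain ⟨R, hR, rfl⟩ := t.isIDB_program.1 hR'
    exact h.2 R hR ((hid R).1 hmem)

end Translation

/-! ### Eliminating arities greater than one -/

/-- A strict upper bound of the identifiers used in a schema. -/
def Schema.fresh (Γ : Schema) : ℕ := Γ.sup (fun R => R.id + 1)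

theorem Schema.lt_fresh {Γ : Schema} {R : RelName} (h : R ∈ Γ) : R.id < Γ.fresh :=
  Finset.le_sup (f := fun R : RelName => R.id + 1) h

/-- Every component is followed by a separator. A component may itself contain the separator, so one
such word is ambiguous; two words with different separators are not. -/
def joinPaths (c : dom) : List (Path dom) → Path dom
  | [] => []
  | p :: l => p ++ Value.atom c :: joinPaths c l

def joinExprs (c : dom) : List (PathExpr dom) → PathExpr dom
  | [] => .empty
  | e :: l => .concat e (.concat (.const c) (joinExprs c l))

theorem eval_joinExprs (c : dom) (l : List (PathExpr dom)) (ν : Valuation dom) :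
    (joinExprs c l).eval ν = joinPaths c (l.map (·.eval ν)) := by
  induction l with
  | nil => rfl
  | cons e l ih => simp [joinExprs, joinPaths, PathExpr.eval, ih]

theorem vars_joinExprs (c : dom) (l : List (PathExpr dom)) (x : Var) :
    x ∈ (joinExprs c l).vars ↔ ∃ e ∈ l, x ∈ e.vars := by
  induction l with
  | nil => simp [joinExprs, PathExpr.vars]
  | cons e l ih => simp [joinExprs, PathExpr.vars, ih]

theorem hasPacking_joinExprs {c : dom} {l : List (PathExpr dom)}
    (h : (joinExprs c l).HasPacking) : ∃ e ∈ l, e.HasPacking := by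
  induction l with
  | nil => exact absurd h (by simp [joinExprs, PathExpr.HasPacking])
  | cons e l ih =>
    rcases h with h | h | h
    · exact ⟨e, List.mem_cons_self, h⟩
    · exact absurd h (by simp [PathExpr.HasPacking])
    · obtain ⟨e', he', h'⟩ := ih h
      exact ⟨e', List.mem_cons_of_mem _ he', h'⟩

theorem length_joinPaths (c c' : dom) (l : List (Path dom)) :
    (joinPaths c l).length = (joinPaths c' l).length := by
  induction l with
  | nil => rfl
  | cons p l ih => simp [joinPaths, ih]

/-- If one of `p`, `q` ended before the other, the next letter of the longer one would have to be a
by the first equation and b by the second. -/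
theorem eq_of_append_atom_eq {a b : dom} (hab : a ≠ b) {p q s t s' t' : Path dom}
    (ha : p ++ Value.atom a :: s = q ++ Value.atom a :: t)
    (hb : p ++ Value.atom b :: s' = q ++ Value.atom b :: t') : p = q := by
  induction p generalizing q with
  | nil =>
    cases q with
    | nil => rfl
    | cons v q =>
      simp only [List.nil_append, List.cons_append, List.cons.injEq] at ha hb
      exact absurd (Value.atom.inj (ha.1.trans hb.1.symm)) hab
  | cons v p ih =>
    cases q with
    | nil =>
      simp only [List.nil_append, List.cons_append, List.cons.injEq] at ha hb
      exact absurd (Value.atom.inj (ha.1.symm.trans hb.1)) hab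
    | cons w q =>
      simp only [List.cons_append, List.cons.injEq] at ha hb
      rw [ha.1, ih ha.2 hb.2]

theorem joinPaths_inj {a b : dom} (hab : a ≠ b) {l l' : List (Path dom)}
    (hlen : l.length = l'.length) (ha : joinPaths a l = joinPaths a l')
    (hb : joinPaths b l = joinPaths b l') : l = l' := by
  induction l generalizing l' with
  | nil => exact (List.length_eq_zero_iff.1 hlen.symm).symm
  | cons p l ih =>
    cases l' with
    | nil => simp at hlen
    | cons q l' =>
      simp only [joinPaths] at ha hb
      have hpq : p = q := eq_of_append_atom_eq hab ha hb
      subst hpq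
      simp only [List.append_cancel_left_eq, List.cons.injEq, true_and] at ha hb
      rw [ih (by simpa using hlen) ha hb]

/-- Tuples of a fixed length are coded injectively as single paths. -/
theorem join_append_inj {a b : dom} (hab : a ≠ b) {l l' : List (Path dom)}
    (hlen : l.length = l'.length)
    (h : joinPaths a l ++ joinPaths b l = joinPaths a l' ++ joinPaths b l') : l = l' := by
  have h1 := congrArg List.length h
  simp only [List.length_append] at h1
  -- The length does not depend on the separator, so the two halves of a code are equally long and
  -- the concatenation can be cut in the middle.
  rw [length_joinPaths b a l, length_joinPaths b a l'] at h1
  obtain ⟨h2, h3⟩ := List.append_inj h (by omega)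
  exact joinPaths_inj hab hlen h2 h3

/-- Keep the relation names of `Γ`; all others become fresh names of arity one. -/
def monadicName (Γ : Schema) (R : RelName) : RelName :=
  -- All new names have arity one, so the old arity must enter the identifier to keep names with the
  -- same identifier apart.
  if R ∈ Γ then R else ⟨Γ.fresh + Nat.pair R.id R.arity, 1⟩

theorem monadicName_injective (Γ : Schema) : Function.Injective (monadicName Γ) := by
  intro R R' h
  unfold monadicName at h
  split_ifs at h with h1 h2 h2
  · exact h
  · have := Schema.lt_fresh h1
    rw [h] at this
    simp at this
  · have := Schema.lt_fresh h2
    rw [← h] at this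
    simp at this
  · simp only [RelName.mk.injEq, Nat.add_left_cancel_iff, Nat.pair_eq_pair, and_true] at h
    cases R; cases R'
    simp_all

/-- Applied with the output name included in `Γ`, so that the input and the output remain literally
the same facts and only intermediate relations are coded. -/
def arityTranslation (Γ : Schema) {a b : dom} (hab : a ≠ b) : Translation dom where
  rel := monadicName Γ
  rel_injective := monadicName_injective Γ
  fact f := if f.rel ∈ Γ then f else
    mkFact (monadicName Γ f.rel) [joinPaths a f.list ++ joinPaths b f.list]
  fact_injective := by
    intro f f' h
    have hrel : f.rel = f'.rel := by
      have h1 := congrArg Fact.rel h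
      apply monadicName_injective Γ
      simp only [monadicName]
      split_ifs at h1 ⊢ <;> simpa [monadicName, *] using h1
    by_cases hf : f.rel ∈ Γ
    · simpa [hf, hrel ▸ hf] using h
    · have hf' : f'.rel ∉ Γ := hrel ▸ hf
      simp only [hf, hf', if_false] at h
      have h2 := (mkFact_one_inj (by simp [monadicName, hf]) h).2
      exact fact_ext hrel (join_append_inj hab (by rw [length_list, length_list, hrel]) h2)
  fact_rel f := by
    split_ifs with h
    · simp [monadicName, h]
    · rfl
  pred Q := if Q.rel ∈ Γ then Q else
    mkPred (monadicName Γ Q.rel) [.concat (joinExprs a Q.list) (joinExprs b Q.list)]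
  pred_rel Q := by
    split_ifs with h
    · simp [monadicName, h]
    · rfl
  pred_vars Q := by
    split_ifs with h
    · rfl
    · ext x
      rw [vars_mkPred (by simp [monadicName, h])]
      simp [PathExpr.vars, vars_joinExprs, mem_predVars]
  eval_pred Q ν := by
    by_cases h : Q.rel ∈ Γ
    · simp only [Predicate.eval_rel, h, if_true]
    · simp only [Predicate.eval_rel, h, if_false, eval_mkPred, list_eval]
      simp [PathExpr.eval, eval_joinExprs]

/-- The number of IDB names is left unmentioned because the lemma is applied only where intermediate
predicates are allowed. -/
theorem eliminate_arity [Infinite dom] {Γ : Schema} {S : RelName} (hΓ : Γ.Monadic)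
    (hS : S ∉ Γ) (hSa : S.arity ≤ 1) {Q : Query dom Γ S} {P : Program dom} (hP : P.Computes Q) :
    ∃ P' : Program dom, P'.Computes Q ∧ ¬ P'.Uses .A ∧
      ∀ f, f ≠ .A → f ≠ .I → P'.Uses f → P.Uses f := by
  obtain ⟨a, b, hab⟩ := exists_pair_ne dom
  let Γ' : Schema := insert S Γ
  let t := arityTranslation Γ' hab
  have hmon : ∀ R, (t.rel R).arity ≤ 1 := by
    intro R
    change (monadicName Γ' R).arity ≤ 1
    unfold monadicName
    split_ifs with h
    · rcases Finset.mem_insert.1 h with rfl | h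
      · exact hSa
      · exact hΓ R h
    · exact le_rfl
  have hid : ∀ R ∈ Γ', t.rel R = R := fun R hR => by
    change monadicName Γ' R = R
    simp [monadicName, hR]
  have hrelmem : ∀ R R', R' ∈ Γ' → (t.rel R = R' ↔ R = R') := fun R R' hR' => by
    constructor
    · intro h
      apply t.rel_injective
      rw [h, hid R' hR']
    · rintro rfl
      exact hid R hR'
  have hfact : ∀ f : Fact dom, f.rel ∈ Γ' → t.fact f = f := fun f hf => by
    change (if f.rel ∈ Γ' then f else _) = f
    rw [if_pos hf]
  refine ⟨t.program P, ?_, ?_, ?_⟩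
  · rw [Program.computes_iff] at hP ⊢
    refine ⟨t.program_over hP.1 fun R => ?_, fun I => ?_⟩
    · constructor
      · intro h
        rw [(hrelmem R _ (Finset.mem_insert_of_mem h)).1 rfl]
        exact h
      · intro h
        rwa [hid R (Finset.mem_insert_of_mem h)]
    · have hI : t.fact '' I.1 = I.1 := by
        have : ∀ f ∈ I.1, t.fact f = f := fun f hf =>
          hfact f (Finset.mem_insert_of_mem (I.2.1.2 f hf))
        rw [Set.image_congr this, Set.image_id']
      have hr := t.run_image P.negFree I.1
      rw [hI] at hr
      change (run (P.strata.map _) I.1).Finite ∧ _ = _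
      refine ⟨hr ▸ (hP.2 I).1.image _, ?_⟩
      rw [← (hP.2 I).2]
      change {f ∈ run (P.strata.map _) I.1 | f.rel = S} = _
      rw [hr]
      have hSΓ : S ∈ Γ' := Finset.mem_insert_self _ _
      ext f
      constructor
      · rintro ⟨⟨g, hg, rfl⟩, hf⟩
        rw [t.fact_rel, hrelmem _ _ hSΓ] at hf
        rw [hfact g (hf ▸ hSΓ)]
        exact ⟨hg, hf⟩
      · rintro ⟨hf, rfl⟩
        exact ⟨⟨f, hf, hfact f hSΓ⟩, rfl⟩
  · rintro ⟨r', hr', h⟩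
    obtain ⟨r, hr, rfl⟩ := t.hasRule_program.1 hr'
    rcases h with h | ⟨R', hR', h⟩
    · have : (t.rule r).head.rel = t.rel r.head.rel := t.pred_rel _
      rw [this] at h
      exact absurd (hmon r.head.rel) (by omega)
    · obtain ⟨R, -, rfl⟩ := t.inBody_rule.1 hR'
      exact absurd (hmon R) (by omega)
  · intro f hA hI hf
    cases f with
    | A => exact absurd rfl hA
    | I => exact absurd rfl hI
    | E => exact t.uses_E hf
    | N => exact t.uses_N hf
    | R => exact t.uses_R hf
    | P =>
      have hpred : ∀ Q : Predicate dom, (t.pred Q).HasPacking → Q.HasPacking := by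
        intro Q hQ
        change (if Q.rel ∈ Γ' then Q else _).HasPacking at hQ
        split_ifs at hQ
        · exact hQ
        · obtain ⟨e, he, hp⟩ := hasPacking_mkPred hQ
          rw [List.mem_singleton.1 he] at hp
          have : ∃ e ∈ Q.list, e.HasPacking := by
            rcases hp with hp | hp <;> exact hasPacking_joinExprs hp
          obtain ⟨e, he, hp⟩ := this
          obtain ⟨i, rfl⟩ := List.mem_ofFn.1 he
          exact ⟨i, hp⟩
      obtain ⟨r', hr', h⟩ := hf
      obtain ⟨r, hr, rfl⟩ := t.hasRule_program.1 hr'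
      refine ⟨r, hr, ?_⟩
      rcases h with h | ⟨L', hL', h⟩
      · exact Or.inl (hpred _ h)
      · obtain ⟨L, hL, rfl⟩ := List.mem_map.1 hL'
        refine Or.inr ⟨L, hL, ?_⟩
        rw [t.literal_atom] at h
        cases hA : L.atom with
        | pred Q => rw [hA] at h; exact hpred Q h
        | eqn e₁ e₂ => rw [hA] at h; exact h

/-! ### Subpaths -/

/-- `p` is a contiguous part of `q`, at any depth. -/
inductive Subpath : Path dom → Path dom → Prop
  | factor (u p v : Path dom) : Subpath p (u ++ p ++ v)
  | nested (u q v p : Path dom) : Subpath p q → Subpath p (u ++ Value.packed q :: v)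

theorem Subpath.refl (p : Path dom) : Subpath p p := by
  simpa using Subpath.factor [] p []

theorem Subpath.append {p q : Path dom} (u v : Path dom) (h : Subpath p q) :
    Subpath p (u ++ q ++ v) := by
  cases h with
  | factor u' _ v' =>
    rw [show u ++ (u' ++ p ++ v') ++ v = (u ++ u') ++ p ++ (v' ++ v) by simp]
    exact .factor _ _ _
  | nested u' q v' _ h =>
    rw [show u ++ (u' ++ Value.packed q :: v') ++ v = (u ++ u') ++ Value.packed q :: (v' ++ v) by simp]
    exact .nested _ _ _ _ h

theorem subpath_get {e : PathExpr dom} {x : Var} (hx : x ∈ e.vars) (ν : Valuation dom) :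
    Subpath (ν.get x) (e.eval ν) := by
  induction e with
  | const a => exact absurd hx (Set.notMem_empty _)
  | var y => rw [Set.mem_singleton_iff.1 hx]; exact Subpath.refl _
  | pack e ih => exact Subpath.nested [] _ [] _ (ih hx)
  | empty => exact absurd hx (Set.notMem_empty _)
  | concat e₁ e₂ ih₁ ih₂ =>
    rw [PathExpr.eval]
    rcases hx with hx | hx
    · simpa using (ih₁ hx).append [] (e₂.eval ν)
    · simpa using (ih₂ hx).append (e₁.eval ν) []

theorem subpath_cons {s p : Path dom} {v : Value dom} (h : Subpath s (v :: p)) :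
    s ∈ (v :: p).inits ∨ Subpath s p ∨ ∃ q, v = Value.packed q ∧ Subpath s q := by
  generalize hw : v :: p = w at h
  cases h with
  | factor u _ t =>
    cases u with
    | nil => exact Or.inl (by simp)
    | cons v' u =>
      simp only [List.cons_append, List.cons.injEq] at hw
      rw [hw.2]
      exact Or.inr (Or.inl (.factor _ _ _))
  | nested u q t _ h =>
    cases u with
    | nil =>
      simp only [List.nil_append, List.cons.injEq] at hw
      exact Or.inr (Or.inr ⟨q, hw.1, h⟩)
    | cons v' u =>
      simp only [List.cons_append, List.cons.injEq] at hw
      rw [hw.2]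
      exact Or.inr (Or.inl (.nested _ _ _ _ h))

/-- Values of variables matched by predicates are subpaths of arguments, so this bounds the facts of
auxiliary relations and keeps transformed programs terminating. -/
theorem finite_subpaths (p : Path dom) : {s | Subpath s p}.Finite := by
  induction p using path_induction with
  | nil =>
    refine (Set.finite_singleton ([] : Path dom)).subset fun s hs => ?_
    generalize hw : ([] : Path dom) = w at hs
    cases hs with
    | factor u _ t => simp only [List.nil_eq, List.append_eq_nil_iff] at hw; simp [hw]
    | nested u q t _ h => simp at hw
  | atom a p ih =>
    refine (((Value.atom a :: p).inits.finite_toSet).union ih).subset fun s hs => ?_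
    rcases subpath_cons hs with h | h | ⟨q, hq, -⟩
    · exact Or.inl h
    · exact Or.inr h
    · exact absurd hq (by simp)
  | packed q p ih₁ ih₂ =>
    refine (((Value.packed q :: p).inits.finite_toSet).union (ih₁.union ih₂)).subset fun s hs => ?_
    rcases subpath_cons hs with h | h | ⟨q', hq, h⟩
    · exact Or.inl h
    · exact Or.inr (Or.inr h)
    · rw [Value.packed.inj hq]
      exact Or.inr (Or.inl h)

/-- All subpaths of arguments of facts. -/
def subpathsOf (K : Set (Fact dom)) : Set (Path dom) := {s | ∃ p ∈ argPaths K, Subpath s p}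

theorem finite_subpathsOf {K : Set (Fact dom)} (h : K.Finite) : (subpathsOf K).Finite := by
  have : subpathsOf K = ⋃ p ∈ argPaths K, {s | Subpath s p} := by ext; simp [subpathsOf]
  rw [this]
  exact (finite_argPaths h).biUnion fun p _ => finite_subpaths p

theorem get_mem_subpathsOf {K : Set (Fact dom)} {Q : Predicate dom} {ν : Valuation dom}
    (h : Q.eval ν ∈ K) {x : Var} (hx : x ∈ Q.vars) : ν.get x ∈ subpathsOf K := by
  obtain ⟨e, he, hx⟩ := mem_predVars.1 hx
  exact ⟨_, ⟨_, h, by rw [list_eval]; exact List.mem_map_of_mem he⟩, subpath_get hx ν⟩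

theorem finite_lists {α : Type*} {s : Set α} (hs : s.Finite) (n : ℕ) :
    {l : List α | l.length = n ∧ ∀ a ∈ l, a ∈ s}.Finite := by
  induction n with
  | zero =>
    refine (Set.finite_singleton ([] : List α)).subset ?_
    rintro l ⟨hl, -⟩
    exact List.length_eq_zero_iff.1 hl
  | succ n ih =>
    refine (Set.Finite.image2 List.cons hs ih).subset ?_
    rintro l ⟨hl, h⟩
    cases l with
    | nil => simp at hl
    | cons a l =>
      exact ⟨a, h a List.mem_cons_self, l, ⟨by simpa using hl,
        fun b hb => h b (List.mem_cons_of_mem _ hb)⟩, rfl⟩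

/-! ### Adding facts that a stratum ignores -/

theorem sat_union_frame {r : Rule dom} {X : Set (Fact dom)} (hX : ∀ f ∈ X, ¬ r.InBody f.rel)
    {L : Literal dom} (hL : L ∈ r.body) (K : Set (Fact dom)) (ν : Valuation dom) :
    L.Sat (K ∪ X) ν ↔ L.Sat K ν := by
  have hA : L.atom.Sat (K ∪ X) ν ↔ L.atom.Sat K ν := by
    cases h : L.atom with
    | pred Q =>
      refine ⟨fun h' => ?_, fun h' => Or.inl h'⟩
      rcases h' with h' | h'
      · exact h'
      · exact absurd ⟨L, hL, Q, h, rfl⟩ (hX _ h')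
    | eqn e₁ e₂ => exact Iff.rfl
  cases L with
  | pos A => exact hA
  | neg A => exact not_congr hA

/-- Facts whose relation is mentioned in no body neither enable nor block any rule. Auxiliary facts
are carried through later strata in this way. -/
theorem lfp_union_frame {Δ : Stratum dom} (hn : NegFree Δ Δ) {I X : Set (Fact dom)}
    (hX : ∀ f ∈ X, ∀ r ∈ Δ, ¬ r.InBody f.rel) : lfp Δ (I ∪ X) = lfp Δ I ∪ X := by
  have hsat : ∀ r ∈ Δ, ∀ L ∈ r.body, ∀ (K : Set (Fact dom)) (ν : Valuation dom),
      L.Sat (K ∪ X) ν ↔ L.Sat K ν := fun r hr L hL K ν =>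
    sat_union_frame (fun f hf => hX f hf r hr) hL K ν
  apply Set.Subset.antisymm
  · refine lfp_least hn (Set.union_subset_union_left _ (subset_lfp Δ I)) ?_ ?_
    · rintro f (hf | hf) hh
      · exact Or.inl (lfp_agree hf hh)
      · exact Or.inr hf
    · intro r hr ν hb
      exact Or.inl (lfp_sat hn hr ν fun L hL => (hsat r hr L hL _ ν).1 (hb L hL))
  · refine Set.union_subset ?_ (Set.subset_union_right.trans (subset_lfp _ _))
    refine lfp_induction hn (Set.subset_union_left.trans (subset_lfp _ _)) fun r hr ν hb hp => ?_
    refine lfp_sat hn hr ν fun L hL => ?_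
    cases L with
    | pos A =>
      cases A with
      | pred Q => exact hp Q hL
      | eqn e₁ e₂ => exact hb _ hL
    | neg A =>
      intro h
      rw [sat_lfp_iff hn hr hL] at h
      have h1 := hb _ hL
      have h2 := hsat r hr _ hL I ν
      simp only [Literal.Sat] at h1 h2
      rw [sat_lfp_iff hn hr hL] at h1
      exact h2.2 h1 h

theorem run_union_frame {s : List (Stratum dom)} (hn : ∀ Δ ∈ s, NegFree Δ Δ)
    {I X : Set (Fact dom)} (hX : ∀ f ∈ X, ∀ Δ ∈ s, ∀ r ∈ Δ, ¬ r.InBody f.rel) :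
    run s (I ∪ X) = run s I ∪ X := by
  induction s generalizing I with
  | nil => rfl
  | cons Δ s ih =>
    rw [run, lfp_union_frame (hn Δ List.mem_cons_self) fun f hf => hX f hf Δ List.mem_cons_self,
      ih (fun Δ' h => hn Δ' (List.mem_cons_of_mem _ h))
        fun f hf Δ' h => hX f hf Δ' (List.mem_cons_of_mem _ h), run]

/-! ### Eliminating positive equations -/

def Program.PosEq (P : Program dom) : Prop :=
  ∃ r, P.HasRule r ∧ ∃ e₁ e₂, .pos (.eqn e₁ e₂) ∈ r.body

def Program.NegEq (P : Program dom) : Prop :=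
  ∃ r, P.HasRule r ∧ ∃ e₁ e₂, .neg (.eqn e₁ e₂) ∈ r.body

theorem Program.uses_E_iff (P : Program dom) : P.Uses .E ↔ P.PosEq ∨ P.NegEq := by
  constructor
  · rintro ⟨r, hr, L, hL, e₁, e₂, he⟩
    cases L with
    | pos A => exact Or.inl ⟨r, hr, e₁, e₂, by rw [← show A = _ from he]; exact hL⟩
    | neg A => exact Or.inr ⟨r, hr, e₁, e₂, by rw [← show A = _ from he]; exact hL⟩
  · rintro (⟨r, hr, e₁, e₂, he⟩ | ⟨r, hr, e₁, e₂, he⟩) <;> exact ⟨r, hr, _, he, e₁, e₂, rfl⟩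

theorem Program.hasRule_iff (P : Program dom) (r : Rule dom) :
    P.HasRule r ↔ r ∈ P.strata.flatten := by
  simp [Program.HasRule, List.mem_flatten]

/-- All relation names occurring in a program. -/
def Program.names (P : Program dom) : Set RelName :=
  {R | P.IsIDB R ∨ ∃ r, P.HasRule r ∧ r.InBody R}

theorem Rule.finite_inBody (r : Rule dom) : {R | r.InBody R}.Finite := by
  refine ((r.body.finite_toSet).image fun L => match L.atom with
      | .pred Q => Q.rel
      | .eqn _ _ => ⟨0, 0⟩).subset ?_
  rintro R ⟨L, hL, Q, hQ, rfl⟩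
  exact ⟨L, hL, by simp only [hQ]⟩

theorem Program.finite_names (P : Program dom) : P.names.Finite := by
  refine P.finite_isIDB.union ?_
  refine (P.finite_hasRule.biUnion fun r _ => r.finite_inBody).subset ?_
  rintro R ⟨r, hr, hb⟩
  exact Set.mem_biUnion (by exact hr) (by exact hb)

/-- An identifier above all those of the program and of a given schema. -/
theorem Program.exists_fresh (P : Program dom) (Γ : Schema) :
    ∃ M : ℕ, (∀ R ∈ P.names, R.id < M) ∧ ∀ R ∈ Γ, R.id < M := by
  obtain ⟨M, hM⟩ := ((P.finite_names.union Γ.finite_toSet).image fun R => R.id).bddAbove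
  exact ⟨M + 1, fun R hR => Nat.lt_succ_of_le (hM ⟨R, Or.inl hR, rfl⟩),
    fun R hR => Nat.lt_succ_of_le (hM ⟨R, Or.inr hR, rfl⟩)⟩

theorem mem_names_of_mem_run {P : Program dom} {Γ : Schema} {I : Set (Fact dom)}
    (hI : ∀ f ∈ I, f.rel ∈ Γ) {s : List (Stratum dom)} (hs : s ⊆ P.strata) {f : Fact dom}
    (hf : f ∈ run s I) : f.rel ∈ P.names ∨ f.rel ∈ Γ := by
  rcases mem_run_cases hf with h | ⟨Δ, hΔ, hh⟩
  · exact Or.inr (hI f h)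
  · exact Or.inl (Or.inl ((P.isIDB_iff _).2 ⟨Δ, hs hΔ, hh⟩))

def posVars (B : List (Literal dom)) : Set Var := {x | ∃ Q, .pos (.pred Q) ∈ B ∧ x ∈ Q.vars}

theorem finite_posVars (B : List (Literal dom)) : (posVars B).Finite :=
  (finite_bodyVars B).subset fun _ ⟨_, hQ, hx⟩ => ⟨_, hQ, hx⟩

/-- Otherwise no equation could ever start to limit a variable, and the limited variables would be
exactly those of positive predicates. But safety makes all variables of each equation limited, so
each equation would have been usable. -/
theorem exists_solvable_equation {r : Rule dom} (hs : r.Safe)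
    (h : ∃ e₁ e₂, .pos (.eqn e₁ e₂) ∈ r.body) :
    ∃ B₁ A B₂ e₁ e₂, r.body = B₁ ++ .pos A :: B₂ ∧ (A = .eqn e₁ e₂ ∨ A = .eqn e₂ e₁) ∧
      e₁.vars ⊆ posVars r.body := by
  by_contra hcon
  have hno : ∀ e₁ e₂, .pos (.eqn e₁ e₂) ∈ r.body →
      ¬ e₁.vars ⊆ posVars r.body ∧ ¬ e₂.vars ⊆ posVars r.body := by
    intro e₁ e₂ he
    obtain ⟨B₁, B₂, hB⟩ := List.append_of_mem he
    exact ⟨fun hv => hcon ⟨B₁, _, B₂, e₁, e₂, hB, Or.inl rfl, hv⟩,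
      fun hv => hcon ⟨B₁, _, B₂, e₂, e₁, hB, Or.inr rfl, hv⟩⟩
  have hlim : ∀ x, Limited r.body x → x ∈ posVars r.body := by
    intro x hx
    induction hx with
    | pred P x hP hx => exact ⟨P, hP, hx⟩
    | eqn_right e₁ e₂ x he _ hx ih => exact absurd ih (hno _ _ he).1
    | eqn_left e₁ e₂ x he _ hx ih => exact absurd ih (hno _ _ he).2
  obtain ⟨e₁, e₂, he⟩ := h
  exact (hno e₁ e₂ he).1 fun x hx => hlim x (hs x (Or.inr ⟨_, he, Or.inl hx⟩))

open Classical in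
/-- The positive predicates of a body. -/
noncomputable def posPreds (B : List (Literal dom)) : List (Literal dom) :=
  B.filter fun L => ∃ Q, L = .pos (.pred Q)

theorem mem_posPreds {B : List (Literal dom)} {L : Literal dom} :
    L ∈ posPreds B ↔ L ∈ B ∧ ∃ Q, L = .pos (.pred Q) := by
  simp [posPreds]

theorem vars_list_pred {T : RelName} {vs : List Var} {e : PathExpr dom}
    (hT : T.arity = vs.length + 1) {x : Var} :
    x ∈ (mkPred T (vs.map .var ++ [e])).vars ↔ x ∈ vs ∨ x ∈ e.vars := by
  rw [vars_mkPred (by simp [hT])]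
  simp [or_and_right, exists_or, PathExpr.vars]

/-- Data of one step of the elimination of positive equations: the equation `e₁ = e₂` of the rule
`r`, all variables of `e₁` being bound by predicates, is replaced using the new relation `T`. -/
structure EquationStep (r : Rule dom) where
  B₁ : List (Literal dom)
  A : Atom dom
  B₂ : List (Literal dom)
  e₁ : PathExpr dom
  e₂ : PathExpr dom
  vs : List Var
  T : RelName
  body_eq : r.body = B₁ ++ .pos A :: B₂
  atom_eq : A = .eqn e₁ e₂ ∨ A = .eqn e₂ e₁
  vars_sub : e₁.vars ⊆ posVars r.body
  mem_vs : ∀ x, x ∈ vs ↔ x ∈ posVars r.body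
  arity_T : T.arity = vs.length + 1

namespace EquationStep

variable {r : Rule dom} (t : EquationStep r)

/-- Stores the value of `e₁` together with all variables bound by predicates. Only positive
predicates are kept in the body, so it contains neither equations nor negation. -/
noncomputable def rule₁ : Rule dom := ⟨mkPred t.T (t.vs.map .var ++ [t.e₁]), posPreds r.body⟩

/-- The first components of `T` select the stored assignment of the variables, and matching the last
one against `e₂` enforces the equation. -/
def rule₂ : Rule dom :=
  ⟨r.head, .pos (.pred (mkPred t.T (t.vs.map .var ++ [t.e₂]))) :: (t.B₁ ++ t.B₂)⟩

theorem mem_body {L : Literal dom} : L ∈ r.body ↔ L = .pos t.A ∨ L ∈ t.B₁ ++ t.B₂ := by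
  rw [t.body_eq]
  simp only [List.mem_append, List.mem_cons]
  tauto

theorem mem_rest_of_pred {Q : Predicate dom} (h : .pos (.pred Q) ∈ r.body) :
    .pos (.pred Q) ∈ t.B₁ ++ t.B₂ := by
  rcases t.mem_body.1 h with h | h
  · rcases t.atom_eq with h' | h' <;> rw [h'] at h <;> simp at h
  · exact h

theorem safe₁ : t.rule₁.Safe := by
  apply safe_of_pos
  have key : ∀ x ∈ posVars r.body, ∃ Q, .pos (.pred Q) ∈ t.rule₁.body ∧ x ∈ Q.vars := by
    rintro x ⟨Q, hQ, hx⟩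
    exact ⟨Q, mem_posPreds.2 ⟨hQ, Q, rfl⟩, hx⟩
  rintro x (hx | ⟨L, hL, hx⟩)
  · rcases (vars_list_pred t.arity_T).1 hx with hx | hx
    · exact key x ((t.mem_vs x).1 hx)
    · exact key x (t.vars_sub hx)
  · obtain ⟨hL, Q, rfl⟩ := mem_posPreds.1 hL
    exact key x ⟨Q, hL, hx⟩

/-- The new predicate limits the variables of both sides of the removed equation, so everything that
equation used to limit stays limited. -/
theorem safe₂ (hs : r.Safe) : t.rule₂.Safe := by
  have hT : ∀ x, x ∈ t.vs ∨ x ∈ t.e₂.vars → Limited t.rule₂.body x := fun x hx =>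
    .pred _ x List.mem_cons_self ((vars_list_pred t.arity_T).2 hx)
  have hA : ∀ x, x ∈ t.A.vars → Limited t.rule₂.body x := by
    intro x hx
    have : x ∈ t.e₁.vars ∨ x ∈ t.e₂.vars := by
      rcases t.atom_eq with h | h <;> rw [h] at hx
      · exact hx
      · exact hx.symm
    rcases this with h | h
    · exact hT x (Or.inl ((t.mem_vs x).2 (t.vars_sub h)))
    · exact hT x (Or.inr h)
  have hlim : ∀ x, Limited r.body x → Limited t.rule₂.body x := by
    intro x hx
    induction hx with
    | pred P x hP hx => exact .pred P x (List.mem_cons_of_mem _ (t.mem_rest_of_pred hP)) hx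
    | eqn_right e₁ e₂ x he _ hx ih =>
      rcases t.mem_body.1 he with h | h
      · exact hA x (by rw [← Literal.pos.inj h]; exact Or.inr hx)
      · exact .eqn_right e₁ e₂ x (List.mem_cons_of_mem _ h) ih hx
    | eqn_left e₁ e₂ x he _ hx ih =>
      rcases t.mem_body.1 he with h | h
      · exact hA x (by rw [← Literal.pos.inj h]; exact Or.inl hx)
      · exact .eqn_left e₁ e₂ x (List.mem_cons_of_mem _ h) ih hx
  rintro x (hx | ⟨L, hL, hx⟩)
  · exact hlim x (hs x (Or.inl hx))
  · rcases List.mem_cons.1 hL with rfl | hL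
    · exact hT x ((vars_list_pred t.arity_T).1 hx)
    · exact hlim x (hs x (Or.inr ⟨L, t.mem_body.2 (Or.inr hL), hx⟩))

theorem inBody₁ {R : RelName} (h : t.rule₁.InBody R) : r.InBody R := by
  obtain ⟨L, hL, Q, hQ⟩ := h
  exact ⟨L, (mem_posPreds.1 hL).1, Q, hQ⟩

theorem inBody₂ {R : RelName} (h : t.rule₂.InBody R) : R = t.T ∨ r.InBody R := by
  obtain ⟨L, hL, Q, hQ, rfl⟩ := h
  rcases List.mem_cons.1 hL with rfl | hL
  · left
    rw [← Atom.pred.inj hQ]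
    rfl
  · exact Or.inr ⟨L, t.mem_body.2 (Or.inr hL), Q, hQ, rfl⟩

theorem neg₂ {A : Atom dom} (h : .neg A ∈ t.rule₂.body) : .neg A ∈ r.body := by
  rcases List.mem_cons.1 h with h | h
  · exact absurd h (by simp)
  · exact t.mem_body.2 (Or.inr h)

theorem neg₁ {A : Atom dom} (h : .neg A ∈ t.rule₁.body) : False := by
  obtain ⟨-, Q, h⟩ := mem_posPreds.1 h
  simp at h

/-- The stratum in which `r` is replaced. -/
noncomputable def stratum (Δ₁ Δ₂ : Stratum dom) : Stratum dom := Δ₁ ++ t.rule₁ :: t.rule₂ :: Δ₂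

theorem mem_stratum {Δ₁ Δ₂ : Stratum dom} {ρ : Rule dom} (h : ρ ∈ t.stratum Δ₁ Δ₂) :
    ρ = t.rule₁ ∨ ρ = t.rule₂ ∨ ρ ∈ Δ₁ ++ r :: Δ₂ := by
  simp only [stratum, List.mem_append, List.mem_cons] at h ⊢
  tauto

theorem isHead_stratum {Δ₁ Δ₂ : Stratum dom} {R : RelName}
    (h : Stratum.IsHead (t.stratum Δ₁ Δ₂) R) : R = t.T ∨ Stratum.IsHead (Δ₁ ++ r :: Δ₂) R := by
  obtain ⟨ρ, hρ, rfl⟩ := h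
  rcases t.mem_stratum hρ with rfl | rfl | h
  · exact Or.inl rfl
  · exact Or.inr ⟨r, by simp, rfl⟩
  · exact Or.inr ⟨ρ, h, rfl⟩

theorem neg_stratum {Δ₁ Δ₂ : Stratum dom} {ρ : Rule dom} (hρ : ρ ∈ t.stratum Δ₁ Δ₂) {A : Atom dom}
    (h : .neg A ∈ ρ.body) : ∃ ρ' ∈ Δ₁ ++ r :: Δ₂, .neg A ∈ ρ'.body := by
  rcases t.mem_stratum hρ with rfl | rfl | h'
  · exact absurd h (fun h => t.neg₁ h)
  · exact ⟨r, by simp, t.neg₂ h⟩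
  · exact ⟨ρ, h', h⟩

theorem negFree_left {Δ₁ Δ₂ Δ' : Stratum dom} (h : NegFree (Δ₁ ++ r :: Δ₂) Δ') :
    NegFree (t.stratum Δ₁ Δ₂) Δ' := by
  intro ρ hρ Q hQ
  obtain ⟨ρ', hρ', h'⟩ := t.neg_stratum hρ hQ
  exact h ρ' hρ' Q h'

theorem negFree_right {Δ₁ Δ₂ Δ' : Stratum dom} (h : NegFree Δ' (Δ₁ ++ r :: Δ₂))
    (hT : ∀ ρ ∈ Δ', ¬ ρ.InBody t.T) : NegFree Δ' (t.stratum Δ₁ Δ₂) := by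
  intro ρ hρ Q hQ hh
  rcases t.isHead_stratum hh with h' | h'
  · exact hT ρ hρ ⟨_, hQ, Q, rfl, h'⟩
  · exact h ρ hρ Q hQ h'

theorem negFree {Δ₁ Δ₂ : Stratum dom} (h : NegFree (Δ₁ ++ r :: Δ₂) (Δ₁ ++ r :: Δ₂))
    (hT : ∀ ρ ∈ Δ₁ ++ r :: Δ₂, ¬ ρ.InBody t.T) :
    NegFree (t.stratum Δ₁ Δ₂) (t.stratum Δ₁ Δ₂) :=
  t.negFree_left (t.negFree_right h hT)

def newFacts (K : Set (Fact dom)) : Set (Fact dom) :=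
  {f | ∃ ν : Valuation dom, (∀ Q, .pos (.pred Q) ∈ r.body → Q.eval ν ∈ K) ∧
    (mkPred t.T (t.vs.map .var ++ [t.e₁])).eval ν = f}

theorem eval_T (ν : Valuation dom) (e : PathExpr dom) :
    (mkPred t.T (t.vs.map .var ++ [e])).eval ν = mkFact t.T (t.vs.map ν.get ++ [e.eval ν]) := by
  rw [eval_mkPred, List.map_append, List.map_map]
  rfl

/-- All components but the last are subpaths of arguments of `K`, and they determine the last one,
since `e₁` contains no other variables. -/
theorem finite_newFacts {K : Set (Fact dom)} (hK : K.Finite) : (t.newFacts K).Finite := by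
  classical
  have hsub : t.newFacts K ⊆ ⋃ l ∈ {l : List (Path dom) | l.length = t.vs.length ∧
      ∀ p ∈ l, p ∈ subpathsOf K}, {f | ∃ ν : Valuation dom, t.vs.map ν.get = l ∧
        mkFact t.T (l ++ [t.e₁.eval ν]) = f} := by
    rintro f ⟨ν, hν, rfl⟩
    refine Set.mem_biUnion (x := t.vs.map ν.get) ⟨by simp, ?_⟩ ⟨ν, rfl, (t.eval_T ν _).symm⟩
    intro p hp
    obtain ⟨x, hx, rfl⟩ := List.mem_map.1 hp
    obtain ⟨Q, hQ, hxQ⟩ := (t.mem_vs x).1 hx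
    exact get_mem_subpathsOf (hν Q hQ) hxQ
  refine ((finite_lists (finite_subpathsOf hK) _).biUnion fun l _ => ?_).subset hsub
  refine Set.Subsingleton.finite ?_
  rintro f ⟨ν, hν, rfl⟩ g ⟨ν', hν', rfl⟩
  have : t.e₁.eval ν = t.e₁.eval ν' := PathExpr.eval_congr _ fun x hx =>
    List.map_inj_left.1 (hν.trans hν'.symm) x ((t.mem_vs x).2 (t.vars_sub hx))
  rw [this]

/-- The new relation records precisely the matches of the positive predicates of `r`. A match of the
second rule therefore recovers the value of `e₁` under the same assignment, and the equation
follows. -/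
theorem lfp_stratum {Δ₁ Δ₂ : Stratum dom} (hn : NegFree (Δ₁ ++ r :: Δ₂) (Δ₁ ++ r :: Δ₂))
    (hTb : ∀ ρ ∈ Δ₁ ++ r :: Δ₂, ¬ ρ.InBody t.T) (hTh : ¬ Stratum.IsHead (Δ₁ ++ r :: Δ₂) t.T)
    {I : Set (Fact dom)} (hI : ∀ f ∈ I, f.rel ≠ t.T) :
    lfp (t.stratum Δ₁ Δ₂) I =
      lfp (Δ₁ ++ r :: Δ₂) I ∪ t.newFacts (lfp (Δ₁ ++ r :: Δ₂) I) := by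
  set Δ := Δ₁ ++ r :: Δ₂ with hΔ
  have hn' := t.negFree hn hTb
  have hmem₁ : t.rule₁ ∈ t.stratum Δ₁ Δ₂ := by simp [stratum]
  have hmem₂ : t.rule₂ ∈ t.stratum Δ₁ Δ₂ := by simp [stratum]
  have hrΔ : r ∈ Δ := by simp [hΔ]
  -- In both strata negated atoms are evaluated in the common input `I`.
  have hneg : ∀ ρ ∈ Δ, ∀ ρ' ∈ t.stratum Δ₁ Δ₂, ∀ A, .neg A ∈ ρ.body → .neg A ∈ ρ'.body →
      ∀ ν : Valuation dom, A.Sat (lfp (t.stratum Δ₁ Δ₂) I) ν ↔ A.Sat (lfp Δ I) ν := by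
    intro ρ hρ ρ' hρ' A h h' ν
    rw [sat_lfp_iff hn hρ h, sat_lfp_iff hn' hρ' h']
  have hfire : ∀ ν : Valuation dom,
      (∀ Q, .pos (.pred Q) ∈ r.body → Q.eval ν ∈ lfp (t.stratum Δ₁ Δ₂) I) →
      (mkPred t.T (t.vs.map .var ++ [t.e₁])).eval ν ∈ lfp (t.stratum Δ₁ Δ₂) I := by
    intro ν hν
    refine lfp_sat hn' hmem₁ ν fun L hL => ?_
    obtain ⟨hL, Q, rfl⟩ := mem_posPreds.1 hL
    exact hν Q hL
  have hsup : lfp Δ I ⊆ lfp (t.stratum Δ₁ Δ₂) I := by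
    refine lfp_induction hn (subset_lfp _ _) fun ρ hρ ν hb hp => ?_
    by_cases hρr : ρ ∈ t.stratum Δ₁ Δ₂
    · refine lfp_sat hn' hρr ν fun L hL => ?_
      cases L with
      | pos A =>
        cases A with
        | pred Q => exact hp Q hL
        | eqn e₁ e₂ => exact hb _ hL
      | neg A => exact fun h => hb _ hL ((hneg ρ hρ ρ hρr A hL hL ν).1 h)
    -- Only the replaced rule can have left the stratum; it may also have stayed, if the list
    -- contained it once more.
    · have : ρ = r := by
        simp only [hΔ, stratum, List.mem_append, List.mem_cons] at hρ hρr
        tauto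
      subst this
      refine lfp_sat hn' hmem₂ ν fun L hL => ?_
      rcases List.mem_cons.1 hL with rfl | hL'
      · have h1 := hfire ν hp
        have h2 : t.e₁.eval ν = t.e₂.eval ν := by
          have := hb _ (t.mem_body.2 (Or.inl rfl))
          rcases t.atom_eq with h | h <;> rw [h] at this
          · exact this
          · exact Eq.symm this
        rw [t.eval_T, h2, ← t.eval_T] at h1
        exact h1
      · have hL'' := t.mem_body.2 (Or.inr hL')
        cases L with
        | pos A =>
          cases A with
          | pred Q => exact hp Q hL''
          | eqn e₁ e₂ => exact hb _ hL''
        | neg A => exact fun h => hb _ hL'' ((hneg ρ hrΔ _ hmem₂ A hL'' hL ν).1 h)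
  apply Set.Subset.antisymm
  · have hlow : ∀ (Q : Predicate dom) (ν : Valuation dom), Q.rel ≠ t.T →
        Q.eval ν ∈ lfp Δ I ∪ t.newFacts (lfp Δ I) → Q.eval ν ∈ lfp Δ I := by
      rintro Q ν hQ (h | ⟨ν', -, h⟩)
      · exact h
      · exact absurd (congrArg Fact.rel h).symm hQ
    have hlow' : ∀ (ρ : Rule dom), ρ ∈ Δ → ∀ Q, .pos (.pred Q) ∈ ρ.body → Q.rel ≠ t.T :=
      fun ρ hρ Q hQ h => hTb ρ hρ ⟨_, hQ, Q, rfl, h⟩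
    refine lfp_induction hn' (Set.subset_union_left.trans' (subset_lfp _ _)) fun ρ hρ ν hb hp => ?_
    rcases t.mem_stratum hρ with rfl | rfl | hρΔ
    · refine Or.inr ⟨ν, fun Q hQ => ?_, rfl⟩
      exact hlow Q ν (hlow' r hrΔ Q hQ) (hp Q (mem_posPreds.2 ⟨hQ, Q, rfl⟩))
    · refine Or.inl (lfp_sat hn hrΔ ν fun L hL => ?_)
      rcases t.mem_body.1 hL with rfl | hL'
      · have h1 := hp _ List.mem_cons_self
        have h2 : t.e₁.eval ν = t.e₂.eval ν := by
          rcases h1 with h1 | ⟨ν', -, h1⟩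
          · exact absurd rfl (fun h => by
              by_cases hh : Stratum.IsHead Δ t.T
              · exact hTh hh
              · exact hI _ (lfp_agree h1 hh) h)
          · rw [t.eval_T, t.eval_T] at h1
            obtain ⟨-, h1⟩ := mkFact_inj (by simp [t.arity_T]) (by simp [t.arity_T]) h1
            obtain ⟨h3, h4⟩ := List.append_inj h1 (by simp)
            simp only [List.cons.injEq, and_true] at h4
            rw [← h4]
            -- The two assignments agree on all stored variables, and these include the variables of
            -- `e₁`.
            exact PathExpr.eval_congr _ fun x hx =>
              (List.map_inj_left.1 h3 x ((t.mem_vs x).2 (t.vars_sub hx))).symm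
        change t.A.Sat _ ν
        rcases t.atom_eq with h | h <;> rw [h]
        · exact h2
        · exact h2.symm
      · have hL₂ : L ∈ t.rule₂.body := List.mem_cons_of_mem _ hL'
        cases L with
        | pos A =>
          cases A with
          | pred Q => exact hlow Q ν (hlow' r hrΔ Q hL) (hp Q hL₂)
          | eqn e₁ e₂ => exact hb _ hL₂
        | neg A => exact fun h => hb _ hL₂ ((hneg r hrΔ _ hmem₂ A hL hL₂ ν).2 h)
    · refine Or.inl (lfp_sat hn hρΔ ν fun L hL => ?_)
      cases L with
      | pos A =>
        cases A with
        | pred Q => exact hlow Q ν (hlow' ρ hρΔ Q hL) (hp Q hL)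
        | eqn e₁ e₂ => exact hb _ hL
      | neg A => exact fun h => hb _ hL ((hneg ρ hρΔ ρ hρ A hL hL ν).2 h)
  · refine Set.union_subset hsup ?_
    rintro f ⟨ν, hν, rfl⟩
    exact hfire ν fun Q hQ => hsup (hν Q hQ)

end EquationStep

/-- The number of positive equations in a body. -/
def eqCount : List (Literal dom) → ℕ
  | [] => 0
  | .pos (.eqn _ _) :: B => eqCount B + 1
  | _ :: B => eqCount B

theorem eqCount_append (B B' : List (Literal dom)) :
    eqCount (B ++ B') = eqCount B + eqCount B' := by
  induction B with
  | nil => simp [eqCount]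
  | cons L B ih =>
    cases L with
    | neg A => simpa [eqCount] using ih
    | pos A =>
      cases A with
      | pred Q => simpa [eqCount] using ih
      | eqn e₁ e₂ => simp only [List.cons_append, eqCount, ih]; omega

theorem eqCount_eq_zero {B : List (Literal dom)} :
    eqCount B = 0 ↔ ∀ e₁ e₂, .pos (.eqn e₁ e₂) ∉ B := by
  induction B with
  | nil => simp [eqCount]
  | cons L B ih =>
    cases L with
    | neg A => simpa [eqCount] using ih
    | pos A =>
      cases A with
      | pred Q => simpa [eqCount] using ih
      | eqn e₁ e₂ =>
        refine iff_of_false (by simp [eqCount]) fun h => h e₁ e₂ List.mem_cons_self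

def Program.eqCount (P : Program dom) : ℕ :=
  (P.strata.flatten.map fun r => SeqDatalog.eqCount r.body).sum

/-- One equation can be removed from a program. -/
theorem eliminate_one_equation {Γ : Schema} {S : RelName} {Q : Query dom Γ S}
    {P : Program dom} (hP : P.Computes Q) (hE : P.PosEq) :
    ∃ P' : Program dom, P'.Computes Q ∧ P'.eqCount < P.eqCount ∧ (P'.NegEq → P.NegEq) ∧
      (P'.Uses .N → P.Uses .N) ∧ (P'.Uses .P → P.Uses .P) ∧ (P'.Uses .R → P.Uses .R) := by
  rw [Program.computes_iff] at hP
  obtain ⟨ho, hP⟩ := hP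
  obtain ⟨r, ⟨Δ, hΔ, hr⟩, heq⟩ := hE
  obtain ⟨B₁, A, B₂, e₁, e₂, hB, hA, hv⟩ := exists_solvable_equation (P.safe Δ hΔ r hr) heq
  obtain ⟨M, hM, hMΓ⟩ := P.exists_fresh (insert S Γ)
  obtain ⟨s₁, s₂, hs⟩ := List.append_of_mem hΔ
  obtain ⟨Δ₁, Δ₂, hΔr⟩ := List.append_of_mem hr
  let vs : List Var := (finite_posVars r.body).toFinset.toList
  let t : EquationStep r := ⟨B₁, A, B₂, e₁, e₂, vs, ⟨M, vs.length + 1⟩, hB, hA, hv,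
    fun x => by simp [vs], rfl⟩
  have hTnames : t.T ∉ P.names := fun h => lt_irrefl M (hM _ h)
  have hTΓ : t.T ∉ Γ := fun h => lt_irrefl M (hMΓ _ (Finset.mem_insert_of_mem h))
  have hTS : t.T ≠ S := fun h => by
    have := hMΓ S (Finset.mem_insert_self _ _)
    rw [← h] at this
    exact lt_irrefl M this
  have hTb : ∀ Δ' ∈ P.strata, ∀ ρ ∈ Δ', ¬ ρ.InBody t.T :=
    fun Δ' hΔ' ρ hρ h => hTnames (Or.inr ⟨ρ, ⟨Δ', hΔ', hρ⟩, h⟩)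
  have hTh : ∀ Δ' ∈ P.strata, ¬ Stratum.IsHead Δ' t.T :=
    fun Δ' hΔ' h => hTnames (Or.inl ((P.isIDB_iff _).2 ⟨Δ', hΔ', h⟩))
  subst hΔr
  have hnf := P.negFree
  have hstr := (stratified_iff _).1 P.stratified
  have hsafe := P.safe
  rw [hs] at hstr hnf hTb hTh hsafe
  let P' : Program dom := {
    strata := s₁ ++ t.stratum Δ₁ Δ₂ :: s₂
    safe := by
      intro Δ' hΔ' ρ hρ
      rcases List.mem_append.1 hΔ' with h | h
      · exact hsafe Δ' (List.mem_append_left _ h) ρ hρ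
      · rcases List.mem_cons.1 h with rfl | h
        · have hm : Δ₁ ++ r :: Δ₂ ∈ s₁ ++ (Δ₁ ++ r :: Δ₂) :: s₂ := by simp
          rcases t.mem_stratum hρ with rfl | rfl | hρ
          · exact t.safe₁
          · exact t.safe₂ (hsafe _ hm r hr)
          · exact hsafe _ hm ρ hρ
        · exact hsafe Δ' (List.mem_append_right _ (List.mem_cons_of_mem _ h)) ρ hρ
    stratified := by
      refine (stratified_iff _).2 ⟨?_, ?_⟩
      · intro Δ' hΔ'
        rcases List.mem_append.1 hΔ' with h | h
        · exact hnf Δ' (List.mem_append_left _ h)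
        · rcases List.mem_cons.1 h with rfl | h
          · exact t.negFree (hnf _ (by simp)) (hTb _ (by simp))
          · exact hnf Δ' (List.mem_append_right _ (List.mem_cons_of_mem _ h))
      · have h := hstr.2
        rw [List.pairwise_append, List.pairwise_cons] at h ⊢
        refine ⟨h.1, ⟨fun Δ' h' => t.negFree_left (h.2.1.1 Δ' h'), h.2.1.2⟩, fun Δ' h' Δ'' h'' => ?_⟩
        rcases List.mem_cons.1 h'' with rfl | h''
        · exact t.negFree_right (h.2.2 Δ' h' _ List.mem_cons_self)
            (hTb Δ' (List.mem_append_left _ h'))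
        · exact h.2.2 Δ' h' Δ'' (List.mem_cons_of_mem _ h'') }
  have hrule : ∀ ρ, P'.HasRule ρ → ρ = t.rule₁ ∨ ρ = t.rule₂ ∨ P.HasRule ρ := by
    intro ρ hρ
    rw [Program.hasRule_iff] at hρ ⊢
    rw [hs]
    simp only [P', EquationStep.stratum, List.flatten_append, List.flatten_cons, List.mem_append,
      List.mem_cons] at hρ ⊢
    tauto
  have hrule₂ : P'.HasRule t.rule₂ := ⟨t.stratum Δ₁ Δ₂, by simp [P'], by simp [EquationStep.stratum]⟩
  have hrule₁ : P'.HasRule t.rule₁ := ⟨t.stratum Δ₁ Δ₂, by simp [P'], by simp [EquationStep.stratum]⟩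
  have hrP : P.HasRule r := ⟨_, hΔ, hr⟩
  have hidb : ∀ R, P'.IsIDB R ↔ R = t.T ∨ P.IsIDB R := by
    intro R
    constructor
    · rintro ⟨ρ, hρ, rfl⟩
      rcases hrule ρ hρ with rfl | rfl | h
      · exact Or.inl rfl
      · exact Or.inr ⟨r, hrP, rfl⟩
      · exact Or.inr ⟨ρ, h, rfl⟩
    · rintro (rfl | ⟨ρ, hρ, rfl⟩)
      · exact ⟨_, hrule₁, rfl⟩
      · by_cases h : ρ = r
        · subst h
          exact ⟨_, hrule₂, rfl⟩
        · refine ⟨ρ, ?_, rfl⟩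
          rw [Program.hasRule_iff] at hρ ⊢
          rw [hs] at hρ
          simp only [P', EquationStep.stratum, List.flatten_append, List.flatten_cons,
            List.mem_append, List.mem_cons] at hρ ⊢
          tauto
  refine ⟨P', ?_, ?_, ?_, ?_, ?_, ?_⟩
  · rw [Program.computes_iff]
    refine ⟨⟨?_, ?_⟩, fun I => ?_⟩
    · rintro R ⟨⟨ρ, hρ, hb⟩, hR⟩
      rw [hidb, not_or] at hR
      rcases hrule ρ hρ with rfl | rfl | h
      · exact ho.1 R ⟨⟨r, hrP, t.inBody₁ hb⟩, hR.2⟩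
      · rcases t.inBody₂ hb with h | h
        · exact absurd h hR.1
        · exact ho.1 R ⟨⟨r, hrP, h⟩, hR.2⟩
      · exact ho.1 R ⟨⟨ρ, h, hb⟩, hR.2⟩
    · intro R hR
      rcases (hidb R).1 hR with rfl | h
      · exact hTΓ
      · exact ho.2 R h
    · have hK : ∀ f ∈ run s₁ I.1, f.rel ≠ t.T := by
        intro f hf he
        rcases mem_names_of_mem_run I.2.1.2 (P := P) (by rw [hs]; exact List.subset_append_left _ _) hf
          with h | h
        · exact hTnames (he ▸ h)
        · exact hTΓ (he ▸ h)
      -- The facts of `T` pass inertly through the later strata, whose bodies do not mention it.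
      have hrun : run P'.strata I.1 = run P.strata I.1 ∪
          t.newFacts (lfp (Δ₁ ++ r :: Δ₂) (run s₁ I.1)) := by
        rw [hs]
        simp only [P', run_append, run]
        rw [t.lfp_stratum (hnf _ (by simp)) (hTb _ (by simp)) (hTh _ (by simp)) hK,
          run_union_frame (fun Δ' h => hnf Δ' (by simp [h]))]
        rintro f ⟨ν, -, rfl⟩ Δ' hΔ' ρ hρ
        exact hTb Δ' (by simp [hΔ']) ρ hρ
      have hsub : lfp (Δ₁ ++ r :: Δ₂) (run s₁ I.1) ⊆ run P.strata I.1 := by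
        rw [hs, run_append]
        exact subset_run s₂ _
      rw [hrun]
      refine ⟨(hP I).1.union (t.finite_newFacts ((hP I).1.subset hsub)), ?_⟩
      rw [← (hP I).2]
      ext f
      constructor
      · rintro ⟨hf | ⟨ν, -, rfl⟩, hS⟩
        · exact ⟨hf, hS⟩
        · exact absurd hS hTS
      · rintro ⟨hf, hS⟩
        exact ⟨Or.inl hf, hS⟩
  · have h1 : eqCount t.rule₁.body = 0 := eqCount_eq_zero.2 fun e₁ e₂ he => by
      obtain ⟨-, Q, h⟩ := mem_posPreds.1 he
      simp at h
    have h2 : eqCount r.body = eqCount t.rule₂.body + 1 := by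
      rw [hB]
      change _ = eqCount (B₁ ++ B₂) + 1
      rw [eqCount_append, eqCount_append]
      rcases hA with rfl | rfl <;> simp only [eqCount] <;> omega
    rw [Program.eqCount, Program.eqCount, hs]
    simp only [P', EquationStep.stratum, List.flatten_append, List.flatten_cons, List.map_append,
      List.map_cons, List.sum_append, List.sum_cons, h1, h2]
    omega
  · rintro ⟨ρ, hρ, e₁, e₂, he⟩
    rcases hrule ρ hρ with rfl | rfl | h
    · exact absurd he fun h => t.neg₁ h
    · exact ⟨r, hrP, e₁, e₂, t.neg₂ he⟩
    · exact ⟨ρ, h, e₁, e₂, he⟩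
  · rintro ⟨ρ, hρ, A, he⟩
    rcases hrule ρ hρ with rfl | rfl | h
    · exact absurd he fun h => t.neg₁ h
    · exact ⟨r, hrP, A, t.neg₂ he⟩
    · exact ⟨ρ, h, A, he⟩
  · have hT : ∀ e : PathExpr dom, (mkPred t.T (vs.map .var ++ [e])).HasPacking → e.HasPacking := by
      intro e h
      obtain ⟨e', he', h'⟩ := hasPacking_mkPred h
      rcases List.mem_append.1 he' with h1 | h1
      · obtain ⟨x, -, rfl⟩ := List.mem_map.1 h1
        exact absurd h' (by simp [PathExpr.HasPacking])
      · rwa [List.mem_singleton.1 h1] at h'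
    have hApk : ∀ e, e = t.e₁ ∨ e = t.e₂ → e.HasPacking → P.Uses .P := by
      intro e he hp
      refine ⟨r, hrP, Or.inr ⟨.pos A, t.mem_body.2 (Or.inl rfl), ?_⟩⟩
      change A.HasPacking
      rcases hA with rfl | rfl <;> rcases he with rfl | rfl
      · exact Or.inl hp
      · exact Or.inr hp
      · exact Or.inr hp
      · exact Or.inl hp
    rintro ⟨ρ, hρ, h⟩
    rcases hrule ρ hρ with rfl | rfl | h'
    · rcases h with h | ⟨L, hL, h⟩
      · exact hApk _ (Or.inl rfl) (hT _ h)
      · exact ⟨r, hrP, Or.inr ⟨L, (mem_posPreds.1 hL).1, h⟩⟩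
    · rcases h with h | ⟨L, hL, h⟩
      · exact ⟨r, hrP, Or.inl h⟩
      · rcases List.mem_cons.1 hL with rfl | hL
        · exact hApk _ (Or.inr rfl) (hT _ h)
        · exact ⟨r, hrP, Or.inr ⟨L, t.mem_body.2 (Or.inr hL), h⟩⟩
    · exact ⟨ρ, h', h⟩
  · intro hR
    by_contra hR'
    obtain ⟨rk, hrk⟩ := P.exists_rank hR'
    -- Doubling the ranks makes room for `T`: it lies just below the head of `r`, at `2 * rk + 1`,
    -- and above every IDB name in the body of `r`, whose new rank is at most `2 * rk - 1`.
    refine P'.not_uses_R_of_rank (fun R => if R = t.T then 2 * rk r.head.rel else 2 * rk R + 1) ?_ hR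
    have hne : ∀ ρ, P.HasRule ρ → ∀ R, ρ.InBody R → R ≠ t.T := fun ρ hρ R hb h =>
      hTnames (Or.inr ⟨ρ, hρ, h ▸ hb⟩)
    have hneh : ∀ ρ, P.HasRule ρ → ρ.head.rel ≠ t.T := fun ρ hρ h =>
      hTnames (Or.inl ⟨ρ, hρ, h⟩)
    have hdep : ∀ ρ, P.HasRule ρ → ∀ R, ρ.InBody R → P'.IsIDB R → rk R < rk ρ.head.rel :=
      fun ρ hρ R hb hi => hrk _ _ ⟨((hidb R).1 hi).resolve_left (hne ρ hρ R hb), ρ, hρ, rfl, hb⟩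
    rintro R₁ R₂ ⟨hi, ρ, hρ, rfl, hb⟩
    rcases hrule ρ hρ with rfl | rfl | h'
    · have hb' := t.inBody₁ hb
      have := hdep r hrP R₂ hb' hi
      have h1 : t.rule₁.head.rel = t.T := rfl
      simp only [hne r hrP R₂ hb', if_false, h1, if_true]
      omega
    · have h1 : t.rule₂.head.rel = r.head.rel := rfl
      simp only [h1, hneh r hrP, if_false]
      rcases t.inBody₂ hb with rfl | hb'
      · simp
      · have := hdep r hrP R₂ hb' hi
        simp only [hne r hrP R₂ hb', if_false]
        omega
    · have := hdep ρ h' R₂ hb hi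
      simp only [hne ρ h' R₂ hb, hneh ρ h', if_false]
      omega

theorem eliminate_posEq {Γ : Schema} {S : RelName} {Q : Query dom Γ S} {P : Program dom}
    (hP : P.Computes Q) :
    ∃ P' : Program dom, P'.Computes Q ∧ ¬ P'.PosEq ∧ (P'.NegEq → P.NegEq) ∧
      (P'.Uses .N → P.Uses .N) ∧ (P'.Uses .P → P.Uses .P) ∧ (P'.Uses .R → P.Uses .R) := by
  induction hn : P.eqCount using Nat.strong_induction_on generalizing P with
  | _ n ih =>
    by_cases hE : P.PosEq
    · obtain ⟨P₁, h1, h2, h3, h4, h5, h6⟩ := eliminate_one_equation hP hE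
      obtain ⟨P₂, k1, k2, k3, k4, k5, k6⟩ := ih _ (hn ▸ h2) h1 rfl
      exact ⟨P₂, k1, k2, h3 ∘ k3, h4 ∘ k4, h5 ∘ k5, h6 ∘ k6⟩
    · exact ⟨P, hP, hE, id, id, id, id⟩

/-! ### Expanding negated equations -/

def Var.idx : Var → ℕ
  | .atomic n => n
  | .path n => n

/-- Overwrite the values of the variables from index `m` on. -/
def Valuation.extend (ν : Valuation dom) (m : ℕ) (α : ℕ → dom) (π : ℕ → Path dom) :
    Valuation dom :=
  ⟨fun n => if n < m then ν.atomic n else α (n - m), fun n => if n < m then ν.path n else π (n - m)⟩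

theorem Valuation.extend_get (ν : Valuation dom) (m : ℕ) (α : ℕ → dom) (π : ℕ → Path dom) {x : Var}
    (hx : x.idx < m) : (ν.extend m α π).get x = ν.get x := by
  cases x with
  | atomic n => simp only [Var.idx] at hx; simp [Valuation.get, PathExpr.eval, extend, hx]
  | path n => simp only [Var.idx] at hx; simp [Valuation.get, PathExpr.eval, extend, hx]

theorem Valuation.extend_atomic (ν : Valuation dom) (m : ℕ) (α : ℕ → dom) (π : ℕ → Path dom)
    (i : ℕ) : (ν.extend m α π).atomic (m + i) = α i := by
  simp [extend]

theorem Valuation.extend_path (ν : Valuation dom) (m : ℕ) (α : ℕ → dom) (π : ℕ → Path dom)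
    (i : ℕ) : (ν.extend m α π).path (m + i) = π i := by
  simp [extend]

/-- The three ways in which `e₁ ≠ e₂` can hold for flat paths, using the relation `Ne` of pairs of
distinct atomic values. -/
def neqOptions (Ne : RelName) (m : ℕ) (e₁ e₂ : PathExpr dom) : List (List (Literal dom)) :=
  [[.pos (.eqn e₁ (.concat (.var (.path (m + 0))) (.concat (.var (.atomic (m + 0)))
      (.var (.path (m + 1)))))),
    .pos (.eqn e₂ (.concat (.var (.path (m + 0))) (.concat (.var (.atomic (m + 1)))
      (.var (.path (m + 2)))))),
    .pos (.pred (mkPred Ne [.concat (.var (.atomic (m + 0))) (.var (.atomic (m + 1)))]))],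
   [.pos (.eqn e₁ (.concat e₂ (.concat (.var (.atomic (m + 0))) (.var (.path (m + 0))))))],
   [.pos (.eqn e₂ (.concat e₁ (.concat (.var (.atomic (m + 0))) (.var (.path (m + 0))))))]]

/-- Every negated equation is replaced by one of three alternatives, and all combinations of choices
are formed. An alternative uses new variables with indices from `m` to `m + 2`, hence the step by 3.
-/
def expandNeq (Ne : RelName) : ℕ → List (Literal dom) → List (List (Literal dom))
  | _, [] => [[]]
  | m, .neg (.eqn e₁ e₂) :: B => (neqOptions Ne m e₁ e₂).flatMap fun o =>
      (expandNeq Ne (m + 3) B).map fun B' => o ++ B'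
  | m, L :: B => (expandNeq Ne m B).map fun B' => L :: B'

theorem expandNeq_cons {Ne : RelName} {m : ℕ} {L : Literal dom} {B : List (Literal dom)}
    (h : ∀ e₁ e₂, L ≠ .neg (.eqn e₁ e₂)) :
    expandNeq Ne m (L :: B) = (expandNeq Ne m B).map fun B' => L :: B' := by
  cases L with
  | pos A => rfl
  | neg A =>
    cases A with
    | pred Q => rfl
    | eqn e₁ e₂ => exact absurd rfl (h e₁ e₂)

/-- Flatness makes the differing values, and the first surplus value in the prefix cases, atomic; so
atomic variables suffice to describe them. -/
theorem exists_first_difference {p q : Path dom} (hp : p.Flat) (hq : q.Flat) (h : p ≠ q) :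
    (∃ u a v b w, p = u ++ Value.atom a :: v ∧ q = u ++ Value.atom b :: w ∧ a ≠ b) ∨
    (∃ a v, p = q ++ Value.atom a :: v) ∨ ∃ a v, q = p ++ Value.atom a :: v := by
  induction p generalizing q with
  | nil =>
    cases q with
    | nil => exact absurd rfl h
    | cons v q =>
      obtain ⟨⟨a, rfl⟩, -⟩ := Path.flat_cons.1 hq
      exact Or.inr (Or.inr ⟨a, q, rfl⟩)
  | cons v p ih =>
    obtain ⟨⟨a, rfl⟩, hp'⟩ := Path.flat_cons.1 hp
    cases q with
    | nil => exact Or.inr (Or.inl ⟨a, p, rfl⟩)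
    | cons w q =>
      obtain ⟨⟨b, rfl⟩, hq'⟩ := Path.flat_cons.1 hq
      by_cases hab : a = b
      · subst hab
        rcases ih hp' hq' (fun he => h (by rw [he])) with ⟨u, c, v, d, w, rfl, rfl, hcd⟩ |
          ⟨c, v, rfl⟩ | ⟨c, v, rfl⟩
        · exact Or.inl ⟨_ :: u, c, v, d, w, rfl, rfl, hcd⟩
        · exact Or.inr (Or.inl ⟨c, v, rfl⟩)
        · exact Or.inr (Or.inr ⟨c, v, rfl⟩)
      · exact Or.inl ⟨[], a, p, b, q, rfl, rfl, hab⟩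

theorem neqOptions_complete {Ne : RelName} {C : Set dom} {K : Set (Fact dom)}
    (hK : ∀ a ∈ C, ∀ b ∈ C, a ≠ b → mkFact Ne [[Value.atom a, Value.atom b]] ∈ K)
    {m : ℕ} {e₁ e₂ : PathExpr dom} (hm₁ : ∀ x ∈ e₁.vars, x.idx < m) (hm₂ : ∀ x ∈ e₂.vars, x.idx < m)
    {ν : Valuation dom} (hf₁ : (e₁.eval ν).Flat) (hf₂ : (e₂.eval ν).Flat)
    (hC₁ : pathAtoms (e₁.eval ν) ⊆ C) (hC₂ : pathAtoms (e₂.eval ν) ⊆ C)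
    (hne : e₁.eval ν ≠ e₂.eval ν) : ∃ o ∈ neqOptions Ne m e₁ e₂, ∃ α π,
      ∀ L ∈ o, L.Sat K (ν.extend m α π) := by
  have h₁ : ∀ α π, e₁.eval (ν.extend m α π) = e₁.eval ν := fun α π =>
    PathExpr.eval_congr _ fun x hx => ν.extend_get m α π (hm₁ x hx)
  have h₂ : ∀ α π, e₂.eval (ν.extend m α π) = e₂.eval ν := fun α π =>
    PathExpr.eval_congr _ fun x hx => ν.extend_get m α π (hm₂ x hx)
  rcases exists_first_difference hf₁ hf₂ hne with ⟨u, a, v, b, w, hp, hq, hab⟩ | ⟨a, v, hp⟩ |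
    ⟨a, v, hp⟩
  · refine ⟨_, List.mem_cons_self, fun i => if i = 0 then a else b,
      fun i => if i = 0 then u else if i = 1 then v else w, ?_⟩
    simp only [List.mem_cons, List.not_mem_nil, or_false, forall_eq_or_imp, forall_eq, Literal.Sat,
      Atom.Sat, h₁, h₂, eval_mkPred, List.map_cons, List.map_nil]
    simp only [PathExpr.eval, Valuation.extend_atomic, Valuation.extend_path]
    refine ⟨by simp [hp], by simp [hq], ?_⟩
    have := hK a (hC₁ (by rw [hp]; exact mem_pathAtoms_of_mem (by simp))) b
      (hC₂ (by rw [hq]; exact mem_pathAtoms_of_mem (by simp))) hab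
    simpa using this
  · refine ⟨_, List.mem_cons_of_mem _ List.mem_cons_self, fun _ => a, fun _ => v, ?_⟩
    simp only [List.mem_singleton, forall_eq, Literal.Sat, Atom.Sat, h₁]
    simp only [PathExpr.eval, Valuation.extend_atomic, Valuation.extend_path, h₂]
    simpa using hp
  · refine ⟨_, List.mem_cons_of_mem _ (List.mem_cons_of_mem _ List.mem_cons_self), fun _ => a,
      fun _ => v, ?_⟩
    simp only [List.mem_singleton, forall_eq, Literal.Sat, Atom.Sat, h₂]
    simp only [PathExpr.eval, Valuation.extend_atomic, Valuation.extend_path, h₁]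
    simpa using hp

theorem neqOptions_sound {Ne : RelName} (hNe : Ne.arity = 1) {K : Set (Fact dom)}
    (hK : ∀ a b, mkFact Ne [[Value.atom a, Value.atom b]] ∈ K → a ≠ b)
    {m : ℕ} {e₁ e₂ : PathExpr dom} {ν : Valuation dom} {o : List (Literal dom)}
    (ho : o ∈ neqOptions Ne m e₁ e₂) (hs : ∀ L ∈ o, L.Sat K ν) : e₁.eval ν ≠ e₂.eval ν := by
  simp only [neqOptions, List.mem_cons, List.not_mem_nil, or_false] at ho
  rcases ho with rfl | rfl | rfl
  · simp only [List.mem_cons, List.not_mem_nil, or_false, forall_eq_or_imp, forall_eq, Literal.Sat,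
      Atom.Sat, eval_mkPred, List.map_cons, List.map_nil, PathExpr.eval] at hs
    obtain ⟨h1, h2, h3⟩ := hs
    have := hK _ _ h3
    rw [h1, h2]
    simpa using fun h => absurd h this
  · simp only [List.mem_singleton, forall_eq, Literal.Sat, Atom.Sat, PathExpr.eval] at hs
    intro h
    -- An atomic value has been appended, so one side is strictly longer than the other.
    have := congrArg List.length (hs.symm.trans h)
    simp at this
  · simp only [List.mem_singleton, forall_eq, Literal.Sat, Atom.Sat, PathExpr.eval] at hs
    intro h
    have := congrArg List.length (hs.symm.trans h.symm)
    simp at this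

theorem neqOptions_vars {Ne : RelName} (hNe : Ne.arity = 1) {m : ℕ} {e₁ e₂ : PathExpr dom}
    (hm₁ : ∀ x ∈ e₁.vars, x.idx < m) (hm₂ : ∀ x ∈ e₂.vars, x.idx < m) {o : List (Literal dom)}
    (ho : o ∈ neqOptions Ne m e₁ e₂) {L : Literal dom} (hL : L ∈ o) {x : Var}
    (hx : x ∈ L.atom.vars) : x.idx < m + 3 := by
  have h₁ := fun y hy => Nat.lt_add_right 3 (hm₁ y hy)
  have h₂ := fun y hy => Nat.lt_add_right 3 (hm₂ y hy)
  simp only [neqOptions, List.mem_cons, List.not_mem_nil, or_false] at ho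
  rcases ho with rfl | rfl | rfl
  · simp only [List.mem_cons, List.not_mem_nil, or_false] at hL
    rcases hL with rfl | rfl | rfl <;>
      simp only [Literal.atom, Atom.vars, PathExpr.vars, vars_mkPred_one hNe, Set.mem_union,
        Set.mem_singleton_iff] at hx
    · rcases hx with hx | rfl | rfl | rfl
      · exact h₁ x hx
      all_goals simp [Var.idx]
    · rcases hx with hx | rfl | rfl | rfl
      · exact h₂ x hx
      all_goals simp [Var.idx]
    · rcases hx with rfl | rfl <;> simp [Var.idx]
  all_goals
    rw [List.mem_singleton.1 hL] at hx
    simp only [Literal.atom, Atom.vars, PathExpr.vars, Set.mem_union, Set.mem_singleton_iff] at hx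
    rcases hx with hx | hx | rfl | rfl
    · first | exact h₁ x hx | exact h₂ x hx
    · first | exact h₁ x hx | exact h₂ x hx
    all_goals simp [Var.idx]

/-- The variables of the original sides are limited beforehand, so each added equation limits the
new variables on its other side. -/
theorem neqOptions_limited {Ne : RelName} (hNe : Ne.arity = 1) {m : ℕ} {e₁ e₂ : PathExpr dom}
    {B : List (Literal dom)} {o : List (Literal dom)} (ho : o ∈ neqOptions Ne m e₁ e₂)
    (hoB : o ⊆ B) (h₁ : ∀ x ∈ e₁.vars, Limited B x) (h₂ : ∀ x ∈ e₂.vars, Limited B x) :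
    ∀ L ∈ o, ∀ x ∈ L.atom.vars, Limited B x := by
  simp only [neqOptions, List.mem_cons, List.not_mem_nil, or_false] at ho
  intro L hL x hx
  rcases ho with rfl | rfl | rfl
  · have hP := hoB (List.mem_cons_of_mem _ (List.mem_cons_of_mem _ List.mem_cons_self))
    have hE₁ := hoB List.mem_cons_self
    have hE₂ := hoB (List.mem_cons_of_mem _ List.mem_cons_self)
    simp only [List.mem_cons, List.not_mem_nil, or_false] at hL
    rcases hL with rfl | rfl | rfl
    · rcases hx with hx | hx
      · exact h₁ x hx
      · exact .eqn_right _ _ x hE₁ h₁ hx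
    · rcases hx with hx | hx
      · exact h₂ x hx
      · exact .eqn_right _ _ x hE₂ h₂ hx
    · exact .pred _ x hP hx
  · have hE := hoB List.mem_cons_self
    rw [List.mem_singleton.1 hL] at hx
    rcases hx with hx | hx
    · exact h₁ x hx
    · exact .eqn_right _ _ x hE h₁ hx
  · have hE := hoB List.mem_cons_self
    rw [List.mem_singleton.1 hL] at hx
    rcases hx with hx | hx
    · exact h₂ x hx
    · exact .eqn_right _ _ x hE h₂ hx

theorem neqOptions_pos {Ne : RelName} {m : ℕ} {e₁ e₂ : PathExpr dom} {o : List (Literal dom)}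
    (ho : o ∈ neqOptions Ne m e₁ e₂) {L : Literal dom} (hL : L ∈ o) :
    (∃ A, L = .pos A) ∧ (∀ Q, L.atom = .pred Q → Q.rel = Ne) ∧
      (L.atom.HasPacking → e₁.HasPacking ∨ e₂.HasPacking) := by
  simp only [neqOptions, List.mem_cons, List.not_mem_nil, or_false] at ho
  have hQ : ¬ (mkPred Ne [PathExpr.concat (.var (.atomic (m + 0))) (.var (.atomic (m + 1)))] :
      Predicate dom).HasPacking := fun h => by
    obtain ⟨e, he, h⟩ := hasPacking_mkPred h
    rw [List.mem_singleton.1 he] at h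
    simp [PathExpr.HasPacking] at h
  rcases ho with rfl | rfl | rfl <;> simp only [List.mem_cons, List.not_mem_nil, or_false] at hL
  · rcases hL with rfl | rfl | rfl <;>
      simp [Literal.atom, Atom.HasPacking, PathExpr.HasPacking] <;> tauto
  all_goals subst hL; simp [Literal.atom, Atom.HasPacking, PathExpr.HasPacking]; try tauto

theorem expandNeq_complete {Ne : RelName} (hNe : Ne.arity = 1) {C : Set dom} {K : Set (Fact dom)}
    (hK : ∀ a ∈ C, ∀ b ∈ C, a ≠ b → mkFact Ne [[Value.atom a, Value.atom b]] ∈ K)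
    {B : List (Literal dom)} {m : ℕ} (hm : ∀ x ∈ bodyVars B, x.idx < m) {ν : Valuation dom}
    (hf : ∀ e₁ e₂, .neg (.eqn e₁ e₂) ∈ B → (e₁.eval ν).Flat ∧ (e₂.eval ν).Flat ∧
      pathAtoms (e₁.eval ν) ⊆ C ∧ pathAtoms (e₂.eval ν) ⊆ C)
    (hs : ∀ L ∈ B, L.Sat K ν) : ∃ B' ∈ expandNeq Ne m B, ∃ ν' : Valuation dom,
      (∀ x : Var, x.idx < m → ν'.get x = ν.get x) ∧ ∀ L ∈ B', L.Sat K ν' := by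
  induction B generalizing m ν with
  | nil => exact ⟨[], List.mem_cons_self, ν, fun _ _ => rfl, by simp⟩
  | cons L B ih =>
    have hm' : ∀ x ∈ bodyVars B, x.idx < m := fun x ⟨L', hL', hx⟩ =>
      hm x ⟨L', List.mem_cons_of_mem _ hL', hx⟩
    by_cases hL : ∃ e₁ e₂, L = .neg (.eqn e₁ e₂)
    · obtain ⟨e₁, e₂, rfl⟩ := hL
      have hm₁ : ∀ x ∈ e₁.vars, x.idx < m := fun x hx => hm x ⟨_, List.mem_cons_self, Or.inl hx⟩
      have hm₂ : ∀ x ∈ e₂.vars, x.idx < m := fun x hx => hm x ⟨_, List.mem_cons_self, Or.inr hx⟩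
      obtain ⟨f1, f2, f3, f4⟩ := hf e₁ e₂ List.mem_cons_self
      obtain ⟨o, ho, α, π, hsat⟩ := neqOptions_complete hK hm₁ hm₂ f1 f2 f3 f4
        (hs _ List.mem_cons_self)
      have hcong : ∀ x : Var, x.idx < m → (ν.extend m α π).get x = ν.get x :=
        fun x hx => ν.extend_get m α π hx
      obtain ⟨B', hB', ν', hag, hsat'⟩ := ih (m := m + 3) (ν := ν.extend m α π)
        (fun x hx => Nat.lt_add_right 3 (hm' x hx))
        (fun e₁' e₂' he => by
          have h1 : e₁'.eval (ν.extend m α π) = e₁'.eval ν := PathExpr.eval_congr _ fun x hx =>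
            hcong x (hm' x ⟨_, he, Or.inl hx⟩)
          have h2 : e₂'.eval (ν.extend m α π) = e₂'.eval ν := PathExpr.eval_congr _ fun x hx =>
            hcong x (hm' x ⟨_, he, Or.inr hx⟩)
          rw [h1, h2]
          exact hf e₁' e₂' (List.mem_cons_of_mem _ he))
        (fun L' hL' => (L'.sat_congr fun x hx => hcong x (hm' x ⟨L', hL', hx⟩)).2
          (hs L' (List.mem_cons_of_mem _ hL')))
      refine ⟨o ++ B', List.mem_flatMap.2 ⟨o, ho, List.mem_map.2 ⟨B', hB', rfl⟩⟩, ν',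
        fun x hx => (hag x (Nat.lt_add_right 3 hx)).trans (hcong x hx), fun L' hL' => ?_⟩
      rcases List.mem_append.1 hL' with h | h
      -- The later choices change only variables of index at least `m + 3`, which do not occur in
      -- this alternative.
      · exact (L'.sat_congr fun x hx => hag x (neqOptions_vars hNe hm₁ hm₂ ho h hx)).2 (hsat L' h)
      · exact hsat' L' h
    · rw [expandNeq_cons (fun e₁ e₂ h => hL ⟨e₁, e₂, h⟩)]
      obtain ⟨B', hB', ν', hag, hsat'⟩ := ih hm'
        (fun e₁ e₂ he => hf e₁ e₂ (List.mem_cons_of_mem _ he))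
        (fun L' hL' => hs L' (List.mem_cons_of_mem _ hL'))
      refine ⟨L :: B', List.mem_map.2 ⟨B', hB', rfl⟩, ν', hag, fun L' hL' => ?_⟩
      rcases List.mem_cons.1 hL' with rfl | h
      · exact (L'.sat_congr fun x hx => hag x (hm x ⟨L', List.mem_cons_self, hx⟩)).2
          (hs L' List.mem_cons_self)
      · exact hsat' L' h

theorem expandNeq_sound {Ne : RelName} (hNe : Ne.arity = 1) {K : Set (Fact dom)}
    (hK : ∀ a b, mkFact Ne [[Value.atom a, Value.atom b]] ∈ K → a ≠ b)
    {B : List (Literal dom)} {m : ℕ} {ν : Valuation dom} {B' : List (Literal dom)}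
    (hB' : B' ∈ expandNeq Ne m B) (hs : ∀ L ∈ B', L.Sat K ν) : ∀ L ∈ B, L.Sat K ν := by
  induction B generalizing m B' with
  | nil => simp
  | cons L B ih =>
    by_cases hL : ∃ e₁ e₂, L = .neg (.eqn e₁ e₂)
    · obtain ⟨e₁, e₂, rfl⟩ := hL
      obtain ⟨o, ho, hB'⟩ := List.mem_flatMap.1 hB'
      obtain ⟨B'', hB'', rfl⟩ := List.mem_map.1 hB'
      intro L' hL'
      rcases List.mem_cons.1 hL' with rfl | hL'
      · exact neqOptions_sound hNe hK ho fun L hL => hs L (List.mem_append_left _ hL)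
      · exact ih hB'' (fun L hL => hs L (List.mem_append_right _ hL)) L' hL'
    · rw [expandNeq_cons (fun e₁ e₂ h => hL ⟨e₁, e₂, h⟩)] at hB'
      obtain ⟨B'', hB'', rfl⟩ := List.mem_map.1 hB'
      intro L' hL'
      rcases List.mem_cons.1 hL' with rfl | hL'
      · exact hs _ List.mem_cons_self
      · exact ih hB'' (fun L hL => hs L (List.mem_cons_of_mem _ hL)) L' hL'

/-- Literals of an expanded body. -/
theorem mem_expandNeq {Ne : RelName} {B : List (Literal dom)} {m : ℕ} {B' : List (Literal dom)}
    (hB' : B' ∈ expandNeq Ne m B) {L : Literal dom} (hL : L ∈ B') :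
    (L ∈ B ∧ ∀ e₁ e₂, L ≠ .neg (.eqn e₁ e₂)) ∨ ∃ e₁ e₂ m', .neg (.eqn e₁ e₂) ∈ B ∧
      ∃ o ∈ neqOptions Ne m' e₁ e₂, L ∈ o ∧ o ⊆ B' := by
  induction B generalizing m B' with
  | nil =>
    rw [List.mem_singleton.1 hB'] at hL
    exact absurd hL List.not_mem_nil
  | cons L' B ih =>
    by_cases hL' : ∃ e₁ e₂, L' = .neg (.eqn e₁ e₂)
    · obtain ⟨e₁, e₂, rfl⟩ := hL'
      obtain ⟨o, ho, hB'⟩ := List.mem_flatMap.1 hB'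
      obtain ⟨B'', hB'', rfl⟩ := List.mem_map.1 hB'
      rcases List.mem_append.1 hL with h | h
      · exact Or.inr ⟨e₁, e₂, m, List.mem_cons_self, o, ho, h, List.subset_append_left _ _⟩
      · rcases ih hB'' h with h | ⟨e₁', e₂', m', h1, o', h2, h3, h4⟩
        · exact Or.inl ⟨List.mem_cons_of_mem _ h.1, h.2⟩
        · exact Or.inr ⟨e₁', e₂', m', List.mem_cons_of_mem _ h1, o', h2, h3,
            fun x hx => List.mem_append_right _ (h4 hx)⟩
    · rw [expandNeq_cons (fun e₁ e₂ h => hL' ⟨e₁, e₂, h⟩)] at hB'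
      obtain ⟨B'', hB'', rfl⟩ := List.mem_map.1 hB'
      rcases List.mem_cons.1 hL with rfl | h
      · exact Or.inl ⟨List.mem_cons_self, fun e₁ e₂ h => hL' ⟨e₁, e₂, h⟩⟩
      · rcases ih hB'' h with h | ⟨e₁', e₂', m', h1, o', h2, h3, h4⟩
        · exact Or.inl ⟨List.mem_cons_of_mem _ h.1, h.2⟩
        · exact Or.inr ⟨e₁', e₂', m', List.mem_cons_of_mem _ h1, o', h2, h3,
            fun x hx => List.mem_cons_of_mem _ (h4 hx)⟩

theorem pos_mem_expandNeq {Ne : RelName} {B : List (Literal dom)} {m : ℕ} {B' : List (Literal dom)}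
    (hB' : B' ∈ expandNeq Ne m B) {A : Atom dom} (hA : .pos A ∈ B) : .pos A ∈ B' := by
  induction B generalizing m B' with
  | nil => exact absurd hA List.not_mem_nil
  | cons L' B ih =>
    by_cases hL' : ∃ e₁ e₂, L' = .neg (.eqn e₁ e₂)
    · obtain ⟨e₁, e₂, rfl⟩ := hL'
      obtain ⟨o, ho, hB'⟩ := List.mem_flatMap.1 hB'
      obtain ⟨B'', hB'', rfl⟩ := List.mem_map.1 hB'
      rcases List.mem_cons.1 hA with h | h
      · exact absurd h (by simp)
      · exact List.mem_append_right _ (ih hB'' h)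
    · rw [expandNeq_cons (fun e₁ e₂ h => hL' ⟨e₁, e₂, h⟩)] at hB'
      obtain ⟨B'', hB'', rfl⟩ := List.mem_map.1 hB'
      rcases List.mem_cons.1 hA with rfl | h
      · exact List.mem_cons_self
      · exact List.mem_cons_of_mem _ (ih hB'' h)

theorem Limited.mono {B B' : List (Literal dom)} (h : ∀ A, .pos A ∈ B → .pos A ∈ B') {x : Var}
    (hx : Limited B x) : Limited B' x := by
  induction hx with
  | pred P x hP hx => exact .pred P x (h _ hP) hx
  | eqn_right e₁ e₂ x he _ hx ih => exact .eqn_right e₁ e₂ x (h _ he) ih hx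
  | eqn_left e₁ e₂ x he _ hx ih => exact .eqn_left e₁ e₂ x (h _ he) ih hx

theorem expandNeq_safe {Ne : RelName} (hNe : Ne.arity = 1) {r : Rule dom} (hs : r.Safe) {m : ℕ}
    {B' : List (Literal dom)} (hB' : B' ∈ expandNeq Ne m r.body) : (Rule.mk r.head B').Safe := by
  have hlim : ∀ x ∈ r.vars, Limited B' x := fun x hx =>
    (hs x hx).mono fun A hA => pos_mem_expandNeq hB' hA
  rintro x (hx | ⟨L, hL, hx⟩)
  · exact hlim x (Or.inl hx)
  · rcases mem_expandNeq hB' hL with h | ⟨e₁, e₂, m', he, o, ho, hLo, hoB⟩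
    · exact hlim x (Or.inr ⟨L, h.1, hx⟩)
    · exact neqOptions_limited hNe ho hoB (fun y hy => hlim y (Or.inr ⟨_, he, Or.inl hy⟩))
        (fun y hy => hlim y (Or.inr ⟨_, he, Or.inr hy⟩)) L hLo x hx

theorem exists_var_bound {s : Set Var} (hs : s.Finite) : ∃ m, ∀ x ∈ s, x.idx < m := by
  obtain ⟨m, hm⟩ := (hs.image Var.idx).bddAbove
  exact ⟨m + 1, fun x hx => Nat.lt_succ_of_le (hm ⟨x, hx, rfl⟩)⟩

/-- A strict upper bound of the variable indices of a rule. -/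
noncomputable def Rule.varBound (r : Rule dom) : ℕ := (exists_var_bound r.finite_vars).choose

theorem Rule.lt_varBound (r : Rule dom) {x : Var} (hx : x ∈ r.vars) : x.idx < r.varBound :=
  (exists_var_bound r.finite_vars).choose_spec x hx

noncomputable def expandStratum (Ne : RelName) (Δ : Stratum dom) : Stratum dom :=
  Δ.flatMap fun r => (expandNeq Ne r.varBound r.body).map fun B => ⟨r.head, B⟩

theorem mem_expandStratum {Ne : RelName} {Δ : Stratum dom} {r' : Rule dom} :
    r' ∈ expandStratum Ne Δ ↔ ∃ r ∈ Δ, ∃ B ∈ expandNeq Ne r.varBound r.body, r' = ⟨r.head, B⟩ := by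
  simp [expandStratum, eq_comm]

theorem isHead_expandStratum {Ne : RelName} {Δ : Stratum dom} {R : RelName}
    (h : (expandStratum Ne Δ).IsHead R) : Δ.IsHead R := by
  obtain ⟨r', hr', rfl⟩ := h
  obtain ⟨r, hr, B, -, rfl⟩ := mem_expandStratum.1 hr'
  exact ⟨r, hr, rfl⟩

theorem neg_mem_expandNeq {Ne : RelName} {B : List (Literal dom)} {m : ℕ} {B' : List (Literal dom)}
    (hB' : B' ∈ expandNeq Ne m B) {A : Atom dom} (h : .neg A ∈ B') : ∃ Q, A = .pred Q ∧ .neg A ∈ B := by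
  rcases mem_expandNeq hB' h with ⟨h1, h2⟩ | ⟨e₁, e₂, m', -, o, ho, hLo, -⟩
  · cases A with
    | pred Q => exact ⟨Q, rfl, h1⟩
    | eqn e₁ e₂ => exact absurd rfl (h2 e₁ e₂)
  · obtain ⟨⟨A', h⟩, -⟩ := neqOptions_pos ho hLo
    simp at h

theorem exists_mem_expandNeq (Ne : RelName) (B : List (Literal dom)) (m : ℕ) :
    ∃ B', B' ∈ expandNeq Ne m B := by
  induction B generalizing m with
  | nil => exact ⟨[], List.mem_cons_self⟩
  | cons L B ih =>
    by_cases hL : ∃ e₁ e₂, L = .neg (.eqn e₁ e₂)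
    · obtain ⟨e₁, e₂, rfl⟩ := hL
      obtain ⟨B', hB'⟩ := ih (m + 3)
      exact ⟨_, List.mem_flatMap.2 ⟨_, List.mem_cons_self, List.mem_map.2 ⟨B', hB', rfl⟩⟩⟩
    · rw [expandNeq_cons (fun e₁ e₂ h => hL ⟨e₁, e₂, h⟩)]
      obtain ⟨B', hB'⟩ := ih m
      exact ⟨_, List.mem_map.2 ⟨B', hB', rfl⟩⟩

theorem inBody_expandNeq {Ne : RelName} {r : Rule dom} {m : ℕ} {B' : List (Literal dom)}
    (hB' : B' ∈ expandNeq Ne m r.body) {R : RelName} (h : (Rule.mk r.head B').InBody R) :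
    R = Ne ∨ r.InBody R := by
  obtain ⟨L, hL, Q, hQ, rfl⟩ := h
  rcases mem_expandNeq hB' hL with ⟨h1, -⟩ | ⟨e₁, e₂, m', -, o, ho, hLo, -⟩
  · exact Or.inr ⟨L, h1, Q, hQ, rfl⟩
  · exact Or.inl ((neqOptions_pos ho hLo).2.1 Q hQ)

theorem negFree_expandStratum {Ne : RelName} {Δ Δ' : Stratum dom} (h : NegFree Δ Δ') :
    NegFree (expandStratum Ne Δ) (expandStratum Ne Δ') := by
  intro r' hr' Q hQ hh
  obtain ⟨r, hr, B, hB, rfl⟩ := mem_expandStratum.1 hr'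
  obtain ⟨-, -, hA⟩ := neg_mem_expandNeq hB hQ
  exact h r hr Q hA (isHead_expandStratum hh)

/-- The facts `X` supply the pairs of distinct letters. Flatness and the bound `C` on letters
guarantee that every mismatch arising in the stratum is witnessed by one of these pairs; the bodies
of the original stratum do not see `X`. -/
theorem lfp_expandStratum {Ne : RelName} (hNe : Ne.arity = 1) {C : Set dom} {Δ : Stratum dom}
    (hn : NegFree Δ Δ) (hs : ∀ r ∈ Δ, r.Safe) (hp : ∀ r ∈ Δ, ¬ r.HasPacking)
    (hC : ∀ r ∈ Δ, r.consts ⊆ C) {K X : Set (Fact dom)}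
    (hKf : FlatFacts K) (hKC : ∀ f ∈ K, ∀ i, pathAtoms (f.args i) ⊆ C)
    (hNeΔ : ¬ Δ.IsHead Ne) (hKNe : ∀ f ∈ K, f.rel ≠ Ne)
    (hX : ∀ f ∈ X, ∀ r ∈ Δ, ¬ r.InBody f.rel)
    (hX₁ : ∀ a ∈ C, ∀ b ∈ C, a ≠ b → mkFact Ne [[Value.atom a, Value.atom b]] ∈ X)
    (hX₂ : ∀ a b, mkFact Ne [[Value.atom a, Value.atom b]] ∈ X → a ≠ b) :
    lfp (expandStratum Ne Δ) (K ∪ X) = lfp Δ K ∪ X := by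
  have hn' := negFree_expandStratum (Ne := Ne) hn
  -- Negated relations are no heads, so both fixpoints inherit them from their inputs, and `X`
  -- contains no fact of such a relation.
  have hneg : ∀ r ∈ Δ, ∀ Q, .neg (.pred Q) ∈ r.body → ∀ ν : Valuation dom,
      (Q.eval ν ∈ lfp (expandStratum Ne Δ) (K ∪ X) ↔ Q.eval ν ∈ lfp Δ K) := by
    intro r hr Q hQ ν
    have hh := hn r hr Q hQ
    constructor
    · intro h
      rcases lfp_agree h (fun h => hh (isHead_expandStratum h)) with h | h
      · exact subset_lfp _ _ h
      · exact absurd ⟨_, hQ, Q, rfl, rfl⟩ (hX _ h r hr)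
    · intro h
      exact subset_lfp _ _ (Or.inl (lfp_agree h hh))
  apply Set.Subset.antisymm
  · refine lfp_induction hn' (Set.union_subset_union_left _ (subset_lfp _ _)) ?_
    intro r' hr' ν hsat hpos
    obtain ⟨r, hr, B, hB, rfl⟩ := mem_expandStratum.1 hr'
    have hsat' := expandNeq_sound hNe (fun a b hab => by
      rcases lfp_agree hab (fun h => hNeΔ (isHead_expandStratum h)) with h | h
      · exact absurd rfl (hKNe _ h)
      · exact hX₂ a b h) hB hsat
    refine Or.inl (lfp_sat hn hr ν fun L hL => ?_)
    cases L with
    | pos A =>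
      cases A with
      | eqn e₁ e₂ => exact hsat' _ hL
      | pred Q =>
        rcases hpos Q (pos_mem_expandNeq hB hL) with h | h
        · exact h
        · exact absurd ⟨_, hL, Q, rfl, rfl⟩ (hX _ h r hr)
    | neg A =>
      cases A with
      | eqn e₁ e₂ => exact hsat' _ hL
      | pred Q => exact fun h => hsat' _ hL ((hneg r hr Q hL ν).2 h)
  · refine Set.union_subset ?_ fun f hf => subset_lfp _ _ (Or.inr hf)
    refine lfp_induction hn (fun f hf => subset_lfp _ _ (Or.inl hf)) ?_
    intro r hr ν hsat hpos
    have hflat := lfp_closed hn hs Path.Flat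
      (fun r hr e he ν => flat_eval (Rule.not_hasPacking_of_hasExpr (hp r hr) he))
      (fun e x hx ν => flat_get hx) hKf
    have hat := lfp_closed hn hs (fun p => pathAtoms p ⊆ C)
      (fun r hr e he ν => pathAtoms_eval ((Rule.consts_of_hasExpr he).trans (hC r hr)))
      (fun e x hx ν h => (pathAtoms_get hx ν).trans h) hKC
    have v1 := rule_vars_flat (hs r hr) (hp r hr) hsat hflat
    have v2 := rule_vars_atoms (hs r hr) (hC r hr) hsat hat
    obtain ⟨B, hB, ν', hag, hsat'⟩ := expandNeq_complete (K := lfp (expandStratum Ne Δ) (K ∪ X))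
      (m := r.varBound) (B := r.body) (ν := ν) hNe (C := C)
      (fun a ha b hb hab => subset_lfp _ _ (Or.inr (hX₁ a ha b hb hab)))
      (fun x hx => r.lt_varBound (Or.inr hx))
      (fun e₁ e₂ he => by
        have hpk : ∀ e, e = e₁ ∨ e = e₂ → ¬ e.HasPacking := fun e h hp' =>
          hp r hr (Or.inr ⟨_, he, by
            rcases h with rfl | rfl
            · exact Or.inl hp'
            · exact Or.inr hp'⟩)
        have hc : (Atom.eqn e₁ e₂).consts ⊆ C := (Rule.consts_of_body he).trans (hC r hr)
        refine ⟨flat_eval (hpk _ (Or.inl rfl)) fun x hx => v1 x (Or.inr ⟨_, he, Or.inl hx⟩),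
          flat_eval (hpk _ (Or.inr rfl)) fun x hx => v1 x (Or.inr ⟨_, he, Or.inr hx⟩),
          pathAtoms_eval (Set.subset_union_left.trans hc)
            fun x hx => v2 x (Or.inr ⟨_, he, Or.inl hx⟩),
          pathAtoms_eval (Set.subset_union_right.trans hc)
            fun x hx => v2 x (Or.inr ⟨_, he, Or.inr hx⟩)⟩)
      (fun L hL => by
        cases L with
        | pos A =>
          cases A with
          | eqn e₁ e₂ => exact hsat _ hL
          | pred Q => exact hpos Q hL
        | neg A =>
          cases A with
          | eqn e₁ e₂ => exact hsat _ hL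
          | pred Q => exact fun h => hsat _ hL ((hneg r hr Q hL ν).1 h))
    have := lfp_sat hn' (mem_expandStratum.2 ⟨r, hr, B, hB, rfl⟩) ν' hsat'
    rwa [r.head.eval_congr fun x hx => hag x (r.lt_varBound (Or.inl hx))] at this

/-- Rules collecting the atomic values of the input and the program, and the pairs `a·a`. -/
noncomputable def atomStratum (Γ : Schema) (C : Finset dom) (At Eq : RelName) : Stratum dom :=
  ((Γ.filter fun R => R.arity = 1).toList.map fun R =>
    ⟨mkPred At [.var (.atomic 0)], [.pos (.pred (mkPred R
      [.concat (.var (.path 0)) (.concat (.var (.atomic 0)) (.var (.path 1)))]))]⟩) ++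
  (C.toList.map fun c => ⟨mkPred At [.const c], []⟩) ++
  [⟨mkPred Eq [.concat (.var (.atomic 0)) (.var (.atomic 0))],
    [.pos (.pred (mkPred At [.var (.atomic 0)]))]⟩]

theorem mem_atomStratum {Γ : Schema} {C : Finset dom} {At Eq : RelName} {r : Rule dom} :
    r ∈ atomStratum Γ C At Eq ↔
      (∃ R ∈ Γ, R.arity = 1 ∧ r = ⟨mkPred At [.var (.atomic 0)], [.pos (.pred (mkPred R
        [.concat (.var (.path 0)) (.concat (.var (.atomic 0)) (.var (.path 1)))]))]⟩) ∨
      (∃ c ∈ C, r = ⟨mkPred At [.const c], []⟩) ∨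
      r = ⟨mkPred Eq [.concat (.var (.atomic 0)) (.var (.atomic 0))],
        [.pos (.pred (mkPred At [.var (.atomic 0)]))]⟩ := by
  simp [atomStratum, eq_comm, and_assoc, or_assoc]

/-- The rule collecting the pairs of distinct atomic values. -/
def distinctStratum (At Eq Ne : RelName) : Stratum dom :=
  [⟨mkPred Ne [.concat (.var (.atomic 0)) (.var (.atomic 1))],
    [.pos (.pred (mkPred At [.var (.atomic 0)])), .pos (.pred (mkPred At [.var (.atomic 1)])),
      .neg (.pred (mkPred Eq [.concat (.var (.atomic 0)) (.var (.atomic 1))]))]⟩]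

def factAtoms (I : Set (Fact dom)) : Set dom := ⋃ p ∈ argPaths I, pathAtoms p

theorem finite_factAtoms {I : Set (Fact dom)} (h : I.Finite) : (factAtoms I).Finite :=
  (finite_argPaths h).biUnion fun p _ => finite_pathAtoms p

def diagonalFacts (At Eq : RelName) (C : Set dom) : Set (Fact dom) :=
  (fun a => mkFact At [[Value.atom a]]) '' C ∪
    (fun a => mkFact Eq [[Value.atom a, Value.atom a]]) '' C

def distinctFacts (Ne : RelName) (C : Set dom) : Set (Fact dom) :=
  (fun ab : dom × dom => mkFact Ne [[Value.atom ab.1, Value.atom ab.2]]) ''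
    {ab | ab.1 ∈ C ∧ ab.2 ∈ C ∧ ab.1 ≠ ab.2}

theorem lfp_atomStratum {Γ : Schema} (hΓ : Γ.Monadic) (C : Finset dom) {At Eq : RelName}
    (hAt : At.arity = 1) (hEq : Eq.arity = 1) (hne : At ≠ Eq) (hAΓ : At ∉ Γ) (hEΓ : Eq ∉ Γ)
    {I : Set (Fact dom)} (hI : IsInstance Γ I) (hf : FlatFacts I) :
    lfp (atomStratum Γ C At Eq) I = I ∪ diagonalFacts At Eq (↑C ∪ factAtoms I) := by
  have hn : NegFree (atomStratum Γ C At Eq) (atomStratum Γ C At Eq) := by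
    intro r hr Q hQ
    rcases mem_atomStratum.1 hr with ⟨R, -, -, rfl⟩ | ⟨c, -, rfl⟩ | rfl <;> simp at hQ
  apply Set.Subset.antisymm
  · refine lfp_induction hn Set.subset_union_left ?_
    intro r hr ν hsat hpos
    rcases mem_atomStratum.1 hr with ⟨R, hR, hRa, rfl⟩ | ⟨c, hc, rfl⟩ | rfl
    · have h := hpos _ List.mem_cons_self
      rw [eval_mkPred] at h
      replace h := h.resolve_right (by
        rintro (⟨a, -, h⟩ | ⟨a, -, h⟩)
        · exact absurd (congrArg Fact.rel h) fun h => hAΓ ((show At = R from h) ▸ hR)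
        · exact absurd (congrArg Fact.rel h) fun h => hEΓ ((show Eq = R from h) ▸ hR))
      refine Or.inr (Or.inl ⟨ν.atomic 0, Or.inr ?_, by simp [eval_mkPred, PathExpr.eval]⟩)
      refine Set.mem_biUnion ⟨_, h, ?_⟩ (mem_pathAtoms_of_mem (p := ν.path 0 ++
        ([Value.atom (ν.atomic 0)] ++ ν.path 1)) (by simp))
      rw [list_mkFact (by simp [hRa])]
      simp [PathExpr.eval]
    · exact Or.inr (Or.inl ⟨c, Or.inl (Finset.mem_coe.2 hc), by simp [eval_mkPred, PathExpr.eval]⟩)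
    · have h := hpos _ List.mem_cons_self
      rw [eval_mkPred] at h
      have h : ν.atomic 0 ∈ (↑C ∪ factAtoms I : Set dom) := by
        rcases h with h | ⟨a, ha, h⟩ | ⟨a, -, h⟩
        · exact absurd (hI.2 _ h) hAΓ
        · have := (mkFact_one_inj hAt h).2
          simp only [PathExpr.eval, List.cons.injEq, Value.atom.injEq, and_true] at this
          exact this ▸ ha
        · exact absurd (congrArg Fact.rel h) fun h => hne h.symm
      exact Or.inr (Or.inr ⟨_, h, by simp [eval_mkPred, PathExpr.eval]⟩)
  · have hat : ∀ a ∈ (↑C ∪ factAtoms I : Set dom),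
        mkFact At [[Value.atom a]] ∈ lfp (atomStratum Γ C At Eq) I := by
      rintro a (ha | ha)
      · have := lfp_sat hn (mem_atomStratum.2 (Or.inr (Or.inl ⟨a, ha, rfl⟩)))
          ⟨fun _ => a, fun _ => []⟩ (I := I) (by simp)
        simpa [eval_mkPred, PathExpr.eval] using this
      · obtain ⟨p, ⟨f, hfI, hpf⟩, ha⟩ := Set.mem_iUnion₂.1 ha
        have hfl : p.Flat := forall_args.1 (hf f hfI) p hpf
        have har : f.rel.arity = 1 := by
          have h1 := hΓ _ (hI.2 f hfI)
          have h2 := List.length_pos_of_mem hpf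
          rw [length_list] at h2
          omega
        -- In a flat path every letter occurs at the top level, where the collecting rule can find
        -- it.
        obtain ⟨u, v, rfl⟩ : ∃ u v, p = u ++ Value.atom a :: v := by
          clear hpf
          induction p with
          | nil => simp [pathAtoms] at ha
          | cons w p ih =>
            obtain ⟨⟨b, rfl⟩, hp⟩ := Path.flat_cons.1 hfl
            rcases ha with ha | ha
            · simp only [Value.atoms, Set.mem_singleton_iff] at ha
              exact ⟨[], p, by simp [ha]⟩
            · obtain ⟨u, v, rfl⟩ := ih ha hp
              exact ⟨_ :: u, v, rfl⟩
        have := lfp_sat hn (mem_atomStratum.2 (Or.inl ⟨f.rel, hI.2 f hfI, har, rfl⟩))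
          ⟨fun _ => a, fun n => if n = 0 then u else v⟩ (I := I) (by
            simp only [List.mem_singleton, forall_eq, Literal.Sat, Atom.Sat, eval_mkPred]
            refine subset_lfp _ _ ?_
            convert hfI using 1
            refine fact_ext rfl ?_
            rw [list_mkFact (by simp [har])]
            obtain ⟨q, hq⟩ := List.length_eq_one_iff.1 ((length_list f).trans har)
            rw [hq] at hpf ⊢
            simpa [PathExpr.eval] using hpf)
        simpa [eval_mkPred, PathExpr.eval] using this
    refine Set.union_subset (subset_lfp _ _) (Set.union_subset ?_ ?_)
    · rintro _ ⟨a, ha, rfl⟩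
      exact hat a ha
    · rintro _ ⟨a, ha, rfl⟩
      have := lfp_sat hn (mem_atomStratum.2 (Or.inr (Or.inr rfl)))
        ⟨fun _ => a, fun _ => []⟩ (I := I) (by
          simpa [Literal.Sat, Atom.Sat, eval_mkPred, PathExpr.eval] using hat a ha)
      simpa [eval_mkPred, PathExpr.eval] using this

theorem lfp_distinctStratum {At Eq Ne : RelName} (hAt : At.arity = 1) (hEq : Eq.arity = 1)
    (hne : At ≠ Eq) (hne' : Ne ≠ At) (hne'' : Ne ≠ Eq) {C : Set dom}
    {I : Set (Fact dom)} (hI : ∀ f ∈ I, f.rel ≠ At ∧ f.rel ≠ Eq) :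
    lfp (distinctStratum At Eq Ne) (I ∪ diagonalFacts At Eq C) =
      I ∪ diagonalFacts At Eq C ∪ distinctFacts Ne C := by
  have hh : ∀ R, (distinctStratum At Eq Ne : Stratum dom).IsHead R → R = Ne := by
    rintro R ⟨r, hr, rfl⟩
    rw [List.mem_singleton.1 hr]
    rfl
  have hn : NegFree (distinctStratum At Eq Ne : Stratum dom) (distinctStratum At Eq Ne) := by
    intro r hr Q hQ h
    rw [List.mem_singleton.1 hr] at hQ
    simp only [List.mem_cons, List.not_mem_nil, or_false, reduceCtorEq, Literal.neg.injEq,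
      Atom.pred.injEq, false_or] at hQ
    rw [hQ] at h
    exact hne'' (hh _ h).symm
  have hAm : ∀ a, mkFact At [[Value.atom a]] ∈ lfp (distinctStratum At Eq Ne)
      (I ∪ diagonalFacts At Eq C) ↔ a ∈ C := by
    intro a
    constructor
    · intro h
      rcases lfp_agree h (fun h => hne' (hh _ h).symm) with h | ⟨b, hb, h⟩ | ⟨b, -, h⟩
      · exact absurd rfl (hI _ h).1
      · have := (mkFact_one_inj hAt h).2
        simp only [List.cons.injEq, Value.atom.injEq, and_true] at this
        exact this ▸ hb
      · exact absurd (congrArg Fact.rel h) fun h => hne h.symm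
    · exact fun h => subset_lfp _ _ (Or.inr (Or.inl ⟨a, h, rfl⟩))
  have hEm : ∀ a b, mkFact Eq [[Value.atom a, Value.atom b]] ∈ lfp (distinctStratum At Eq Ne)
      (I ∪ diagonalFacts At Eq C) ↔ a ∈ C ∧ a = b := by
    intro a b
    constructor
    · intro h
      rcases lfp_agree h (fun h => hne'' (hh _ h).symm) with h | ⟨c, hc, h⟩ | ⟨c, hc, h⟩
      · exact absurd rfl (hI _ h).2
      · exact absurd (congrArg Fact.rel h) fun h => hne h
      · have := (mkFact_one_inj hEq h).2
        simp only [List.cons.injEq, Value.atom.injEq, and_true] at this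
        exact ⟨this.1 ▸ hc, this.1.symm.trans this.2⟩
    · rintro ⟨h, rfl⟩
      exact subset_lfp _ _ (Or.inr (Or.inr ⟨a, h, rfl⟩))
  have hbody : ∀ ν : Valuation dom, (∀ L ∈ [Literal.pos (.pred (mkPred At [.var (.atomic 0)])),
      .pos (.pred (mkPred At [.var (.atomic 1)])),
      .neg (.pred (mkPred Eq [.concat (.var (.atomic 0)) (.var (.atomic 1))]))],
      L.Sat (lfp (distinctStratum At Eq Ne) (I ∪ diagonalFacts At Eq C)) ν) ↔
      ν.atomic 0 ∈ C ∧ ν.atomic 1 ∈ C ∧ ν.atomic 0 ≠ ν.atomic 1 := by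
    intro ν
    simp only [List.mem_cons, List.not_mem_nil, or_false, forall_eq_or_imp, forall_eq, Literal.Sat,
      Atom.Sat, eval_mkPred, List.map_cons, List.map_nil, PathExpr.eval, hAm, List.singleton_append,
      hEm]
    tauto
  apply Set.Subset.antisymm
  · refine lfp_induction hn Set.subset_union_left ?_
    intro r hr ν hsat hpos
    have hr := List.mem_singleton.1 hr
    subst hr
    exact Or.inr ⟨(ν.atomic 0, ν.atomic 1), (hbody ν).1 hsat, by simp [eval_mkPred, PathExpr.eval]⟩
  · refine Set.union_subset (subset_lfp _ _) ?_
    rintro _ ⟨⟨a, b⟩, ⟨ha, hb, hab⟩, rfl⟩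
    have := lfp_sat hn List.mem_cons_self ⟨fun n => if n = 0 then a else b, fun _ => []⟩
      ((hbody _).2 ⟨by simpa using ha, by simpa using hb, by simpa using hab⟩)
    simpa [eval_mkPred, PathExpr.eval] using this

theorem safe_atomStratum {Γ : Schema} {C : Finset dom} {At Eq : RelName} (hAt : At.arity = 1)
    (hEq : Eq.arity = 1) : ∀ r ∈ atomStratum Γ C At Eq, r.Safe := by
  intro r hr
  rcases mem_atomStratum.1 hr with ⟨R, -, hRa, rfl⟩ | ⟨c, -, rfl⟩ | rfl
  · apply safe_of_pos
    simp [Rule.vars, vars_mkPred_one, hAt, hRa, PathExpr.vars, Literal.atom, Atom.vars]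
  · simp [Rule.Safe, Rule.vars, vars_mkPred_one, hAt, PathExpr.vars]
  · apply safe_of_pos
    simp [Rule.vars, vars_mkPred_one, hAt, hEq, PathExpr.vars, Literal.atom, Atom.vars]

theorem safe_distinctStratum {At Eq Ne : RelName} (hAt : At.arity = 1) (hEq : Eq.arity = 1)
    (hNe : Ne.arity = 1) : ∀ r ∈ (distinctStratum At Eq Ne : Stratum dom), r.Safe := by
  intro r hr
  rw [List.mem_singleton.1 hr]
  apply safe_of_pos
  simp [Rule.vars, vars_mkPred_one, hAt, hEq, hNe, PathExpr.vars, Literal.atom, Atom.vars]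
  tauto

theorem lfp_flat {Δ : Stratum dom} (hn : NegFree Δ Δ) (hs : ∀ r ∈ Δ, r.Safe)
    (hp : ∀ r ∈ Δ, ¬ r.HasPacking) {I : Set (Fact dom)} (hI : FlatFacts I) : FlatFacts (lfp Δ I) :=
  lfp_closed hn hs Path.Flat
    (fun r hr e he ν => flat_eval (Rule.not_hasPacking_of_hasExpr (hp r hr) he))
    (fun e x hx ν => flat_get hx) hI

theorem lfp_atoms {C : Set dom} {Δ : Stratum dom} (hn : NegFree Δ Δ) (hs : ∀ r ∈ Δ, r.Safe)
    (hC : ∀ r ∈ Δ, r.consts ⊆ C) {I : Set (Fact dom)} (hI : ∀ f ∈ I, ∀ i, pathAtoms (f.args i) ⊆ C) :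
    ∀ f ∈ lfp Δ I, ∀ i, pathAtoms (f.args i) ⊆ C :=
  lfp_closed hn hs (fun p => pathAtoms p ⊆ C)
    (fun r hr e he ν => pathAtoms_eval ((Rule.consts_of_hasExpr he).trans (hC r hr)))
    (fun e x hx ν h => (pathAtoms_get hx ν).trans h) hI

theorem run_expandStratum {Ne : RelName} (hNe : Ne.arity = 1) {C : Set dom}
    {s : List (Stratum dom)} (hn : ∀ Δ ∈ s, NegFree Δ Δ) (hs : ∀ Δ ∈ s, ∀ r ∈ Δ, r.Safe)
    (hp : ∀ Δ ∈ s, ∀ r ∈ Δ, ¬ r.HasPacking) (hC : ∀ Δ ∈ s, ∀ r ∈ Δ, r.consts ⊆ C)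
    {K X : Set (Fact dom)} (hKf : FlatFacts K) (hKC : ∀ f ∈ K, ∀ i, pathAtoms (f.args i) ⊆ C)
    (hNes : ∀ Δ ∈ s, ¬ Δ.IsHead Ne) (hKNe : ∀ f ∈ K, f.rel ≠ Ne)
    (hX : ∀ f ∈ X, ∀ Δ ∈ s, ∀ r ∈ Δ, ¬ r.InBody f.rel)
    (hX₁ : ∀ a ∈ C, ∀ b ∈ C, a ≠ b → mkFact Ne [[Value.atom a, Value.atom b]] ∈ X)
    (hX₂ : ∀ a b, mkFact Ne [[Value.atom a, Value.atom b]] ∈ X → a ≠ b) :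
    run (s.map (expandStratum Ne)) (K ∪ X) = run s K ∪ X := by
  induction s generalizing K with
  | nil => rfl
  | cons Δ s ih =>
    have m : Δ ∈ Δ :: s := List.mem_cons_self
    simp only [List.map_cons, run]
    rw [lfp_expandStratum hNe (hn Δ m) (hs Δ m) (hp Δ m) (hC Δ m) hKf hKC (hNes Δ m) hKNe
      (fun f hf => hX f hf Δ m) hX₁ hX₂]
    refine ih (fun Δ' h => hn Δ' (List.mem_cons_of_mem _ h))
      (fun Δ' h => hs Δ' (List.mem_cons_of_mem _ h)) (fun Δ' h => hp Δ' (List.mem_cons_of_mem _ h))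
      (fun Δ' h => hC Δ' (List.mem_cons_of_mem _ h)) (lfp_flat (hn Δ m) (hs Δ m) (hp Δ m) hKf)
      (lfp_atoms (hn Δ m) (hs Δ m) (hC Δ m) hKC)
      (fun Δ' h => hNes Δ' (List.mem_cons_of_mem _ h)) (fun f hf he => ?_)
      (fun f hf Δ' h => hX f hf Δ' (List.mem_cons_of_mem _ h))
    exact hKNe f (lfp_agree hf (he ▸ hNes Δ m)) he

/-- Inequality of letters is the complement of the diagonal, and this complement costs a negated
predicate. That is no new feature, since a negated equation is already a use of negation. Positive
equations may be introduced, to be removed afterwards. -/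
theorem eliminate_negEq [Nonempty dom] {Γ : Schema} {S : RelName} (hΓ : Γ.Monadic)
    {Q : Query dom Γ S} {P : Program dom} (hP : P.Computes Q) (hPk : ¬ P.Uses .P) :
    ∃ P' : Program dom, P'.Computes Q ∧ ¬ P'.NegEq ∧ ¬ P'.Uses .P ∧
      (P'.Uses .N → P.Uses .N) ∧ (P'.Uses .R → P.Uses .R) := by
  -- Without a negated equation nothing must be done, and the negation in the auxiliary strata must
  -- not be introduced.
  by_cases hE : P.NegEq
  swap
  · exact ⟨P, hP, hE, hPk, id, id⟩
  obtain ⟨M, hM, hMΓ⟩ := P.exists_fresh (insert S Γ)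
  rw [Program.computes_iff] at hP
  obtain ⟨ho, hP⟩ := hP
  have hN : P.Uses .N := by
    obtain ⟨r, hr, e₁, e₂, h⟩ := hE
    exact ⟨r, hr, _, h⟩
  obtain ⟨At, hAt, hAti⟩ : ∃ R : RelName, R.arity = 1 ∧ R.id = M := ⟨⟨M, 1⟩, rfl, rfl⟩
  obtain ⟨Eq, hEq, hEqi⟩ : ∃ R : RelName, R.arity = 1 ∧ R.id = M + 1 := ⟨⟨M + 1, 1⟩, rfl, rfl⟩
  obtain ⟨Ne, hNe, hNei⟩ : ∃ R : RelName, R.arity = 1 ∧ R.id = M + 2 := ⟨⟨M + 2, 1⟩, rfl, rfl⟩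
  have hAE : At ≠ Eq := fun h => by rw [h] at hAti; omega
  have hNA : Ne ≠ At := fun h => by rw [h] at hNei; omega
  have hNE : Ne ≠ Eq := fun h => by rw [h] at hNei; omega
  have hnew : ∀ R, R = At ∨ R = Eq ∨ R = Ne → R ∉ P.names ∧ R ∉ insert S Γ := by
    intro R hR
    have : M ≤ R.id := by rcases hR with rfl | rfl | rfl <;> omega
    exact ⟨fun h => absurd (hM R h) (by omega), fun h => absurd (hMΓ R h) (by omega)⟩
  have hΓnew : ∀ R, R = At ∨ R = Eq ∨ R = Ne → R ∉ Γ := fun R hR h =>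
    (hnew R hR).2 (Finset.mem_insert_of_mem h)
  obtain ⟨c₀⟩ := ‹Nonempty dom›
  -- The extra letter makes `C₀` nonempty, so the letter relation is the head of some rule even for
  -- empty `Γ`, and thus IDB.
  let C₀ : Finset dom := (P.finite_consts.insert c₀).toFinset
  have hC₀ : P.consts ⊆ ↑C₀ := by simp [C₀]
  let A := atomStratum Γ C₀ At Eq
  let D : Stratum dom := distinctStratum At Eq Ne
  have hAhead : ∀ R, A.IsHead R → R = At ∨ R = Eq := by
    rintro R ⟨r, hr, rfl⟩
    rcases mem_atomStratum.1 hr with ⟨R, -, -, rfl⟩ | ⟨c, -, rfl⟩ | rfl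
    exacts [Or.inl rfl, Or.inl rfl, Or.inr rfl]
  have hDhead : ∀ R, D.IsHead R → R = Ne := by
    rintro R ⟨r, hr, rfl⟩
    rw [List.mem_singleton.1 hr]
    rfl
  have hAneg : ∀ r ∈ A, ∀ B, .neg B ∉ r.body := by
    intro r hr B hB
    rcases mem_atomStratum.1 hr with ⟨R, -, -, rfl⟩ | ⟨c, -, rfl⟩ | rfl <;> simp at hB
  have hDneg : ∀ r ∈ D, ∀ B, .neg B ∈ r.body →
      B = .pred (mkPred Eq [.concat (.var (.atomic 0)) (.var (.atomic 1))]) := by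
    intro r hr B hB
    rw [List.mem_singleton.1 hr] at hB
    simpa using hB
  have hAbody : ∀ r ∈ A, ∀ R, r.InBody R → R ∈ Γ ∨ R = At ∧ r.head.rel = Eq := by
    intro r hr R hR
    rcases mem_atomStratum.1 hr with ⟨R', hR', -, rfl⟩ | ⟨c, -, rfl⟩ | rfl <;>
      rw [inBody_iff] at hR
    · obtain ⟨L, hL, Q, hQ, rfl⟩ := hR
      rw [List.mem_singleton.1 hL] at hQ
      cases hQ
      exact Or.inl hR'
    · simp at hR
    · obtain ⟨L, hL, Q, hQ, rfl⟩ := hR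
      rw [List.mem_singleton.1 hL] at hQ
      cases hQ
      exact Or.inr ⟨rfl, rfl⟩
  have hDbody : ∀ r ∈ D, ∀ R, r.InBody R → R = At ∨ R = Eq := by
    intro r hr R hR
    rw [List.mem_singleton.1 hr, inBody_iff] at hR
    obtain ⟨L, hL, Q, hQ, rfl⟩ := hR
    simp only [List.mem_cons, List.not_mem_nil, or_false] at hL
    rcases hL with rfl | rfl | rfl <;> cases hQ
    exacts [Or.inl rfl, Or.inl rfl, Or.inr rfl]
  have hsP := (stratified_iff _).1 P.stratified
  have hPhead : ∀ Δ ∈ P.strata, ∀ R, Δ.IsHead R → R ∈ P.names := by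
    rintro Δ hΔ R ⟨r, hr, rfl⟩
    exact Or.inl ⟨r, ⟨Δ, hΔ, hr⟩, rfl⟩
  have hPbody : ∀ Δ ∈ P.strata, ∀ r ∈ Δ, ∀ R, r.InBody R → R ∈ P.names := fun Δ hΔ r hr R hR =>
    Or.inr ⟨r, ⟨Δ, hΔ, hr⟩, hR⟩
  let P' : Program dom :=
    { strata := A :: D :: P.strata.map (expandStratum Ne)
      safe := by
        intro Δ hΔ r hr
        rcases List.mem_cons.1 hΔ with rfl | hΔ
        · exact safe_atomStratum hAt hEq r hr
        rcases List.mem_cons.1 hΔ with rfl | hΔ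
        · exact safe_distinctStratum hAt hEq hNe r hr
        obtain ⟨Δ, hΔ', rfl⟩ := List.mem_map.1 hΔ
        obtain ⟨r, hr₀, B, hB, rfl⟩ := mem_expandStratum.1 hr
        exact expandNeq_safe hNe (P.safe Δ hΔ' r hr₀) hB
      stratified := by
        refine (stratified_iff _).2 ⟨?_, ?_⟩
        · intro Δ hΔ
          rcases List.mem_cons.1 hΔ with rfl | hΔ
          · exact fun r hr Q hQ => absurd hQ (hAneg r hr _)
          rcases List.mem_cons.1 hΔ with rfl | hΔ
          · intro r hr Q hQ h
            cases hDneg r hr _ hQ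
            exact hNE (hDhead _ h).symm
          obtain ⟨Δ, hΔ', rfl⟩ := List.mem_map.1 hΔ
          exact negFree_expandStratum (hsP.1 Δ hΔ')
        · refine List.pairwise_cons.2 ⟨fun Δ _ r hr Q hQ => absurd hQ (hAneg r hr _),
            List.pairwise_cons.2 ⟨fun Δ hΔ r hr Q hQ h => ?_, ?_⟩⟩
          · cases hDneg r hr _ hQ
            obtain ⟨Δ, hΔ', rfl⟩ := List.mem_map.1 hΔ
            exact (hnew Eq (by simp)).1 (hPhead Δ hΔ' _ (isHead_expandStratum h))
          · exact List.pairwise_map.2 (hsP.2.imp fun h => negFree_expandStratum h) }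
  have hrule : ∀ r', P'.HasRule r' → r' ∈ A ∨ r' ∈ D ∨ ∃ r, P.HasRule r ∧
      ∃ B ∈ expandNeq Ne r.varBound r.body, r' = ⟨r.head, B⟩ := by
    rintro r' ⟨Δ, hΔ, hr⟩
    rcases List.mem_cons.1 hΔ with rfl | hΔ
    · exact Or.inl hr
    rcases List.mem_cons.1 hΔ with rfl | hΔ
    · exact Or.inr (Or.inl hr)
    obtain ⟨Δ, hΔ', rfl⟩ := List.mem_map.1 hΔ
    obtain ⟨r, hr₀, B, hB, rfl⟩ := mem_expandStratum.1 hr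
    exact Or.inr (Or.inr ⟨r, ⟨Δ, hΔ', hr₀⟩, B, hB, rfl⟩)
  have hidb : ∀ R, P'.IsIDB R → (R = At ∨ R = Eq ∨ R = Ne) ∨ P.IsIDB R := by
    rintro R ⟨r', hr', rfl⟩
    rcases hrule r' hr' with h | h | ⟨r, hr, B, -, rfl⟩
    · exact Or.inl ((hAhead _ ⟨_, h, rfl⟩).imp id Or.inl)
    · exact Or.inl (Or.inr (Or.inr (hDhead _ ⟨_, h, rfl⟩)))
    · exact Or.inr ⟨r, hr, rfl⟩
  have hAtI : P'.IsIDB At := ⟨_, ⟨A, List.mem_cons_self,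
    mem_atomStratum.2 (Or.inr (Or.inl ⟨c₀, by simp [C₀], rfl⟩))⟩, rfl⟩
  have hEqI : P'.IsIDB Eq := ⟨_, ⟨A, List.mem_cons_self,
    mem_atomStratum.2 (Or.inr (Or.inr rfl))⟩, rfl⟩
  have hNeI : P'.IsIDB Ne := ⟨_, ⟨D, List.mem_cons_of_mem _ List.mem_cons_self,
    List.mem_cons_self⟩, rfl⟩
  have hPI : ∀ R, P.IsIDB R → P'.IsIDB R := by
    rintro R ⟨r, ⟨Δ, hΔ, hr⟩, rfl⟩
    obtain ⟨B, hB⟩ := exists_mem_expandNeq Ne r.body r.varBound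
    exact ⟨⟨r.head, B⟩, ⟨_, List.mem_cons_of_mem _ (List.mem_cons_of_mem _
      (List.mem_map.2 ⟨Δ, hΔ, rfl⟩)), mem_expandStratum.2 ⟨r, hr, B, hB, rfl⟩⟩, rfl⟩
  refine ⟨P', (P'.computes_iff Q).2 ⟨⟨?_, ?_⟩, fun I => ?_⟩, ?_, ?_, fun _ => hN, ?_⟩
  · rintro R ⟨⟨r', hr', hR⟩, hRI⟩
    rcases hrule r' hr' with h | h | ⟨r, hr, B, hB, rfl⟩
    · rcases hAbody r' h R hR with h | ⟨rfl, -⟩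
      · exact h
      · exact absurd hAtI hRI
    · rcases hDbody r' h R hR with rfl | rfl
      · exact absurd hAtI hRI
      · exact absurd hEqI hRI
    · rcases inBody_expandNeq hB hR with rfl | hR
      · exact absurd hNeI hRI
      · exact ho.1 R ⟨⟨r, hr, hR⟩, fun h => hRI (hPI R h)⟩
  · intro R hR
    rcases hidb R hR with h | h
    · exact hΓnew R h
    · exact ho.2 R h
  -- All letters that can ever occur: those of the program and those of the input.
  · let C : Set dom := ↑C₀ ∪ factAtoms I.1
    let X : Set (Fact dom) := diagonalFacts At Eq C ∪ distinctFacts Ne C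
    have hXrel : ∀ f ∈ X, f.rel = At ∨ f.rel = Eq ∨ f.rel = Ne := by
      rintro f ((⟨a, -, rfl⟩ | ⟨a, -, rfl⟩) | ⟨a, -, rfl⟩)
      exacts [Or.inl rfl, Or.inr (Or.inl rfl), Or.inr (Or.inr rfl)]
    have hCfin : C.Finite := C₀.finite_toSet.union (finite_factAtoms I.2.1.1)
    have hXfin : X.Finite := by
      refine ((hCfin.image _).union (hCfin.image _)).union (Set.Finite.image _ ?_)
      exact (hCfin.prod hCfin).subset fun ab h => ⟨h.1, h.2.1⟩
    have hrun : run P'.strata I.1 = run P.strata I.1 ∪ X := by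
      change run (P.strata.map (expandStratum Ne)) (lfp D (lfp A I.1)) = _
      rw [lfp_atomStratum hΓ C₀ hAt hEq hAE (hΓnew _ (by simp)) (hΓnew _ (by simp)) I.2.1 I.2.2,
        lfp_distinctStratum hAt hEq hAE hNA hNE (fun f hf => ⟨fun h =>
          hΓnew At (by simp) (h ▸ I.2.1.2 f hf), fun h => hΓnew Eq (by simp) (h ▸ I.2.1.2 f hf)⟩),
        Set.union_assoc]
      refine run_expandStratum hNe P.negFree P.safe
        (fun Δ hΔ r hr h => hPk ⟨r, ⟨Δ, hΔ, hr⟩, h⟩)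
        (fun Δ hΔ r hr => (Program.consts_of_rule ⟨Δ, hΔ, hr⟩).trans
          (hC₀.trans Set.subset_union_left)) I.2.2 ?_
        (fun Δ hΔ h => (hnew Ne (by simp)).1 (hPhead Δ hΔ _ h))
        (fun f hf h => hΓnew Ne (by simp) (h ▸ I.2.1.2 f hf))
        (fun f hf Δ hΔ r hr h => (hnew _ (hXrel f hf)).1 (hPbody Δ hΔ r hr _ h))
        (fun a ha b hb hab => Or.inr ⟨(a, b), ⟨ha, hb, hab⟩, rfl⟩) ?_
      · intro f hf i a ha
        refine Or.inr (Set.mem_biUnion ⟨f, hf, ?_⟩ ha)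
        simp [Fact.list]
      · rintro a b ((⟨c, -, h⟩ | ⟨c, -, h⟩) | ⟨⟨c, d⟩, ⟨-, -, hcd⟩, h⟩)
        · exact absurd (congrArg Fact.rel h) fun h => hNA h.symm
        · exact absurd (congrArg Fact.rel h) fun h => hNE h.symm
        · have := (mkFact_one_inj hNe h).2
          simp only [List.cons.injEq, Value.atom.injEq, and_true] at this
          rw [← this.1, ← this.2]
          exact hcd
    rw [hrun]
    refine ⟨(hP I).1.union hXfin, ?_⟩
    rw [← (hP I).2]
    ext f
    constructor
    · rintro ⟨hf | hf, hS⟩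
      · exact ⟨hf, hS⟩
      · exact absurd (Finset.mem_insert_self S Γ) (hS ▸ (hnew _ (hXrel f hf)).2)
    · rintro ⟨hf, hS⟩
      exact ⟨Or.inl hf, hS⟩
  · rintro ⟨r', hr', e₁, e₂, he⟩
    rcases hrule r' hr' with h | h | ⟨r, hr, B, hB, rfl⟩
    · exact hAneg r' h _ he
    · simpa using hDneg r' h _ he
    · obtain ⟨Q, hQ, -⟩ := neg_mem_expandNeq hB he
      simp at hQ
  · rintro ⟨r', hr', h⟩
    have hone : ∀ (R : RelName) (e : PathExpr dom), (mkPred R [e]).HasPacking → e.HasPacking := by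
      intro R e h
      obtain ⟨e', he', h⟩ := hasPacking_mkPred h
      rwa [List.mem_singleton.1 he'] at h
    rcases hrule r' hr' with hA | hD | ⟨r, hr, B, hB, rfl⟩
    · rcases mem_atomStratum.1 hA with ⟨R, -, -, rfl⟩ | ⟨c, -, rfl⟩ | rfl <;>
        rcases h with h | ⟨L, hL, h⟩
      all_goals first
        | exact absurd (hone _ _ h) (by simp [PathExpr.HasPacking])
        | (rw [List.mem_singleton.1 hL] at h
           exact absurd (hone _ _ h) (by simp [PathExpr.HasPacking]))
        | exact absurd hL List.not_mem_nil
    · rw [List.mem_singleton.1 hD] at h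
      rcases h with h | ⟨L, hL, h⟩
      · exact absurd (hone _ _ h) (by simp [PathExpr.HasPacking])
      · simp only [List.mem_cons, List.not_mem_nil, or_false] at hL
        rcases hL with rfl | rfl | rfl <;> exact absurd (hone _ _ h) (by simp [PathExpr.HasPacking])
    · rcases h with h | ⟨L, hL, h⟩
      · exact hPk ⟨r, hr, Or.inl h⟩
      · rcases mem_expandNeq hB hL with ⟨h1, -⟩ | ⟨e₁, e₂, m', he, o, ho', hLo, -⟩
        · exact hPk ⟨r, hr, Or.inr ⟨L, h1, h⟩⟩
        · exact hPk ⟨r, hr, Or.inr ⟨_, he, (neqOptions_pos ho' hLo).2.2 h⟩⟩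
  · intro hR
    by_contra hR'
    obtain ⟨rk, hrk⟩ := P.exists_rank hR'
    -- The letters, the diagonal and its complement take ranks 0, 1 and 2; the old names are moved
    -- above them.
    refine P'.not_uses_R_of_rank (fun R => if R = At then 0 else if R = Eq then 1 else
      if R = Ne then 2 else rk R + 3) ?_ hR
    rintro R₁ R₂ ⟨hi, r', hr', rfl, hb⟩
    have hold : ∀ R, R ∈ P.names ∨ R ∈ Γ → R ≠ At ∧ R ≠ Eq ∧ R ≠ Ne := by
      intro R h
      have h' : ¬ (R = At ∨ R = Eq ∨ R = Ne) := fun hR => h.elim (hnew R hR).1 (hΓnew R hR)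
      simpa only [not_or] using h'
    have hΓI : ∀ R ∈ Γ, ¬ P'.IsIDB R := by
      intro R hR hI
      rcases hidb R hI with h | h
      · exact hΓnew R h hR
      · exact ho.2 R h hR
    rcases hrule r' hr' with hA | hD | ⟨r, hr, B, hB, rfl⟩
    · rcases hAbody r' hA _ hb with h | ⟨rfl, h⟩
      · exact absurd hi (hΓI _ h)
      · simp [h, hAE.symm]
    · have hh : r'.head.rel = Ne := hDhead _ ⟨r', hD, rfl⟩
      rcases hDbody r' hD _ hb with rfl | rfl
      · simp [hh, hNA, hNE]
      · simp [hh, hNA, hNE, hAE.symm]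
    · have hh := hold r.head.rel (Or.inl (Or.inl ⟨r, hr, rfl⟩))
      simp only [hh, if_false]
      rcases inBody_expandNeq hB hb with rfl | hb
      · simp [hNA, hNE]
      · have h2 := hold R₂ (Or.inl (Or.inr ⟨r, hr, hb⟩))
        simp only [h2, if_false]
        have hI : P.IsIDB R₂ := (hidb R₂ hi).resolve_left fun h => by
          rcases h with h | h | h
          exacts [h2.1 h, h2.2.1 h, h2.2.2 h]
        have := hrk _ _ ⟨hI, r, hr, rfl, hb⟩
        omega

/-! ### Bracket shapes of paths -/

-- `inl true` is an opening bracket and `inl false` a closing one.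
mutual
def Value.tokens : Value dom → List (Bool ⊕ Value dom)
  | .atom a => [.inr (.atom a)]
  | .packed p => .inl true :: (pathTokens p ++ [.inl false])
/-- The sequence of atomic values and brackets that spells out a path. -/
def pathTokens : List (Value dom) → List (Bool ⊕ Value dom)
  | [] => []
  | v :: p => v.tokens ++ pathTokens p
end

theorem pathTokens_append (p q : Path dom) : pathTokens (p ++ q) = pathTokens p ++ pathTokens q := by
  induction p with
  | nil => rfl
  | cons v p ih => simp [pathTokens, ih]

theorem pathTokens_atom (a : dom) (p : Path dom) :
    pathTokens (.atom a :: p) = .inr (.atom a) :: pathTokens p := by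
  simp [pathTokens, Value.tokens]

theorem pathTokens_packed (q p : Path dom) :
    pathTokens (.packed q :: p) = .inl true :: (pathTokens q ++ .inl false :: pathTokens p) := by
  simp [pathTokens, Value.tokens]

theorem pathTokens_flat {p : Path dom} (h : p.Flat) : pathTokens p = p.map .inr := by
  induction p with
  | nil => rfl
  | cons v p ih =>
    obtain ⟨⟨a, rfl⟩, hp⟩ := Path.flat_cons.1 h
    rw [pathTokens_atom, ih hp]
    rfl

/-- The statement is strengthened to sequences with remainders. A remainder is empty or begins with
a closing bracket, so the end of the path can be recognized from the next token. -/
theorem pathTokens_inj_aux (p : Path dom) : ∀ (q : Path dom) (s t : List (Bool ⊕ Value dom)),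
    s.head? = none ∨ s.head? = some (.inl false) → t.head? = none ∨ t.head? = some (.inl false) →
    pathTokens p ++ s = pathTokens q ++ t → p = q ∧ s = t := by
  induction p using path_induction with
  | nil =>
    intro q s t hs ht h
    cases q with
    | nil => exact ⟨rfl, by simpa [pathTokens] using h⟩
    | cons v q =>
      cases v with
      | atom a => rw [pathTokens_atom] at h; simp [pathTokens] at h; simp [h] at hs
      | packed q' => rw [pathTokens_packed] at h; simp [pathTokens] at h; simp [h] at hs
  | atom a p ih =>
    intro q s t hs ht h
    rw [pathTokens_atom] at h
    cases q with
    | nil => simp [pathTokens] at h; simp [← h] at ht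
    | cons v q =>
      cases v with
      | atom b =>
        rw [pathTokens_atom] at h
        simp only [List.cons_append, List.cons.injEq, Sum.inr.injEq, Value.atom.injEq] at h
        obtain ⟨rfl, rfl⟩ := ih q s t hs ht h.2
        exact ⟨by rw [h.1], rfl⟩
      | packed q' => rw [pathTokens_packed] at h; simp at h
  | packed q' p ihq ihp =>
    intro q s t hs ht h
    rw [pathTokens_packed] at h
    cases q with
    | nil => simp [pathTokens] at h; simp [← h] at ht
    | cons v q =>
      cases v with
      | atom b => rw [pathTokens_atom] at h; simp at h
      | packed q'' =>
        rw [pathTokens_packed] at h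
        simp only [List.cons_append, List.append_assoc, List.cons.injEq, true_and] at h
        obtain ⟨rfl, h'⟩ := ihq _ _ _ (Or.inr rfl) (Or.inr rfl) h
        simp only [List.cons.injEq, true_and] at h'
        obtain ⟨rfl, rfl⟩ := ihp q s t hs ht h'
        exact ⟨rfl, rfl⟩

theorem pathTokens_injective : Function.Injective (pathTokens : Path dom → _) := fun p q h =>
  (pathTokens_inj_aux p q [] [] (Or.inl rfl) (Or.inl rfl) (by rw [h])).1

section Split

variable {α β : Type*}

def splitShape : List (Bool ⊕ α) → List Bool
  | [] => []
  | .inl b :: t => b :: splitShape t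
  | .inr _ :: t => splitShape t

/-- The segments between the brackets. -/
def splitComps : List (Bool ⊕ α) → List (List α)
  | [] => [[]]
  | .inl _ :: t => [] :: splitComps t
  | .inr x :: t => (x :: (splitComps t).headD []) :: (splitComps t).tail

/-- Inverse to splitting when there is exactly one more segment than brackets; missing segments
count as empty and surplus ones are ignored. -/
def assemble : List Bool → List (List α) → List (Bool ⊕ α)
  | [], cs => (cs.headD []).map .inr
  | b :: bs, cs => (cs.headD []).map .inr ++ .inl b :: assemble bs cs.tail

theorem length_splitComps (t : List (Bool ⊕ α)) :
    (splitComps t).length = (splitShape t).length + 1 := by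
  induction t with
  | nil => rfl
  | cons x t ih =>
    rcases x with b | x
    · simp [splitComps, splitShape, ih]
    · simp [splitComps, splitShape, ih]

theorem assemble_split (t : List (Bool ⊕ α)) : assemble (splitShape t) (splitComps t) = t := by
  induction t with
  | nil => rfl
  | cons x t ih =>
    rcases x with b | x
    · simp [splitComps, splitShape, assemble, ih]
    · obtain ⟨c, cs, hc⟩ := List.exists_cons_of_length_eq_add_one (length_splitComps t)
      rw [hc] at ih
      simp only [splitComps, splitShape, hc]
      cases hs : splitShape t with
      | nil =>
        rw [hs] at ih
        simpa [assemble] using ih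
      | cons b bs =>
        rw [hs] at ih
        simpa [assemble] using ih

theorem assemble_append {bs : List Bool} {cs : List (List α)} (h : cs.length = bs.length + 1)
    (b : Bool) (bs' : List Bool) (cs' : List (List α)) :
    assemble (bs ++ b :: bs') (cs ++ cs') = assemble bs cs ++ .inl b :: assemble bs' cs' := by
  induction bs generalizing cs with
  | nil =>
    obtain ⟨c, rfl⟩ := List.length_eq_one_iff.1 h
    simp [assemble]
  | cons b' bs ih =>
    obtain ⟨c, cs, rfl⟩ := List.exists_cons_of_length_eq_add_one h
    simp only [List.length_cons, Nat.add_right_cancel_iff] at h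
    simp [assemble, ih h]

theorem splitShape_append (s t : List (Bool ⊕ α)) :
    splitShape (s ++ t) = splitShape s ++ splitShape t := by
  induction s with
  | nil => rfl
  | cons x s ih => rcases x with b | x <;> simp [splitShape, ih]

theorem mem_assemble {bs : List Bool} {cs : List (List α)} (h : cs.length = bs.length + 1) {x : α} :
    .inr x ∈ assemble bs cs ↔ ∃ c ∈ cs, x ∈ c := by
  induction bs generalizing cs with
  | nil =>
    obtain ⟨c, rfl⟩ := List.length_eq_one_iff.1 h
    simp [assemble]
  | cons b bs ih =>
    obtain ⟨c, cs, rfl⟩ := List.exists_cons_of_length_eq_add_one h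
    simp only [List.length_cons, Nat.add_right_cancel_iff] at h
    simp [assemble, ih h]

theorem mem_splitComps {t : List (Bool ⊕ α)} {x : α} :
    (∃ c ∈ splitComps t, x ∈ c) ↔ .inr x ∈ t := by
  rw [← mem_assemble (length_splitComps t), assemble_split]

/-- Substitute the letters of a token sequence. -/
def mapTokens (f : α → List β) (t : List (Bool ⊕ α)) : List (Bool ⊕ β) :=
  t.flatMap fun x => match x with
    | .inl b => [.inl b]
    | .inr x => (f x).map .inr

theorem mapTokens_append (f : α → List β) (s t : List (Bool ⊕ α)) :
    mapTokens f (s ++ t) = mapTokens f s ++ mapTokens f t := by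
  simp [mapTokens]

/-- Substituting for letters leaves the brackets in place and acts on each segment separately. -/
theorem mapTokens_assemble (f : α → List β) (bs : List Bool) (cs : List (List α)) :
    mapTokens f (assemble bs cs) = assemble bs (cs.map fun c => c.flatMap f) := by
  have hc : ∀ c : List α, mapTokens f (c.map .inr) = (c.flatMap f).map .inr := by
    intro c
    induction c with
    | nil => rfl
    | cons x c ih => simp only [mapTokens] at ih; simp [mapTokens, ih]
  have hh : ∀ cs : List (List α), (cs.map fun c => c.flatMap f).headD [] =
      (cs.headD []).flatMap f := by
    intro cs
    cases cs <;> simp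
  induction bs generalizing cs with
  | nil => simp only [assemble, hc, hh]
  | cons b bs ih =>
    simp only [assemble, mapTokens_append, hc, hh]
    rw [← List.map_tail, ← ih]
    simp [mapTokens]

theorem splitShape_assemble {bs : List Bool} {cs : List (List α)} :
    splitShape (assemble bs cs) = bs := by
  have hc : ∀ (c : List α) (t : List (Bool ⊕ α)), splitShape (c.map .inr ++ t) = splitShape t := by
    intro c t
    induction c with
    | nil => rfl
    | cons x c ih => simpa [splitShape] using ih
  induction bs generalizing cs with
  | nil => simpa [assemble, splitShape] using hc (cs.headD []) []
  | cons b bs ih => simp [assemble, hc, splitShape, ih]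

theorem splitComps_assemble {bs : List Bool} {cs : List (List α)} (h : cs.length = bs.length + 1) :
    splitComps (assemble bs cs) = cs := by
  have hc : ∀ (c : List α) (t : List (Bool ⊕ α)), splitComps (c.map .inr ++ t) =
      (c ++ (splitComps t).headD []) :: (splitComps t).tail := by
    intro c t
    induction c with
    | nil =>
      obtain ⟨d, ds, hd⟩ := List.exists_cons_of_length_eq_add_one (length_splitComps t)
      simp [hd]
    | cons x c ih => simp [splitComps, ih]
  induction bs generalizing cs with
  | nil =>
    obtain ⟨c, rfl⟩ := List.length_eq_one_iff.1 h
    simpa [assemble, splitComps] using hc c []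
  | cons b bs ih =>
    obtain ⟨c, cs, rfl⟩ := List.exists_cons_of_length_eq_add_one h
    simp only [List.length_cons, Nat.add_right_cancel_iff] at h
    simp [assemble, hc, splitComps, ih h]

theorem splitShape_mapTokens (f : α → List β) (t : List (Bool ⊕ α)) :
    splitShape (mapTokens f t) = splitShape t := by
  conv_lhs => rw [← assemble_split t]
  rw [mapTokens_assemble, splitShape_assemble]

theorem splitComps_mapTokens (f : α → List β) (t : List (Bool ⊕ α)) :
    splitComps (mapTokens f t) = (splitComps t).map fun c => c.flatMap f := by
  conv_lhs => rw [← assemble_split t]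
  rw [mapTokens_assemble, splitComps_assemble (by simp [length_splitComps])]

end Split

/-- The bracket word of a path. Together with the flat segments between the brackets it determines
the path, see `path_ext`. -/
def pathShape (p : Path dom) : List Bool := splitShape (pathTokens p)

def pathComps (p : Path dom) : List (Path dom) := splitComps (pathTokens p)

theorem length_pathComps (p : Path dom) : (pathComps p).length = (pathShape p).length + 1 :=
  length_splitComps _

theorem path_ext {p q : Path dom} (h : pathShape p = pathShape q) (h' : pathComps p = pathComps q) :
    p = q := by
  apply pathTokens_injective
  rw [← assemble_split (pathTokens p), ← assemble_split (pathTokens q)]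
  exact congrArg₂ _ h h'

/-- Each packed value contributes two brackets, so a bound on packed values leaves finitely many
shapes. -/
theorem length_pathShape (p : Path dom) : (pathShape p).length = 2 * pathPacks p := by
  induction p using path_induction with
  | nil => rfl
  | atom a p ih =>
    simp only [pathShape, pathTokens_atom, splitShape, pathPacks, Value.packs] at ih ⊢
    omega
  | packed q p ihq ihp =>
    simp only [pathShape, pathTokens_packed, splitShape, splitShape_append, pathPacks, Value.packs,
      List.length_cons, List.length_append] at ihq ihp ⊢
    omega

theorem pathShape_eq_nil {p : Path dom} : pathShape p = [] ↔ p.Flat := by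
  rw [← pathPacks_eq_zero, ← List.length_eq_zero_iff, length_pathShape]
  omega

theorem pathComps_of_flat {p : Path dom} (h : p.Flat) : pathComps p = [p] := by
  have := splitComps_assemble (bs := []) (cs := [p]) rfl
  rw [pathComps, pathTokens_flat h]
  simpa [assemble] using this

theorem flat_pathComps (p : Path dom) : ∀ c ∈ pathComps p, c.Flat := by
  have h : ∀ v, .inr v ∈ pathTokens p → ∃ a, v = Value.atom a := by
    induction p using path_induction with
    | nil => simp [pathTokens]
    | atom a p ih =>
      intro v hv
      rw [pathTokens_atom] at hv
      rcases List.mem_cons.1 hv with h | h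
      · exact ⟨a, by simpa using h⟩
      · exact ih v h
    | packed q p ihq ihp =>
      intro v hv
      rw [pathTokens_packed] at hv
      simp only [List.mem_cons, reduceCtorEq, List.mem_append, false_or] at hv
      exact hv.elim (ihq v) (ihp v)
  exact fun c hc v hv => h v (mem_splitComps.1 ⟨c, hc, hv⟩)

/-- The segments of a path can be replaced by arbitrary flat paths. -/
theorem exists_pathTokens_eq (p : Path dom) : ∀ cs : List (Path dom), (∀ c ∈ cs, c.Flat) →
    cs.length = (pathShape p).length + 1 → ∃ p', pathTokens p' = assemble (pathShape p) cs := by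
  induction p using path_induction with
  | nil =>
    intro cs hf hl
    obtain ⟨c, rfl⟩ := List.length_eq_one_iff.1 hl
    exact ⟨c, by simpa [pathShape, pathTokens, splitShape, assemble] using
      pathTokens_flat (hf c (by simp))⟩
  | atom a p ih =>
    intro cs hf hl
    have : pathShape (.atom a :: p) = pathShape p := by simp [pathShape, pathTokens_atom, splitShape]
    rw [this] at hl ⊢
    exact ih cs hf hl
  | packed q p ihq ihp =>
    intro cs hf hl
    have : pathShape (.packed q :: p) = true :: (pathShape q ++ false :: pathShape p) := by
      simp [pathShape, pathTokens_packed, splitShape, splitShape_append]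
    rw [this] at hl ⊢
    simp only [List.length_cons, List.length_append] at hl
    obtain ⟨c, cs, rfl⟩ := List.exists_cons_of_length_eq_add_one hl
    simp only [List.length_cons, Nat.add_right_cancel_iff] at hl
    obtain ⟨q', hq'⟩ := ihq (cs.take ((pathShape q).length + 1))
      (fun c hc => hf c (List.mem_cons_of_mem _ (List.mem_of_mem_take hc)))
      (by rw [List.length_take]; omega)
    obtain ⟨p', hp'⟩ := ihp (cs.drop ((pathShape q).length + 1))
      (fun c hc => hf c (List.mem_cons_of_mem _ (List.mem_of_mem_drop hc)))
      (by rw [List.length_drop]; omega)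
    refine ⟨c ++ .packed q' :: p', ?_⟩
    rw [pathTokens_append, pathTokens_flat (hf c (by simp)), pathTokens_packed, hq', hp',
      ← assemble_append (by rw [List.length_take]; omega), List.take_append_drop]
    simp [assemble]

/-! ### Splitting expressions -/

/-- The tokens of an expression when the path variable `n` has the bracket shape `σ n`. -/
def exprTokens (σ : ℕ → List Bool) : PathExpr dom → List (Bool ⊕ PathExpr dom)
  | .const a => [.inr (.const a)]
  | .var (.atomic n) => [.inr (.var (.atomic n))]
  | .var (.path n) => assemble (σ n) ((List.range ((σ n).length + 1)).map fun i =>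
      [.var (.path (Nat.pair n i))])
  | .pack e => .inl true :: (exprTokens σ e ++ [.inl false])
  | .empty => []
  | .concat e₁ e₂ => exprTokens σ e₁ ++ exprTokens σ e₂

def concatExprs : List (PathExpr dom) → PathExpr dom
  | [] => .empty
  | e :: l => .concat e (concatExprs l)

theorem eval_concatExprs (ν : Valuation dom) (l : List (PathExpr dom)) :
    (concatExprs l).eval ν = l.flatMap (·.eval ν) := by
  induction l with
  | nil => rfl
  | cons e l ih => simp [concatExprs, PathExpr.eval, ih]

theorem vars_concatExprs (l : List (PathExpr dom)) (x : Var) :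
    x ∈ (concatExprs l).vars ↔ ∃ e ∈ l, x ∈ e.vars := by
  induction l with
  | nil => simp [concatExprs, PathExpr.vars]
  | cons e l ih => simp [concatExprs, PathExpr.vars, ih]

theorem hasPacking_concatExprs {l : List (PathExpr dom)} (h : (concatExprs l).HasPacking) :
    ∃ e ∈ l, e.HasPacking := by
  induction l with
  | nil => simp [concatExprs, PathExpr.HasPacking] at h
  | cons e l ih =>
    rcases h with h | h
    · exact ⟨e, List.mem_cons_self, h⟩
    · obtain ⟨e', he', h⟩ := ih h
      exact ⟨e', List.mem_cons_of_mem _ he', h⟩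

def exprShape (σ : ℕ → List Bool) (e : PathExpr dom) : List Bool := splitShape (exprTokens σ e)

def exprComps (σ : ℕ → List Bool) (e : PathExpr dom) : List (PathExpr dom) :=
  (splitComps (exprTokens σ e)).map concatExprs

/-- `ν'` assigns to the segment variables the segments of the values of `ν`. -/
def SplitMatch (σ : ℕ → List Bool) (ν ν' : Valuation dom) : Var → Prop
  | .atomic n => ν.atomic n = ν'.atomic n
  | .path n => pathTokens (ν.path n) = assemble (σ n)
      ((List.range ((σ n).length + 1)).map fun i => ν'.path (Nat.pair n i))

/-- Spelling out commutes with evaluation: the tokens of a value arise from those of the expression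
by inserting the segments of its variables. Shapes and segments of values can hence be read off
syntactically. -/
theorem pathTokens_eval {σ : ℕ → List Bool} {ν ν' : Valuation dom} {e : PathExpr dom}
    (h : ∀ x ∈ e.vars, SplitMatch σ ν ν' x) :
    pathTokens (e.eval ν) = mapTokens (·.eval ν') (exprTokens σ e) := by
  induction e with
  | const a => simp [PathExpr.eval, exprTokens, pathTokens, Value.tokens, mapTokens]
  | var x =>
    have := h x rfl
    cases x with
    | atomic n =>
      simp only [SplitMatch] at this
      simp [PathExpr.eval, exprTokens, pathTokens, Value.tokens, mapTokens, this]
    | path n =>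
      simp only [SplitMatch] at this
      simp only [exprTokens, mapTokens_assemble, List.map_map, PathExpr.eval, this]
      congr 1
      refine List.map_congr_left fun i _ => ?_
      simp [PathExpr.eval]
  | pack e ih =>
    simp only [PathExpr.eval, pathTokens_packed, ih h, exprTokens]
    simp [mapTokens, pathTokens]
  | empty => rfl
  | concat e₁ e₂ ih₁ ih₂ =>
    simp only [PathExpr.eval, pathTokens_append, exprTokens, mapTokens_append]
    rw [ih₁ fun x hx => h x (Or.inl hx), ih₂ fun x hx => h x (Or.inr hx)]

theorem pathShape_eval {σ : ℕ → List Bool} {ν ν' : Valuation dom} {e : PathExpr dom}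
    (h : ∀ x ∈ e.vars, SplitMatch σ ν ν' x) : pathShape (e.eval ν) = exprShape σ e := by
  rw [pathShape, pathTokens_eval h, splitShape_mapTokens, exprShape]

theorem pathComps_eval {σ : ℕ → List Bool} {ν ν' : Valuation dom} {e : PathExpr dom}
    (h : ∀ x ∈ e.vars, SplitMatch σ ν ν' x) :
    pathComps (e.eval ν) = (exprComps σ e).map (·.eval ν') := by
  rw [pathComps, pathTokens_eval h, splitComps_mapTokens, exprComps, List.map_map]
  exact List.map_congr_left fun c _ => (eval_concatExprs ν' c).symm

theorem length_exprComps (σ : ℕ → List Bool) (e : PathExpr dom) :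
    (exprComps σ e).length = (exprShape σ e).length + 1 := by
  rw [exprComps, List.length_map, length_splitComps, exprShape]

/-- The variables for the segments of the value of a variable. -/
def segmentVars (σ : ℕ → List Bool) : Var → Set Var
  | .atomic n => {.atomic n}
  | .path n => {x | ∃ i ≤ (σ n).length, x = .path (Nat.pair n i)}

theorem mem_vars_exprComps {σ : ℕ → List Bool} {e : PathExpr dom} {x : Var} :
    (∃ c ∈ exprComps σ e, x ∈ c.vars) ↔ ∃ y ∈ e.vars, x ∈ segmentVars σ y := by
  have h1 : (∃ c ∈ exprComps σ e, x ∈ c.vars) ↔ ∃ l, .inr l ∈ exprTokens σ e ∧ x ∈ l.vars := by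
    simp only [exprComps, List.mem_map, exists_exists_and_eq_and, vars_concatExprs,
      ← mem_splitComps]
    constructor
    · rintro ⟨c, hc, l, hl, hx⟩
      exact ⟨l, ⟨c, hc, hl⟩, hx⟩
    · rintro ⟨l, ⟨c, hc, hl⟩, hx⟩
      exact ⟨c, hc, l, hl, hx⟩
  rw [h1]
  clear h1
  induction e with
  | const a => simp [exprTokens, PathExpr.vars]
  | var y =>
    cases y with
    | atomic n => simp [exprTokens, PathExpr.vars, segmentVars]
    | path n =>
      simp only [exprTokens, PathExpr.vars, Set.mem_singleton_iff, exists_eq_left, segmentVars]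
      simp only [mem_assemble (α := PathExpr dom) (bs := σ n)
        (cs := (List.range ((σ n).length + 1)).map fun i => [.var (.path (Nat.pair n i))])
        (by simp)]
      simp [PathExpr.vars, Nat.lt_succ_iff]
  | pack e ih => simpa [exprTokens, PathExpr.vars] using ih
  | empty => simp [exprTokens, PathExpr.vars]
  | concat e₁ e₂ ih₁ ih₂ =>
    simp only [exprTokens, PathExpr.vars, List.mem_append, Set.mem_union, or_and_right, exists_or,
      ih₁, ih₂]

theorem not_hasPacking_exprComps (σ : ℕ → List Bool) (e : PathExpr dom) :
    ∀ c ∈ exprComps σ e, ¬ c.HasPacking := by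
  have h1 : ∀ l, .inr l ∈ exprTokens σ e → ¬ l.HasPacking := by
    induction e with
    | const a => simp [exprTokens, PathExpr.HasPacking]
    | var y =>
      cases y with
      | atomic n => simp [exprTokens, PathExpr.HasPacking]
      | path n =>
        intro l hl
        rw [exprTokens, mem_assemble (by simp)] at hl
        obtain ⟨c, hc, hl⟩ := hl
        obtain ⟨i, -, rfl⟩ := List.mem_map.1 hc
        rw [List.mem_singleton.1 hl]
        simp [PathExpr.HasPacking]
    | pack e ih =>
      intro l hl
      exact ih l (by simpa [exprTokens] using hl)
    | empty => simp [exprTokens]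
    | concat e₁ e₂ ih₁ ih₂ =>
      intro l hl
      exact (List.mem_append.1 hl).elim (ih₁ l) (ih₂ l)
  intro c hc h
  obtain ⟨c', hc', rfl⟩ := List.mem_map.1 hc
  obtain ⟨l, hl, h⟩ := hasPacking_concatExprs h
  exact h1 l (mem_splitComps.1 ⟨c', hc', hl⟩) h

/-- Not every word of brackets is balanced, so the prescribed shapes must come from actual paths;
the segments may then be arbitrary flat paths. -/
theorem exists_splitMatch_left {σ : ℕ → List Bool} {s : Set Var} {ν' : Valuation dom}
    (hσ : ∀ n, .path n ∈ s → ∃ p : Path dom, pathShape p = σ n)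
    (hf : ∀ y ∈ s, ∀ x ∈ segmentVars σ y, (ν'.get x).Flat) :
    ∃ ν : Valuation dom, ∀ x ∈ s, SplitMatch σ ν ν' x := by
  have h : ∀ n, ∃ p : Path dom, .path n ∈ s → pathTokens p = assemble (σ n)
      ((List.range ((σ n).length + 1)).map fun i => ν'.path (Nat.pair n i)) := by
    intro n
    by_cases hn : .path n ∈ s
    · obtain ⟨p, hp⟩ := hσ n hn
      obtain ⟨p', hp'⟩ := exists_pathTokens_eq p
        ((List.range ((σ n).length + 1)).map fun i => ν'.path (Nat.pair n i)) (by
          intro c hc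
          obtain ⟨i, hi, rfl⟩ := List.mem_map.1 hc
          exact hf _ hn (.path (Nat.pair n i)) ⟨i, Nat.lt_succ_iff.1 (List.mem_range.1 hi), rfl⟩)
        (by simp [hp])
      exact ⟨p', fun _ => by rw [hp', hp]⟩
    · exact ⟨[], fun h => absurd h hn⟩
  choose p hp using h
  refine ⟨⟨ν'.atomic, p⟩, fun x hx => ?_⟩
  cases x with
  | atomic n => rfl
  | path n => exact hp n hx

/-- The segment variables are indexed by pairs, so their values are found by unpairing the index. -/
theorem exists_splitMatch_right (σ : ℕ → List Bool) (ν : Valuation dom) :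
    ∃ ν' : Valuation dom, ∀ x, (∀ n, x = .path n → pathShape (ν.path n) = σ n) →
      SplitMatch σ ν ν' x := by
  refine ⟨⟨ν.atomic, fun k => (pathComps (ν.path k.unpair.1)).getD k.unpair.2 []⟩, fun x hx => ?_⟩
  cases x with
  | atomic n => rfl
  | path n =>
    simp only [SplitMatch, Nat.unpair_pair]
    rw [← hx n rfl, ← length_pathComps]
    have : (List.range (pathComps (ν.path n)).length).map
        (fun i => (pathComps (ν.path n)).getD i []) = pathComps (ν.path n) := by
      apply List.ext_getElem (by simp)
      intro i h1 h2
      simp [h2]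
    rw [this]
    exact (assemble_split _).symm

/-! ### Eliminating packing when the number of packed values is bounded -/

theorem length_flatMap_of_shapes {α β : Type*} {shape : α → List Bool} {comp : α → List β}
    (hc : ∀ x, (comp x).length = (shape x).length + 1) {l : List α}
    (h : ∀ s ∈ l.map shape, s = []) : (l.flatMap comp).length = l.length := by
  induction l with
  | nil => rfl
  | cons x l ih =>
    simp only [List.map_cons, List.mem_cons, forall_eq_or_imp] at h
    rw [List.flatMap_cons, List.length_append, hc, h.1, ih h.2, List.length_cons, List.length_nil]
    omega

/-- The shapes tell how many segments belong to each path, and so where the joint list of segments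
is to be cut. -/
theorem eq_of_shapes_comps {l l' : List (Path dom)} (h : l.map pathShape = l'.map pathShape)
    (h' : l.flatMap pathComps = l'.flatMap pathComps) : l = l' := by
  induction l generalizing l' with
  | nil => cases l' with
    | nil => rfl
    | cons p l' => simp at h
  | cons p l ih => cases l' with
    | nil => simp at h
    | cons q l' =>
      simp only [List.map_cons, List.cons.injEq] at h
      simp only [List.flatMap_cons] at h'
      obtain ⟨h1, h2⟩ := List.append_inj h' (by rw [length_pathComps, length_pathComps, h.1])
      rw [path_ext h.1 h1, ih h.2 h2]

theorem length_flatMap_congr {l l' : List (Path dom)} (h : l.map pathShape = l'.map pathShape) :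
    (l.flatMap pathComps).length = (l'.flatMap pathComps).length := by
  have : ∀ l : List (Path dom), (l.flatMap pathComps).length =
      ((l.map pathShape).map fun s => s.length + 1).sum := by
    intro l
    induction l with
    | nil => rfl
    | cons p l ih => simp [ih, length_pathComps]
  rw [this, this, h]

theorem flat_joinPaths {c : dom} {l : List (Path dom)} (h : ∀ p ∈ l, p.Flat) :
    (joinPaths c l).Flat := by
  induction l with
  | nil => exact Path.flat_nil
  | cons p l ih =>
    exact Path.flat_append.2 ⟨h p List.mem_cons_self, Path.flat_cons.2 ⟨⟨c, rfl⟩,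
      ih fun q hq => h q (List.mem_cons_of_mem _ hq)⟩⟩

/-- A program in which the number of packed values in derived facts is bounded. -/
structure Splitting (dom : Type u) where
  P : Program dom
  Γ : Schema
  S : RelName
  a : dom
  b : dom
  hab : a ≠ b
  bounded : ∃ N, ∀ I : FlatInstance dom Γ, ∀ f ∈ run P.strata I.1, ∀ i, pathPacks (f.args i) ≤ N

namespace Splitting

variable (t : Splitting dom)

/-- Arguments without brackets of the input and output relations are left alone. -/
def plain (R : RelName) (sh : List (List Bool)) : Bool :=
  decide (R ∈ insert t.S t.Γ ∧ ∀ s ∈ sh, s = [])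

theorem plain_iff {R : RelName} {sh : List (List Bool)} :
    t.plain R sh = true ↔ R ∈ insert t.S t.Γ ∧ ∀ s ∈ sh, s = [] := by
  simp [plain]

/-- The bracket words move from the arguments into the name; identifier, arity and shapes are all
encoded, since the new names are unary. -/
def name (R : RelName) (sh : List (List Bool)) : RelName :=
  if t.plain R sh then R else
    ⟨(insert t.S t.Γ : Schema).fresh + Encodable.encode (R.id, R.arity, sh), 1⟩

theorem name_of_plain {R : RelName} {sh : List (List Bool)} (h : t.plain R sh) : t.name R sh = R := by
  simp [name, h]

theorem plain_of_name_mem {R : RelName} {sh : List (List Bool)}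
    (h : t.name R sh ∈ insert t.S t.Γ) : t.plain R sh := by
  by_contra hp
  have := Schema.lt_fresh h
  simp only [name, hp, Bool.false_eq_true, if_false] at this
  omega

theorem name_inj {R R' : RelName} {sh sh' : List (List Bool)} (hl : sh.length = R.arity)
    (hl' : sh'.length = R'.arity) (h : t.name R sh = t.name R' sh') : R = R' ∧ sh = sh' := by
  by_cases hp : t.plain R sh
  · have hm := ((t.plain_iff).1 hp).1
    rw [t.name_of_plain hp] at h
    have hp' : t.plain R' sh' := t.plain_of_name_mem (h ▸ hm)
    rw [t.name_of_plain hp'] at h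
    subst h
    refine ⟨rfl, ?_⟩
    rw [List.eq_replicate_iff.2 ⟨hl, ((t.plain_iff).1 hp).2⟩,
      List.eq_replicate_iff.2 ⟨hl', ((t.plain_iff).1 hp').2⟩]
  · by_cases hp' : t.plain R' sh'
    · have hm := ((t.plain_iff).1 hp').1
      rw [t.name_of_plain hp'] at h
      exact absurd (t.plain_of_name_mem (h ▸ hm)) hp
    · simp only [name, hp, hp', Bool.false_eq_true, if_false, RelName.mk.injEq, and_true,
        Nat.add_left_cancel_iff, Encodable.encode_inj, Prod.mk.injEq] at h
      obtain ⟨h1, h2, h3⟩ := h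
      refine ⟨?_, h3⟩
      cases R
      cases R'
      simp_all

theorem arity_name_le (hΓ : t.Γ.Monadic) (hS : t.S.arity ≤ 1) (R : RelName)
    (sh : List (List Bool)) : (t.name R sh).arity ≤ 1 := by
  by_cases hp : t.plain R sh
  · rw [t.name_of_plain hp]
    rcases Finset.mem_insert.1 ((t.plain_iff).1 hp).1 with rfl | h
    · exact hS
    · exact hΓ R h
  · simp [name, hp]

def joinPath (cs : List (Path dom)) : Path dom := joinPaths t.a cs ++ joinPaths t.b cs

def joinExpr (cs : List (PathExpr dom)) : PathExpr dom :=
  .concat (joinExprs t.a cs) (joinExprs t.b cs)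

theorem eval_joinExpr (ν : Valuation dom) (cs : List (PathExpr dom)) :
    (t.joinExpr cs).eval ν = t.joinPath (cs.map (·.eval ν)) := by
  simp [joinExpr, joinPath, PathExpr.eval, eval_joinExprs]

theorem vars_joinExpr (cs : List (PathExpr dom)) (x : Var) :
    x ∈ (t.joinExpr cs).vars ↔ ∃ e ∈ cs, x ∈ e.vars := by
  simp [joinExpr, PathExpr.vars, vars_joinExprs]

theorem hasPacking_joinExpr {cs : List (PathExpr dom)} (h : (t.joinExpr cs).HasPacking) :
    ∃ e ∈ cs, e.HasPacking := by
  rcases h with h | h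
  · exact hasPacking_joinExprs h
  · exact hasPacking_joinExprs h

def fact (f : Fact dom) : Fact dom :=
  mkFact (t.name f.rel (f.list.map pathShape))
    (if t.plain f.rel (f.list.map pathShape) then f.list.flatMap pathComps
      else [t.joinPath (f.list.flatMap pathComps)])

def pred (σ : ℕ → List Bool) (Q : Predicate dom) : Predicate dom :=
  mkPred (t.name Q.rel (Q.list.map (exprShape σ)))
    (if t.plain Q.rel (Q.list.map (exprShape σ)) then Q.list.flatMap (exprComps σ)
      else [t.joinExpr (Q.list.flatMap (exprComps σ))])

theorem fact_of_plain {f : Fact dom} (h : t.plain f.rel (f.list.map pathShape)) : t.fact f = f := by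
  have hc : f.list.flatMap pathComps = f.list := by
    have : ∀ l : List (Path dom), (∀ s ∈ l.map pathShape, s = []) → l.flatMap pathComps = l := by
      intro l hl
      induction l with
      | nil => rfl
      | cons p l ih =>
        simp only [List.map_cons, List.mem_cons, forall_eq_or_imp] at hl
        rw [List.flatMap_cons, pathComps_of_flat (pathShape_eq_nil.1 hl.1), ih hl.2]
        rfl
    exact this _ ((t.plain_iff).1 h).2
  simp only [fact, t.name_of_plain h, h, if_true, hc]
  exact mkFact_list f

theorem plain_of_flat {f : Fact dom} (h : f.rel ∈ insert t.S t.Γ) (hf : ∀ i, (f.args i).Flat) :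
    t.plain f.rel (f.list.map pathShape) := by
  refine (t.plain_iff).2 ⟨h, fun s hs => ?_⟩
  obtain ⟨p, hp, rfl⟩ := List.mem_map.1 hs
  exact pathShape_eq_nil.2 (forall_args.1 hf p hp)

theorem fact_injective : Function.Injective t.fact := by
  intro f g h
  obtain ⟨h1, h2⟩ := t.name_inj (by simp [length_list]) (by simp [length_list])
    (congrArg Fact.rel h)
  by_cases hp : t.plain f.rel (f.list.map pathShape)
  · rw [t.fact_of_plain hp, t.fact_of_plain (h1 ▸ h2 ▸ hp)] at h
    exact h
  · have hp' : ¬ t.plain g.rel (g.list.map pathShape) := h1 ▸ h2 ▸ hp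
    simp only [fact, hp, hp', Bool.false_eq_true, if_false] at h
    have h3 := (mkFact_one_inj (by simp [name, hp]) h).2
    exact fact_ext h1 (eq_of_shapes_comps h2 (join_append_inj t.hab (length_flatMap_congr h2) h3))

theorem flat_fact (f : Fact dom) : ∀ i, ((t.fact f).args i).Flat := by
  have hc : ∀ c ∈ f.list.flatMap pathComps, c.Flat := by
    intro c hc
    obtain ⟨p, -, hc⟩ := List.mem_flatMap.1 hc
    exact flat_pathComps p c hc
  by_cases hp : t.plain f.rel (f.list.map pathShape)
  · rw [t.fact_of_plain hp]
    refine forall_args.2 fun q hq => pathShape_eq_nil.1 ?_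
    exact ((t.plain_iff).1 hp).2 _ (List.mem_map_of_mem hq)
  · refine forall_args.2 fun q hq => ?_
    rw [fact, list_mkFact (by simp [name, hp])] at hq
    simp only [hp, Bool.false_eq_true, if_false, List.mem_singleton] at hq
    rw [hq]
    exact Path.flat_append.2 ⟨flat_joinPaths hc, flat_joinPaths hc⟩

theorem shapes_eval {σ : ℕ → List Bool} {ν ν' : Valuation dom} {Q : Predicate dom}
    (h : ∀ x ∈ Q.vars, SplitMatch σ ν ν' x) :
    (Q.eval ν).list.map pathShape = Q.list.map (exprShape σ) := by
  rw [list_eval, List.map_map]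
  exact List.map_congr_left fun e he =>
    pathShape_eval fun x hx => h x (mem_predVars.2 ⟨e, he, hx⟩)

theorem eval_pred {σ : ℕ → List Bool} {ν ν' : Valuation dom} {Q : Predicate dom}
    (h : ∀ x ∈ Q.vars, SplitMatch σ ν ν' x) : (t.pred σ Q).eval ν' = t.fact (Q.eval ν) := by
  have h2 : (Q.eval ν).list.flatMap pathComps =
      (Q.list.flatMap (exprComps σ)).map (·.eval ν') := by
    rw [list_eval, List.flatMap_map, List.map_flatMap]
    exact List.flatMap_congr fun e he =>
      pathComps_eval fun x hx => h x (mem_predVars.2 ⟨e, he, hx⟩)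
  have h1 := shapes_eval h
  rw [fact, pred, eval_mkPred, h1, h2, Predicate.eval_rel]
  split_ifs
  · rfl
  · simp [eval_joinExpr]

theorem mem_vars_pred {σ : ℕ → List Bool} {Q : Predicate dom} {x : Var} :
    x ∈ (t.pred σ Q).vars ↔ ∃ y ∈ Q.vars, x ∈ segmentVars σ y := by
  have h1 : (∃ e ∈ Q.list.flatMap (exprComps σ), x ∈ e.vars) ↔
      ∃ y ∈ Q.vars, x ∈ segmentVars σ y := by
    constructor
    · rintro ⟨c, hc, hx⟩
      obtain ⟨e, he, hc⟩ := List.mem_flatMap.1 hc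
      obtain ⟨y, hy, hx⟩ := mem_vars_exprComps.1 ⟨c, hc, hx⟩
      exact ⟨y, mem_predVars.2 ⟨e, he, hy⟩, hx⟩
    · rintro ⟨y, hy, hx⟩
      obtain ⟨e, he, hy⟩ := mem_predVars.1 hy
      obtain ⟨c, hc, hx⟩ := mem_vars_exprComps.2 ⟨y, hy, hx⟩
      exact ⟨c, List.mem_flatMap.2 ⟨e, he, hc⟩, hx⟩
  rw [← h1, pred]
  by_cases hp : t.plain Q.rel (Q.list.map (exprShape σ))
  · simp only [hp, if_true]
    rw [vars_mkPred]
    rw [t.name_of_plain hp, length_flatMap_of_shapes (length_exprComps σ) ((t.plain_iff).1 hp).2,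
      length_predList]
  · simp only [hp, Bool.false_eq_true, if_false]
    rw [vars_mkPred (by simp [name, hp])]
    simp [vars_joinExpr]

theorem not_hasPacking_pred (σ : ℕ → List Bool) (Q : Predicate dom) :
    ¬ (t.pred σ Q).HasPacking := by
  intro h
  obtain ⟨e, he, h⟩ := hasPacking_mkPred h
  split_ifs at he
  · obtain ⟨e', -, he⟩ := List.mem_flatMap.1 he
    exact not_hasPacking_exprComps σ e' e he h
  · rw [List.mem_singleton.1 he] at h
    obtain ⟨c, hc, h⟩ := t.hasPacking_joinExpr h
    obtain ⟨e', -, he⟩ := List.mem_flatMap.1 hc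
    exact not_hasPacking_exprComps σ e' c he h

/-- For equations this is adequate only when both sides have equal shapes. Positive equations of
realized rules satisfy this, and negated ones that do not are dropped by `Keep`. -/
def atom (σ : ℕ → List Bool) : Atom dom → Atom dom
  | .pred Q => .pred (t.pred σ Q)
  | .eqn e₁ e₂ => .eqn (t.joinExpr (exprComps σ e₁)) (t.joinExpr (exprComps σ e₂))

def literal (σ : ℕ → List Bool) : Literal dom → Literal dom
  | .pos A => .pos (t.atom σ A)
  | .neg A => .neg (t.atom σ A)

theorem literal_atom (σ : ℕ → List Bool) (L : Literal dom) :
    (t.literal σ L).atom = t.atom σ L.atom := by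
  cases L <;> rfl

theorem mem_vars_joined {σ : ℕ → List Bool} {e : PathExpr dom} {x : Var} :
    x ∈ (t.joinExpr (exprComps σ e)).vars ↔ ∃ y ∈ e.vars, x ∈ segmentVars σ y := by
  rw [vars_joinExpr, mem_vars_exprComps]

theorem mem_vars_atom {σ : ℕ → List Bool} {A : Atom dom} {x : Var} :
    x ∈ (t.atom σ A).vars ↔ ∃ y ∈ A.vars, x ∈ segmentVars σ y := by
  cases A with
  | pred Q => exact t.mem_vars_pred
  | eqn e₁ e₂ =>
    simp only [atom, Atom.vars, Set.mem_union, mem_vars_joined, or_and_right, exists_or]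

theorem sat_eqn {σ : ℕ → List Bool} {ν ν' : Valuation dom} {e₁ e₂ : PathExpr dom}
    (h₁ : ∀ x ∈ e₁.vars, SplitMatch σ ν ν' x) (h₂ : ∀ x ∈ e₂.vars, SplitMatch σ ν ν' x)
    (hs : exprShape σ e₁ = exprShape σ e₂) :
    (t.joinExpr (exprComps σ e₁)).eval ν' = (t.joinExpr (exprComps σ e₂)).eval ν' ↔
      e₁.eval ν = e₂.eval ν := by
  rw [eval_joinExpr, eval_joinExpr, ← pathComps_eval h₁, ← pathComps_eval h₂]
  have hs' : pathShape (e₁.eval ν) = pathShape (e₂.eval ν) := by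
    rw [pathShape_eval h₁, pathShape_eval h₂, hs]
  constructor
  · intro h
    exact path_ext hs' (join_append_inj t.hab (by rw [length_pathComps, length_pathComps, hs']) h)
  · intro h
    rw [h]

theorem sat_pred {σ : ℕ → List Bool} {ν ν' : Valuation dom} {Q : Predicate dom}
    (h : ∀ x ∈ Q.vars, SplitMatch σ ν ν' x) (M : Set (Fact dom)) :
    (t.pred σ Q).eval ν' ∈ t.fact '' M ↔ Q.eval ν ∈ M := by
  rw [t.eval_pred h]
  exact t.fact_injective.mem_set_image

open Classical in
/-- The shapes of the values of the variables of a rule. -/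
noncomputable def _root_.SeqDatalog.Rule.shapeOf (r : Rule dom) (ν : Valuation dom) (n : ℕ) :
    List Bool :=
  if .path n ∈ r.vars then pathShape (ν.path n) else []

/-- The rule fires on some input with variable shapes `σ`. -/
def Realized (r : Rule dom) (σ : ℕ → List Bool) : Prop :=
  ∃ (I : FlatInstance dom t.Γ) (M : Set (Fact dom)) (ν : Valuation dom),
    M ⊆ run t.P.strata I.1 ∧ (∀ L ∈ r.body, L.Sat M ν) ∧
    r.head.eval ν ∈ run t.P.strata I.1 ∧ r.shapeOf ν = σ

/-- Packed values are bounded in derived facts, hence by safety in the values of all variables; so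
the variable shapes have bounded length. -/
theorem finite_realized {r : Rule dom} (hs : r.Safe) : {σ | t.Realized r σ}.Finite := by
  obtain ⟨N, hN⟩ := t.bounded
  obtain ⟨m, hm⟩ := tameMeasure_packs.rule_vars r hs N
  -- A shape assignment is determined by its values below the variable bound and is empty beyond it.
  refine ((finite_lists (List.finite_length_le Bool (2 * m)) r.varBound).image
    fun l n => l.getD n []).subset ?_
  rintro σ ⟨I, M, ν, hM, hsat, -, rfl⟩
  refine ⟨(List.range r.varBound).map (r.shapeOf ν), ⟨by simp, ?_⟩, ?_⟩
  · intro s hs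
    obtain ⟨n, -, rfl⟩ := List.mem_map.1 hs
    simp only [Rule.shapeOf]
    split_ifs with h
    · have := hm M ν hsat (fun Q hQ i => hN I _ (hM (hsat _ hQ)) i) _ h
      change (pathShape (ν.path n)).length ≤ 2 * m
      rw [length_pathShape]
      exact Nat.mul_le_mul_left 2 this
    · exact Nat.zero_le _
  · funext n
    by_cases hn : n < r.varBound
    · simp [hn]
    · have : .path n ∉ r.vars := fun h => hn (r.lt_varBound h)
      simp [hn, Rule.shapeOf, this]

open Classical in
noncomputable def shapes (r : Rule dom) : List (ℕ → List Bool) :=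
  if h : {σ | t.Realized r σ}.Finite then h.toFinset.toList else []

theorem mem_shapes {r : Rule dom} (hs : r.Safe) {σ : ℕ → List Bool} :
    σ ∈ t.shapes r ↔ t.Realized r σ := by
  simp [shapes, t.finite_realized hs]

/-- Negated literals that hold because of their shapes are dropped. -/
def Keep (σ : ℕ → List Bool) : Literal dom → Prop
  | .pos _ => True
  | .neg (.eqn e₁ e₂) => exprShape σ e₁ = exprShape σ e₂
  -- A name under which no fact is ever derived need be neither in `Γ` nor IDB; keeping it could
  -- turn it into an EDB name outside the schema.
  | .neg (.pred Q) => ∃ I : FlatInstance dom t.Γ, ∃ f ∈ run t.P.strata I.1,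
      (t.fact f).rel = (t.pred σ Q).rel

open Classical in
noncomputable def rule (σ : ℕ → List Bool) (r : Rule dom) : Rule dom :=
  ⟨t.pred σ r.head, (r.body.filter fun L => t.Keep σ L).map (t.literal σ)⟩

theorem mem_body_rule {σ : ℕ → List Bool} {r : Rule dom} {L' : Literal dom} :
    L' ∈ (t.rule σ r).body ↔ ∃ L ∈ r.body, t.Keep σ L ∧ t.literal σ L = L' := by
  simp [rule, and_assoc]

theorem pos_mem_body_rule {σ : ℕ → List Bool} {r : Rule dom} {A : Atom dom}
    (h : .pos A ∈ r.body) : .pos (t.atom σ A) ∈ (t.rule σ r).body :=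
  t.mem_body_rule.2 ⟨_, h, trivial, rfl⟩

theorem limited {σ : ℕ → List Bool} {r : Rule dom} {y : Var} (h : Limited r.body y) :
    ∀ x ∈ segmentVars σ y, Limited (t.rule σ r).body x := by
  induction h with
  | pred Q y hQ hy =>
    exact fun x hx => .pred _ x (t.pos_mem_body_rule hQ) (t.mem_vars_pred.2 ⟨y, hy, hx⟩)
  | eqn_right e₁ e₂ y he _ hy ih =>
    refine fun x hx => .eqn_right _ _ x (t.pos_mem_body_rule he) (fun z hz => ?_)
      (t.mem_vars_joined.2 ⟨y, hy, hx⟩)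
    obtain ⟨w, hw, hz⟩ := t.mem_vars_joined.1 hz
    exact ih w hw z hz
  | eqn_left e₁ e₂ y he _ hy ih =>
    refine fun x hx => .eqn_left _ _ x (t.pos_mem_body_rule he) (fun z hz => ?_)
      (t.mem_vars_joined.2 ⟨y, hy, hx⟩)
    obtain ⟨w, hw, hz⟩ := t.mem_vars_joined.1 hz
    exact ih w hw z hz

theorem safe {σ : ℕ → List Bool} {r : Rule dom} (hs : r.Safe) : (t.rule σ r).Safe := by
  rintro x (hx | ⟨L', hL', hx⟩)
  · obtain ⟨y, hy, hx⟩ := t.mem_vars_pred.1 hx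
    exact t.limited (hs y (Or.inl hy)) x hx
  · obtain ⟨L, hL, -, rfl⟩ := t.mem_body_rule.1 hL'
    rw [literal_atom] at hx
    obtain ⟨y, hy, hx⟩ := t.mem_vars_atom.1 hx
    exact t.limited (hs y (Or.inr ⟨L, hL, hy⟩)) x hx

theorem not_hasPacking_rule (σ : ℕ → List Bool) (r : Rule dom) : ¬ (t.rule σ r).HasPacking := by
  rintro (h | ⟨L', hL', h⟩)
  · exact t.not_hasPacking_pred σ _ h
  · obtain ⟨L, hL, -, rfl⟩ := t.mem_body_rule.1 hL'
    rw [literal_atom] at h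
    cases hA : L.atom with
    | pred Q =>
      rw [hA] at h
      exact t.not_hasPacking_pred σ Q h
    | eqn e₁ e₂ =>
      rw [hA] at h
      rcases h with h | h
      all_goals
        obtain ⟨c, hc, h⟩ := t.hasPacking_joinExpr h
        exact not_hasPacking_exprComps σ _ c hc h

/-- A rule is copied once for each shape assignment that it actually realizes. -/
noncomputable def stratum (Δ : Stratum dom) : Stratum dom :=
  Δ.flatMap fun r => (t.shapes r).map fun σ => t.rule σ r

theorem mem_stratum {Δ : Stratum dom} {r' : Rule dom} :
    r' ∈ t.stratum Δ ↔ ∃ r ∈ Δ, ∃ σ ∈ t.shapes r, r' = t.rule σ r := by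
  simp [stratum, eq_comm]

theorem limited_mem_bodyVars {B : List (Literal dom)} {x : Var} (h : Limited B x) :
    x ∈ bodyVars B := by
  cases h with
  | pred Q x hQ hx => exact ⟨_, hQ, hx⟩
  | eqn_right e₁ e₂ x he _ hx => exact ⟨_, he, Or.inr hx⟩
  | eqn_left e₁ e₂ x he _ hx => exact ⟨_, he, Or.inl hx⟩

theorem realized_shape {r : Rule dom} {σ : ℕ → List Bool} (h : t.Realized r σ) :
    ∀ n, .path n ∈ r.vars → ∃ p : Path dom, pathShape p = σ n := by
  obtain ⟨I, M, ν, -, -, -, rfl⟩ := h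
  exact fun n hn => ⟨ν.path n, by simp [Rule.shapeOf, hn]⟩

theorem exists_match (r : Rule dom) (ν : Valuation dom) : ∃ ν' : Valuation dom, ∀ x ∈ r.vars,
    SplitMatch (r.shapeOf ν) ν ν' x := by
  obtain ⟨ν', h⟩ := exists_splitMatch_right (r.shapeOf ν) ν
  exact ⟨ν', fun x hx => h x fun n hn => by subst hn; simp [Rule.shapeOf, hx]⟩

/-- Some valuation with these shapes satisfies the equation, so both sides even have a common value.
-/
theorem shape_eq_of_realized {r : Rule dom} {σ : ℕ → List Bool} (h : t.Realized r σ)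
    {e₁ e₂ : PathExpr dom} (he : .pos (.eqn e₁ e₂) ∈ r.body) : exprShape σ e₁ = exprShape σ e₂ := by
  obtain ⟨I, M, ν, -, hsat, -, rfl⟩ := h
  obtain ⟨ν', hν'⟩ := exists_match r ν
  rw [← pathShape_eval fun x hx => hν' x (Or.inr ⟨_, he, Or.inl hx⟩),
    ← pathShape_eval fun x hx => hν' x (Or.inr ⟨_, he, Or.inr hx⟩)]
  exact congrArg _ (hsat _ he)

theorem isHead_of_name {Δ' : Stratum dom} {σ : ℕ → List Bool} {Q : Predicate dom}
    (h : (t.stratum Δ').IsHead (t.pred σ Q).rel) : Δ'.IsHead Q.rel := by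
  obtain ⟨r', hr', h⟩ := h
  obtain ⟨r, hr, σ', -, rfl⟩ := t.mem_stratum.1 hr'
  exact ⟨r, hr, (t.name_inj (by simp [length_predList]) (by simp [length_predList]) h).1⟩

theorem negFree {Δ Δ' : Stratum dom} (h : NegFree Δ Δ') : NegFree (t.stratum Δ) (t.stratum Δ') := by
  intro r' hr' Q' hQ' hh
  obtain ⟨r, hr, σ, -, rfl⟩ := t.mem_stratum.1 hr'
  obtain ⟨L, hL, -, hL'⟩ := t.mem_body_rule.1 hQ'
  cases L with
  | pos A => simp [literal] at hL'
  | neg A =>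
    cases A with
    | eqn e₁ e₂ => simp [literal, atom] at hL'
    | pred Q =>
      simp only [literal, atom, Literal.neg.injEq, Atom.pred.injEq] at hL'
      subst hL'
      exact h r hr Q hL (t.isHead_of_name hh)

/-- Flat segments in a translated firing can be reassembled to paths of the required shape, and an
original firing realizes its own shapes. The hypothesis `hK` places the stratum inside an actual
run, to which the notion of realized shapes refers. -/
theorem lfp_image {Δ : Stratum dom} (hn : NegFree Δ Δ) (hs : ∀ r ∈ Δ, r.Safe)
    (I : FlatInstance dom t.Γ) {K : Set (Fact dom)} (hK : lfp Δ K ⊆ run t.P.strata I.1) :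
    lfp (t.stratum Δ) (t.fact '' K) = t.fact '' lfp Δ K := by
  have hn' := t.negFree hn
  have hflat : FlatFacts (lfp (t.stratum Δ) (t.fact '' K)) := by
    refine lfp_flat hn' ?_ ?_ ?_
    · intro r' hr'
      obtain ⟨r, hr, σ, -, rfl⟩ := t.mem_stratum.1 hr'
      exact t.safe (hs r hr)
    · intro r' hr'
      obtain ⟨r, hr, σ, -, rfl⟩ := t.mem_stratum.1 hr'
      exact t.not_hasPacking_rule σ r
    · rintro _ ⟨f, -, rfl⟩
      exact t.flat_fact f
  -- This inclusion comes first because the converse needs it for negated predicates.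
  have hsub : lfp (t.stratum Δ) (t.fact '' K) ⊆ t.fact '' lfp Δ K := by
    refine lfp_induction hn' (Set.image_mono (subset_lfp _ _)) ?_
    intro r' hr' ν' hsat hpos
    obtain ⟨r, hr, σ, hσ, rfl⟩ := t.mem_stratum.1 hr'
    have hre := (t.mem_shapes (hs r hr)).1 hσ
    have hfl := rule_vars_flat (t.safe (hs r hr)) (t.not_hasPacking_rule σ r) hsat hflat
    obtain ⟨ν, hν⟩ := exists_splitMatch_left (s := r.vars) (σ := σ) (ν' := ν') (t.realized_shape hre)
      (fun y hy x hx => hfl x (Or.inr (limited_mem_bodyVars (t.limited (hs r hr y hy) x hx))))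
    refine ⟨r.head.eval ν, lfp_sat hn hr ν fun L hL => ?_,
      (t.eval_pred fun x hx => hν x (Or.inl hx)).symm⟩
    have hv : ∀ x ∈ L.atom.vars, SplitMatch σ ν ν' x := fun x hx => hν x (Or.inr ⟨L, hL, hx⟩)
    cases L with
    | pos A =>
      cases A with
      | pred Q => exact (t.sat_pred hv _).1 (hpos _ (t.pos_mem_body_rule hL))
      | eqn e₁ e₂ =>
        exact (t.sat_eqn (fun x hx => hv x (Or.inl hx)) (fun x hx => hv x (Or.inr hx))
          (t.shape_eq_of_realized hre hL)).1 (hsat _ (t.pos_mem_body_rule hL))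
    | neg A =>
      cases A with
      | pred Q =>
        intro h
        have h' := lfp_agree h (hn r hr Q hL)
        -- If the negated fact were present, it would witness its own coded name, so the literal
        -- cannot have been dropped.
        have hk : t.Keep σ (.neg (.pred Q)) := ⟨I, _, hK h, by rw [← t.eval_pred hv]; rfl⟩
        exact hsat _ (t.mem_body_rule.2 ⟨_, hL, hk, rfl⟩)
          (subset_lfp _ _ ((t.sat_pred hv _).2 h'))
      | eqn e₁ e₂ =>
        intro h
        have h1 : ∀ x ∈ e₁.vars, SplitMatch σ ν ν' x := fun x hx => hv x (Or.inl hx)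
        have h2 : ∀ x ∈ e₂.vars, SplitMatch σ ν ν' x := fun x hx => hv x (Or.inr hx)
        have hk : exprShape σ e₁ = exprShape σ e₂ := by
          rw [← pathShape_eval h1, ← pathShape_eval h2]
          exact congrArg _ h
        exact hsat _ (t.mem_body_rule.2 ⟨_, hL, hk, rfl⟩) ((t.sat_eqn h1 h2 hk).2 h)
  refine Set.Subset.antisymm hsub ?_
  rw [Set.image_subset_iff]
  refine lfp_induction hn (fun f hf => subset_lfp _ _ ⟨f, hf, rfl⟩) ?_
  intro r hr ν hsat hpos
  obtain ⟨ν', hν'⟩ := exists_match r ν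
  have hσ : r.shapeOf ν ∈ t.shapes r := (t.mem_shapes (hs r hr)).2
    ⟨I, _, ν, hK, hsat, hK (lfp_sat hn hr ν hsat), rfl⟩
  rw [Set.mem_preimage, ← t.eval_pred fun x hx => hν' x (Or.inl hx)]
  refine lfp_sat hn' (t.mem_stratum.2 ⟨r, hr, _, hσ, rfl⟩) ν' fun L' hL' => ?_
  obtain ⟨L, hL, hk, rfl⟩ := t.mem_body_rule.1 hL'
  have hv : ∀ x ∈ L.atom.vars, SplitMatch (r.shapeOf ν) ν ν' x := fun x hx =>
    hν' x (Or.inr ⟨L, hL, hx⟩)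
  cases L with
  | pos A =>
    cases A with
    | pred Q =>
      change (t.pred _ Q).eval ν' ∈ _
      rw [t.eval_pred hv]
      exact hpos Q hL
    | eqn e₁ e₂ =>
      exact (t.sat_eqn (fun x hx => hv x (Or.inl hx)) (fun x hx => hv x (Or.inr hx))
        (t.shape_eq_of_realized ((t.mem_shapes (hs r hr)).1 hσ) hL)).2 (hsat _ hL)
  | neg A =>
    cases A with
    | pred Q => exact fun h => hsat _ hL ((t.sat_pred hv _).1 (hsub h))
    | eqn e₁ e₂ =>
      exact fun h => hsat _ hL ((t.sat_eqn (fun x hx => hv x (Or.inl hx))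
        (fun x hx => hv x (Or.inr hx)) hk).1 h)

theorem run_image (I : FlatInstance dom t.Γ) {s : List (Stratum dom)} (hn : ∀ Δ ∈ s, NegFree Δ Δ)
    (hs : ∀ Δ ∈ s, ∀ r ∈ Δ, r.Safe) {K : Set (Fact dom)} (hK : run s K ⊆ run t.P.strata I.1) :
    run (s.map t.stratum) (t.fact '' K) = t.fact '' run s K := by
  induction s generalizing K with
  | nil => rfl
  | cons Δ s ih =>
    have m : Δ ∈ Δ :: s := List.mem_cons_self
    simp only [List.map_cons, run]
    rw [t.lfp_image (hn Δ m) (hs Δ m) I ((subset_run s _).trans hK)]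
    exact ih (fun Δ' h => hn Δ' (List.mem_cons_of_mem _ h))
      (fun Δ' h => hs Δ' (List.mem_cons_of_mem _ h)) hK

noncomputable def program : Program dom where
  strata := t.P.strata.map t.stratum
  safe := by
    intro Δ' hΔ' r' hr'
    obtain ⟨Δ, hΔ, rfl⟩ := List.mem_map.1 hΔ'
    obtain ⟨r, hr, σ, -, rfl⟩ := t.mem_stratum.1 hr'
    exact t.safe (t.P.safe Δ hΔ r hr)
  stratified := by
    have h := (stratified_iff _).1 t.P.stratified
    refine (stratified_iff _).2 ⟨?_, ?_⟩
    · intro Δ' hΔ'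
      obtain ⟨Δ, hΔ, rfl⟩ := List.mem_map.1 hΔ'
      exact t.negFree (h.1 Δ hΔ)
    · exact List.pairwise_map.2 (h.2.imp fun h => t.negFree h)

theorem hasRule_program {r' : Rule dom} (h : t.program.HasRule r') :
    ∃ r, t.P.HasRule r ∧ ∃ σ, t.Realized r σ ∧ r' = t.rule σ r := by
  obtain ⟨Δ', hΔ', hr'⟩ := h
  obtain ⟨Δ, hΔ, rfl⟩ := List.mem_map.1 hΔ'
  obtain ⟨r, hr, σ, hσ, rfl⟩ := t.mem_stratum.1 hr'
  exact ⟨r, ⟨Δ, hΔ, hr⟩, σ, (t.mem_shapes (t.P.safe Δ hΔ r hr)).1 hσ, rfl⟩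

theorem run_program (I : FlatInstance dom t.Γ) :
    run t.program.strata I.1 = t.fact '' run t.P.strata I.1 := by
  have hI : t.fact '' I.1 = I.1 := by
    have : ∀ f ∈ I.1, t.fact f = f := fun f hf => t.fact_of_plain (t.plain_of_flat
      (Finset.mem_insert_of_mem (I.2.1.2 f hf)) (I.2.2 f hf))
    ext f
    constructor
    · rintro ⟨g, hg, rfl⟩
      rwa [this g hg]
    · exact fun hf => ⟨f, hf, this f hf⟩
  have := t.run_image I t.P.negFree t.P.safe (K := I.1) subset_rfl
  rwa [hI] at this

theorem inBody_program {r : Rule dom} {σ : ℕ → List Bool} {R : RelName}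
    (h : (t.rule σ r).InBody R) : ∃ L ∈ r.body, t.Keep σ L ∧ ∃ Q : Predicate dom,
      L.atom = .pred Q ∧ (t.pred σ Q).rel = R := by
  obtain ⟨L', hL', Q', hQ', rfl⟩ := h
  obtain ⟨L, hL, hk, rfl⟩ := t.mem_body_rule.1 hL'
  rw [literal_atom] at hQ'
  cases hA : L.atom with
  | eqn e₁ e₂ => simp [hA, atom] at hQ'
  | pred Q =>
    simp only [hA, atom, Atom.pred.injEq] at hQ'
    exact ⟨L, hL, hk, Q, hA, by rw [hQ']⟩

end Splitting

/-- Arities are removed by the same coding. If the output is the only IDB name, no new IDB name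
arises, because output facts are flat and therefore keep their name. -/
theorem eliminate_bounded_packing [Infinite dom] {Γ : Schema} {S : RelName} (hΓ : Γ.Monadic)
    (hSa : S.arity ≤ 1) {Q : Query dom Γ S} {P : Program dom}
    (hP : P.Computes Q) (hb : ∃ N, ∀ I : FlatInstance dom Γ, ∀ f ∈ run P.strata I.1, ∀ i,
      pathPacks (f.args i) ≤ N) :
    ∃ P' : Program dom, P'.Computes Q ∧ ¬ P'.Uses .P ∧ ¬ P'.Uses .A ∧
      (P'.Uses .E → P.Uses .E) ∧ (P'.Uses .N → P.Uses .N) ∧ (P'.Uses .R → P.Uses .R) ∧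
      (P.IsIDB S → P'.Uses .I → P.Uses .I) := by
  obtain ⟨a, b, hab⟩ := exists_pair_ne dom
  let t : Splitting dom := ⟨P, Γ, S, a, b, hab, hb⟩
  rw [Program.computes_iff] at hP
  obtain ⟨ho, hP⟩ := hP
  -- A name that carries a fact of the result is an input name or a head, which settles all EDB
  -- requirements for names in bodies.
  have hnameI : ∀ I : FlatInstance dom Γ, ∀ f ∈ run P.strata I.1,
      (t.fact f).rel ∈ Γ ∨ t.program.IsIDB (t.fact f).rel := by
    intro I f hf
    have h : t.fact f ∈ run t.program.strata I.1 := by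
      rw [t.run_program I]
      exact ⟨f, hf, rfl⟩
    rcases mem_run_cases h with h | h
    · exact Or.inl (I.2.1.2 _ h)
    · exact Or.inr ((Program.isIDB_iff _ _).2 h)
  have hSflat : ∀ I : FlatInstance dom Γ, ∀ f ∈ run P.strata I.1, f.rel = S →
      t.plain f.rel (f.list.map pathShape) := by
    intro I f hf hS
    have : f ∈ (Q I).1 := by
      rw [← (hP I).2]
      exact ⟨hf, hS⟩
    exact t.plain_of_flat (hS ▸ Finset.mem_insert_self S Γ) ((Q I).2.2 f this)
  have hidb : ∀ r σ, P.HasRule r → t.Realized r σ → (t.pred σ r.head).rel ∉ Γ := by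
    intro r σ hr _ h
    have hp := t.plain_of_name_mem (Finset.mem_insert_of_mem h)
    have h' : (t.pred σ r.head).rel = r.head.rel := t.name_of_plain hp
    exact ho.2 r.head.rel ⟨r, hr, rfl⟩ (h' ▸ h)
  have hpk : ¬ t.program.Uses .P := by
    rintro ⟨r', hr', h⟩
    obtain ⟨r, hr, σ, -, rfl⟩ := t.hasRule_program hr'
    exact t.not_hasPacking_rule σ r h
  refine ⟨t.program, (Program.computes_iff _ _).2 ⟨⟨?_, ?_⟩, fun I => ?_⟩, hpk, ?_, ?_, ?_, ?_, ?_⟩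
  · rintro R ⟨⟨r', hr', hR⟩, hRI⟩
    obtain ⟨r, hr, σ, hσ, rfl⟩ := t.hasRule_program hr'
    obtain ⟨L, hL, hk, Q', hA, rfl⟩ := t.inBody_program hR
    obtain ⟨I, f, hf, hfn⟩ : ∃ I : FlatInstance dom Γ, ∃ f ∈ run P.strata I.1,
        (t.fact f).rel = (t.pred σ Q').rel := by
      cases L with
      | neg A =>
        simp only [Literal.atom] at hA
        subst hA
        exact hk
      | pos A =>
        simp only [Literal.atom] at hA
        subst hA
        obtain ⟨I, M, ν, hM, hsat, -, rfl⟩ := hσ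
        obtain ⟨ν', hν'⟩ := Splitting.exists_match r ν
        refine ⟨I, Q'.eval ν, hM (hsat _ hL), ?_⟩
        rw [← t.eval_pred fun x hx => hν' x (Or.inr ⟨_, hL, hx⟩)]
        rfl
    rw [← hfn] at hRI ⊢
    exact (hnameI I f hf).resolve_right hRI
  · rintro R ⟨r', hr', rfl⟩
    obtain ⟨r, hr, σ, hσ, rfl⟩ := t.hasRule_program hr'
    exact hidb r σ hr hσ
  · rw [t.run_program I]
    refine ⟨(hP I).1.image _, ?_⟩
    rw [← (hP I).2]
    ext f
    constructor
    · rintro ⟨⟨g, hg, rfl⟩, hS⟩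
      have hp := t.plain_of_name_mem (R := g.rel) (sh := g.list.map pathShape)
        (Finset.mem_insert.2 (Or.inl hS))
      rw [t.fact_of_plain hp] at hS ⊢
      exact ⟨hg, hS⟩
    · rintro ⟨hf, hS⟩
      exact ⟨⟨f, hf, t.fact_of_plain (hSflat I f hf hS)⟩, hS⟩
  · rintro ⟨r', hr', h⟩
    obtain ⟨r, hr, σ, -, rfl⟩ := t.hasRule_program hr'
    rcases h with h | ⟨R, hR, h⟩
    · exact absurd (t.arity_name_le hΓ hSa _ _) (not_le.2 h)
    · obtain ⟨L, -, -, Q', -, rfl⟩ := t.inBody_program hR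
      exact absurd (t.arity_name_le hΓ hSa _ _) (not_le.2 h)
  · rintro ⟨r', hr', L', hL', e₁, e₂, h⟩
    obtain ⟨r, hr, σ, -, rfl⟩ := t.hasRule_program hr'
    obtain ⟨L, hL, -, rfl⟩ := t.mem_body_rule.1 hL'
    rw [Splitting.literal_atom] at h
    cases hA : L.atom with
    | pred Q => simp [hA, Splitting.atom] at h
    | eqn e₁ e₂ => exact ⟨r, hr, L, hL, e₁, e₂, hA⟩
  · rintro ⟨r', hr', A, hA⟩
    obtain ⟨r, hr, σ, -, rfl⟩ := t.hasRule_program hr'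
    obtain ⟨L, hL, -, h⟩ := t.mem_body_rule.1 hA
    cases L with
    | pos A' => simp [Splitting.literal] at h
    | neg A' => exact ⟨r, hr, A', hL⟩
  · intro hR
    by_contra hR'
    obtain ⟨rk, hrk⟩ := P.exists_rank hR'
    classical
    -- The original name is recovered from the coded one, so a rank of the old program serves for
    -- the new one.
    let origin : RelName → RelName := fun R =>
      if h : ∃ T : RelName, ∃ sh : List (List Bool), sh.length = T.arity ∧ t.name T sh = R then
        h.choose else R
    have horigin : ∀ σ (Q : Predicate dom), origin (t.pred σ Q).rel = Q.rel := by
      intro σ Q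
      have h : ∃ T : RelName, ∃ sh : List (List Bool), sh.length = T.arity ∧
          t.name T sh = (t.pred σ Q).rel := ⟨Q.rel, _, by simp [length_predList], rfl⟩
      simp only [origin, dif_pos h]
      obtain ⟨sh, hl, hn⟩ := h.choose_spec
      exact (t.name_inj hl (by simp [length_predList]) hn).1
    refine t.program.not_uses_R_of_rank (fun R => rk (origin R)) ?_ hR
    rintro R₁ R₂ ⟨⟨r₂', hr₂', h₂⟩, r', hr', rfl, hb⟩
    obtain ⟨r, hr, σ, -, rfl⟩ := t.hasRule_program hr'
    obtain ⟨r₂, hr₂, σ₂, -, rfl⟩ := t.hasRule_program hr₂'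
    obtain ⟨L, hL, -, Q', hA, rfl⟩ := t.inBody_program hb
    have h3 : r₂.head.rel = Q'.rel := by
      have := congrArg origin h₂
      rwa [horigin, show (t.rule σ₂ r₂).head = t.pred σ₂ r₂.head from rfl, horigin] at this
    rw [show (t.rule σ r).head = t.pred σ r.head from rfl, horigin, horigin]
    exact hrk _ _ ⟨⟨r₂, hr₂, h3⟩, r, hr, rfl, L, hL, Q', hA, rfl⟩
  · rintro hS ⟨R₁, R₂, ⟨r₁', hr₁, rfl⟩, ⟨r₂', hr₂, rfl⟩, hne⟩
    by_contra hI
    -- A rule copy exists only because it fired in some run, and there its head was a flat output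
    -- fact.
    have : ∀ r', t.program.HasRule r' → r'.head.rel = S := by
      intro r' hr'
      obtain ⟨r, hr, σ, ⟨I, M, ν, -, -, hh, rfl⟩, rfl⟩ := t.hasRule_program hr'
      have hrel := head_rel_of_single hI hS hr
      obtain ⟨ν', hν'⟩ := Splitting.exists_match r ν
      have h1 := t.eval_pred (Q := r.head) fun x hx => hν' x (Or.inl hx)
      rw [t.fact_of_plain (hSflat I _ hh hrel)] at h1
      exact (congrArg Fact.rel h1).trans hrel
    exact hne ((this _ hr₁).trans (this _ hr₂).symm)

/-! ### Encoding packed values by pairs of flat paths -/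

def tokenValue (o c : dom) : Bool ⊕ Value dom → Value dom
  | .inl true => .atom o
  | .inl false => .atom c
  | .inr v => v

/-- Spell out a path, with the atomic values `o` and `c` as brackets. -/
def track (o c : dom) (p : Path dom) : Path dom := (pathTokens p).map (tokenValue o c)

theorem track_append (o c : dom) (p q : Path dom) : track o c (p ++ q) = track o c p ++ track o c q := by
  simp [track, pathTokens_append]

theorem track_nil (o c : dom) : track o c [] = [] := rfl

theorem track_atom (o c x : dom) (p : Path dom) :
    track o c (.atom x :: p) = .atom x :: track o c p := by
  simp [track, pathTokens_atom, tokenValue]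

theorem track_packed (o c : dom) (q p : Path dom) :
    track o c (.packed q :: p) = .atom o :: (track o c q ++ .atom c :: track o c p) := by
  simp [track, pathTokens_packed, tokenValue]

theorem track_flat (o c : dom) {p : Path dom} (h : p.Flat) : track o c p = p := by
  simp [track, pathTokens_flat h, Function.comp_def, tokenValue]

theorem length_track (o c o' c' : dom) (p : Path dom) :
    (track o c p).length = (track o' c' p).length := by
  simp [track]

/-- A letter looks the same in both tracks, while a bracket looks different. So the pair reveals
whether the token is a letter, and if not, which bracket it is. -/
theorem tokenValue_inj {a b : dom} (hab : a ≠ b) {x y : Bool ⊕ Value dom}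
    (h₁ : tokenValue a b x = tokenValue a b y) (h₂ : tokenValue b a x = tokenValue b a y) : x = y := by
  rcases x with (_ | _) | v <;> rcases y with (_ | _) | w <;> simp only [tokenValue] at h₁ h₂
  all_goals first
    | rfl
    | exact absurd (Value.atom.inj h₁) hab
    | exact absurd (Value.atom.inj h₂) hab
    | exact absurd (Value.atom.inj (h₁.trans h₂.symm)) hab
    | exact absurd (Value.atom.inj (h₂.trans h₁.symm)) hab
    | exact absurd (Value.atom.inj (h₁.symm.trans h₂)) hab
    | exact absurd (Value.atom.inj (h₂.symm.trans h₁)) hab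
    | rw [h₁]

theorem track_inj {a b : dom} (hab : a ≠ b) {p q : Path dom} (h₁ : track a b p = track a b q)
    (h₂ : track b a p = track b a q) : p = q := by
  apply pathTokens_injective
  simp only [track] at h₁ h₂
  generalize pathTokens p = s at h₁ h₂
  generalize pathTokens q = t at h₁ h₂
  induction s generalizing t with
  | nil => simpa using h₁.symm
  | cons x s ih =>
    cases t with
    | nil => simp at h₁
    | cons y t =>
      simp only [List.map_cons, List.cons.injEq] at h₁ h₂
      rw [tokenValue_inj hab h₁.1 h₂.1, ih t h₁.2 h₂.2]

theorem track_concat_inj {a b : dom} (hab : a ≠ b) {p q : Path dom}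
    (h : track a b p ++ track b a p = track a b q ++ track b a q) : p = q := by
  have hl := congrArg List.length h
  rw [List.length_append, List.length_append, length_track b a a b p, length_track b a a b q] at hl
  obtain ⟨h₁, h₂⟩ := List.append_inj h (by omega)
  exact track_inj hab h₁ h₂

/-- Spelling out makes nested parts contiguous, so subpaths at any depth become factors of the token
sequence. -/
theorem Subpath.tokens {s p : Path dom} (h : Subpath s p) : pathTokens s <:+: pathTokens p := by
  induction h with
  | factor u p v =>
    rw [pathTokens_append, pathTokens_append]
    exact ⟨_, _, rfl⟩
  | nested u q v p _ ih =>
    rw [pathTokens_append, pathTokens_packed]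
    obtain ⟨x, y, h⟩ := ih
    refine ⟨pathTokens u ++ .inl true :: x, y ++ .inl false :: pathTokens v, ?_⟩
    simp [← h]

/-- The index `2 * n + i` provides a separate path variable for each of the two tracks. Atomic
variables are shared, being equal in both. -/
def exprTrack (o c : dom) (i : ℕ) : PathExpr dom → PathExpr dom
  | .const a => .const a
  | .var (.atomic n) => .var (.atomic n)
  | .var (.path n) => .var (.path (2 * n + i))
  | .pack e => .concat (.const o) (.concat (exprTrack o c i e) (.const c))
  | .empty => .empty
  | .concat e₁ e₂ => .concat (exprTrack o c i e₁) (exprTrack o c i e₂)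

theorem not_hasPacking_exprTrack (o c : dom) (i : ℕ) (e : PathExpr dom) :
    ¬ (exprTrack o c i e).HasPacking := by
  induction e with
  | var x => cases x <;> simp [exprTrack, PathExpr.HasPacking]
  | _ => simp [exprTrack, PathExpr.HasPacking, *]

def trackVar (i : ℕ) : Var → Var
  | .atomic n => .atomic n
  | .path n => .path (2 * n + i)

theorem vars_exprTrack (o c : dom) (i : ℕ) (e : PathExpr dom) :
    (exprTrack o c i e).vars = trackVar i '' e.vars := by
  induction e with
  | var x => cases x <;> simp [exprTrack, PathExpr.vars, trackVar]
  | concat e₁ e₂ ih₁ ih₂ => simp only [exprTrack, PathExpr.vars, ih₁, ih₂, Set.image_union]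
  | _ => simp [exprTrack, PathExpr.vars, *]

theorem eval_exprTrack {o c : dom} {i : ℕ} {ν ν' : Valuation dom} {e : PathExpr dom}
    (h : ∀ x ∈ e.vars, ν'.get (trackVar i x) = track o c (ν.get x)) :
    (exprTrack o c i e).eval ν' = track o c (e.eval ν) := by
  induction e with
  | const a => simp [exprTrack, PathExpr.eval, track_atom, track_nil]
  | var x =>
    have := h x rfl
    cases x <;> exact this
  | pack e ih =>
    simp only [exprTrack, PathExpr.eval, track_packed, ih h, track_nil]
    simp
  | empty => rfl
  | concat e₁ e₂ ih₁ ih₂ =>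
    simp only [exprTrack, PathExpr.eval, track_append]
    rw [ih₁ fun x hx => h x (Or.inl hx), ih₂ fun x hx => h x (Or.inr hx)]

theorem mkFact_pair_inj {R R' : RelName} (h : R.arity = 2) {p q p' q' : Path dom}
    (he : mkFact R [p, q] = mkFact R' [p', q']) : R = R' ∧ p = p' ∧ q = q' := by
  have h1 : R = R' := congrArg Fact.rel he
  have := mkFact_inj (by simp [h]) (by simp [← h1, h]) he
  exact ⟨h1, by simpa using this.2⟩

/-- The data of the pair encoding: the brackets are `(a, b)` and `(b, a)`. -/
structure PairCoding (dom : Type u) where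
  Γ : Schema
  S : RelName
  a : dom
  b : dom
  hab : a ≠ b

namespace PairCoding

variable (t : PairCoding dom)

def M : ℕ := (insert t.S t.Γ : Schema).fresh

/-- The relation of all encoded arguments of derived facts. -/
def arg : RelName := ⟨t.M, 2⟩

/-- The relation of well-formed codes. -/
def valid : RelName := ⟨t.M + 1, 2⟩

/-- The offset 2 reserves the first two fresh identifiers for `arg` and `valid`. -/
def name (R : RelName) : RelName := ⟨t.M + 2 + Nat.pair R.id R.arity, 2 * R.arity⟩

theorem name_injective : Function.Injective t.name := by
  rintro ⟨i, n⟩ ⟨j, m⟩ h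
  simp only [name, RelName.mk.injEq, Nat.add_left_cancel_iff, Nat.pair_eq_pair] at h
  simp [h.1]

theorem lt_M {R : RelName} (h : R ∈ insert t.S t.Γ) : R.id < t.M := Schema.lt_fresh h

theorem arg_ne_valid : t.arg ≠ t.valid := by simp [arg, valid]

theorem name_ne_arg (R : RelName) : t.name R ≠ t.arg := by
  simp only [name, arg, ne_eq, RelName.mk.injEq]; omega

theorem name_ne_valid (R : RelName) : t.name R ≠ t.valid := by
  simp only [name, valid, ne_eq, RelName.mk.injEq]; omega

theorem new_not_mem {R : RelName} (h : R = t.arg ∨ R = t.valid ∨ ∃ T, R = t.name T) :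
    R ∉ insert t.S t.Γ := by
  intro hR
  have := t.lt_M hR
  rcases h with rfl | rfl | ⟨T, rfl⟩ <;> simp only [arg, valid, name] at this <;> omega

def codes (p : Path dom) : List (Path dom) := [track t.a t.b p, track t.b t.a p]

def exprCodes (e : PathExpr dom) : List (PathExpr dom) :=
  [exprTrack t.a t.b 0 e, exprTrack t.b t.a 1 e]

def fact (f : Fact dom) : Fact dom := mkFact (t.name f.rel) (f.list.flatMap t.codes)

def pred (Q : Predicate dom) : Predicate dom := mkPred (t.name Q.rel) (Q.list.flatMap t.exprCodes)

theorem length_flatMap_codes (l : List (Path dom)) : (l.flatMap t.codes).length = 2 * l.length := by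
  induction l with
  | nil => rfl
  | cons p l ih => simp [codes, ih]; omega

theorem length_flatMap_exprCodes (l : List (PathExpr dom)) :
    (l.flatMap t.exprCodes).length = 2 * l.length := by
  induction l with
  | nil => rfl
  | cons p l ih => simp [exprCodes, ih]; omega

theorem codes_inj {l l' : List (Path dom)} (h : l.flatMap t.codes = l'.flatMap t.codes) : l = l' := by
  induction l generalizing l' with
  | nil => cases l' with
    | nil => rfl
    | cons q l' => simp [codes] at h
  | cons p l ih => cases l' with
    | nil => simp [codes] at h
    | cons q l' =>
      simp only [codes, List.flatMap_cons, List.cons_append, List.cons.injEq, List.nil_append] at h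
      rw [track_inj t.hab h.1 h.2.1, ih h.2.2]

theorem fact_injective : Function.Injective t.fact := by
  intro f g h
  obtain ⟨h1, h2⟩ := mkFact_inj (by rw [length_flatMap_codes, length_list]; rfl)
    (by rw [length_flatMap_codes, length_list]; rfl) h
  exact fact_ext (t.name_injective h1) (t.codes_inj h2)

/-- `ν'` assigns the codes of the value of a variable under `ν`. -/
def Match (ν ν' : Valuation dom) (x : Var) : Prop :=
  ν'.get (trackVar 0 x) = track t.a t.b (ν.get x) ∧ ν'.get (trackVar 1 x) = track t.b t.a (ν.get x)

theorem map_exprCodes {ν ν' : Valuation dom} {e : PathExpr dom} (h : ∀ x ∈ e.vars, t.Match ν ν' x) :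
    (t.exprCodes e).map (·.eval ν') = t.codes (e.eval ν) := by
  simp only [exprCodes, codes, List.map_cons, List.map_nil]
  rw [eval_exprTrack fun x hx => (h x hx).1, eval_exprTrack fun x hx => (h x hx).2]

theorem eval_pred {ν ν' : Valuation dom} {Q : Predicate dom} (h : ∀ x ∈ Q.vars, t.Match ν ν' x) :
    (t.pred Q).eval ν' = t.fact (Q.eval ν) := by
  rw [pred, eval_mkPred, fact, list_eval, List.flatMap_map, List.map_flatMap]
  congr 1
  exact List.flatMap_congr fun e he => t.map_exprCodes fun x hx => h x (mem_predVars.2 ⟨e, he, hx⟩)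

def CodeVar (y : Var) : Set Var := {trackVar 0 y, trackVar 1 y}

theorem mem_vars_exprCodes {e : PathExpr dom} {x : Var} :
    (∃ c ∈ t.exprCodes e, x ∈ c.vars) ↔ ∃ y ∈ e.vars, x ∈ CodeVar y := by
  simp only [exprCodes, List.mem_cons, List.not_mem_nil, or_false, exists_eq_or_imp, exists_eq_left,
    vars_exprTrack, CodeVar, Set.mem_insert_iff, Set.mem_singleton_iff, Set.mem_image]
  constructor
  · rintro (⟨y, hy, rfl⟩ | ⟨y, hy, rfl⟩)
    exacts [⟨y, hy, Or.inl rfl⟩, ⟨y, hy, Or.inr rfl⟩]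
  · rintro ⟨y, hy, rfl | rfl⟩
    exacts [Or.inl ⟨y, hy, rfl⟩, Or.inr ⟨y, hy, rfl⟩]

theorem mem_vars_pred {Q : Predicate dom} {x : Var} :
    x ∈ (t.pred Q).vars ↔ ∃ y ∈ Q.vars, x ∈ CodeVar y := by
  rw [pred, vars_mkPred (by rw [length_flatMap_exprCodes, length_predList]; rfl)]
  constructor
  · rintro ⟨c, hc, hx⟩
    obtain ⟨e, he, hc⟩ := List.mem_flatMap.1 hc
    obtain ⟨y, hy, hx⟩ := t.mem_vars_exprCodes.1 ⟨c, hc, hx⟩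
    exact ⟨y, mem_predVars.2 ⟨e, he, hy⟩, hx⟩
  · rintro ⟨y, hy, hx⟩
    obtain ⟨e, he, hy⟩ := mem_predVars.1 hy
    obtain ⟨c, hc, hx⟩ := t.mem_vars_exprCodes.2 ⟨y, hy, hx⟩
    exact ⟨c, List.mem_flatMap.2 ⟨e, he, hc⟩, hx⟩

theorem not_hasPacking_codes {R : RelName} {l : List (PathExpr dom)} :
    ¬ (mkPred R (l.flatMap t.exprCodes)).HasPacking := by
  intro h
  obtain ⟨e, he, h⟩ := hasPacking_mkPred h
  obtain ⟨e', -, he⟩ := List.mem_flatMap.1 he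
  simp only [exprCodes, List.mem_cons, List.not_mem_nil, or_false] at he
  rcases he with rfl | rfl <;> exact not_hasPacking_exprTrack _ _ _ _ h

def joined (e : PathExpr dom) : PathExpr dom := concatExprs (t.exprCodes e)

theorem mem_vars_joined {e : PathExpr dom} {x : Var} :
    x ∈ (t.joined e).vars ↔ ∃ y ∈ e.vars, x ∈ CodeVar y := by
  rw [joined, vars_concatExprs, mem_vars_exprCodes]

theorem eval_joined {ν ν' : Valuation dom} {e : PathExpr dom} (h : ∀ x ∈ e.vars, t.Match ν ν' x) :
    (t.joined e).eval ν' = track t.a t.b (e.eval ν) ++ track t.b t.a (e.eval ν) := by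
  have := t.map_exprCodes h
  rw [joined, eval_concatExprs, List.flatMap_def, this]
  simp [codes]

def atom : Atom dom → Atom dom
  | .pred Q => .pred (t.pred Q)
  | .eqn e₁ e₂ => .eqn (t.joined e₁) (t.joined e₂)

def literal : Literal dom → Literal dom
  | .pos A => .pos (t.atom A)
  | .neg A => .neg (t.atom A)

theorem literal_atom (L : Literal dom) : (t.literal L).atom = t.atom L.atom := by
  cases L <;> rfl

theorem mem_vars_atom {A : Atom dom} {x : Var} :
    x ∈ (t.atom A).vars ↔ ∃ y ∈ A.vars, x ∈ CodeVar y := by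
  cases A with
  | pred Q => exact t.mem_vars_pred
  | eqn e₁ e₂ =>
    simp only [atom, Atom.vars, Set.mem_union, mem_vars_joined, or_and_right, exists_or]

theorem not_hasPacking_atom (A : Atom dom) : ¬ (t.atom A).HasPacking := by
  cases A with
  | pred Q => exact t.not_hasPacking_codes
  | eqn e₁ e₂ =>
    rintro (h | h)
    all_goals
      obtain ⟨c, hc, h⟩ := hasPacking_concatExprs h
      simp only [exprCodes, List.mem_cons, List.not_mem_nil, or_false] at hc
      rcases hc with rfl | rfl <;> exact not_hasPacking_exprTrack _ _ _ _ h

theorem sat_eqn {ν ν' : Valuation dom} {e₁ e₂ : PathExpr dom}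
    (h₁ : ∀ x ∈ e₁.vars, t.Match ν ν' x) (h₂ : ∀ x ∈ e₂.vars, t.Match ν ν' x) :
    (t.joined e₁).eval ν' = (t.joined e₂).eval ν' ↔ e₁.eval ν = e₂.eval ν := by
  rw [t.eval_joined h₁, t.eval_joined h₂]
  exact ⟨fun h => track_concat_inj t.hab h, fun h => by rw [h]⟩

/-- The two track variables could match arbitrary pairs of flat paths; the guard restricts them to
the two codes of a single path. -/
def guard (n : ℕ) : Literal dom :=
  .pos (.pred (mkPred t.valid [.var (.path (2 * n + 0)), .var (.path (2 * n + 1))]))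

open Classical in
noncomputable def body (r : Rule dom) : List (Literal dom) :=
  (((List.range r.varBound).filter fun n => .path n ∈ r.vars).map t.guard) ++ r.body.map t.literal

theorem guard_mem {r : Rule dom} {n : ℕ} (h : .path n ∈ r.vars) : t.guard n ∈ t.body r := by
  refine List.mem_append_left _ (List.mem_map_of_mem (List.mem_filter.2 ⟨?_, by simpa using h⟩))
  exact List.mem_range.2 (r.lt_varBound h)

theorem mem_body {r : Rule dom} {L' : Literal dom} (h : L' ∈ t.body r) :
    (∃ n, .path n ∈ r.vars ∧ L' = t.guard n) ∨ ∃ L ∈ r.body, L' = t.literal L := by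
  rcases List.mem_append.1 h with h | h
  · obtain ⟨n, hn, rfl⟩ := List.mem_map.1 h
    exact Or.inl ⟨n, by simpa using (List.mem_filter.1 hn).2, rfl⟩
  · obtain ⟨L, hL, rfl⟩ := List.mem_map.1 h
    exact Or.inr ⟨L, hL, rfl⟩

theorem literal_mem {r : Rule dom} {L : Literal dom} (h : L ∈ r.body) : t.literal L ∈ t.body r :=
  List.mem_append_right _ (List.mem_map_of_mem h)

theorem vars_pair {R : RelName} (h : R.arity = 2) {e₁ e₂ : PathExpr dom} :
    (mkPred R [e₁, e₂]).vars = e₁.vars ∪ e₂.vars := by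
  ext x
  rw [vars_mkPred (by simp [h])]
  simp

theorem limited {r : Rule dom} {y : Var} (h : Limited r.body y) :
    ∀ x ∈ CodeVar y, Limited (t.body r) x := by
  induction h with
  | pred Q y hQ hy =>
    exact fun x hx => .pred _ x (t.literal_mem hQ) (t.mem_vars_pred.2 ⟨y, hy, hx⟩)
  | eqn_right e₁ e₂ y he _ hy ih =>
    refine fun x hx => .eqn_right _ _ x (t.literal_mem he) (fun z hz => ?_)
      (t.mem_vars_joined.2 ⟨y, hy, hx⟩)
    obtain ⟨w, hw, hz⟩ := t.mem_vars_joined.1 hz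
    exact ih w hw z hz
  | eqn_left e₁ e₂ y he _ hy ih =>
    refine fun x hx => .eqn_left _ _ x (t.literal_mem he) (fun z hz => ?_)
      (t.mem_vars_joined.2 ⟨y, hy, hx⟩)
    obtain ⟨w, hw, hz⟩ := t.mem_vars_joined.1 hz
    exact ih w hw z hz

/-- The encoded head, and the arguments of the head. -/
def heads (r : Rule dom) : List (Predicate dom) :=
  t.pred r.head :: r.head.list.map fun e => mkPred t.arg (t.exprCodes e)

theorem mem_vars_heads {r : Rule dom} {h : Predicate dom} (hh : h ∈ t.heads r) {x : Var}
    (hx : x ∈ h.vars) : ∃ y ∈ r.head.vars, x ∈ CodeVar y := by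
  rcases List.mem_cons.1 hh with rfl | hh
  · exact t.mem_vars_pred.1 hx
  · obtain ⟨e, he, rfl⟩ := List.mem_map.1 hh
    rw [vars_mkPred (by rfl)] at hx
    obtain ⟨y, hy, hx⟩ := t.mem_vars_exprCodes.1 hx
    exact ⟨y, mem_predVars.2 ⟨e, he, hy⟩, hx⟩

theorem safe {r : Rule dom} (hs : r.Safe) {h : Predicate dom} (hh : h ∈ t.heads r) :
    (Rule.mk h (t.body r)).Safe := by
  rintro x (hx | ⟨L', hL', hx⟩)
  · obtain ⟨y, hy, hx⟩ := t.mem_vars_heads hh hx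
    exact t.limited (hs y (Or.inl hy)) x hx
  · rcases t.mem_body hL' with ⟨n, hn, rfl⟩ | ⟨L, hL, rfl⟩
    · exact .pred _ x hL' hx
    · rw [literal_atom] at hx
      obtain ⟨y, hy, hx⟩ := t.mem_vars_atom.1 hx
      exact t.limited (hs y (Or.inr ⟨L, hL, hy⟩)) x hx

/-- The rules generating the codes of all subpaths of arguments. -/
def validRules : List (Rule dom) :=
  [⟨mkPred t.valid [.empty, .empty], []⟩,
   ⟨mkPred t.valid [concatExprs [.var (.atomic 0), .var (.path 0)],
      concatExprs [.var (.atomic 0), .var (.path 1)]],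
    [.pos (.pred (mkPred t.valid [.var (.path 0), .var (.path 1)])),
     .pos (.pred (mkPred t.arg
      [concatExprs [.var (.path 2), .var (.atomic 0), .var (.path 0), .var (.path 3)],
       concatExprs [.var (.path 4), .var (.atomic 0), .var (.path 1), .var (.path 5)]]))]⟩,
   ⟨mkPred t.valid [concatExprs [.const t.a, .var (.path 6), .const t.b, .var (.path 0)],
      concatExprs [.const t.b, .var (.path 7), .const t.a, .var (.path 1)]],
    [.pos (.pred (mkPred t.valid [.var (.path 0), .var (.path 1)])),
     .pos (.pred (mkPred t.valid [.var (.path 6), .var (.path 7)])),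
     .pos (.pred (mkPred t.arg
      [concatExprs [.var (.path 2), .const t.a, .var (.path 6), .const t.b, .var (.path 0),
        .var (.path 3)],
       concatExprs [.var (.path 4), .const t.b, .var (.path 7), .const t.a, .var (.path 1),
        .var (.path 5)]]))]⟩]

theorem safe_validRules : ∀ r ∈ t.validRules, r.Safe := by
  intro r hr
  simp only [validRules, List.mem_cons, List.not_mem_nil, or_false] at hr
  have hv : t.valid.arity = 2 := rfl
  have ha : t.arg.arity = 2 := rfl
  rcases hr with rfl | rfl | rfl <;> apply safe_of_pos <;>
    simp [Rule.vars, vars_pair, hv, ha, concatExprs, PathExpr.vars, Literal.atom, Atom.vars] <;> tauto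

/-- The rules for valid codes are repeated in every stratum, because new arguments appear there and
require further codes. -/
noncomputable def stratum (Δ : Stratum dom) : Stratum dom :=
  t.validRules ++ Δ.flatMap fun r => (t.heads r).map fun h => ⟨h, t.body r⟩

theorem mem_stratum {Δ : Stratum dom} {r' : Rule dom} : r' ∈ t.stratum Δ ↔
    r' ∈ t.validRules ∨ ∃ r ∈ Δ, ∃ h ∈ t.heads r, r' = ⟨h, t.body r⟩ := by
  simp [stratum, eq_comm]

def argFact (p : Path dom) : Fact dom := mkFact t.arg (t.codes p)

def validFact (p : Path dom) : Fact dom := mkFact t.valid (t.codes p)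

def argsOf (L : Set (Fact dom)) : Set (Path dom) := insert [] (argPaths L)

/-- The paths whose codes occur in the codes of arguments. -/
def validPaths (L : Set (Fact dom)) : Set (Path dom) :=
  {p | ∃ q ∈ argsOf L, track t.a t.b p <:+: track t.a t.b q ∧ track t.b t.a p <:+: track t.b t.a q}

def baseFacts (L : Set (Fact dom)) : Set (Fact dom) := t.fact '' L ∪ t.argFact '' argsOf L

theorem argPaths_mono {K L : Set (Fact dom)} (h : K ⊆ L) : argPaths K ⊆ argPaths L :=
  fun _ ⟨f, hf, hp⟩ => ⟨f, h hf, hp⟩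

theorem baseFacts_mono {K L : Set (Fact dom)} (h : K ⊆ L) : t.baseFacts K ⊆ t.baseFacts L :=
  Set.union_subset_union (Set.image_mono h)
    (Set.image_mono (Set.insert_subset_insert (argPaths_mono h)))

theorem finite_baseFacts {L : Set (Fact dom)} (h : L.Finite) : (t.baseFacts L).Finite :=
  (h.image _).union (((finite_argPaths h).insert _).image _)

/-- Each track of a valid code is a factor of the track of an argument, and finitely many words have
finitely many factors. -/
theorem finite_validFacts {L : Set (Fact dom)} (h : L.Finite) :
    (t.validFact '' t.validPaths L).Finite := by
  have hfin : ∀ o c : dom, {x | ∃ q ∈ argsOf L, x <:+: track o c q}.Finite := by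
    intro o c
    have : {x | ∃ q ∈ argsOf L, x <:+: track o c q} ⊆
        ⋃ q ∈ argsOf L, {s | Subpath s (track o c q)} := by
      rintro x ⟨q, hq, u, v, hx⟩
      refine Set.mem_biUnion hq ?_
      change Subpath x (track o c q)
      rw [← hx]
      exact .factor u x v
    exact Set.Finite.subset (((finite_argPaths h).insert _).biUnion fun q _ => finite_subpaths _) this
  refine (((hfin t.a t.b).prod (hfin t.b t.a)).image
    fun xy => mkFact t.valid [xy.1, xy.2]).subset ?_
  rintro _ ⟨p, ⟨q, hq, h1, h2⟩, rfl⟩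
  exact ⟨(_, _), ⟨⟨q, hq, h1⟩, ⟨q, hq, h2⟩⟩, rfl⟩

theorem arg_mem_iff {L : Set (Fact dom)} {x y : Path dom} {W : Set (Fact dom)}
    (hW : ∀ f ∈ W, f.rel = t.valid) (h : mkFact t.arg [x, y] ∈ t.baseFacts L ∪ W) :
    ∃ q ∈ argsOf L, x = track t.a t.b q ∧ y = track t.b t.a q := by
  rcases h with (⟨f, -, h⟩ | ⟨q, hq, h⟩) | h
  · exact absurd (congrArg Fact.rel h) (t.name_ne_arg _)
  · obtain ⟨-, h1, h2⟩ := mkFact_pair_inj rfl h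
    exact ⟨q, hq, h1.symm, h2.symm⟩
  · exact absurd (hW _ h) t.arg_ne_valid

theorem valid_mem_iff {L : Set (Fact dom)} {x y : Path dom} {V : Set (Path dom)}
    (h : mkFact t.valid [x, y] ∈ t.baseFacts L ∪ t.validFact '' V) :
    ∃ p ∈ V, x = track t.a t.b p ∧ y = track t.b t.a p := by
  rcases h with (⟨f, -, h⟩ | ⟨q, hq, h⟩) | ⟨p, hp, h⟩
  · exact absurd (congrArg Fact.rel h) (t.name_ne_valid _)
  · exact absurd (congrArg Fact.rel h) t.arg_ne_valid
  · obtain ⟨-, h1, h2⟩ := mkFact_pair_inj rfl h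
    exact ⟨p, hp, h1.symm, h2.symm⟩

theorem fact_mem_iff {L : Set (Fact dom)} {W : Set (Fact dom)} (hW : ∀ f ∈ W, f.rel = t.valid)
    {f : Fact dom} : t.fact f ∈ t.baseFacts L ∪ W ↔ f ∈ L := by
  constructor
  · rintro ((⟨g, hg, h⟩ | ⟨q, -, h⟩) | h)
    · exact t.fact_injective h ▸ hg
    · exact absurd (congrArg Fact.rel h).symm (t.name_ne_arg _)
    · exact absurd (hW _ h) (t.name_ne_valid _)
  · exact fun h => Or.inl (Or.inl ⟨f, h, rfl⟩)

theorem validFacts_rel (V : Set (Path dom)) : ∀ f ∈ t.validFact '' V, f.rel = t.valid := by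
  rintro _ ⟨p, -, rfl⟩
  rfl

theorem neg_mem_stratum {Δ : Stratum dom} {r' : Rule dom} (hr' : r' ∈ t.stratum Δ) {A' : Atom dom}
    (h : .neg A' ∈ r'.body) : ∃ r ∈ Δ, ∃ A, .neg A ∈ r.body ∧ A' = t.atom A := by
  rcases t.mem_stratum.1 hr' with hr | ⟨r, hr, hd, -, rfl⟩
  · simp only [validRules, List.mem_cons, List.not_mem_nil, or_false] at hr
    rcases hr with rfl | rfl | rfl <;> simp at h
  · rcases t.mem_body h with ⟨n, -, h⟩ | ⟨L, hL, h⟩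
    · simp [guard] at h
    · cases L with
      | pos A => simp [literal] at h
      | neg A => exact ⟨r, hr, A, hL, by simpa [literal] using h⟩

theorem isHead_stratum {Δ : Stratum dom} {R : RelName} (h : (t.stratum Δ).IsHead R) :
    R = t.valid ∨ R = t.arg ∨ ∃ T, Δ.IsHead T ∧ R = t.name T := by
  obtain ⟨r', hr', rfl⟩ := h
  rcases t.mem_stratum.1 hr' with hr | ⟨r, hr, hd, hhd, rfl⟩
  · simp only [validRules, List.mem_cons, List.not_mem_nil, or_false] at hr
    rcases hr with rfl | rfl | rfl <;> exact Or.inl rfl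
  · rcases List.mem_cons.1 hhd with rfl | hhd
    · exact Or.inr (Or.inr ⟨_, ⟨r, hr, rfl⟩, rfl⟩)
    · obtain ⟨e, -, rfl⟩ := List.mem_map.1 hhd
      exact Or.inr (Or.inl rfl)

theorem isHead_name {Δ : Stratum dom} {T : RelName} (h : (t.stratum Δ).IsHead (t.name T)) :
    Δ.IsHead T := by
  rcases t.isHead_stratum h with h | h | ⟨T', hT', h⟩
  · exact absurd h (t.name_ne_valid T)
  · exact absurd h (t.name_ne_arg T)
  · exact t.name_injective h ▸ hT'

theorem negFree {Δ Δ' : Stratum dom} (h : NegFree Δ Δ') : NegFree (t.stratum Δ) (t.stratum Δ') := by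
  intro r' hr' Q' hQ' hh
  obtain ⟨r, hr, A, hA, he⟩ := t.neg_mem_stratum hr' hQ'
  cases A with
  | eqn e₁ e₂ => simp [atom] at he
  | pred Q =>
    simp only [atom, Atom.pred.injEq] at he
    subst he
    exact h r hr Q hA (t.isHead_name hh)

/-- The code of `p` is built from its end: first that of the tail, then a letter or a packed value
in front. All intermediate codes are factors of the tracks of the same argument `q`, as the rules
demand. -/
theorem valid_complete {M : Set (Fact dom)} (hM : ∀ r ∈ t.validRules, r.Sat M) (p : Path dom) :
    ∀ q, t.argFact q ∈ M → track t.a t.b p <:+: track t.a t.b q →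
      track t.b t.a p <:+: track t.b t.a q → t.validFact p ∈ M := by
  induction p using path_induction with
  | nil =>
    intro q _ _ _
    have := hM _ List.mem_cons_self ⟨fun _ => t.a, fun _ => []⟩ (by simp)
    simpa [eval_mkPred, PathExpr.eval, validFact, codes, track_nil] using this
  | atom x p ih =>
    intro q hq h1 h2
    rw [track_atom] at h1 h2
    have hp := ih q hq ((List.infix_cons (List.infix_refl _)).trans h1)
      ((List.infix_cons (List.infix_refl _)).trans h2)
    obtain ⟨u, v, h1⟩ := h1
    obtain ⟨w, z, h2⟩ := h2
    have := hM _ (List.mem_cons_of_mem _ List.mem_cons_self) ⟨fun _ => x, fun n => match n with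
      | 0 => track t.a t.b p
      | 1 => track t.b t.a p
      | 2 => u
      | 3 => v
      | 4 => w
      | _ => z⟩ (by
        simp only [List.mem_cons, List.not_mem_nil, or_false, forall_eq_or_imp, forall_eq,
          Literal.Sat, Atom.Sat, eval_mkPred, List.map_cons, List.map_nil, eval_concatExprs,
          List.flatMap_cons, List.flatMap_nil, PathExpr.eval]
        refine ⟨hp, ?_⟩
        simp only [argFact, codes, ← h1, ← h2] at hq
        simpa using hq)
    simpa [eval_mkPred, PathExpr.eval, eval_concatExprs, validFact, codes, track_atom] using this
  | packed p' p ihp' ihp =>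
    intro q hq h1 h2
    rw [track_packed] at h1 h2
    have hi' : ∀ (o c : dom) {l : Path dom}, (.atom o :: (track o c p' ++ .atom c :: track o c p)) <:+: l →
        track o c p' <:+: l := fun o c l h =>
      List.IsInfix.trans ⟨[.atom o], .atom c :: track o c p, by simp⟩ h
    have hi : ∀ (o c : dom) {l : Path dom}, (.atom o :: (track o c p' ++ .atom c :: track o c p)) <:+: l →
        track o c p <:+: l := fun o c l h =>
      List.IsInfix.trans ⟨.atom o :: (track o c p' ++ [.atom c]), [], by simp⟩ h
    have hp' := ihp' q hq (hi' _ _ h1) (hi' _ _ h2)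
    have hp := ihp q hq (hi _ _ h1) (hi _ _ h2)
    obtain ⟨u, v, h1⟩ := h1
    obtain ⟨w, z, h2⟩ := h2
    have := hM _ (List.mem_cons_of_mem _ (List.mem_cons_of_mem _ List.mem_cons_self))
      ⟨fun _ => t.a, fun n => match n with
      | 0 => track t.a t.b p
      | 1 => track t.b t.a p
      | 2 => u
      | 3 => v
      | 4 => w
      | 5 => z
      | 6 => track t.a t.b p'
      | _ => track t.b t.a p'⟩ (by
        simp only [List.mem_cons, List.not_mem_nil, or_false, forall_eq_or_imp, forall_eq,
          Literal.Sat, Atom.Sat, eval_mkPred, List.map_cons, List.map_nil, eval_concatExprs,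
          List.flatMap_cons, List.flatMap_nil, PathExpr.eval]
        refine ⟨hp, hp', ?_⟩
        simp only [argFact, codes, ← h1, ← h2] at hq
        simpa using hq)
    simpa [eval_mkPred, PathExpr.eval, eval_concatExprs, validFact, codes, track_packed] using this

theorem match_atomic {ν ν' : Valuation dom} {n : ℕ} (h : ν'.atomic n = ν.atomic n) :
    t.Match ν ν' (.atomic n) := by
  simp [Match, trackVar, Valuation.get, PathExpr.eval, track_atom, track_nil, h]

/-- The rules extend both tracks in parallel by the same letter or by the code of the same packed
value, so derived pairs remain codes. -/
theorem valid_sound (L : Set (Fact dom)) :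
    ∀ r ∈ t.validRules, r.Sat (t.baseFacts L ∪ t.validFact '' t.validPaths L) := by
  intro r hr ν hsat
  simp only [validRules, List.mem_cons, List.not_mem_nil, or_false] at hr
  rcases hr with rfl | rfl | rfl
  · exact Or.inr ⟨[], ⟨[], Or.inl rfl, List.infix_refl _, List.infix_refl _⟩,
      by simp [validFact, codes, track_nil, eval_mkPred, PathExpr.eval]⟩
  · simp only [List.mem_cons, List.not_mem_nil, or_false, forall_eq_or_imp, forall_eq,
      Literal.Sat, Atom.Sat, eval_mkPred, List.map_cons, List.map_nil, eval_concatExprs,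
      List.flatMap_cons, List.flatMap_nil, PathExpr.eval] at hsat
    obtain ⟨p, -, h1, h2⟩ := t.valid_mem_iff hsat.1
    obtain ⟨q, hq, h3, h4⟩ := t.arg_mem_iff (t.validFacts_rel _) hsat.2
    refine Or.inr ⟨.atom (ν.atomic 0) :: p, ⟨q, hq, ?_, ?_⟩, ?_⟩
    · rw [← h3, track_atom, ← h1]
      exact ⟨ν.path 2, ν.path 3, by simp⟩
    · rw [← h4, track_atom, ← h2]
      exact ⟨ν.path 4, ν.path 5, by simp⟩
    · simp [validFact, codes, track_atom, eval_mkPred, PathExpr.eval, eval_concatExprs, ← h1, ← h2]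
  · simp only [List.mem_cons, List.not_mem_nil, or_false, forall_eq_or_imp, forall_eq,
      Literal.Sat, Atom.Sat, eval_mkPred, List.map_cons, List.map_nil, eval_concatExprs,
      List.flatMap_cons, List.flatMap_nil, PathExpr.eval] at hsat
    obtain ⟨p, -, h1, h2⟩ := t.valid_mem_iff hsat.1
    obtain ⟨p', -, h1', h2'⟩ := t.valid_mem_iff hsat.2.1
    obtain ⟨q, hq, h3, h4⟩ := t.arg_mem_iff (t.validFacts_rel _) hsat.2.2
    refine Or.inr ⟨.packed p' :: p, ⟨q, hq, ?_, ?_⟩, ?_⟩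
    · rw [← h3, track_packed, ← h1, ← h1']
      exact ⟨ν.path 2, ν.path 3, by simp⟩
    · rw [← h4, track_packed, ← h2, ← h2']
      exact ⟨ν.path 4, ν.path 5, by simp⟩
    · simp [validFact, codes, track_packed, eval_mkPred, PathExpr.eval, eval_concatExprs, ← h1,
        ← h2, ← h1', ← h2']

theorem eval_guard (M : Set (Fact dom)) (ν' : Valuation dom) (n : ℕ) : (t.guard n).Sat M ν' ↔
    mkFact t.valid [ν'.get (trackVar 0 (.path n)), ν'.get (trackVar 1 (.path n))] ∈ M := by
  simp only [guard, Literal.Sat, Atom.Sat, eval_mkPred]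
  rfl

theorem sat_literal {ν ν' : Valuation dom} {L : Literal dom} (h : ∀ x ∈ L.atom.vars, t.Match ν ν' x)
    {K W : Set (Fact dom)} (hW : ∀ f ∈ W, f.rel = t.valid) :
    (t.literal L).Sat (t.baseFacts K ∪ W) ν' ↔ L.Sat K ν := by
  have hA : ∀ A : Atom dom, (∀ x ∈ A.vars, t.Match ν ν' x) →
      ((t.atom A).Sat (t.baseFacts K ∪ W) ν' ↔ A.Sat K ν) := by
    intro A hA
    cases A with
    | pred Q =>
      change (t.pred Q).eval ν' ∈ _ ↔ _
      rw [t.eval_pred hA, t.fact_mem_iff hW]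
      rfl
    | eqn e₁ e₂ => exact t.sat_eqn (fun x hx => hA x (Or.inl hx)) (fun x hx => hA x (Or.inr hx))
  cases L with
  | pos A => exact hA A h
  | neg A => exact not_congr (hA A h)

/-- Guards allow every translated firing to be decoded. Conversely, in the absence of positive
equations each variable is bound by a predicate, its value is a subpath of an argument, and so its
guard can be derived. The set `V` is arbitrary below the bound, because codes inherited from earlier
strata may be incomplete. -/
theorem lfp_stratum {Δ : Stratum dom} (hn : NegFree Δ Δ) (hs : ∀ r ∈ Δ, r.Safe)
    (he : ∀ r ∈ Δ, ∀ e₁ e₂, .pos (.eqn e₁ e₂) ∉ r.body) {K : Set (Fact dom)} {V : Set (Path dom)}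
    (hV : V ⊆ t.validPaths K) : lfp (t.stratum Δ) (t.baseFacts K ∪ t.validFact '' V) =
      t.baseFacts (lfp Δ K) ∪ t.validFact '' t.validPaths (lfp Δ K) := by
  have hn' := t.negFree hn
  have hKL : K ⊆ lfp Δ K := subset_lfp _ _
  have hVm : t.validPaths K ⊆ t.validPaths (lfp Δ K) := fun p ⟨q, hq, h⟩ =>
    ⟨q, Set.insert_subset_insert (argPaths_mono hKL) hq, h⟩
  have hsub : lfp (t.stratum Δ) (t.baseFacts K ∪ t.validFact '' V) ⊆
      t.baseFacts (lfp Δ K) ∪ t.validFact '' t.validPaths (lfp Δ K) := by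
    refine lfp_induction hn' (Set.union_subset_union (t.baseFacts_mono hKL)
      (Set.image_mono (hV.trans hVm))) ?_
    intro r' hr' ν' hsat hpos
    rcases t.mem_stratum.1 hr' with hr | ⟨r, hr, hd, hhd, rfl⟩
    · refine t.valid_sound _ r' hr ν' fun L hL => ?_
      cases L with
      | neg A =>
        simp only [validRules, List.mem_cons, List.not_mem_nil, or_false] at hr
        rcases hr with rfl | rfl | rfl <;> simp at hL
      | pos A =>
        cases A with
        | pred Q => exact hpos Q hL
        | eqn e₁ e₂ => exact hsat _ hL
    -- The guards provide the decoded path for each path variable of the rule.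
    · have hg : ∀ n, ∃ p : Path dom, .path n ∈ r.vars →
          ν'.path (2 * n + 0) = track t.a t.b p ∧ ν'.path (2 * n + 1) = track t.b t.a p := by
        intro n
        by_cases h : .path n ∈ r.vars
        · have := hpos _ (t.guard_mem h)
          rw [eval_mkPred] at this
          obtain ⟨p, -, h1, h2⟩ := t.valid_mem_iff this
          exact ⟨p, fun _ => ⟨h1, h2⟩⟩
        · exact ⟨[], fun h' => absurd h' h⟩
      choose p hp using hg
      have hm : ∀ x ∈ r.vars, t.Match ⟨ν'.atomic, p⟩ ν' x := by
        intro x hx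
        cases x with
        | atomic n => exact t.match_atomic rfl
        | path n => exact hp n hx
      have hhead : r.head.eval ⟨ν'.atomic, p⟩ ∈ lfp Δ K := by
        refine lfp_sat hn hr _ fun L hL => ?_
        have hmL : ∀ x ∈ L.atom.vars, t.Match ⟨ν'.atomic, p⟩ ν' x := fun x hx =>
          hm x (Or.inr ⟨L, hL, hx⟩)
        have hL' := t.literal_mem hL
        have hWL := t.validFacts_rel (t.validPaths (lfp Δ K))
        cases L with
        | pos A =>
          cases A with
          | pred Q => exact (t.sat_literal hmL hWL).1 (hpos _ hL')
          | eqn e₁ e₂ => exact absurd hL (he r hr e₁ e₂)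
        | neg A =>
          cases A with
          | eqn e₁ e₂ => exact (t.sat_literal (L := .neg (.eqn e₁ e₂)) hmL hWL).1 (hsat _ hL')
          | pred Q =>
            intro h
            have h' := lfp_agree h (hn r hr Q hL)
            exact hsat _ hL' (subset_lfp _ _ ((t.sat_literal (L := .pos (.pred Q)) hmL
              (t.validFacts_rel V)).2 h'))
      refine Or.inl ?_
      rcases List.mem_cons.1 hhd with rfl | hhd
      · exact Or.inl ⟨_, hhead, (t.eval_pred fun x hx => hm x (Or.inl hx)).symm⟩
      · obtain ⟨e, hee, rfl⟩ := List.mem_map.1 hhd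
        refine Or.inr ⟨e.eval ⟨ν'.atomic, p⟩, Or.inr ⟨_, hhead, ?_⟩, ?_⟩
        · rw [list_eval]
          exact List.mem_map_of_mem hee
        · rw [eval_mkPred, t.map_exprCodes fun x hx => hm x (Or.inl (mem_predVars.2 ⟨e, hee, hx⟩))]
          rfl
  refine Set.Subset.antisymm hsub ?_
  have hcomplete := t.valid_complete (M := lfp (t.stratum Δ) (t.baseFacts K ∪ t.validFact '' V))
    fun r hr => lfp_sat hn' (t.mem_stratum.2 (Or.inl hr))
  have hnil : t.argFact [] ∈ lfp (t.stratum Δ) (t.baseFacts K ∪ t.validFact '' V) :=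
    subset_lfp _ _ (Or.inl (Or.inr ⟨[], Or.inl rfl, rfl⟩))
  have hmain : lfp Δ K ⊆ {f | t.fact f ∈ lfp (t.stratum Δ) (t.baseFacts K ∪ t.validFact '' V) ∧
      ∀ q ∈ f.list, t.argFact q ∈ lfp (t.stratum Δ) (t.baseFacts K ∪ t.validFact '' V)} := by
    refine lfp_induction hn (fun f hf => ⟨subset_lfp _ _ (Or.inl (Or.inl ⟨f, hf, rfl⟩)),
      fun q hq => subset_lfp _ _ (Or.inl (Or.inr ⟨q, Or.inr ⟨f, hf, hq⟩, rfl⟩))⟩) ?_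
    intro r hr ν hsat hpos
    -- Even indices carry the first track, odd indices the second.
    let ν' : Valuation dom := ⟨ν.atomic, fun k =>
      if k % 2 = 0 then track t.a t.b (ν.path (k / 2)) else track t.b t.a (ν.path (k / 2))⟩
    have hm : ∀ x, t.Match ν ν' x := by
      intro x
      cases x with
      | atomic n => exact t.match_atomic rfl
      | path n =>
        refine ⟨?_, ?_⟩
        · simp [ν', trackVar, Valuation.get, PathExpr.eval]
        · have h1 : (2 * n + 1) % 2 = 1 := by omega
          have h2 : (2 * n + 1) / 2 = n := by omega
          simp [ν', trackVar, Valuation.get, PathExpr.eval, h1, h2]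
    have hbody : ∀ L' ∈ t.body r, L'.Sat (lfp (t.stratum Δ) (t.baseFacts K ∪ t.validFact '' V)) ν' := by
      intro L' hL'
      rcases t.mem_body hL' with ⟨n, hn, rfl⟩ | ⟨L, hL, rfl⟩
      · rw [t.eval_guard, (hm _).1, (hm _).2]
        cases hs r hr _ hn with
        | pred Q x hQ hx =>
          obtain ⟨e, hee, hx⟩ := mem_predVars.1 hx
          have hi := (subpath_get hx ν).tokens
          refine hcomplete (ν.path n) (e.eval ν) ((hpos Q hQ).2 _ ?_) (hi.map _) (hi.map _)
          rw [list_eval]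
          exact List.mem_map_of_mem hee
        | eqn_right e₁ e₂ x h => exact absurd h (he r hr _ _)
        | eqn_left e₁ e₂ x h => exact absurd h (he r hr _ _)
      · cases L with
        | pos A =>
          cases A with
          | eqn e₁ e₂ => exact absurd hL (he r hr _ _)
          | pred Q =>
            change (t.pred Q).eval ν' ∈ _
            rw [t.eval_pred fun x _ => hm x]
            exact (hpos Q hL).1
        | neg A =>
          have h1 := (t.sat_literal (L := .neg A) (fun x _ => hm x)
            (t.validFacts_rel (t.validPaths (lfp Δ K)))).2 (hsat _ hL)
          cases A with
          | pred Q => exact fun h => h1 (hsub h)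
          | eqn e₁ e₂ => exact h1
    have hfire : ∀ hd ∈ t.heads r, hd.eval ν' ∈
        lfp (t.stratum Δ) (t.baseFacts K ∪ t.validFact '' V) := fun hd hhd =>
      lfp_sat hn' (t.mem_stratum.2 (Or.inr ⟨r, hr, hd, hhd, rfl⟩)) ν' hbody
    refine ⟨?_, fun q hq => ?_⟩
    · rw [← t.eval_pred fun x _ => hm x]
      exact hfire _ List.mem_cons_self
    · rw [list_eval] at hq
      obtain ⟨e, hee, rfl⟩ := List.mem_map.1 hq
      have := hfire _ (List.mem_cons_of_mem _ (List.mem_map_of_mem hee))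
      rwa [eval_mkPred, t.map_exprCodes fun x _ => hm x] at this
  have hargs : ∀ q ∈ argsOf (lfp Δ K),
      t.argFact q ∈ lfp (t.stratum Δ) (t.baseFacts K ∪ t.validFact '' V) := by
    rintro q (rfl | ⟨f, hf, hq⟩)
    · exact hnil
    · exact (hmain hf).2 q hq
  refine Set.union_subset (Set.union_subset ?_ ?_) ?_
  · rintro _ ⟨f, hf, rfl⟩
    exact (hmain hf).1
  · rintro _ ⟨q, hq, rfl⟩
    exact hargs q hq
  · rintro _ ⟨p, ⟨q, hq, h1, h2⟩, rfl⟩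
    exact hcomplete p q (hargs q hq) h1 h2

theorem run_strata {s : List (Stratum dom)} (hn : ∀ Δ ∈ s, NegFree Δ Δ)
    (hs : ∀ Δ ∈ s, ∀ r ∈ Δ, r.Safe)
    (he : ∀ Δ ∈ s, ∀ r ∈ Δ, ∀ e₁ e₂, .pos (.eqn e₁ e₂) ∉ r.body) {K : Set (Fact dom)}
    {V : Set (Path dom)} (hV : V ⊆ t.validPaths K) : ∃ V' ⊆ t.validPaths (run s K),
      run (s.map t.stratum) (t.baseFacts K ∪ t.validFact '' V) =
        t.baseFacts (run s K) ∪ t.validFact '' V' := by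
  induction s generalizing K V with
  | nil => exact ⟨V, hV, rfl⟩
  | cons Δ s ih =>
    have m : Δ ∈ Δ :: s := List.mem_cons_self
    simp only [List.map_cons, run]
    rw [t.lfp_stratum (hn Δ m) (hs Δ m) (he Δ m) hV]
    exact ih (fun Δ' h => hn Δ' (List.mem_cons_of_mem _ h))
      (fun Δ' h => hs Δ' (List.mem_cons_of_mem _ h))
      (fun Δ' h => he Δ' (List.mem_cons_of_mem _ h)) subset_rfl

/-! Copying the input and the output. -/

def varList (dom : Type u) (n : ℕ) : List (PathExpr dom) :=
  (List.range n).map fun i => .var (.path i)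

/-- A flat path contains no brackets, so both of its tracks are the path itself. -/
def dup {α : Type*} (l : List α) : List α := l.flatMap fun x => [x, x]

theorem dup_inj {α : Type*} {l l' : List α} (h : dup l = dup l') : l = l' := by
  induction l generalizing l' with
  | nil => cases l' with
    | nil => rfl
    | cons q l' => simp [dup] at h
  | cons p l ih => cases l' with
    | nil => simp [dup] at h
    | cons q l' =>
      simp only [dup, List.flatMap_cons, List.cons_append, List.cons.injEq, List.nil_append] at h
      rw [h.1, ih h.2.2]

theorem length_dup {α : Type*} (l : List α) : (dup l).length = 2 * l.length := by
  induction l with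
  | nil => rfl
  | cons p l ih => simp [dup] at ih ⊢; omega

theorem map_dup {α β : Type*} (g : α → β) (l : List α) : (dup l).map g = dup (l.map g) := by
  simp [dup, List.map_flatMap, List.flatMap_map]

theorem mem_dup {α : Type*} {l : List α} {x : α} : x ∈ dup l ↔ x ∈ l := by
  simp [dup]

theorem length_varList (n : ℕ) : (varList dom n).length = n := by simp [varList]

theorem exists_eval_varList [Nonempty dom] (l : List (Path dom)) :
    ∃ ν : Valuation dom, (varList dom l.length).map (·.eval ν) = l := by
  obtain ⟨c⟩ := ‹Nonempty dom›
  refine ⟨⟨fun _ => c, fun i => l.getD i []⟩, List.ext_getElem (by simp [varList]) ?_⟩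
  intro i h1 h2
  simp [varList, PathExpr.eval, h2]

theorem fact_of_flat {f : Fact dom} (h : ∀ i, (f.args i).Flat) :
    t.fact f = mkFact (t.name f.rel) (dup f.list) := by
  rw [fact, dup]
  congr 1
  refine List.flatMap_congr fun p hp => ?_
  have := forall_args.1 h p hp
  simp [codes, track_flat _ _ this]

theorem argFact_of_flat {p : Path dom} (h : p.Flat) : t.argFact p = mkFact t.arg [p, p] := by
  simp [argFact, codes, track_flat _ _ h]

def copyHeads (R : RelName) : List (Predicate dom) :=
  mkPred (t.name R) (dup (varList dom R.arity)) ::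
    (varList dom R.arity).map fun e => mkPred t.arg [e, e]

/-- The rule for the empty argument also makes `arg` an IDB name when `Γ` is empty. -/
noncomputable def inputStratum : Stratum dom :=
  ⟨mkPred t.arg [.empty, .empty], []⟩ :: t.Γ.toList.flatMap fun R =>
    (t.copyHeads R).map fun h => ⟨h, [.pos (.pred (mkPred R (varList dom R.arity)))]⟩

theorem mem_inputStratum {r : Rule dom} : r ∈ t.inputStratum ↔
    r = ⟨mkPred t.arg [.empty, .empty], []⟩ ∨ ∃ R ∈ t.Γ, ∃ h ∈ t.copyHeads R,
      r = ⟨h, [.pos (.pred (mkPred R (varList dom R.arity)))]⟩ := by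
  simp [inputStratum, eq_comm]

/-- Output facts are flat, so matching equal tracks reaches all of them and decodes them at once. -/
def outputStratum : Stratum dom :=
  [⟨mkPred t.S (varList dom t.S.arity),
    [.pos (.pred (mkPred (t.name t.S) (dup (varList dom t.S.arity))))]⟩]

theorem negFree_inputStratum (Δ : Stratum dom) : NegFree t.inputStratum Δ := by
  intro r hr Q hQ
  rcases t.mem_inputStratum.1 hr with rfl | ⟨R, -, h, -, rfl⟩ <;> simp at hQ

theorem negFree_outputStratum (Δ : Stratum dom) : NegFree t.outputStratum Δ := by
  intro r hr Q hQ
  rw [List.mem_singleton.1 hr] at hQ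
  simp at hQ

theorem safe_inputStratum : ∀ r ∈ t.inputStratum, r.Safe := by
  intro r hr
  apply safe_of_pos
  rcases t.mem_inputStratum.1 hr with rfl | ⟨R, -, h, hh, rfl⟩
  · simp [Rule.vars, vars_pair (R := t.arg) rfl, PathExpr.vars]
  · have hv : ∀ x, x ∈ (mkPred R (varList dom R.arity)).vars ↔
        ∃ e ∈ varList dom R.arity, x ∈ e.vars := fun x => vars_mkPred (length_varList _)
    rintro x (hx | ⟨L, hL, hx⟩)
    · refine ⟨_, List.mem_cons_self, (hv x).2 ?_⟩
      rcases List.mem_cons.1 hh with rfl | hh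
      · obtain ⟨e, he, hx⟩ := mem_vars_mkPred hx
        exact ⟨e, mem_dup.1 he, hx⟩
      · obtain ⟨e, he, rfl⟩ := List.mem_map.1 hh
        rw [vars_pair rfl, Set.union_self] at hx
        exact ⟨e, he, hx⟩
    · rw [List.mem_singleton.1 hL] at hx
      exact ⟨_, List.mem_cons_self, hx⟩

theorem safe_outputStratum : ∀ r ∈ t.outputStratum, r.Safe := by
  intro r hr
  apply safe_of_pos
  rw [List.mem_singleton.1 hr]
  rintro x (hx | ⟨L, hL, hx⟩)
  · refine ⟨_, List.mem_cons_self, (vars_mkPred (by rw [length_dup, length_varList]; rfl)).2 ?_⟩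
    obtain ⟨e, he, hx⟩ := mem_vars_mkPred hx
    exact ⟨e, mem_dup.2 he, hx⟩
  · rw [List.mem_singleton.1 hL] at hx
    exact ⟨_, List.mem_cons_self, hx⟩

theorem baseFacts_rel {L : Set (Fact dom)} {f : Fact dom} (h : f ∈ t.baseFacts L) :
    f.rel ∉ insert t.S t.Γ := by
  rcases h with ⟨g, -, rfl⟩ | ⟨q, -, rfl⟩
  · exact t.new_not_mem (Or.inr (Or.inr ⟨g.rel, rfl⟩))
  · exact t.new_not_mem (Or.inl rfl)

theorem lfp_inputStratum [Nonempty dom] {I : Set (Fact dom)} (hI : IsInstance t.Γ I)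
    (hf : FlatFacts I) : lfp t.inputStratum I = I ∪ t.baseFacts I := by
  have hn := t.negFree_inputStratum t.inputStratum
  apply Set.Subset.antisymm
  · refine lfp_induction hn Set.subset_union_left ?_
    intro r hr ν hsat hpos
    rcases t.mem_inputStratum.1 hr with rfl | ⟨R, hR, h, hh, rfl⟩
    · exact Or.inr (Or.inr ⟨[], Or.inl rfl, by
        simp [argFact, codes, track_nil, eval_mkPred, PathExpr.eval]⟩)
    · have hb := (hpos _ List.mem_cons_self).resolve_right fun h =>
        t.baseFacts_rel h (Finset.mem_insert_of_mem hR)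
      have hl := list_eval (mkPred R (varList dom R.arity)) ν
      have hfl := hf _ hb
      set f := (mkPred R (varList dom R.arity)).eval ν with hfdef
      have hl' : f.list = (varList dom R.arity).map (·.eval ν) := by
        rw [hfdef, eval_mkPred, list_mkFact (by simp [length_varList])]
      refine Or.inr ?_
      rcases List.mem_cons.1 hh with rfl | hh
      · refine Or.inl ⟨f, hb, ?_⟩
        rw [t.fact_of_flat hfl, eval_mkPred, map_dup, ← hl']
        rfl
      · obtain ⟨e, he, rfl⟩ := List.mem_map.1 hh
        have hm : e.eval ν ∈ f.list := by
          rw [hl']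
          exact List.mem_map_of_mem he
        refine Or.inr ⟨e.eval ν, Or.inr ⟨f, hb, hm⟩, ?_⟩
        rw [t.argFact_of_flat (forall_args.1 hfl _ hm), eval_mkPred]
        rfl
  · have hfire : ∀ f ∈ I, ∃ ν : Valuation dom, (varList dom f.rel.arity).map (·.eval ν) = f.list ∧
        ∀ h ∈ t.copyHeads f.rel, h.eval ν ∈ lfp t.inputStratum I := by
      intro f hfI
      obtain ⟨ν, hν⟩ := exists_eval_varList f.list
      rw [length_list] at hν
      refine ⟨ν, hν, fun h hh => lfp_sat hn (t.mem_inputStratum.2 (Or.inr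
        ⟨f.rel, hI.2 f hfI, h, hh, rfl⟩)) ν ?_⟩
      simp only [List.mem_singleton, forall_eq, Literal.Sat, Atom.Sat, eval_mkPred, hν, mkFact_list]
      exact subset_lfp _ _ hfI
    refine Set.union_subset (subset_lfp _ _) (Set.union_subset ?_ ?_)
    · rintro _ ⟨f, hfI, rfl⟩
      obtain ⟨ν, hν, h⟩ := hfire f hfI
      have := h _ List.mem_cons_self
      rwa [eval_mkPred, map_dup, hν, ← t.fact_of_flat (hf f hfI)] at this
    · rintro _ ⟨p, rfl | ⟨f, hfI, hp⟩, rfl⟩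
      · have := lfp_sat hn (I := I) (t.mem_inputStratum.2 (Or.inl rfl)) ⟨fun _ => t.a, fun _ => []⟩
          (by simp)
        simpa [argFact, codes, track_nil, eval_mkPred, PathExpr.eval] using this
      · obtain ⟨ν, hν, h⟩ := hfire f hfI
        have hpf := forall_args.1 (hf f hfI) p hp
        rw [← hν] at hp
        obtain ⟨e, he, rfl⟩ := List.mem_map.1 hp
        have := h _ (List.mem_cons_of_mem _ (List.mem_map_of_mem he))
        rwa [eval_mkPred, List.map_cons, List.map_cons, List.map_nil,
          ← t.argFact_of_flat hpf] at this

theorem lfp_outputStratum [Nonempty dom] {I L W : Set (Fact dom)} (hI : ∀ f ∈ I, f.rel ∈ t.Γ)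
    (hL : ∀ f ∈ L, f.rel = t.S → ∀ i, (f.args i).Flat) (hW : ∀ f ∈ W, f.rel = t.valid) :
    lfp t.outputStratum (t.baseFacts L ∪ W ∪ I) =
      t.baseFacts L ∪ W ∪ I ∪ {f ∈ L | f.rel = t.S} := by
  have hn := t.negFree_outputStratum t.outputStratum
  apply Set.Subset.antisymm
  · refine lfp_induction hn Set.subset_union_left ?_
    intro r hr ν hsat hpos
    have hr := List.mem_singleton.1 hr
    subst hr
    have h := hpos _ List.mem_cons_self
    rw [eval_mkPred, map_dup] at h
    have hnew := t.new_not_mem (Or.inr (Or.inr ⟨t.S, rfl⟩))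
    refine Or.inr ?_
    rcases h with (((⟨f, hf, h⟩ | ⟨p, -, h⟩) | h) | h) | ⟨-, h⟩
    · have hS : f.rel = t.S := t.name_injective (congrArg Fact.rel h)
      rw [t.fact_of_flat (hL f hf hS)] at h
      have hl := dup_inj (mkFact_inj (by rw [length_dup, length_list]; rfl)
        (by rw [length_dup, List.length_map, length_varList]; rfl) h).2
      have : f = (mkPred t.S (varList dom t.S.arity)).eval ν := by
        rw [eval_mkPred, ← hl, ← hS, mkFact_list]
      exact this ▸ ⟨hf, hS⟩
    · exact absurd (congrArg Fact.rel h).symm (t.name_ne_arg _)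
    · exact absurd (hW _ h) (t.name_ne_valid _)
    · exact absurd (Finset.mem_insert_of_mem (hI _ h)) hnew
    · exact absurd (Finset.mem_insert.2 (Or.inl h)) hnew
  · refine Set.union_subset (subset_lfp _ _) ?_
    rintro f ⟨hf, hS⟩
    obtain ⟨ν, hν⟩ := exists_eval_varList f.list
    rw [length_list, hS] at hν
    have := lfp_sat hn List.mem_cons_self ν (I := t.baseFacts L ∪ W ∪ I) (by
      simp only [List.mem_singleton, forall_eq, Literal.Sat, Atom.Sat, eval_mkPred, map_dup, hν]
      refine subset_lfp _ _ (Or.inl (Or.inl (Or.inl ⟨f, hf, ?_⟩)))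
      rw [t.fact_of_flat (hL f hf hS), hS])
    rwa [eval_mkPred, hν, ← hS, mkFact_list] at this

theorem inBody_stratum {Δ : Stratum dom} {r' : Rule dom} (hr' : r' ∈ t.stratum Δ) {R : RelName}
    (h : r'.InBody R) : R = t.valid ∨ R = t.arg ∨ ∃ r ∈ Δ, ∃ T, r.InBody T ∧ R = t.name T := by
  obtain ⟨L', hL', Q', hQ', rfl⟩ := h
  rcases t.mem_stratum.1 hr' with hr | ⟨r, hr, hd, -, rfl⟩
  · simp only [validRules, List.mem_cons, List.not_mem_nil, or_false] at hr
    rcases hr with rfl | rfl | rfl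
    · simp at hL'
    · simp only [List.mem_cons, List.not_mem_nil, or_false] at hL'
      rcases hL' with rfl | rfl <;> cases hQ'
      exacts [Or.inl rfl, Or.inr (Or.inl rfl)]
    · simp only [List.mem_cons, List.not_mem_nil, or_false] at hL'
      rcases hL' with rfl | rfl | rfl <;> cases hQ'
      exacts [Or.inl rfl, Or.inl rfl, Or.inr (Or.inl rfl)]
  · rcases t.mem_body hL' with ⟨n, -, rfl⟩ | ⟨L, hL, rfl⟩
    · cases hQ'
      exact Or.inl rfl
    · rw [literal_atom] at hQ'
      cases hA : L.atom with
      | eqn e₁ e₂ => simp [hA, atom] at hQ'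
      | pred Q =>
        simp only [hA, atom, Atom.pred.injEq] at hQ'
        exact Or.inr (Or.inr ⟨r, hr, Q.rel, ⟨L, hL, Q, hA, rfl⟩, by rw [← hQ']; rfl⟩)

theorem not_hasPacking_stratum {Δ : Stratum dom} {r' : Rule dom} (hr' : r' ∈ t.stratum Δ) :
    ¬ r'.HasPacking := by
  have hc : ∀ {l : List (PathExpr dom)}, (∀ e ∈ l, ¬ e.HasPacking) → ¬ (concatExprs l).HasPacking :=
    fun hl h => by
      obtain ⟨e, he, h⟩ := hasPacking_concatExprs h
      exact hl e he h
  have hp : ∀ {R : RelName} {l : List (PathExpr dom)}, (∀ e ∈ l, ¬ e.HasPacking) →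
      ¬ (mkPred R l).HasPacking := fun hl h => by
    obtain ⟨e, he, h⟩ := hasPacking_mkPred h
    exact hl e he h
  rcases t.mem_stratum.1 hr' with hr | ⟨r, hr, hd, hhd, rfl⟩
  · simp only [validRules, List.mem_cons, List.not_mem_nil, or_false] at hr
    rcases hr with rfl | rfl | rfl <;> rintro (h | ⟨L, hL, h⟩)
    all_goals try simp only [List.mem_cons, List.not_mem_nil, or_false] at hL
    all_goals try rcases hL with rfl | rfl | rfl
    all_goals
      refine hp ?_ h
      simp [concatExprs, PathExpr.HasPacking]
  · rintro (h | ⟨L', hL', h⟩)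
    · rcases List.mem_cons.1 hhd with rfl | hhd
      · exact t.not_hasPacking_codes h
      · obtain ⟨e, -, rfl⟩ := List.mem_map.1 hhd
        exact t.not_hasPacking_codes (l := [e]) (by simpa using h)
    · rcases t.mem_body hL' with ⟨n, -, rfl⟩ | ⟨L, hL, rfl⟩
      · refine hp ?_ h
        simp [PathExpr.HasPacking]
      · rw [literal_atom] at h
        exact t.not_hasPacking_atom _ h

end PairCoding

/-- The relation of valid codes is recursive, so nothing is claimed about R; the lemma is applied
only to programs that arise from recursive ones. -/
theorem eliminate_packing_of_not_posEq [Infinite dom] {Γ : Schema} {S : RelName} (hS : S ∉ Γ)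
    {Q : Query dom Γ S} {P : Program dom} (hP : P.Computes Q) (hE : ¬ P.PosEq) (hSI : P.IsIDB S) :
    ∃ P' : Program dom, P'.Computes Q ∧ ¬ P'.Uses .P ∧ (P'.Uses .N → P.Uses .N) := by
  obtain ⟨a, b, hab⟩ := exists_pair_ne dom
  let t : PairCoding dom := ⟨Γ, S, a, b, hab⟩
  rw [Program.computes_iff] at hP
  obtain ⟨ho, hP⟩ := hP
  have hsP := (stratified_iff _).1 P.stratified
  have hout : ∀ R, t.outputStratum.IsHead R → R = S := by
    rintro R ⟨r, hr, rfl⟩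
    rw [List.mem_singleton.1 hr]
    rfl
  let P' : Program dom :=
    { strata := t.inputStratum :: (P.strata.map t.stratum ++ [t.outputStratum])
      safe := by
        intro Δ hΔ r hr
        rcases List.mem_cons.1 hΔ with rfl | hΔ
        · exact t.safe_inputStratum r hr
        rcases List.mem_append.1 hΔ with hΔ | hΔ
        · obtain ⟨Δ, hΔ', rfl⟩ := List.mem_map.1 hΔ
          rcases t.mem_stratum.1 hr with hr | ⟨r₀, hr₀, h, hh, rfl⟩
          · exact t.safe_validRules r hr
          · exact t.safe (P.safe Δ hΔ' r₀ hr₀) hh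
        · rw [List.mem_singleton.1 hΔ] at hr
          exact t.safe_outputStratum r hr
      stratified := by
        refine (stratified_iff _).2 ⟨?_, List.pairwise_cons.2 ⟨fun Δ _ => t.negFree_inputStratum Δ,
          List.pairwise_append.2 ⟨List.pairwise_map.2 (hsP.2.imp fun h => t.negFree h),
            List.pairwise_singleton _ _, ?_⟩⟩⟩
        · intro Δ hΔ
          rcases List.mem_cons.1 hΔ with rfl | hΔ
          · exact t.negFree_inputStratum _
          rcases List.mem_append.1 hΔ with hΔ | hΔ
          · obtain ⟨Δ, hΔ', rfl⟩ := List.mem_map.1 hΔ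
            exact t.negFree (hsP.1 Δ hΔ')
          · rw [List.mem_singleton.1 hΔ]
            exact t.negFree_outputStratum _
        · intro Δ hΔ Δ' hΔ' r hr R hR hh
          rw [List.mem_singleton.1 hΔ'] at hh
          obtain ⟨Δ, -, rfl⟩ := List.mem_map.1 hΔ
          obtain ⟨r₀, -, A, -, hA⟩ := t.neg_mem_stratum hr hR
          cases A with
          | eqn e₁ e₂ => simp [PairCoding.atom] at hA
          | pred Q =>
            simp only [PairCoding.atom, Atom.pred.injEq] at hA
            subst hA
            exact t.new_not_mem (Or.inr (Or.inr ⟨Q.rel, rfl⟩))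
              (Finset.mem_insert.2 (Or.inl (hout _ hh))) }
  have hrule : ∀ r', P'.HasRule r' → r' ∈ t.inputStratum ∨
      (∃ Δ ∈ P.strata, r' ∈ t.stratum Δ) ∨ r' ∈ t.outputStratum := by
    rintro r' ⟨Δ, hΔ, hr⟩
    rcases List.mem_cons.1 hΔ with rfl | hΔ
    · exact Or.inl hr
    rcases List.mem_append.1 hΔ with hΔ | hΔ
    · obtain ⟨Δ, hΔ', rfl⟩ := List.mem_map.1 hΔ
      exact Or.inr (Or.inl ⟨Δ, hΔ', hr⟩)
    · rw [List.mem_singleton.1 hΔ] at hr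
      exact Or.inr (Or.inr hr)
  have hmid : ∀ Δ ∈ P.strata, ∀ r' ∈ t.stratum Δ, P'.HasRule r' := fun Δ hΔ r' hr' =>
    ⟨_, List.mem_cons_of_mem _ (List.mem_append_left _ (List.mem_map_of_mem hΔ)), hr'⟩
  have hargI : P'.IsIDB t.arg :=
    ⟨_, ⟨_, List.mem_cons_self, t.mem_inputStratum.2 (Or.inl rfl)⟩, rfl⟩
  have hnameI : ∀ T, P.IsIDB T ∨ T ∈ Γ → P'.IsIDB (t.name T) := by
    rintro T (⟨r, ⟨Δ, hΔ, hr⟩, rfl⟩ | hT)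
    · exact ⟨_, hmid Δ hΔ _ (t.mem_stratum.2 (Or.inr ⟨r, hr, _, List.mem_cons_self, rfl⟩)), rfl⟩
    · exact ⟨_, ⟨_, List.mem_cons_self, t.mem_inputStratum.2 (Or.inr ⟨T, hT, _,
        List.mem_cons_self, rfl⟩)⟩, rfl⟩
  refine ⟨P', (P'.computes_iff Q).2 ⟨⟨?_, ?_⟩, fun I => ?_⟩, ?_, ?_⟩
  · rintro R ⟨⟨r', hr', hR⟩, hRI⟩
    rcases hrule r' hr' with hr | ⟨Δ, hΔ, hr⟩ | hr
    · rcases t.mem_inputStratum.1 hr with rfl | ⟨T, hT, h, -, rfl⟩ <;> rw [inBody_iff] at hR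
      · simp at hR
      · obtain ⟨L, hL, Q', hQ', rfl⟩ := hR
        rw [List.mem_singleton.1 hL] at hQ'
        cases hQ'
        exact hT
    · rcases t.inBody_stratum hr hR with rfl | rfl | ⟨r, hr₀, T, hT, rfl⟩
      · exact absurd ⟨_, hmid Δ hΔ _ (t.mem_stratum.2 (Or.inl List.mem_cons_self)), rfl⟩ hRI
      · exact absurd hargI hRI
      · refine absurd (hnameI T ?_) hRI
        by_contra h
        rw [not_or] at h
        exact h.2 (ho.1 T ⟨⟨r, ⟨Δ, hΔ, hr₀⟩, hT⟩, h.1⟩)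
    · rw [List.mem_singleton.1 hr, inBody_iff] at hR
      obtain ⟨L, hL, Q', hQ', rfl⟩ := hR
      rw [List.mem_singleton.1 hL] at hQ'
      cases hQ'
      -- The output rule reads the coded output relation, which is IDB because `S` is.
      exact absurd (hnameI S (Or.inl hSI)) hRI
  · rintro R ⟨r', hr', rfl⟩ hΓ
    have hnew : ∀ R, (R = t.arg ∨ R = t.valid ∨ ∃ T, R = t.name T) → R ∉ Γ := fun R h h' =>
      t.new_not_mem h (Finset.mem_insert_of_mem h')
    rcases hrule r' hr' with hr | ⟨Δ, hΔ, hr⟩ | hr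
    · rcases t.mem_inputStratum.1 hr with rfl | ⟨T, hT, h, hh, rfl⟩
      · exact hnew _ (Or.inl rfl) hΓ
      · rcases List.mem_cons.1 hh with rfl | hh
        · exact hnew _ (Or.inr (Or.inr ⟨T, rfl⟩)) hΓ
        · obtain ⟨e, -, rfl⟩ := List.mem_map.1 hh
          exact hnew _ (Or.inl rfl) hΓ
    · rcases t.isHead_stratum ⟨r', hr, rfl⟩ with h | h | ⟨T, -, h⟩
      · exact hnew _ (Or.inr (Or.inl h)) hΓ
      · exact hnew _ (Or.inl h) hΓ
      · exact hnew _ (Or.inr (Or.inr ⟨T, h⟩)) hΓ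
    · exact hS (hout _ ⟨r', hr, rfl⟩ ▸ hΓ)
  · obtain ⟨V, hV, hrun⟩ := t.run_strata (K := I.1) (V := ∅) P.negFree P.safe
      (fun Δ hΔ r hr e₁ e₂ h => hE ⟨r, ⟨Δ, hΔ, hr⟩, e₁, e₂, h⟩) (Set.empty_subset _)
    have hLS : ∀ f ∈ run P.strata I.1, f.rel = S → ∀ i, (f.args i).Flat := fun f hf h =>
      (Q I).2.2 f ((hP I).2 ▸ ⟨hf, h⟩)
    have hfinal : run P'.strata I.1 = t.baseFacts (run P.strata I.1) ∪ t.validFact '' V ∪ I.1 ∪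
        {f ∈ run P.strata I.1 | f.rel = S} := by
      change run (P.strata.map t.stratum ++ [t.outputStratum]) (lfp t.inputStratum I.1) = _
      -- The uncoded input remains present, but no translated rule mentions its names.
      rw [t.lfp_inputStratum I.2.1 I.2.2, run_append, Set.union_comm I.1, run_union_frame]
      · rw [Set.image_empty, Set.union_empty] at hrun
        rw [hrun]
        exact t.lfp_outputStratum I.2.1.2 hLS (t.validFacts_rel V)
      · intro Δ hΔ
        obtain ⟨Δ, hΔ', rfl⟩ := List.mem_map.1 hΔ
        exact t.negFree (hsP.1 Δ hΔ')
      · intro f hf Δ hΔ r hr hb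
        obtain ⟨Δ, hΔ', rfl⟩ := List.mem_map.1 hΔ
        refine t.new_not_mem (R := f.rel) ?_ (Finset.mem_insert_of_mem (I.2.1.2 f hf))
        rcases t.inBody_stratum hr hb with h | h | ⟨_, _, T, _, h⟩
        exacts [Or.inr (Or.inl h), Or.inl h, Or.inr (Or.inr ⟨T, h⟩)]
    rw [hfinal]
    refine ⟨(((t.finite_baseFacts (hP I).1).union ((t.finite_validFacts (hP I).1).subset
      (Set.image_mono hV))).union I.2.1.1).union ((hP I).1.subset fun f hf => hf.1), ?_⟩
    rw [← (hP I).2]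
    ext f
    constructor
    · rintro ⟨((hf | ⟨p, -, rfl⟩) | hf) | hf, h⟩
      · exact absurd (Finset.mem_insert.2 (Or.inl h)) (t.baseFacts_rel hf)
      · exact absurd (Finset.mem_insert.2 (Or.inl h)) (t.new_not_mem (Or.inr (Or.inl rfl)))
      · exact absurd (h ▸ I.2.1.2 f hf) hS
      · exact hf
    · exact fun hf => ⟨Or.inr hf, hf.2⟩
  · rintro ⟨r', hr', h⟩
    have hvar : ∀ (n : ℕ), ∀ e ∈ PairCoding.varList dom n, ¬ e.HasPacking := by
      intro n e he
      obtain ⟨i, -, rfl⟩ := List.mem_map.1 he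
      simp [PathExpr.HasPacking]
    have hp : ∀ {R : RelName} {l : List (PathExpr dom)}, (∀ e ∈ l, ¬ e.HasPacking) →
        ¬ (mkPred R l).HasPacking := fun hl h => by
      obtain ⟨e, he, h⟩ := hasPacking_mkPred h
      exact hl e he h
    rcases hrule r' hr' with hr | ⟨Δ, hΔ, hr⟩ | hr
    · rcases t.mem_inputStratum.1 hr with rfl | ⟨T, hT, hd, hh, rfl⟩
      · rcases h with h | ⟨L, hL, -⟩
        · exact hp (by simp [PathExpr.HasPacking]) h
        · exact absurd hL List.not_mem_nil
      · rcases h with h | ⟨L, hL, h⟩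
        · rcases List.mem_cons.1 hh with rfl | hh
          · exact hp (fun e he => hvar _ e (PairCoding.mem_dup.1 he)) h
          · obtain ⟨e, he, rfl⟩ := List.mem_map.1 hh
            exact hp (by simpa using hvar _ e he) h
        · rw [List.mem_singleton.1 hL] at h
          exact hp (hvar _) h
    · exact t.not_hasPacking_stratum hr h
    · rw [List.mem_singleton.1 hr] at h
      rcases h with h | ⟨L, hL, h⟩
      · exact hp (hvar _) h
      · rw [List.mem_singleton.1 hL] at h
        exact hp (fun e he => hvar _ e (PairCoding.mem_dup.1 he)) h
  · rintro ⟨r', hr', A, hA⟩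
    rcases hrule r' hr' with hr | ⟨Δ, hΔ, hr⟩ | hr
    · rcases t.mem_inputStratum.1 hr with rfl | ⟨T, hT, hd, hh, rfl⟩ <;> simp at hA
    · obtain ⟨r, hr, A, hA, -⟩ := t.neg_mem_stratum hr hA
      exact ⟨r, ⟨Δ, hΔ, hr⟩, A, hA⟩
    · rw [List.mem_singleton.1 hr] at hA
      simp at hA

/-! ### Unfolding nonrecursive programs without negation -/

def Var.shift (m : ℕ) : Var → Var
  | .atomic n => .atomic (m + n)
  | .path n => .path (m + n)

def PathExpr.shift (m : ℕ) : PathExpr dom → PathExpr dom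
  | .const a => .const a
  | .var x => .var (x.shift m)
  | .pack e => .pack (e.shift m)
  | .empty => .empty
  | .concat e₁ e₂ => .concat (e₁.shift m) (e₂.shift m)

def Predicate.shift (m : ℕ) (Q : Predicate dom) : Predicate dom :=
  ⟨Q.rel, fun i => (Q.args i).shift m⟩

def Atom.shift (m : ℕ) : Atom dom → Atom dom
  | .pred Q => .pred (Q.shift m)
  | .eqn e₁ e₂ => .eqn (e₁.shift m) (e₂.shift m)

def Literal.shift (m : ℕ) : Literal dom → Literal dom
  | .pos A => .pos (A.shift m)
  | .neg A => .neg (A.shift m)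

theorem PathExpr.vars_shift (m : ℕ) (e : PathExpr dom) : (e.shift m).vars = Var.shift m '' e.vars := by
  induction e with
  | concat e₁ e₂ ih₁ ih₂ => simp only [shift, vars, ih₁, ih₂, Set.image_union]
  | _ => simp [shift, vars, *]

theorem Predicate.vars_shift (m : ℕ) (Q : Predicate dom) :
    (Q.shift m).vars = Var.shift m '' Q.vars := by
  simp [Predicate.vars, shift, PathExpr.vars_shift, Set.image_iUnion]

theorem Atom.vars_shift (m : ℕ) (A : Atom dom) : (A.shift m).vars = Var.shift m '' A.vars := by
  cases A with
  | pred Q => exact Q.vars_shift m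
  | eqn e₁ e₂ => simp [Atom.vars, shift, PathExpr.vars_shift, Set.image_union]

theorem Literal.atom_shift (m : ℕ) (L : Literal dom) : (L.shift m).atom = L.atom.shift m := by
  cases L <;> rfl

theorem PathExpr.eval_shift {m : ℕ} {ν μ : Valuation dom} (h : ∀ x, ν.get (x.shift m) = μ.get x)
    (e : PathExpr dom) : (e.shift m).eval ν = e.eval μ := by
  induction e with
  | var x => exact h x
  | _ => simp [shift, eval, *]

theorem Predicate.eval_shift {m : ℕ} {ν μ : Valuation dom} (h : ∀ x, ν.get (x.shift m) = μ.get x)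
    (Q : Predicate dom) : (Q.shift m).eval ν = Q.eval μ := by
  simp [Predicate.eval, shift, PathExpr.eval_shift h]

theorem Literal.sat_shift {m : ℕ} {ν μ : Valuation dom} (h : ∀ x, ν.get (x.shift m) = μ.get x)
    (I : Set (Fact dom)) (L : Literal dom) : (L.shift m).Sat I ν ↔ L.Sat I μ := by
  have : ∀ A : Atom dom, (A.shift m).Sat I ν ↔ A.Sat I μ := by
    intro A
    cases A with
    | pred Q => simp [Atom.shift, Atom.Sat, Q.eval_shift h]
    | eqn e₁ e₂ => simp [Atom.shift, Atom.Sat, PathExpr.eval_shift h]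
  cases L with
  | pos A => exact this A
  | neg A => exact not_congr (this A)

theorem exists_unshift (m : ℕ) (ν : Valuation dom) :
    ∃ μ : Valuation dom, ∀ x, ν.get (x.shift m) = μ.get x :=
  ⟨⟨fun n => ν.atomic (m + n), fun n => ν.path (m + n)⟩, fun x => by cases x <;> rfl⟩

theorem Limited.shift {B : List (Literal dom)} {x : Var} (h : Limited B x) (m : ℕ) :
    Limited (B.map (Literal.shift m)) (x.shift m) := by
  induction h with
  | pred Q x hQ hx =>
    exact .pred (Q.shift m) _ (List.mem_map_of_mem (f := Literal.shift m) hQ)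
      (Q.vars_shift m ▸ ⟨x, hx, rfl⟩)
  | eqn_right e₁ e₂ x he _ hx ih =>
    refine .eqn_right (e₁.shift m) (e₂.shift m) _ (List.mem_map_of_mem (f := Literal.shift m) he)
      ?_ (e₂.vars_shift m ▸ ⟨x, hx, rfl⟩)
    rw [e₁.vars_shift m]
    rintro _ ⟨y, hy, rfl⟩
    exact ih y hy
  | eqn_left e₁ e₂ x he _ hx ih =>
    refine .eqn_left (e₁.shift m) (e₂.shift m) _ (List.mem_map_of_mem (f := Literal.shift m) he)
      ?_ (e₁.vars_shift m ▸ ⟨x, hx, rfl⟩)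
    rw [e₂.vars_shift m]
    rintro _ ⟨y, hy, rfl⟩
    exact ih y hy

theorem Var.idx_shift (m : ℕ) (x : Var) : (x.shift m).idx = m + x.idx := by cases x <;> rfl

/-- The facts derived by single applications of rules. -/
def fire (D : List (Rule dom)) (I : Set (Fact dom)) : Set (Fact dom) :=
  {f | ∃ d ∈ D, ∃ ν : Valuation dom, (∀ L ∈ d.body, L.Sat I ν) ∧ d.head.eval ν = f}

/-- The data for replacing predicates by the bodies of the rules `D` defining them. -/
structure Unfolding (dom : Type u) where
  Γ : Schema
  a : dom
  b : dom
  hab : a ≠ b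

namespace Unfolding

variable (t : Unfolding dom)

def join (Q : Predicate dom) : PathExpr dom :=
  .concat (joinExprs t.a Q.list) (joinExprs t.b Q.list)

theorem mem_vars_join {Q : Predicate dom} {x : Var} : x ∈ (t.join Q).vars ↔ x ∈ Q.vars := by
  simp [join, PathExpr.vars, vars_joinExprs, mem_predVars]

theorem eval_join_eq {Q Q' : Predicate dom} (h : Q.rel = Q'.rel) {ν : Valuation dom} :
    (t.join Q).eval ν = (t.join Q').eval ν ↔ Q.eval ν = Q'.eval ν := by
  simp only [join, PathExpr.eval, eval_joinExprs]
  constructor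
  · intro h'
    refine fact_ext h ?_
    rw [list_eval, list_eval]
    exact join_append_inj t.hab (by simp [length_predList, h]) h'
  · intro h'
    rw [← list_eval, ← list_eval, h']

/-- A predicate over the schema may stay. Any predicate may be replaced by a renamed defining body,
where a single equation between joined argument lists expresses that the head equals the predicate.
-/
def options (D : List (Rule dom)) (m : ℕ) : Literal dom → List (List (Literal dom))
  | .pos (.pred Q) => (if Q.rel ∈ t.Γ then [[.pos (.pred Q)]] else []) ++
      (D.filter fun d => d.head.rel = Q.rel).map fun d =>
        .pos (.eqn (t.join (d.head.shift m)) (t.join Q)) :: d.body.map (Literal.shift m)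
  | L => [[L]]

/-- The options for a literal: the literal itself, or the body of a rule defining it. -/
theorem mem_options {D : List (Rule dom)} {m : ℕ} {L : Literal dom} {o : List (Literal dom)} :
    o ∈ t.options D m L ↔ (o = [L] ∧ ∀ Q, L = .pos (.pred Q) → Q.rel ∈ t.Γ) ∨
      ∃ Q, L = .pos (.pred Q) ∧ ∃ d ∈ D, d.head.rel = Q.rel ∧
        o = .pos (.eqn (t.join (d.head.shift m)) (t.join Q)) :: d.body.map (Literal.shift m) := by
  cases L with
  | neg A => simp [options]
  | pos A =>
    cases A with
    | eqn e₁ e₂ => simp [options]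
    | pred Q =>
      simp only [options, List.mem_append, List.mem_map, List.mem_filter, decide_eq_true_eq,
        Literal.pos.injEq, Atom.pred.injEq, forall_eq']
      refine or_congr (by split_ifs with h <;> simp [h]) ?_
      constructor
      · rintro ⟨d, ⟨hd, hr⟩, rfl⟩
        exact ⟨Q, rfl, d, hd, hr, rfl⟩
      · rintro ⟨_, rfl, d, hd, hr, rfl⟩
        exact ⟨d, ⟨hd, hr⟩, rfl⟩

/-- The shift grows by `N`, a bound for the variables of `D`, after each literal, so the inlined
bodies have no variables in common. -/
def expand (D : List (Rule dom)) (N : ℕ) : ℕ → List (Literal dom) → List (List (Literal dom))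
  | _, [] => [[]]
  | m, L :: B => (t.options D m L).flatMap fun o => (expand D N (m + N) B).map fun B' => o ++ B'

theorem mem_expand_cons {D : List (Rule dom)} {N m : ℕ} {L : Literal dom} {B B' : List (Literal dom)} :
    B' ∈ t.expand D N m (L :: B) ↔
      ∃ o ∈ t.options D m L, ∃ B'' ∈ t.expand D N (m + N) B, B' = o ++ B'' := by
  simp [expand, eq_comm]

theorem mem_expand {D : List (Rule dom)} {N m : ℕ} {B B' : List (Literal dom)}
    (h : B' ∈ t.expand D N m B) :
    (∀ L ∈ B, ∃ m', ∃ o ∈ t.options D m' L, ∀ x ∈ o, x ∈ B') ∧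
    ∀ L' ∈ B', ∃ L ∈ B, ∃ m', ∃ o ∈ t.options D m' L, L' ∈ o ∧ ∀ x ∈ o, x ∈ B' := by
  induction B generalizing m B' with
  | nil =>
    rw [expand, List.mem_singleton] at h
    subst h
    simp
  | cons L B ih =>
    obtain ⟨o, ho, B'', hB'', rfl⟩ := t.mem_expand_cons.1 h
    obtain ⟨h1, h2⟩ := ih hB''
    have hl : ∀ x ∈ o, x ∈ o ++ B'' := fun x hx => List.mem_append_left _ hx
    have hr : ∀ x ∈ B'', x ∈ o ++ B'' := fun x hx => List.mem_append_right _ hx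
    refine ⟨fun L₀ hL₀ => ?_, fun L' hL' => ?_⟩
    · rcases List.mem_cons.1 hL₀ with rfl | hL₀
      · exact ⟨m, o, ho, hl⟩
      · obtain ⟨m', o', ho', h⟩ := h1 L₀ hL₀
        exact ⟨m', o', ho', fun x hx => hr x (h x hx)⟩
    · rcases List.mem_append.1 hL' with hL' | hL'
      · exact ⟨L, List.mem_cons_self, m, o, ho, hL', hl⟩
      · obtain ⟨L₀, hL₀, m', o', ho', h, h'⟩ := h2 L' hL'
        exact ⟨L₀, List.mem_cons_of_mem _ hL₀, m', o', ho', h, fun x hx => hr x (h' x hx)⟩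

theorem expand_sound {D : List (Rule dom)} {N m : ℕ} {B B' : List (Literal dom)}
    (hB : ∀ A, .neg A ∉ B) (h : B' ∈ t.expand D N m B) {I : Set (Fact dom)} {ν : Valuation dom}
    (hs : ∀ L ∈ B', L.Sat I ν) : ∀ L ∈ B, L.Sat (I ∪ fire D I) ν := by
  intro L hL
  obtain ⟨m', o, ho, hsub⟩ := (t.mem_expand h).1 L hL
  rcases t.mem_options.1 ho with ⟨rfl, -⟩ | ⟨Q, rfl, d, hd, hr, rfl⟩
  · have := hs L (hsub L List.mem_cons_self)
    cases L with
    | neg A => exact absurd hL (hB A)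
    | pos A =>
      cases A with
      | pred Q => exact Or.inl this
      | eqn e₁ e₂ => exact this
  · obtain ⟨μ, hμ⟩ := exists_unshift m' ν
    have h1 : (d.head.shift m').eval ν = Q.eval ν :=
      (t.eval_join_eq (Q := d.head.shift m') hr).1 (hs _ (hsub _ List.mem_cons_self))
    refine Or.inr ⟨d, hd, μ, fun L hL => (L.sat_shift hμ I).1 (hs _ (hsub _
      (List.mem_cons_of_mem _ (List.mem_map_of_mem hL)))), ?_⟩
    rw [← h1, Predicate.eval_shift hμ]

theorem expand_complete {D : List (Rule dom)} {N : ℕ} (hN : ∀ d ∈ D, ∀ x ∈ d.vars, x.idx < N)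
    {I : Set (Fact dom)} (hI : ∀ f ∈ I, f.rel ∈ t.Γ) {B : List (Literal dom)} (hB : ∀ A, .neg A ∉ B)
    {m : ℕ} (hm : ∀ x ∈ bodyVars B, x.idx < m) {ν : Valuation dom}
    (hs : ∀ L ∈ B, L.Sat (I ∪ fire D I) ν) : ∃ B' ∈ t.expand D N m B, ∃ ν' : Valuation dom,
      (∀ x : Var, x.idx < m → ν'.get x = ν.get x) ∧ ∀ L ∈ B', L.Sat I ν' := by
  induction B generalizing m ν with
  | nil => exact ⟨[], List.mem_cons_self, ν, fun _ _ => rfl, by simp⟩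
  | cons L B ih =>
    have hmL : ∀ x ∈ L.atom.vars, x.idx < m := fun x hx => hm x ⟨L, List.mem_cons_self, hx⟩
    have hm' : ∀ x ∈ bodyVars B, x.idx < m := fun x ⟨L', hL', hx⟩ =>
      hm x ⟨L', List.mem_cons_of_mem _ hL', hx⟩
    obtain ⟨o, ho, ν₁, hag₁, hsat₁, hv₁⟩ : ∃ o ∈ t.options D m L, ∃ ν₁ : Valuation dom,
        (∀ x : Var, x.idx < m → ν₁.get x = ν.get x) ∧ (∀ L' ∈ o, L'.Sat I ν₁) ∧
        ∀ L' ∈ o, ∀ x ∈ L'.atom.vars, x.idx < m + N := by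
      have hself : (∀ Q, L = .pos (.pred Q) → Q.rel ∈ t.Γ) → L.Sat I ν →
          ∃ o ∈ t.options D m L, ∃ ν₁ : Valuation dom,
          (∀ x : Var, x.idx < m → ν₁.get x = ν.get x) ∧ (∀ L' ∈ o, L'.Sat I ν₁) ∧
          ∀ L' ∈ o, ∀ x ∈ L'.atom.vars, x.idx < m + N := fun h1 h2 =>
        ⟨[L], t.mem_options.2 (Or.inl ⟨rfl, h1⟩), ν, fun _ _ => rfl, by simpa using h2,
          by simpa using fun x hx => Nat.lt_add_right N (hmL x hx)⟩
      have hL := hs L List.mem_cons_self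
      cases L with
      | neg A => exact absurd List.mem_cons_self (hB A)
      | pos A =>
        cases A with
        | eqn e₁ e₂ => exact hself (by simp) hL
        | pred Q =>
          rcases hL with hL | ⟨d, hd, μ, hμ, he⟩
          · refine hself ?_ hL
            rintro _ ⟨⟩
            exact hI _ hL
          -- Variables below `m` keep their values, while those of the inlined body, shifted by `m`,
          -- receive their values from `μ`.
          · have hag : ∀ x : Var, x.idx < m → (ν.extend m μ.atomic μ.path).get x = ν.get x :=
              fun x hx => ν.extend_get m _ _ hx
            have hsh : ∀ x, (ν.extend m μ.atomic μ.path).get (x.shift m) = μ.get x := by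
              intro x
              cases x with
              | atomic n => simp [Valuation.get, PathExpr.eval, Var.shift, Valuation.extend_atomic]
              | path n => simp [Valuation.get, PathExpr.eval, Var.shift, Valuation.extend_path]
            have hrel : d.head.rel = Q.rel := congrArg Fact.rel he
            have hdv : ∀ y ∈ d.vars, (y.shift m).idx < m + N := fun y hy => by
              rw [Var.idx_shift]
              exact Nat.add_lt_add_left (hN d hd y hy) m
            refine ⟨_, t.mem_options.2 (Or.inr ⟨Q, rfl, d, hd, hrel, rfl⟩), _, hag, ?_, ?_⟩
            · intro L' hL'
              rcases List.mem_cons.1 hL' with rfl | hL'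
              · refine (t.eval_join_eq (Q := d.head.shift m) hrel).2 ?_
                rw [Predicate.eval_shift hsh, he]
                exact (Q.eval_congr fun x hx => hag x (hmL x hx)).symm
              · obtain ⟨L₀, hL₀, rfl⟩ := List.mem_map.1 hL'
                exact (L₀.sat_shift hsh I).2 (hμ L₀ hL₀)
            · intro L' hL' x hx
              rcases List.mem_cons.1 hL' with rfl | hL'
              · rcases hx with hx | hx
                · rw [t.mem_vars_join, Predicate.vars_shift] at hx
                  obtain ⟨y, hy, rfl⟩ := hx
                  exact hdv y (Or.inl hy)
                · exact Nat.lt_add_right N (hmL x (t.mem_vars_join.1 hx))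
              · obtain ⟨L₀, hL₀, rfl⟩ := List.mem_map.1 hL'
                rw [Literal.atom_shift, Atom.vars_shift] at hx
                obtain ⟨y, hy, rfl⟩ := hx
                exact hdv y (Or.inr ⟨L₀, hL₀, hy⟩)
    obtain ⟨B', hB', ν', hag, hsat⟩ := ih (fun A h => hB A (List.mem_cons_of_mem _ h))
      (m := m + N) (ν := ν₁) (fun x hx => Nat.lt_add_right N (hm' x hx))
      (fun L' hL' => (L'.sat_congr fun x hx => hag₁ x (hm' x ⟨L', hL', hx⟩)).2
        (hs L' (List.mem_cons_of_mem _ hL')))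
    refine ⟨o ++ B', t.mem_expand_cons.2 ⟨o, ho, B', hB', rfl⟩, ν',
      fun x hx => (hag x (Nat.lt_add_right N hx)).trans (hag₁ x hx), fun L' hL' => ?_⟩
    rcases List.mem_append.1 hL' with h | h
    · exact (L'.sat_congr fun x hx => hag x (hv₁ L' h x hx)).2 (hsat₁ L' h)
    · exact hsat L' h

/-- The inlined body limits the variables of its own head, and the joining equation passes this on
to the variables of the replaced predicate. -/
theorem expand_safe {D : List (Rule dom)} (hD : ∀ d ∈ D, d.Safe) {N m : ℕ} {r : Rule dom}
    (hr : r.Safe) {B' : List (Literal dom)} (h : B' ∈ t.expand D N m r.body) :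
    (Rule.mk r.head B').Safe := by
  have hshift : ∀ {d : Rule dom}, d ∈ D → ∀ {m'}, (∀ x ∈ d.body.map (Literal.shift m'), x ∈ B') →
      ∀ y ∈ d.vars, Limited B' (y.shift m') := fun hd _ hsub y hy =>
    ((hD _ hd y hy).shift _).mono fun A hA => hsub _ hA
  have hlim : ∀ x, Limited r.body x → Limited B' x := by
    intro x hx
    have heq : ∀ e₁ e₂, .pos (.eqn e₁ e₂) ∈ r.body → .pos (.eqn e₁ e₂) ∈ B' := by
      intro e₁ e₂ he
      obtain ⟨m', o, ho, hsub⟩ := (t.mem_expand h).1 _ he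
      rcases t.mem_options.1 ho with ⟨rfl, -⟩ | ⟨Q, hQ, -⟩
      · exact hsub _ List.mem_cons_self
      · simp at hQ
    induction hx with
    | pred Q x hQ hx =>
      obtain ⟨m', o, ho, hsub⟩ := (t.mem_expand h).1 _ hQ
      rcases t.mem_options.1 ho with ⟨rfl, -⟩ | ⟨Q', hQ', d, hd, -, rfl⟩
      · exact .pred Q x (hsub _ List.mem_cons_self) hx
      · cases hQ'
        refine .eqn_right _ _ x (hsub _ List.mem_cons_self) (fun y hy => ?_) (t.mem_vars_join.2 hx)
        rw [t.mem_vars_join, Predicate.vars_shift] at hy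
        obtain ⟨z, hz, rfl⟩ := hy
        exact hshift hd (fun x hx => hsub x (List.mem_cons_of_mem _ hx)) z (Or.inl hz)
    | eqn_right e₁ e₂ x he _ hx ih => exact .eqn_right e₁ e₂ x (heq _ _ he) ih hx
    | eqn_left e₁ e₂ x he _ hx ih => exact .eqn_left e₁ e₂ x (heq _ _ he) ih hx
  rintro x (hx | ⟨L', hL', hx⟩)
  · exact hlim x (hr x (Or.inl hx))
  · obtain ⟨L, hL, m', o, ho, hLo, hsub⟩ := (t.mem_expand h).2 L' hL'
    rcases t.mem_options.1 ho with ⟨rfl, -⟩ | ⟨Q, rfl, d, hd, -, rfl⟩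
    · rw [List.mem_singleton.1 hLo] at hx
      exact hlim x (hr x (Or.inr ⟨L, hL, hx⟩))
    · have hs' := hshift hd fun x hx => hsub x (List.mem_cons_of_mem _ hx)
      rcases List.mem_cons.1 hLo with rfl | hLo
      · rcases hx with hx | hx
        · rw [t.mem_vars_join, Predicate.vars_shift] at hx
          obtain ⟨z, hz, rfl⟩ := hx
          exact hs' z (Or.inl hz)
        · exact hlim x (hr x (Or.inr ⟨_, hL, t.mem_vars_join.1 hx⟩))
      · obtain ⟨L₀, hL₀, rfl⟩ := List.mem_map.1 hLo
        rw [Literal.atom_shift, Atom.vars_shift] at hx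
        obtain ⟨y, hy, rfl⟩ := hx
        exact hs' y (Or.inr ⟨L₀, hL₀, hy⟩)

end Unfolding

/-- One application of the immediate consequence operator, keeping the given facts. -/
def consequence (D : List (Rule dom)) (I : Set (Fact dom)) : Set (Fact dom) := I ∪ fire D I

/-- Safe rules without negated literals. -/
def Rule.IsPositive (r : Rule dom) : Prop := r.Safe ∧ ∀ A, Literal.neg A ∉ r.body

theorem Literal.sat_mono {L : Literal dom} (hL : ∀ A, L ≠ .neg A) {I K : Set (Fact dom)}
    (h : I ⊆ K) {ν : Valuation dom} (hs : L.Sat I ν) : L.Sat K ν := by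
  rcases L with (⟨Q⟩ | ⟨e₁, e₂⟩) | A
  · exact h hs
  · exact hs
  · exact absurd rfl (hL A)

theorem fire_subset_lfp {Δ : Stratum dom} (hp : ∀ r ∈ Δ, r.IsPositive) {I K : Set (Fact dom)}
    (h : K ⊆ lfp Δ I) : fire Δ K ⊆ lfp Δ I := by
  rintro _ ⟨r, hr, ν, hs, rfl⟩
  refine lfp_sat (fun r hr Q hQ => absurd hQ ((hp r hr).2 _)) hr ν fun L hL => ?_
  exact Literal.sat_mono (fun A hA => (hp r hr).2 A (hA ▸ hL)) h (hs L hL)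

theorem monotone_iterate_consequence (Δ : Stratum dom) (I : Set (Fact dom)) :
    Monotone fun n => (consequence Δ)^[n] I :=
  monotone_nat_of_le_succ fun n => by
    simp only [Function.iterate_succ_apply']
    exact Set.subset_union_left

/-- A fact of rank k is derived after at most k + 1 rounds, because body facts have smaller rank or
belong to the input. -/
theorem lfp_eq_iterate {Δ : Stratum dom} (hp : ∀ r ∈ Δ, r.IsPositive) {rk : RelName → ℕ}
    (hrk : ∀ r ∈ Δ, ∀ R, r.InBody R → Δ.IsHead R → rk R < rk r.head.rel) {n : ℕ}
    (hn : ∀ r ∈ Δ, rk r.head.rel < n) (I : Set (Fact dom)) :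
    lfp Δ I = (consequence Δ)^[n] I := by
  have hneg : NegFree Δ Δ := fun r hr Q hQ => absurd hQ ((hp r hr).2 _)
  have hmono := monotone_iterate_consequence Δ I
  have h0 : ∀ k, I ⊆ (consequence Δ)^[k] I := fun k => hmono (Nat.zero_le k)
  apply Set.Subset.antisymm
  · have key : lfp Δ I ⊆ {f | f ∈ (consequence Δ)^[rk f.rel + 1] I} := by
      refine lfp_induction hneg (fun f hf => h0 _ hf) fun r hr ν hs hX => ?_
      simp only [Set.mem_ofPred_eq, Function.iterate_succ_apply']
      refine Or.inr ⟨r, hr, ν, fun L hL => ?_, rfl⟩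
      rcases L with (⟨Q⟩ | ⟨e₁, e₂⟩) | A
      · by_cases hQ : Δ.IsHead Q.rel
        · exact hmono (hrk r hr Q.rel ⟨_, hL, Q, rfl, rfl⟩ hQ) (hX Q hL)
        · exact h0 _ (lfp_agree (hs _ hL) hQ)
      · exact hs _ hL
      · exact absurd hL ((hp r hr).2 A)
    intro f hf
    by_cases hh : Δ.IsHead f.rel
    · obtain ⟨r, hr, he⟩ := hh
      exact hmono (he ▸ hn r hr : rk f.rel + 1 ≤ n) (key hf)
    · exact h0 _ (lfp_agree hf hh)
  · have : ∀ k, (consequence Δ)^[k] I ⊆ lfp Δ I := by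
      intro k
      induction k with
      | zero => exact subset_lfp Δ I
      | succ k ih =>
        rw [Function.iterate_succ_apply']
        exact Set.union_subset ih (fire_subset_lfp hp ih)
    exact this n

theorem Program.exists_varBound (D : List (Rule dom)) :
    ∃ N, ∀ d ∈ D, ∀ x ∈ d.vars, x.idx < N :=
  exists_bound_of_list D (fun d N => ∀ x ∈ d.vars, x.idx < N)
    (fun _ _ _ h h' x hx => (h' x hx).trans_le h) fun d _ => ⟨d.varBound, fun _ hx => d.lt_varBound hx⟩

namespace Unfolding

variable (t : Unfolding dom)

/-- Positive rules whose bodies mention only relation names of the schema. -/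
def Flattened (D : List (Rule dom)) : Prop :=
  ∀ d ∈ D, d.IsPositive ∧ ∀ R, d.InBody R → R ∈ t.Γ

/-- Two rounds become one: the rules of the second round are expanded by those of the first, which
are kept as well. Only names of the schema then remain in bodies. -/
theorem exists_unfold_consequence {D Δ : List (Rule dom)} (hD : t.Flattened D)
    (hΔ : ∀ r ∈ Δ, r.IsPositive) :
    ∃ D', t.Flattened D' ∧ ∀ I : Set (Fact dom), (∀ f ∈ I, f.rel ∈ t.Γ) →
      consequence D' I = consequence Δ (consequence D I) := by
  obtain ⟨N, hN⟩ := Program.exists_varBound D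
  refine ⟨D ++ Δ.flatMap fun r => (t.expand D N r.varBound r.body).map (Rule.mk r.head ·),
    fun d hd => ?_, fun I hI => Set.Subset.antisymm ?_ ?_⟩
  · simp only [List.mem_append, List.mem_flatMap, List.mem_map] at hd
    rcases hd with hd | ⟨r, hr, B, hB, rfl⟩
    · exact hD d hd
    · have hlit : ∀ L' ∈ B, (∀ A, L' ≠ .neg A) ∧
          ∀ Q : Predicate dom, L'.atom = .pred Q → Q.rel ∈ t.Γ := by
        intro L' hL'
        obtain ⟨L, hL, m, o, ho, hLo, -⟩ := (t.mem_expand hB).2 L' hL'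
        rcases t.mem_options.1 ho with ⟨rfl, hQ⟩ | ⟨Q, rfl, d, hd, -, rfl⟩
        · obtain rfl := List.mem_singleton.1 hLo
          refine ⟨fun A hA => (hΔ r hr).2 A (hA ▸ hL), fun Q hQ' => ?_⟩
          rcases L' with A | A
          · exact hQ Q (congrArg _ hQ')
          · exact absurd hL ((hΔ r hr).2 A)
        · rcases List.mem_cons.1 hLo with rfl | hLo
          · exact ⟨by simp, by simp [Literal.atom]⟩
          · obtain ⟨L₀, hL₀, rfl⟩ := List.mem_map.1 hLo
            have hd' := hD d hd
            rcases L₀ with (⟨Q₀⟩ | ⟨e₁, e₂⟩) | A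
            · refine ⟨by simp [Literal.shift], fun Q₁ h => ?_⟩
              simp only [Literal.shift, Atom.shift, Literal.atom, Atom.pred.injEq] at h
              subst h
              exact hd'.2 _ ⟨_, hL₀, Q₀, rfl, rfl⟩
            · exact ⟨by simp [Literal.shift], by simp [Literal.shift, Atom.shift, Literal.atom]⟩
            · exact absurd hL₀ (hd'.1.2 A)
      refine ⟨⟨t.expand_safe (fun d hd => (hD d hd).1.1) (hΔ r hr).1 hB,
        fun A hA => (hlit _ hA).1 A rfl⟩, ?_⟩
      rintro R ⟨L, hL, Q, hQ, rfl⟩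
      exact (hlit L hL).2 Q hQ
  · rintro f (hf | ⟨d, hd, ν, hs, rfl⟩)
    · exact Or.inl (Or.inl hf)
    · simp only [List.mem_append, List.mem_flatMap, List.mem_map] at hd
      rcases hd with hd | ⟨r, hr, B, hB, rfl⟩
      · exact Or.inl (Or.inr ⟨d, hd, ν, hs, rfl⟩)
      · exact Or.inr ⟨r, hr, ν, t.expand_sound (hΔ r hr).2 hB hs, rfl⟩
  · rintro f ((hf | ⟨d, hd, h⟩) | ⟨r, hr, ν, hs, rfl⟩)
    · exact Or.inl hf
    · exact Or.inr ⟨d, List.mem_append_left _ hd, h⟩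
    · obtain ⟨B, hB, ν', hν, hs'⟩ := t.expand_complete hN hI (hΔ r hr).2
        (fun x hx => r.lt_varBound (Or.inr hx)) hs
      refine Or.inr ⟨⟨r.head, B⟩, List.mem_append_right _ (List.mem_flatMap.2
        ⟨r, hr, List.mem_map.2 ⟨B, hB, rfl⟩⟩), ν', hs', ?_⟩
      exact r.head.eval_congr fun x hx => hν x (r.lt_varBound (Or.inl hx))

theorem exists_unfold_iterate {D Δ : List (Rule dom)} (hD : t.Flattened D)
    (hΔ : ∀ r ∈ Δ, r.IsPositive) (n : ℕ) :
    ∃ D', t.Flattened D' ∧ ∀ I : Set (Fact dom), (∀ f ∈ I, f.rel ∈ t.Γ) →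
      consequence D' I = (consequence Δ)^[n] (consequence D I) := by
  induction n with
  | zero => exact ⟨D, hD, fun _ _ => rfl⟩
  | succ n ih =>
    obtain ⟨D₁, hD₁, h₁⟩ := ih
    obtain ⟨D₂, hD₂, h₂⟩ := t.exists_unfold_consequence hD₁ hΔ
    exact ⟨D₂, hD₂, fun I hI => by rw [h₂ I hI, h₁ I hI, Function.iterate_succ_apply']⟩

/-- Each stratum is a fixed finite number of rounds, so the whole program collapses into one round
of rules over the input schema. -/
theorem exists_unfold_strata (rk : RelName → ℕ) (s : List (Stratum dom))
    (hs : ∀ Δ ∈ s, ∀ r ∈ Δ, r.IsPositive ∧ ∀ R, r.InBody R → Δ.IsHead R → rk R < rk r.head.rel)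
    {D : List (Rule dom)} (hD : t.Flattened D) :
    ∃ D', t.Flattened D' ∧ ∀ I : Set (Fact dom), (∀ f ∈ I, f.rel ∈ t.Γ) →
      run s (consequence D I) = consequence D' I := by
  induction s generalizing D with
  | nil => exact ⟨D, hD, fun _ _ => rfl⟩
  | cons Δ s ih =>
    have hΔ := hs Δ List.mem_cons_self
    obtain ⟨n, hn⟩ := exists_bound_of_list Δ (fun r n => rk r.head.rel < n)
      (fun _ _ _ h h' => h'.trans_le h) fun r _ => ⟨_, Nat.lt_succ_self _⟩
    obtain ⟨D₁, hD₁, h₁⟩ := t.exists_unfold_iterate hD (fun r hr => (hΔ r hr).1) n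
    obtain ⟨D₂, hD₂, h₂⟩ := ih (fun Δ' h => hs Δ' (List.mem_cons_of_mem _ h)) hD₁
    refine ⟨D₂, hD₂, fun I hI => ?_⟩
    rw [run, lfp_eq_iterate (fun r hr => (hΔ r hr).1) (fun r hr => (hΔ r hr).2) hn, ← h₁ I hI,
      h₂ I hI]

end Unfolding

/-- After unfolding, intermediate facts are no longer read by any rule, so only the rules with head
`S` need to be kept. -/
theorem unfold_program [Infinite dom] {Γ : Schema} {S : RelName} (hΓ : Γ.Monadic) (hS : S ∉ Γ)
    (hSa : S.arity ≤ 1) {Q : Query dom Γ S} {P : Program dom} (hP : P.Computes Q)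
    (hN : ¬ P.Uses .N) (hR : ¬ P.Uses .R) :
    ∃ P' : Program dom, P'.Computes Q ∧ ∀ f, P'.Uses f → f = .E ∨ f = .P := by
  obtain ⟨a, b, hab⟩ := exists_pair_ne dom
  let t : Unfolding dom := ⟨Γ, a, b, hab⟩
  obtain ⟨rk, hrk⟩ := P.exists_rank hR
  obtain ⟨D, hD, hrun⟩ := t.exists_unfold_strata rk P.strata
    (fun Δ hΔ r hr => ⟨⟨P.safe Δ hΔ r hr, fun A hA => hN ⟨r, ⟨Δ, hΔ, hr⟩, A, hA⟩⟩,
      fun R hb hh => hrk _ _ ⟨(P.isIDB_iff R).2 ⟨Δ, hΔ, hh⟩, r, ⟨Δ, hΔ, hr⟩, rfl, hb⟩⟩)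
    (D := []) (by simp [Unfolding.Flattened])
  let Δ : Stratum dom := D.filter fun d => d.head.rel = S
  have hΔ : ∀ r, r ∈ Δ ↔ r ∈ D ∧ r.head.rel = S := by simp [Δ]
  have hpos : ∀ r ∈ Δ, r.IsPositive := fun r hr => (hD r ((hΔ r).1 hr).1).1
  have hbody : ∀ r ∈ Δ, ∀ R, r.InBody R → R ∈ Γ := fun r hr => (hD r ((hΔ r).1 hr).1).2
  let P' : Program dom := ⟨[Δ], by simpa using fun r hr => (hpos r hr).1,
    (stratified_iff _).2 ⟨fun Δ' h r hr Q hQ => absurd hQ ((hpos r (by simp_all)).2 _), by simp⟩⟩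
  have hrule : ∀ r, P'.HasRule r ↔ r ∈ Δ := by simp [P', Program.HasRule]
  have hidb : ∀ R, P'.IsIDB R → R = S := by
    rintro R ⟨r, hr, rfl⟩
    exact ((hΔ r).1 ((hrule r).1 hr)).2
  -- No body mentions the only head `S`, so a constant rank is admissible and a single round
  -- suffices.
  have hres : ∀ I : Set (Fact dom), run P'.strata I = I ∪ fire Δ I := fun I => by
    refine (lfp_eq_iterate hpos (rk := fun _ => 0) (n := 1) (fun r hr R hb hh => ?_)
      (fun _ _ => one_pos) I)
    obtain ⟨r', hr', rfl⟩ := hh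
    exact absurd (hbody r hr _ hb) (((hΔ r').1 hr').2 ▸ hS)
  refine ⟨P', (P'.computes_iff Q).2 ⟨⟨?_, ?_⟩, fun I => ?_⟩, ?_⟩
  · rintro R ⟨⟨r, hr, hb⟩, -⟩
    exact hbody r ((hrule r).1 hr) R hb
  · intro R hR
    rwa [hidb R hR]
  · obtain ⟨hfin, hQ⟩ := ((P.computes_iff Q).1 hP).2 I
    have h := hrun I.1 I.2.1.2
    rw [show consequence [] I.1 = I.1 by simp [consequence, fire]] at h
    rw [h] at hfin hQ
    rw [hres, ← hQ]
    refine ⟨hfin.subset (Set.union_subset_union_right _ ?_), ?_⟩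
    · rintro f ⟨d, hd, h⟩
      exact ⟨d, ((hΔ d).1 hd).1, h⟩
    · ext f
      constructor
      · rintro ⟨hf | ⟨d, hd, h⟩, hfS⟩
        · exact ⟨Or.inl hf, hfS⟩
        · exact ⟨Or.inr ⟨d, ((hΔ d).1 hd).1, h⟩, hfS⟩
      · rintro ⟨hf | ⟨d, hd, ν, h, rfl⟩, hfS⟩
        · exact ⟨Or.inl hf, hfS⟩
        · exact ⟨Or.inr ⟨d, (hΔ d).2 ⟨hd, hfS⟩, ν, h, rfl⟩, hfS⟩
  · rintro (_ | _ | _ | _ | _ | _) hf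
    · obtain ⟨r, hr, h⟩ := hf
      rw [hrule] at hr
      rcases h with h | ⟨R, hb, h⟩
      · rw [((hΔ r).1 hr).2] at h
        omega
      · have := hΓ R (hbody r hr R hb)
        omega
    · exact Or.inl rfl
    · obtain ⟨R₁, R₂, h₁, h₂, h⟩ := hf
      exact absurd ((hidb _ h₁).trans (hidb _ h₂).symm) h
    · obtain ⟨r, hr, A, hA⟩ := hf
      exact absurd hA ((hpos r ((hrule r).1 hr)).2 A)
    · exact Or.inr rfl
    · refine absurd hf (P'.not_uses_R_of_rank (fun _ => 0) fun R₁ R₂ hd => ?_)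
      obtain ⟨hi, r, hr, -, hb⟩ := hd
      exact absurd (hbody r ((hrule r).1 hr) _ hb) (hidb _ hi ▸ hS)

-- Normal forms with and without intermediate predicates.

theorem computes_of_not_isIDB {Γ : Schema} {S : RelName} {Q : Query dom Γ S}
    {P : Program dom} (hP : P.Computes Q) (hSI : ¬ P.IsIDB S) :
    ∃ P' : Program dom, P'.Computes Q ∧ ∀ f, ¬ P'.Uses f := by
  have hQ := ((P.computes_iff Q).1 hP).2
  refine ⟨⟨[], by simp, trivial⟩, (Program.computes_iff _ Q).2 ⟨⟨?_, ?_⟩, fun I => ?_⟩, ?_⟩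
  · simp [Program.IsEDB, Program.HasRule]
  · simp [Program.IsIDB, Program.HasRule]
  · refine ⟨I.2.1.1, ?_⟩
    rw [← (hQ I).2]
    ext f
    -- Facts of a relation that is never a head come from the input, so the empty program gives the
    -- same answer.
    refine ⟨fun hf => ⟨subset_run _ _ hf.1, hf.2⟩, fun hf => ⟨?_, hf.2⟩⟩
    rcases mem_run_cases hf.1 with h | h
    · exact h
    · exact absurd ((P.isIDB_iff S).2 (hf.2 ▸ h)) hSI
  · rintro (_ | _ | _ | _ | _ | _)
    on_goal 6 => exact Program.not_uses_R_of_rank _ (fun _ => 0) (by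
      simp [Program.Depends, Program.HasRule])
    all_goals simp [Program.Uses, Program.IsIDB, Program.HasRule]

/-- Without intermediate predicates, packing and arity are redundant. -/
theorem normalize_without_intermediate [Infinite dom] {Γ : Schema} {S : RelName} (hΓ : Γ.Monadic)
    (hSa : S.arity ≤ 1) {Q : Query dom Γ S} {P : Program dom} (hP : P.Computes Q)
    (hI : ¬ P.Uses .I) :
    ∃ P' : Program dom, P'.Computes Q ∧
      ∀ f, P'.Uses f → P.Uses f ∧ (f = .E ∨ f = .N ∨ f = .R) := by
  by_cases hSI : P.IsIDB S
  -- The only derived relation is the output, whose facts are flat by the definition of a query; so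
  -- the bound on packed values is zero.
  · have hflat : ∀ I : FlatInstance dom Γ, ∀ f ∈ run P.strata I.1, ∀ i, (f.args i).Flat := by
      intro I f hf i
      rcases mem_run_cases hf with hf' | h
      · exact I.2.2 f hf' i
      · obtain ⟨r, hr, he⟩ := (P.isIDB_iff _).2 h
        have hfS : f.rel = S := he ▸ head_rel_of_single hI hSI hr
        have hfQ : f ∈ (Q I).1 := by
          rw [← (((P.computes_iff Q).1 hP).2 I).2]
          exact ⟨hf, hfS⟩
        exact (Q I).2.2 f hfQ i
    obtain ⟨P', h, hp, ha, he, hn, hr, hi⟩ := eliminate_bounded_packing hΓ hSa hP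
      ⟨0, fun I f hf i => (pathPacks_eq_zero.2 (hflat I f hf i)).le⟩
    refine ⟨P', h, ?_⟩
    rintro (_ | _ | _ | _ | _ | _) hf
    · exact absurd hf ha
    · exact ⟨he hf, by simp⟩
    · exact absurd (hi hSI hf) hI
    · exact ⟨hn hf, by simp⟩
    · exact absurd hf hp
    · exact ⟨hr hf, by simp⟩
  · obtain ⟨P', h, hu⟩ := computes_of_not_isIDB hP hSI
    exact ⟨P', h, fun f hf => absurd hf (hu f)⟩

/-- Packing can be removed at the cost of intermediate predicates, equations and arity. -/
theorem eliminate_packing [Infinite dom] {Γ : Schema} {S : RelName} (hΓ : Γ.Monadic)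
    (hS : S ∉ Γ) (hSa : S.arity ≤ 1) {Q : Query dom Γ S} {P : Program dom} (hP : P.Computes Q) :
    ∃ P' : Program dom, P'.Computes Q ∧ ¬ P'.Uses .P ∧ (P'.Uses .N → P.Uses .N) ∧
      (P'.Uses .R → P.Uses .R) := by
  -- A recursive program may use the recursive pair coding, once its positive equations are gone. A
  -- nonrecursive one creates boundedly many packed values and is split by shapes, which introduces
  -- no recursion.
  by_cases hR : P.Uses .R
  · obtain ⟨P₁, h₁, he, -, hn, -, -⟩ := eliminate_posEq hP
    by_cases hSI : P₁.IsIDB S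
    · obtain ⟨P₂, h₂, hp, hn'⟩ := eliminate_packing_of_not_posEq hS h₁ he hSI
      exact ⟨P₂, h₂, hp, hn ∘ hn', fun _ => hR⟩
    · obtain ⟨P₂, h₂, hu⟩ := computes_of_not_isIDB h₁ hSI
      exact ⟨P₂, h₂, hu _, fun h => absurd h (hu _), fun h => absurd h (hu _)⟩
  · obtain ⟨m, hm⟩ := tameMeasure_packs.program P hR 0
    obtain ⟨P', h, hp, -, -, hn, hr, -⟩ := eliminate_bounded_packing hΓ hSa hP
      ⟨m, fun I => hm I.1 fun f hf i => (pathPacks_eq_zero.2 (I.2.2 f hf i)).le⟩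
    exact ⟨P', h, hp, hn, hr⟩

/-- With intermediate predicates, packing, equations and arity are redundant. -/
theorem normalize_with_intermediate [Infinite dom] {Γ : Schema} {S : RelName} (hΓ : Γ.Monadic)
    (hS : S ∉ Γ) (hSa : S.arity ≤ 1) {Q : Query dom Γ S} {P : Program dom} (hP : P.Computes Q) :
    ∃ P' : Program dom, P'.Computes Q ∧
      ∀ f, P'.Uses f → f = .I ∨ P.Uses f ∧ (f = .N ∨ f = .R) := by
  -- The order is forced: expanding negated equations needs flat values and creates positive
  -- equations, and removing those creates relations of larger arity.
  obtain ⟨P₁, h₁, p₁, n₁, r₁⟩ := eliminate_packing hΓ hS hSa hP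
  obtain ⟨P₂, h₂, e₂, p₂, n₂, r₂⟩ := eliminate_negEq hΓ h₁ p₁
  obtain ⟨P₃, h₃, e₃, e₃', n₃, p₃, r₃⟩ := eliminate_posEq h₂
  obtain ⟨P₄, h₄, a₄, u₄⟩ := eliminate_arity hΓ hS hSa h₃
  refine ⟨P₄, h₄, ?_⟩
  rintro (_ | _ | _ | _ | _ | _) hf
  · exact absurd hf a₄
  · rcases P₃.uses_E_iff.1 (u₄ _ (by simp) (by simp) hf) with h | h
    · exact absurd h e₃
    · exact absurd (e₃' h) e₂
  · exact Or.inl rfl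
  · exact Or.inr ⟨n₁ (n₂ (n₃ (u₄ _ (by simp) (by simp) hf))), by simp⟩
  · exact absurd (p₃ (u₄ _ (by simp) (by simp) hf)) p₂
  · exact Or.inr ⟨r₁ (r₂ (r₃ (u₄ _ (by simp) (by simp) hf))), by simp⟩

-- The classification and its Hasse diagram.

/-- The syntactic characterization of subsumption between fragments. -/
def Fragment.Below (F₁ F₂ : Fragment) : Prop :=
  (Feature.N ∈ F₁ → Feature.N ∈ F₂) ∧
  (Feature.R ∈ F₁ → Feature.R ∈ F₂) ∧
  (Feature.E ∈ F₁ → Feature.E ∈ F₂ ∨ Feature.I ∈ F₂) ∧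
  (Feature.I ∈ F₁ ∧ Feature.R ∉ F₁ ∧ Feature.N ∉ F₁ → Feature.I ∈ F₂ ∨ Feature.E ∈ F₂) ∧
  (Feature.I ∈ F₁ ∧ (Feature.R ∈ F₁ ∨ Feature.N ∈ F₁) → Feature.I ∈ F₂)

/-- If `F₂` lacks I, a program using I must be free of N and R. It is then unfolded using E, and the
packing left over is removed without intermediate predicates. -/
theorem subsumed_of_below [Infinite dom] {F₁ F₂ : Fragment} (h : F₁.Below F₂) :
    Subsumed dom F₁ F₂ := by
  obtain ⟨hN, hR, hE, hI, hI'⟩ := h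
  rintro Γ S hΓ hS hSa Q ⟨P, hPF, hP⟩
  by_cases hI₂ : .I ∈ F₂
  · obtain ⟨P', h', hu⟩ := normalize_with_intermediate hΓ hS hSa hP
    refine ⟨P', fun f hf => ?_, h'⟩
    rcases hu f hf with rfl | ⟨hf, rfl | rfl⟩
    exacts [hI₂, hN (hPF _ hf), hR (hPF _ hf)]
  · by_cases hI₁ : P.Uses .I
    · have hI₁ := hPF _ hI₁
      have hRN : .R ∉ F₁ ∧ .N ∉ F₁ := by tauto
      have hE₂ : .E ∈ F₂ := by tauto
      obtain ⟨P₁, h₁, hu₁⟩ := unfold_program hΓ hS hSa hP (fun h => hRN.2 (hPF _ h))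
        fun h => hRN.1 (hPF _ h)
      obtain ⟨P', h', hu⟩ := normalize_without_intermediate hΓ hSa h₁ fun h => by
        simpa using hu₁ _ h
      refine ⟨P', fun f hf => ?_, h'⟩
      obtain ⟨hf₁, hf₂⟩ := hu f hf
      rcases hu₁ f hf₁ with rfl | rfl
      · exact hE₂
      · simp at hf₂
    · obtain ⟨P', h', hu⟩ := normalize_without_intermediate hΓ hSa hP hI₁
      refine ⟨P', fun f hf => ?_, h'⟩
      obtain ⟨hf₁, rfl | rfl | rfl⟩ := hu f hf
      exacts [(hE (hPF _ hf₁)).resolve_right hI₂, hN (hPF _ hf₁), hR (hPF _ hf₁)]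

theorem subsumed_iff_below [Infinite dom] {F₁ F₂ : Fragment} :
    Subsumed dom F₁ F₂ ↔ F₁.Below F₂ := by
  refine ⟨fun h => ⟨negation_necessary h, recursion_necessary h, equation_necessary h, ?_, ?_⟩,
    subsumed_of_below⟩
  · rintro ⟨hI, -, -⟩
    -- Equations are expressible through intermediate predicates, so a fragment above one containing
    -- I also computes every query of the equation fragment.
    have hEI : Subsumed dom {.E} {.I} := subsumed_of_below (by simp [Fragment.Below])
    have hIF : Subsumed dom {.I} F₁ := fun Γ S hΓ hS hSa Q ⟨P, hPF, hP⟩ =>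
      ⟨P, fun f hf => Finset.mem_singleton.1 (hPF f hf) ▸ hI, hP⟩
    exact (equation_necessary (fun Γ S hΓ hS hSa Q hQ => h Γ S hΓ hS hSa Q
      (hIF Γ S hΓ hS hSa Q (hEI Γ S hΓ hS hSa Q hQ))) (Finset.mem_singleton_self _)).symm
  · rintro ⟨hI, hR | hN⟩
    · exact intermediate_necessary_of_recursion h hI hR
    · exact intermediate_necessary_of_negation h hI hN

instance Feature.fintype : Fintype Feature :=
  ⟨{.A, .E, .I, .N, .P, .R}, by rintro (_ | _ | _ | _ | _ | _) <;> decide⟩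

instance Fragment.decidableBelow (F₁ F₂ : Fragment) : Decidable (F₁.Below F₂) := by
  unfold Fragment.Below
  infer_instance

/-- A finite check over all fragments, as is the next one, since the relation is decidable. -/
theorem hasseNodes_representatives : ∀ F : Fragment, ∃ G ∈ hasseNodes, (F.Below G ∧ G.Below F) ∧
    ∀ G' ∈ hasseNodes, F.Below G' ∧ G'.Below F → G' = G := by
  decide +kernel

theorem hasseEdges_covering : ∀ G ∈ hasseNodes, ∀ G' ∈ hasseNodes, (G, G') ∈ hasseEdges ↔
    (G.Below G' ∧ ¬ G'.Below G) ∧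
      ¬ ∃ F : Fragment, (G.Below F ∧ ¬ F.Below G) ∧ (F.Below G' ∧ ¬ G'.Below F) := by
  decide +kernel

end SeqDatalog

open SeqDatalog in
theorem mainTheorem1 (dom : Type*) [Countable dom] [Infinite dom] :
    (∀ F₁ F₂ : Fragment, Subsumed dom F₁ F₂ ↔
      (Feature.N ∈ F₁ → Feature.N ∈ F₂) ∧
      (Feature.R ∈ F₁ → Feature.R ∈ F₂) ∧
      (Feature.E ∈ F₁ → Feature.E ∈ F₂ ∨ Feature.I ∈ F₂) ∧
      (Feature.I ∈ F₁ ∧ Feature.R ∉ F₁ ∧ Feature.N ∉ F₁ → Feature.I ∈ F₂ ∨ Feature.E ∈ F₂) ∧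
      (Feature.I ∈ F₁ ∧ (Feature.R ∈ F₁ ∨ Feature.N ∈ F₁) → Feature.I ∈ F₂)) ∧
    hasseNodes.length = 11 ∧
    (∀ F : Fragment, ∃! G : Fragment, G ∈ hasseNodes ∧ Equivalent dom F G) ∧
    (∀ G ∈ hasseNodes, ∀ G' ∈ hasseNodes, (G, G') ∈ hasseEdges ↔
      StrictlySubsumed dom G G' ∧
      ¬ ∃ F : Fragment, StrictlySubsumed dom G F ∧ StrictlySubsumed dom F G') := by
  refine ⟨fun F₁ F₂ => subsumed_iff_below, rfl, fun F => ?_, ?_⟩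
  · obtain ⟨G, hG, he, hu⟩ := hasseNodes_representatives F
    simp only [Equivalent, subsumed_iff_below]
    exact ⟨G, ⟨hG, he⟩, fun G' hG' => hu G' hG'.1 hG'.2⟩
  · simp only [StrictlySubsumed, subsumed_iff_below]
    exact hasseEdges_covering
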